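/- \textbf{Conventions.} Let $d\ge 0$. Colors are the integers $1,\dots,d-1$, and a word is a finite sequence of colors. A \emph{Demazure weave} $\mathfrak w:\beta\rightrightarrows\beta'$ is a planar graph in a rectangle, considered up to isotopy, with edges descending from the top word $\beta$ to the bottom word $\beta'$, whose internal vertices, scanned from top to bottom, act on the row word by $ii\rightrightarrows i$ (trivalent), $ij\rightrightarrows ji$ with $|i-j|>1$ (4-valent), $iji\rightrightarrows jij$ with $|i-j|=1$ (6-valent). Some letters of $\beta$ are \emph{marked}. Two Demazure weaves $\beta\rightrightarrows\beta'$ with the same marked letters are \emph{equivalent} if they are related by a sequence of the following local moves, their inverses and their mirror images: (i) any two partial weaves with only 4- and 6-valent vertices and the same top and bottom words are exchanged; (ii) $ijij\rightrightarrows jijj\rightrightarrows jij$ is exchanged with $ijij\rightrightarrows iiji\rightrightarrows iji\rightrightarrows jij$, and $ijii\rightrightarrows iji\rightrightarrows jij$ with $ijii\rightrightarrows jiji\rightrightarrows jjij\rightrightarrows jij$ ($|i-j|=1$); (iii) $iji\rightrightarrows iij\rightrightarrows ij\rightrightarrows ji$ is exchanged with $iji\rightrightarrows jii\rightrightarrows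 ji$ ($|i-j|>1$). They are \emph{mutation equivalent} if one also allows to exchange $(ii)i\rightrightarrows ii\rightrightarrows i$ with $i(ii)\rightrightarrows ii\rightrightarrows i$. \textbf{Quiver.} Each marked letter of $\beta$ and each trivalent vertex $v$ of $\mathfrak w$ defines a \emph{cycle} $\gamma$, a function from the edges to $\mathbb Z_{\ge0}$: it is $1$ on the edge that begins at $v$ (resp. at the marked letter), $0$ on the other edges that begin at the same height or above, and below it is computed from the top down by $\min$ at trivalent vertices, unchanged along the lines through 4-valent vertices, and $(\gamma(a),\gamma(f),\gamma(e))\mapsto(\gamma(f)+\gamma(e)-m,\,m,\,\gamma(a)+\gamma(f)-m)$, $m=\min(\gamma(a),\gamma(e))$, at 6-valent vertices. A cycle is frozen if it comes from a marked letter or is nonzero on an edge at the bottom; otherwise it is mutable. The quiver $Q(\mathfrak w)$ has the cycles as vertices, and the number of arrows $\gamma\to\gamma'$ (minus the number of opposite arrows) is the sum of the local pairings $$\begin{vmatrix}1&1&1\\ \gamma(a)&\gamma(b)&\gamma(c)\\ \gamma'(a)&\gamma'(b)&\gamma'(c)\end{vmatrix},\qquad \tfrac12\left(\begin{vmatrix}1&1&1\\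 \gamma(a)&\gamma(c)&\gamma(e)\\ \gamma'(a)&\gamma'(c)&\gamma'(e)\end{vmatrix}+\begin{vmatrix}1&1&1\\ \gamma(b)&\gamma(d)&\gamma(f)\\ \gamma'(b)&\gamma'(d)&\gamma'(f)\end{vmatrix}\right)$$ over the trivalent and the 6-valent vertices, the edges $a,b,c,\dots$ at a vertex being listed counterclockwise from the top left one. \textbf{Seeds.} Let $K$ be a field containing $\mathbb C$. A decorated flag $\mathcal F$ in $K^d$ is a tuple of nonzero $\mathcal F^k\in\bigwedge^kK^d$, $1\le k\le d-1$, with $\mathcal F^{k+1}\in\mathcal F^k\wedge K^d$; put $\mathcal F^0=1$ and let $\mathcal F^d$ be the standard volume form. Write $\mathcal G\overset{k}{-}\mathcal H$ if $\mathcal G^i=\mathcal H^i$ for $i\ne k$ and $\mathcal G^k\notin K\mathcal H^k$; the \emph{crossing value} is then the $\mu\in K$ with $u\wedge\mathcal G^{k-1}\wedge v=\mu\,\mathcal G^{k+1}$, where $\mathcal G^k=u\wedge\mathcal G^{k-1}$ and $\mathcal H^k=\mathcal G^{k-1}\wedge v$. A \emph{normalized decoration} of the marked word $\beta=\beta_1\cdots\beta_s$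 over $K$ is a tuple $\mathcal G_1\overset{\beta_1}{-}\mathcal G_2\overset{\beta_2}{-}\cdots\overset{\beta_s}{-}\mathcal G_{s+1}$ whose crossing values at unmarked letters are $1$. A \emph{decoration} of $\mathfrak w$ assigns a decorated flag to each face such that there are $\Delta_\gamma\in K$ (for all cycles $\gamma$) with the property that for each edge $e$, of color $k$, the flags to its left and right are in relative position $\overset{k}{-}$ with crossing value $\prod_\gamma\Delta_\gamma^{\gamma(e)}$. The \emph{seed} $\Sigma(\mathfrak w)$ of a decorated weave is $Q(\mathfrak w)$ with the variables $\Delta_\gamma$. Seeds are considered up to renaming the vertices, and algebraic independence is not required; two seeds are \emph{mutation equivalent} if a sequence of quiver mutations at mutable vertices, with the corresponding exchange transformations of the variables, transforms one into the other. The \emph{cluster algebra} of a seed is the $\mathbb C$-subalgebra of $K$ generated by the variables of all seeds mutation equivalent to it. \textbf{Theorem.} Let $\beta$ be a marked word and let $\mathfrak d$ be a normalized decoration of $\beta$ over a field $K\supseteq\mathbb C$. Call $\mathfrak d$ \emph{generic} if each polynomial over $\mathbb C$ in the Plücker coordinates of the flags that vanishes at $\mathfrak d$ vanishes at all normalized decorations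 of $\beta$ over $\mathbb C$, and \emph{extendable} if each Demazure weave with marked top word $\beta$ has a decoration that restricts to $\mathfrak d$ on $\beta$. \begin{enumerate} \item If $\mathfrak d$ is generic, then it is extendable. For any decorated Demazure weave that restricts to $\mathfrak d$ on its top word, the numbers $\Delta_\gamma$ are uniquely determined by $\mathfrak d$. \item Let $\mathfrak w,\mathfrak w':\beta\rightrightarrows\beta'$ be equivalent Demazure weaves with decorations that restrict to $\mathfrak d$. Then $\Sigma(\mathfrak w)=\Sigma(\mathfrak w')$, and the two cluster algebras in $K$ are equal. \item Let $\mathfrak d$ be extendable, and let $\mathfrak w,\mathfrak w':\beta\rightrightarrows\beta'$ be mutation equivalent Demazure weaves with decorations that restrict to $\mathfrak d$. Then $\Sigma(\mathfrak w)$ and $\Sigma(\mathfrak w')$ are mutation equivalent, and the two cluster algebras in $K$ are equal. \item Let $\mathfrak d$ be extendable, and let $\mathfrak w,\mathfrak w':\beta\rightrightarrows\beta'$ be any Demazure weaves with decorations that restrict to $\mathfrak d$. If $\beta'$ is a reduced word for the Demazure product of $\beta$ in the 0-Hecke monoid, then $\Sigma(\mathfrak w)$ and $\Sigma(\mathfrak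 w')$ are mutation equivalent, and the two cluster algebras in $K$ are equal. \end{enumerate} -/

import Mathlib

namespace DemazureWeaves

/-! ### Colors, words, and the 0-Hecke monoid -/

/-- The colors `1, …, d - 1`. -/
abbrev Color (d : ℕ) : Type := {i : ℕ // 1 ≤ i ∧ i < d}

/-- `|i - j| = 1`. -/
def Adjacent {d : ℕ} (i j : Color d) : Prop := (i : ℕ) + 1 = j ∨ (j : ℕ) + 1 = i

/-- `|i - j| > 1`. -/
def Distant {d : ℕ} (i j : Color d) : Prop := (i : ℕ) + 1 < j ∨ (j : ℕ) + 1 < i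

theorem Adjacent.symm {d : ℕ} {i j : Color d} (h : Adjacent i j) : Adjacent j i := Or.symm h

theorem Distant.symm {d : ℕ} {i j : Color d} (h : Distant i j) : Distant j i := Or.symm h

/-- The defining relations of the 0-Hecke monoid. -/
inductive HeckeRel (d : ℕ) : FreeMonoid (Color d) → FreeMonoid (Color d) → Prop
  | idem (i : Color d) : HeckeRel d (FreeMonoid.ofList [i, i]) (FreeMonoid.ofList [i])
  | comm (i j : Color d) (h : Distant i j) :
      HeckeRel d (FreeMonoid.ofList [i, j]) (FreeMonoid.ofList [j, i])
  | braid (i j : Color d) (h : Adjacent i j) :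
      HeckeRel d (FreeMonoid.ofList [i, j, i]) (FreeMonoid.ofList [j, i, j])

/-- The 0-Hecke monoid. -/
abbrev ZeroHecke (d : ℕ) : Type := PresentedMonoid (HeckeRel d)

/-- The Demazure product of a word. -/
def demazureProduct {d : ℕ} (β : List (Color d)) : ZeroHecke d :=
  PresentedMonoid.mk (HeckeRel d) (FreeMonoid.ofList β)

/-- `β` is a reduced word for the element `δ` of the 0-Hecke monoid. -/
def IsReducedWordFor {d : ℕ} (β : List (Color d)) (δ : ZeroHecke d) : Prop :=
  demazureProduct β = δ ∧ ∀ γ : List (Color d), demazureProduct γ = δ → β.length ≤ γ.length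

/-! ### Demazure weaves

A Demazure weave is recorded by the list of its internal vertices, from top to bottom, after they
have been put at different heights. A vertex is recorded with the words of colors of the weave
lines that pass to its left and to its right at its height. Two such records of the same planar
graph differ by exchanging the heights of vertices, see `EquivMove.isotopy`. -/

/-- The types of internal vertices, with the colors of the incident weave lines. -/
inductive VertexKind (d : ℕ) : Type
  | tri (i : Color d) : VertexKind d
  | four (i j : Color d) (h : Distant i j) : VertexKind d
  | six (i j : Color d) (h : Adjacent i j) : VertexKind d

/-- The weave lines above a vertex, from left to right. -/
def VertexKind.top {d : ℕ} : VertexKind d → List (Color d)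
  | .tri i => [i, i]
  | .four i j _ => [i, j]
  | .six i j _ => [i, j, i]

/-- The weave lines below a vertex, from left to right. -/
def VertexKind.bot {d : ℕ} : VertexKind d → List (Color d)
  | .tri i => [i]
  | .four i j _ => [j, i]
  | .six i j _ => [j, i, j]

/-- Is the vertex trivalent? -/
def VertexKind.isTri {d : ℕ} : VertexKind d → Bool
  | .tri _ => true
  | .four _ _ _ => false
  | .six _ _ _ => false

/-- An internal vertex, with the weave lines to its left and to its right. -/
structure Vertex (d : ℕ) : Type where
  left : List (Color d)
  kind : VertexKind d
  right : List (Color d)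

/-- The row word just above a vertex. -/
def Vertex.top {d : ℕ} (v : Vertex d) : List (Color d) := v.left ++ v.kind.top ++ v.right

/-- The row word just below a vertex. -/
def Vertex.bot {d : ℕ} (v : Vertex d) : List (Color d) := v.left ++ v.kind.bot ++ v.right

/-- The list of vertices `w` transforms the word `β` into the word `β'`. -/
def IsWeave {d : ℕ} : List (Color d) → List (Vertex d) → List (Color d) → Prop
  | β, [], β' => β = β'
  | β, v :: w, β' => v.top = β ∧ IsWeave v.bot w β'

/-- Demazure weaves with top word `β` and bottom word `β'`. -/
structure DemazureWeave {d : ℕ} (β β' : List (Color d)) : Type where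
  vertices : List (Vertex d)
  isWeave : IsWeave β vertices β'

/-- The `t`-th row word, between the vertices number `t - 1` and number `t`. -/
def DemazureWeave.rowWord {d : ℕ} {β β' : List (Color d)} (w : DemazureWeave β β') :
    ℕ → List (Color d)
  | 0 => β
  | t + 1 =>
    match w.vertices[t]? with
    | some v => v.bot
    | none => w.rowWord t

/-! ### Equivalence and mutation equivalence of weaves -/

/-- The local equivalence moves. In each of them, the partial weave on the left and the partial
weave on the right transform the same word into the same word. The words `l` and `r` are the
colors of the weave lines that pass to the left and to the right. -/
inductive EquivMove {d : ℕ} : List (Vertex d) → List (Vertex d) → Prop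
  /-- Planar isotopy: the heights of two horizontally separated vertices are exchanged. -/
  | isotopy (l m r : List (Color d)) (k₁ k₂ : VertexKind d) :
      EquivMove [⟨l, k₁, m ++ k₂.top ++ r⟩, ⟨l ++ k₁.bot ++ m, k₂, r⟩]
        [⟨l ++ k₁.top ++ m, k₂, r⟩, ⟨l, k₁, m ++ k₂.bot ++ r⟩]
  /-- Any two partial weaves with the same top and bottom words, and without trivalent vertices. -/
  | braid (x y : List (Vertex d)) (α α' : List (Color d)) (hx : IsWeave α x α')
      (hy : IsWeave α y α') (hx' : ∀ v ∈ x, v.kind.isTri = false)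
      (hy' : ∀ v ∈ y, v.kind.isTri = false) : EquivMove x y
  /-- `ijij ⇉ jijj ⇉ jij` and `ijij ⇉ iiji ⇉ iji ⇉ jij`. -/
  | pushBelow (l r : List (Color d)) (i j : Color d) (h : Adjacent i j) :
      EquivMove [⟨l, .six i j h, j :: r⟩, ⟨l ++ [j, i], .tri j, r⟩]
        [⟨l ++ [i], .six j i h.symm, r⟩, ⟨l, .tri i, j :: i :: r⟩, ⟨l, .six i j h, r⟩]
  /-- `jiji ⇉ jjij ⇉ jij` and `jiji ⇉ ijii ⇉ iji ⇉ jij`. -/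
  | pushBelowMirror (l r : List (Color d)) (i j : Color d) (h : Adjacent i j) :
      EquivMove [⟨l ++ [j], .six i j h, r⟩, ⟨l, .tri j, i :: j :: r⟩]
        [⟨l, .six j i h.symm, i :: r⟩, ⟨l ++ [i, j], .tri i, r⟩, ⟨l, .six i j h, r⟩]
  /-- `ijii ⇉ iji ⇉ jij` and `ijii ⇉ jiji ⇉ jjij ⇉ jij`. -/
  | pushAbove (l r : List (Color d)) (i j : Color d) (h : Adjacent i j) :
      EquivMove [⟨l ++ [i, j], .tri i, r⟩, ⟨l, .six i j h, r⟩]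
        [⟨l, .six i j h, i :: r⟩, ⟨l ++ [j], .six i j h, r⟩, ⟨l, .tri j, i :: j :: r⟩]
  /-- `iiji ⇉ iji ⇉ jij` and `iiji ⇉ ijij ⇉ jijj ⇉ jij`. -/
  | pushAboveMirror (l r : List (Color d)) (i j : Color d) (h : Adjacent i j) :
      EquivMove [⟨l, .tri i, j :: i :: r⟩, ⟨l, .six i j h, r⟩]
        [⟨l ++ [i], .six i j h, r⟩, ⟨l, .six i j h, j :: r⟩, ⟨l ++ [j, i], .tri j, r⟩]
  /-- `iji ⇉ iij ⇉ ij ⇉ ji` and `iji ⇉ jii ⇉ ji`. -/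
  | passThrough (l r : List (Color d)) (i j : Color d) (h : Distant i j) :
      EquivMove [⟨l ++ [i], .four j i h.symm, r⟩, ⟨l, .tri i, j :: r⟩, ⟨l, .four i j h, r⟩]
        [⟨l, .four i j h, i :: r⟩, ⟨l ++ [j], .tri i, r⟩]
  /-- `iji ⇉ jii ⇉ ji ⇉ ij` and `iji ⇉ iij ⇉ ij`. -/
  | passThroughMirror (l r : List (Color d)) (i j : Color d) (h : Distant i j) :
      EquivMove [⟨l, .four i j h, i :: r⟩, ⟨l ++ [j], .tri i, r⟩, ⟨l, .four j i h.symm, r⟩]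
        [⟨l ++ [i], .four j i h.symm, r⟩, ⟨l, .tri i, j :: r⟩]

/-- The weave mutation move: `(ii)i ⇉ ii ⇉ i` and `i(ii) ⇉ ii ⇉ i`. -/
inductive MutationMove {d : ℕ} : List (Vertex d) → List (Vertex d) → Prop
  | mk (l r : List (Color d)) (i : Color d) :
      MutationMove [⟨l, .tri i, i :: r⟩, ⟨l, .tri i, r⟩] [⟨l ++ [i], .tri i, r⟩, ⟨l, .tri i, r⟩]

/-- `w'` is obtained from `w` by replacing a partial weave `x` by a partial weave `y`, where `x`
and `y` are related by `R`. -/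
def LocalStep {d : ℕ} (R : List (Vertex d) → List (Vertex d) → Prop) {β β' : List (Color d)}
    (w w' : DemazureWeave β β') : Prop :=
  ∃ above x y below : List (Vertex d),
    w.vertices = above ++ x ++ below ∧ w'.vertices = above ++ y ++ below ∧ R x y

/-- Equivalence of Demazure weaves. -/
def DemazureWeave.Equivalent {d : ℕ} {β β' : List (Color d)} (w w' : DemazureWeave β β') : Prop :=
  Relation.EqvGen (LocalStep EquivMove) w w'

/-- Mutation equivalence of Demazure weaves. -/
def DemazureWeave.MutationEquivalent {d : ℕ} {β β' : List (Color d)}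
    (w w' : DemazureWeave β β') : Prop :=
  Relation.EqvGen (fun u u' => LocalStep EquivMove u u' ∨ LocalStep MutationMove u u') w w'

/-! ### Lusztig cycles and the quiver of a weave

The marked boundary vertices are given by a set `M` of positions in the top word `β`. A function
on the edges is given by its values on every row, as a function of the position in the row word. -/

/-- The (Lusztig) cycles are indexed by the marked boundary vertices and the trivalent vertices. -/
abbrev Cycle {d : ℕ} {β β' : List (Color d)} (M : Finset (Fin β.length))
    (w : DemazureWeave β β') : Type :=
  {q : Fin β.length // q ∈ M} ⊕
    {t : Fin w.vertices.length // (w.vertices.get t).kind.isTri = true}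

/-- The values of a cycle on the row below a vertex, from its values on the row above it, for a
vertex at which the cycle does not originate. At a 6-valent vertex with weave lines `a, f, e` above
and `b, c, d` below (from left to right), these are `γ(b) = γ(f) + γ(e) - min(γ(a), γ(e))`,
`γ(c) = min(γ(a), γ(e))`, `γ(d) = γ(a) + γ(f) - min(γ(a), γ(e))`. -/
def Vertex.transport {d : ℕ} (v : Vertex d) (γ : ℕ → ℕ) (p : ℕ) : ℕ :=
  let n := v.left.length
  match v.kind with
  | .tri _ => if p < n then γ p else if p = n then min (γ n) (γ (n + 1)) else γ (p + 1)
  | .four _ _ _ => if p = n then γ (n + 1) else if p = n + 1 then γ n else γ p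
  | .six _ _ _ =>
      if p = n then γ (n + 1) + γ (n + 2) - min (γ n) (γ (n + 2))
      else if p = n + 1 then min (γ n) (γ (n + 2))
      else if p = n + 2 then γ n + γ (n + 1) - min (γ n) (γ (n + 2))
      else γ p

/-- Does the cycle originate at the vertex number `t`? -/
def Cycle.startsAt {d : ℕ} {β β' : List (Color d)} {M : Finset (Fin β.length)}
    {w : DemazureWeave β β'} (c : Cycle M w) (t : ℕ) : Bool :=
  match c with
  | .inl _ => false
  | .inr s => decide ((s.1 : ℕ) = t)

/-- The value of a cycle on the weave line at position `p` in the `t`-th row. -/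
def Cycle.weight {d : ℕ} {β β' : List (Color d)} {M : Finset (Fin β.length)}
    {w : DemazureWeave β β'} (c : Cycle M w) : ℕ → ℕ → ℕ
  | 0 => fun p =>
    match c with
    | .inl q => if p = (q.1 : ℕ) then 1 else 0
    | .inr _ => 0
  | t + 1 => fun p =>
    match w.vertices[t]? with
    | none => Cycle.weight c t p
    | some v =>
      if Cycle.startsAt c t = true then (if p = v.left.length then 1 else 0)
      else v.transport (Cycle.weight c t) p

/-- A cycle is frozen if it meets the boundary: it originates at a marked boundary vertex, or it
is nonzero on a weave line incident to the bottom boundary. -/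
def Cycle.IsFrozen {d : ℕ} {β β' : List (Color d)} {M : Finset (Fin β.length)}
    {w : DemazureWeave β β'} (c : Cycle M w) : Prop :=
  c.isLeft = true ∨ ∃ p < β'.length, Cycle.weight c w.vertices.length p ≠ 0

/-- The determinant with rows `(1, 1, 1)`, `(x₁, x₂, x₃)`, `(y₁, y₂, y₃)`. -/
def tripleDet (x₁ x₂ x₃ y₁ y₂ y₃ : ℤ) : ℤ :=
  Matrix.det !![1, 1, 1; x₁, x₂, x₃; y₁, y₂, y₃]

/-- The local intersection pairing at a vertex of two functions on the edges, with values `γ₀`,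
`δ₀` on the row above the vertex and `γ₁`, `δ₁` on the row below it. At a 6-valent vertex the
division by `2` is exact for cycles, see `two_dvd_six`. -/
def Vertex.pairing {d : ℕ} (v : Vertex d) (γ₀ γ₁ δ₀ δ₁ : ℕ → ℕ) : ℤ :=
  let n := v.left.length
  match v.kind with
  | .tri _ => tripleDet (γ₀ n) (γ₁ n) (γ₀ (n + 1)) (δ₀ n) (δ₁ n) (δ₀ (n + 1))
  | .four _ _ _ => 0
  | .six _ _ _ =>
      (tripleDet (γ₀ n) (γ₁ (n + 1)) (γ₀ (n + 2)) (δ₀ n) (δ₁ (n + 1)) (δ₀ (n + 2)) +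
        tripleDet (γ₁ n) (γ₁ (n + 2)) (γ₀ (n + 1)) (δ₁ n) (δ₁ (n + 2)) (δ₀ (n + 1))) / 2

/-- The intersection pairing of two cycles. -/
def Cycle.pairing {d : ℕ} {β β' : List (Color d)} {M : Finset (Fin β.length)}
    {w : DemazureWeave β β'} (c e : Cycle M w) : ℤ :=
  ∑ t : Fin w.vertices.length, (w.vertices.get t).pairing
    (Cycle.weight c t) (Cycle.weight c (t + 1)) (Cycle.weight e t) (Cycle.weight e (t + 1))

theorem tripleDet_swap (x₁ x₂ x₃ y₁ y₂ y₃ : ℤ) :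
    tripleDet x₁ x₂ x₃ y₁ y₂ y₃ = -tripleDet y₁ y₂ y₃ x₁ x₂ x₃ := by
  simp [tripleDet, Matrix.det_fin_three]
  ring

theorem two_dvd_six (a f e a' f' e' : ℤ) :
    (2 : ℤ) ∣ tripleDet a (min a e) e a' (min a' e') e' +
      tripleDet (f + e - min a e) (a + f - min a e) f
        (f' + e' - min a' e') (a' + f' - min a' e') f' := by
  rcases le_total a e with h | h <;> rcases le_total a' e' with h' | h' <;>
    simp only [min_eq_left, min_eq_right, h, h', tripleDet, Matrix.det_fin_three] <;>
    simp
  · exact ⟨(e - a) * (a' - e'), by ring⟩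
  · exact ⟨(a - e) * (a' - e'), by ring⟩

theorem Cycle.weight_succ_of_six {d : ℕ} {β β' : List (Color d)} {M : Finset (Fin β.length)}
    {w : DemazureWeave β β'} (c : Cycle M w) (t : Fin w.vertices.length)
    (h : (w.vertices.get t).kind.isTri = false) :
    Cycle.weight c (t + 1) = (w.vertices.get t).transport (Cycle.weight c t) := by
  funext p
  have h1 : w.vertices[(t : ℕ)]? = some (w.vertices.get t) := by simp
  have h2 : Cycle.startsAt c (t : ℕ) = false := by
    rcases c with q | s
    · rfl
    · simp only [Cycle.startsAt, decide_eq_false_iff_not]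
      intro hs
      have hst : s.1 = t := Fin.ext hs
      have := s.2
      rw [hst, h] at this
      exact Bool.false_ne_true this
  rw [Cycle.weight, h1]
  simp [h2]

theorem Cycle.pairing_skew {d : ℕ} {β β' : List (Color d)} {M : Finset (Fin β.length)}
    {w : DemazureWeave β β'} (c e : Cycle M w) : Cycle.pairing c e = -Cycle.pairing e c := by
  unfold Cycle.pairing
  rw [← Finset.sum_neg_distrib]
  refine Finset.sum_congr rfl fun t _ => ?_
  generalize hv : w.vertices.get t = v
  obtain ⟨l, k, r⟩ := v
  cases k with
  | tri i => exact tripleDet_swap _ _ _ _ _ _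
  | four i j h => simp [Vertex.pairing]
  | six i j h =>
    have hk : (w.vertices.get t).kind.isTri = false := by rw [hv]; rfl
    rw [Cycle.weight_succ_of_six c t hk, Cycle.weight_succ_of_six e t hk, hv]
    simp only [Vertex.pairing, Vertex.transport]
    generalize Cycle.weight c t = g
    generalize Cycle.weight e t = g'
    have key := two_dvd_six (g l.length) (g (l.length + 1)) (g (l.length + 2))
      (g' l.length) (g' (l.length + 1)) (g' (l.length + 2))
    have e1 : ∀ a f b : ℕ, ((f + b - min a b : ℕ) : ℤ) = f + b - min (a : ℤ) b := by
      intro a f b; omega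
    have e2 : ∀ a f b : ℕ, ((a + f - min a b : ℕ) : ℤ) = a + f - min (a : ℤ) b := by
      intro a f b; omega
    simp only [if_true, Nat.add_eq_left, Nat.add_left_cancel_iff, one_ne_zero, if_false,
      OfNat.ofNat_ne_zero, OfNat.ofNat_ne_one, e1, e2, Nat.cast_min]
    rw [tripleDet_swap (g' l.length : ℤ), tripleDet_swap ((g' (l.length + 1) : ℤ) + _ - _),
      ← neg_add, Int.neg_ediv_of_dvd key, neg_neg]

/-! ### Seeds and cluster algebras -/

/-- A seed in the field `F`, without the requirement of algebraic independence. A quiver without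
loops and oriented 2-cycles on the vertex set `I` is given by the skew-symmetric matrix `arrows`,
where `arrows i j` is the number of arrows from `i` to `j` minus the number of arrows from
`j` to `i`. -/
structure Seed (F : Type*) where
  I : Type
  [fintype : Fintype I]
  [decEq : DecidableEq I]
  frozen : I → Prop
  arrows : I → I → ℤ
  skew : ∀ i j, arrows i j = -arrows j i
  var : I → F

attribute [instance] Seed.fintype Seed.decEq

/-- Two seeds are the same: they agree up to the names of the vertices of the quivers. -/
def Seed.Same {F : Type*} (S T : Seed F) : Prop :=
  ∃ f : S.I ≃ T.I, (∀ i, S.frozen i ↔ T.frozen (f i)) ∧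
    (∀ i j, S.arrows i j = T.arrows (f i) (f j)) ∧ ∀ i, S.var i = T.var (f i)

/-- Seed mutation at the vertex `k`. All arrows between frozen vertices are kept. -/
def Seed.mutate {F : Type*} [Field F] (S : Seed F) (k : S.I) : Seed F where
  I := S.I
  frozen := S.frozen
  arrows i j :=
    if i = k ∨ j = k then -S.arrows i j
    else S.arrows i j + max (S.arrows i k) 0 * max (S.arrows k j) 0
      - min (S.arrows i k) 0 * min (S.arrows k j) 0
  skew i j := by
    by_cases h : i = k ∨ j = k
    · rw [if_pos h, if_pos (Or.symm h), S.skew i j]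
    · rw [if_neg h, if_neg (fun h' => h (Or.symm h')), S.skew i j, S.skew k j, S.skew k i]
      have e1 : ∀ x : ℤ, max (-x) 0 = -min x 0 := by intro x; omega
      have e2 : ∀ x : ℤ, min (-x) 0 = -max x 0 := by intro x; omega
      simp only [e1, e2]
      ring
  var i :=
    if i = k then
      (∏ j, S.var j ^ (S.arrows j k).toNat + ∏ j, S.var j ^ (S.arrows k j).toNat) / S.var k
    else S.var i

/-- `T` is obtained from `S` by a sequence of mutations at mutable vertices. -/
inductive Seed.MutationEquivalent {F : Type*} [Field F] : Seed F → Seed F → Prop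
  | same {S T : Seed F} (h : S.Same T) : Seed.MutationEquivalent S T
  | mutate {S T : Seed F} (k : S.I) (hk : ¬ S.frozen k)
      (h : Seed.MutationEquivalent (S.mutate k) T) : Seed.MutationEquivalent S T

/-- The cluster algebra of a seed: the subalgebra generated over `ℂ` by all cluster and frozen
variables in the seeds that are mutation equivalent to it. -/
def Seed.clusterAlgebra {F : Type*} [Field F] [Algebra ℂ F] (S : Seed F) : Subalgebra ℂ F :=
  Algebra.adjoin ℂ {x | ∃ T : Seed F, S.MutationEquivalent T ∧ ∃ i, T.var i = x}

/-! ### Decorated flags -/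

/-- The volume form `e₁ ∧ ⋯ ∧ e_d`. -/
noncomputable def volumeForm (K : Type*) [Field K] (d : ℕ) : ExteriorAlgebra K (Fin d → K) :=
  ExteriorAlgebra.ιMulti K d fun i => Pi.single i 1

/-- Decorated flags in `K ^ d`: tuples of nonzero extensors `F^k`, `1 ≤ k ≤ d - 1`, of degree `k`
with `F^(k+1) = F^k ∧ v` for some vector `v`. -/
structure DecoratedFlag (K : Type*) [Field K] (d : ℕ) where
  extensor : Color d → ExteriorAlgebra K (Fin d → K)
  mem : ∀ k : Color d, extensor k ∈ ⋀[K]^(k : ℕ) (Fin d → K)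
  ne_zero : ∀ k, extensor k ≠ 0
  nested : ∀ k k' : Color d, (k' : ℕ) = k + 1 →
    ∃ v : Fin d → K, extensor k' = extensor k * ExteriorAlgebra.ι K v

/-- The extensor `F^k` for `0 ≤ k ≤ d`, with `F^0 = 1`, and with `F^d` the volume form (which is
identified with its determinant `1`). -/
noncomputable def DecoratedFlag.level {K : Type*} [Field K] {d : ℕ} (F : DecoratedFlag K d)
    (k : ℕ) : ExteriorAlgebra K (Fin d → K) :=
  if h : 1 ≤ k ∧ k < d then F.extensor ⟨k, h⟩ else if k = 0 then 1 else volumeForm K d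

/-- `G` and `H` are in relative position `s_k`. -/
def RelativePosition {K : Type*} [Field K] {d : ℕ} (G H : DecoratedFlag K d) (k : Color d) : Prop :=
  (∀ i, i ≠ k → G.extensor i = H.extensor i) ∧ ∀ c : K, G.extensor k ≠ c • H.extensor k

/-- The crossing value of `G` and `H` is `μ`: one has `G^k = u ∧ G^(k-1)` and `H^k = G^(k-1) ∧ v`,
and the wedge `u ∧ G^(k-1) ∧ v` of `G^k` and `H^k` over `G^(k-1)` is `μ G^(k+1)`. -/
def HasCrossingValue {K : Type*} [Field K] {d : ℕ} (G H : DecoratedFlag K d) (k : Color d)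
    (μ : K) : Prop :=
  ∃ u v : Fin d → K,
    G.level k = ExteriorAlgebra.ι K u * G.level (k - 1) ∧
    H.level k = G.level (k - 1) * ExteriorAlgebra.ι K v ∧
    ExteriorAlgebra.ι K u * G.level (k - 1) * ExteriorAlgebra.ι K v = μ • G.level (k + 1)

/-- Normalized decorations of the word `β` with marked letters at the positions in `M`. -/
def IsNormalizedDecoration {K : Type*} [Field K] {d : ℕ} {β : List (Color d)}
    (M : Finset (Fin β.length)) (𝔡 : Fin (β.length + 1) → DecoratedFlag K d) : Prop :=
  ∀ p : Fin β.length, RelativePosition (𝔡 p.castSucc) (𝔡 p.succ) (β.get p) ∧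
    (p ∉ M → HasCrossingValue (𝔡 p.castSucc) (𝔡 p.succ) (β.get p) 1)

/-! ### Decorated Demazure weaves -/

/-- The faces of a weave are recorded by their positions in the rows. The families `F` and `F'`
of flags on the rows above and below the vertex `v` give the same flag to each face that meets
both rows. -/
def Vertex.FacesAgree {K : Type*} [Field K] {d : ℕ} (v : Vertex d)
    (F F' : ℕ → DecoratedFlag K d) : Prop :=
  let n := v.left.length
  match v.kind with
  | .tri _ => (∀ p ≤ n, F' p = F p) ∧ ∀ p > n, F' p = F (p + 1)
  | .four _ _ _ => ∀ p, p ≠ n + 1 → F' p = F p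
  | .six _ _ _ => ∀ p, p ≠ n + 1 → p ≠ n + 2 → F' p = F p

/-- A decoration of a Demazure weave, with the numbers `Δ_γ` indexed by the cycles. The weave line
at position `p` of the `t`-th row separates the faces `flag t p` and `flag t (p + 1)`. Values
`flag t p` where the `t`-th row or its face number `p` do not exist have no meaning. -/
structure Decoration (K : Type*) [Field K] {d : ℕ} {β β' : List (Color d)}
    (M : Finset (Fin β.length)) (w : DemazureWeave β β') where
  flag : ℕ → ℕ → DecoratedFlag K d
  Δ : Cycle M w → K
  faces : ∀ t : Fin w.vertices.length,
    (w.vertices.get t).FacesAgree (flag t) (flag (t + 1))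
  edge : ∀ t ≤ w.vertices.length, ∀ p : Fin (w.rowWord t).length,
    RelativePosition (flag t p) (flag t (p + 1)) ((w.rowWord t).get p) ∧
    HasCrossingValue (flag t p) (flag t (p + 1)) ((w.rowWord t).get p)
      (∏ c : Cycle M w, Δ c ^ Cycle.weight c t p)

/-- The decoration of the weave restricts to the decoration `𝔡` of its top word. -/
def Decoration.Extends {K : Type*} [Field K] {d : ℕ} {β β' : List (Color d)}
    {M : Finset (Fin β.length)} {w : DemazureWeave β β'} (D : Decoration K M w)
    (𝔡 : Fin (β.length + 1) → DecoratedFlag K d) : Prop :=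
  ∀ p : Fin (β.length + 1), D.flag 0 p = 𝔡 p

/-- The seed of a decorated Demazure weave. -/
def Decoration.seed {K : Type*} [Field K] {d : ℕ} {β β' : List (Color d)}
    {M : Finset (Fin β.length)} {w : DemazureWeave β β'} (D : Decoration K M w) : Seed K where
  I := Cycle M w
  frozen := Cycle.IsFrozen
  arrows := Cycle.pairing
  skew := Cycle.pairing_skew
  var := D.Δ

/-- The decoration `𝔡` extends to all Demazure weaves with top word `β`, so that all of these
have a seed. -/
def IsExtendable {K : Type*} [Field K] {d : ℕ} {β : List (Color d)} (M : Finset (Fin β.length))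
    (𝔡 : Fin (β.length + 1) → DecoratedFlag K d) : Prop :=
  ∀ (β' : List (Color d)) (w : DemazureWeave β β'), ∃ D : Decoration K M w, D.Extends 𝔡

/-- The linear functional on the exterior algebra that sends `v₁ ∧ ⋯ ∧ v_k` to the minor of
`v₁, …, v_k` on the coordinates `c`, and that vanishes in degrees other than `k`. -/
noncomputable def pluckerCoordinate (K : Type*) [Field K] {d k : ℕ} (c : Fin k → Fin d) :
    ExteriorAlgebra K (Fin d → K) →ₗ[K] K :=
  ExteriorAlgebra.liftAlternating
    (Pi.single k (Matrix.detRowAlternating.compLinearMap (LinearMap.funLeft K K c)))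

/-- The Plücker coordinates of a tuple of `n` decorated flags. -/
noncomputable def flagCoordinates {K : Type*} [Field K] {d n : ℕ} (𝔡 : Fin n → DecoratedFlag K d)
    (x : Fin n × (Σ k : Color d, (Fin (k : ℕ) → Fin d))) : K :=
  pluckerCoordinate K x.2.2 ((𝔡 x.1).extensor x.2.1)

/-- The normalized decoration `𝔡` over the extension `K` of `ℂ` is a generic point of the decorated
flag moduli space of the marked word `β`: each polynomial with complex coefficients in the Plücker
coordinates that vanishes at `𝔡` vanishes on all normalized decorations over `ℂ`. -/
def IsGeneric {K : Type*} [Field K] [Algebra ℂ K] {d : ℕ} {β : List (Color d)}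
    (M : Finset (Fin β.length)) (𝔡 : Fin (β.length + 1) → DecoratedFlag K d) : Prop :=
  ∀ P : MvPolynomial (Fin (β.length + 1) × (Σ k : Color d, (Fin (k : ℕ) → Fin d))) ℂ,
    MvPolynomial.aeval (flagCoordinates 𝔡) P = 0 →
    ∀ 𝔢 : Fin (β.length + 1) → DecoratedFlag ℂ d, IsNormalizedDecoration M 𝔢 →
      MvPolynomial.eval (flagCoordinates 𝔢) P = 0

end DemazureWeaves

/-! Choose a frame of the leftmost flag of a row. A crossing of color `k` then becomes a braid
matrix `crossFrame`, which changes the vectors number `k - 1` and `k` of the frame and has a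
coordinate `z` and the crossing value `μ` as parameters. A decorated row is thus a word whose
letters carry labels: the values of all cycles and a coordinate. A weave transforms such rows from
top to bottom (`Run`), with cycles named by a fixed type `N`, so that runs of different weaves can
be compared. It suffices to see what a local move does to the row at its bottom and to the sum of
the local pairings.

At a 6-valent vertex the labels change by an explicit involution `sixLabels`, tropical in the
weights and rational in the coordinates. It is compatible with the cycle of braid moves in rank
three (`rankThreeCoherent_sixLabels`). An induction on the length of words in the style of Garside
then shows that braid moves that return to the same colors return to the same labels
(`BraidEq.eq_of_map_fst`). In the absence of trivalent vertices, twice the pairing is the difference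
of a boundary pairing on the top and bottom rows (`Run.two_mul_pairing`). This settles the moves
without trivalent vertices. For a trivalent vertex that is pushed through a 6-valent one, the
crossing values before and after the move are equations for one and the same coordinate
(`tri_transfer`), and the pairings agree by a piecewise polynomial identity (`tri_pairing`). The
other push moves are conjugates of this one by invertible vertices. The variables are determined by
the top row (`Run.unique`), because each cycle has the value one on the edge where it begins. Hence
equivalent weaves have the same seed (`Decoration.Extends.seed_same`).

A mutation move concerns four flags that differ in one degree. Their three-term relation, divided by
a common monomial, is the exchange relation, and the local pairings change by matrix mutation
(`run_mutation`). Extendability provides decorations of the intermediate weaves.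

For a reduced bottom word, every weave is mutation equivalent to an inductive weave, which reads the
top word from left to right and adds or absorbs one letter at a time. Inductive weaves are unique up
to equivalence (`InductiveWeave.weaveEquiv`). A vertex on top of an inductive weave is removed by a
confluence in a parabolic subgroup of rank one or two (`InductiveWeave.exists_cons`), so a weave is
normalized from the bottom upwards.

A decoration extends to a weave unless a coordinate vanishes at some trivalent vertex. A complex
decoration of the weave with all crossing values equal to one can be built from the bottom to the
top (`exists_descends`). The rational functions defined at it form a local ring, and the coordinates
of a generic decoration at trivalent vertices are units of this ring, hence nonzero
(`IsGeneric.isExtendable`). -/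

namespace DemazureWeaves

/-! ### Coherence of braid moves on labelled words -/

section Labelled

variable {d : ℕ} {L : Type*}

/-- A braid move on words whose letters carry labels, where `φ` transforms the labels in the braid
relation of length three. -/
inductive BraidStep (φ : L × L × L → L × L × L) : List (Color d × L) → List (Color d × L) → Prop
  | four (u v : List (Color d × L)) (i j : Color d) (a b : L) (h : Distant i j) :
      BraidStep φ (u ++ (i, a) :: (j, b) :: v) (u ++ (j, b) :: (i, a) :: v)
  | six (u v : List (Color d × L)) (i j : Color d) (a f e b c g : L) (h : Adjacent i j)
      (hφ : φ (a, f, e) = (b, c, g)) :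
      BraidStep φ (u ++ (i, a) :: (j, f) :: (i, e) :: v) (u ++ (j, b) :: (i, c) :: (j, g) :: v)

/-- Equality of labelled words up to braid moves. -/
def BraidEq (φ : L × L × L → L × L × L) : List (Color d × L) → List (Color d × L) → Prop :=
  Relation.EqvGen (BraidStep φ)

/-- The eight braid moves around the commutation classes of reduced words of the longest
permutation of four letters have trivial monodromy. -/
def RankThreeCoherent (φ : L × L × L → L × L × L) : Prop :=
  ∀ x₁ x₂ x₃ x₄ x₅ x₆ y₁ y₂ y₃ u₁ u₂ u₃ v₁ v₂ v₃ s₁ s₂ s₃ t₁ t₂ t₃ p₁ p₂ p₃ q₁ q₂ q₃ r₁ r₂ r₃ : L,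
    φ (x₁, x₂, x₃) = (y₁, y₂, y₃) → φ (y₃, x₄, x₅) = (u₁, u₂, u₃) →
    φ (y₂, u₂, x₆) = (v₁, v₂, v₃) → φ (y₁, u₁, v₁) = (s₁, s₂, s₃) →
    φ (s₃, v₃, u₃) = (t₁, t₂, t₃) → φ (s₂, v₂, t₁) = (p₁, p₂, p₃) →
    φ (s₁, p₂, t₂) = (q₁, q₂, q₃) → φ (q₃, p₃, t₃) = (r₁, r₂, r₃) →
    p₁ = x₁ ∧ q₁ = x₂ ∧ r₁ = x₃ ∧ q₂ = x₄ ∧ r₂ = x₅ ∧ r₃ = x₆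

variable {φ : L × L × L → L × L × L}

theorem BraidEq.refl (X : List (Color d × L)) : BraidEq φ X X := Relation.EqvGen.refl X
theorem BraidEq.symm {X Y : List (Color d × L)} (h : BraidEq φ X Y) : BraidEq φ Y X :=
  Relation.EqvGen.symm _ _ h
theorem BraidEq.trans {X Y Z : List (Color d × L)} (h : BraidEq φ X Y) (h' : BraidEq φ Y Z) :
    BraidEq φ X Z := Relation.EqvGen.trans _ _ _ h h'

theorem BraidEq.cons (x : Color d × L) {X Y : List (Color d × L)} (h : BraidEq φ X Y) :
    BraidEq φ (x :: X) (x :: Y) := by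
  induction h with
  | rel X Y h =>
    refine Relation.EqvGen.rel _ _ ?_
    cases h with
    | four u v i j a b h => exact BraidStep.four (x :: u) v i j a b h
    | six u v i j a f e b c g h hφ => exact BraidStep.six (x :: u) v i j a f e b c g h hφ
  | refl X => exact BraidEq.refl _
  | symm X Y _ ih => exact ih.symm
  | trans X Y Z _ _ ih ih' => exact ih.trans ih'

theorem BraidEq.length_eq {X Y : List (Color d × L)} (h : BraidEq φ X Y) :
    X.length = Y.length := by
  induction h with
  | rel X Y h => cases h <;> simp
  | refl X => rfl
  | symm X Y _ ih => exact ih.symm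
  | trans X Y Z _ _ ih ih' => exact ih.trans ih'

theorem BraidEq.four {i j : Color d} (h : Distant i j) (a b : L) (v : List (Color d × L)) :
    BraidEq φ ((i, a) :: (j, b) :: v) ((j, b) :: (i, a) :: v) :=
  Relation.EqvGen.rel _ _ (BraidStep.four [] v i j a b h)

theorem BraidEq.six {i j : Color d} (h : Adjacent i j) {a f e b c g : L}
    (hφ : φ (a, f, e) = (b, c, g)) (v : List (Color d × L)) :
    BraidEq φ ((i, a) :: (j, f) :: (i, e) :: v) ((j, b) :: (i, c) :: (j, g) :: v) :=
  Relation.EqvGen.rel _ _ (BraidStep.six [] v i j a f e b c g h hφ)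

/-- The first letters of two words that agree up to braid moves complete each other to a common
multiple. -/
inductive HeadRel (φ : L × L × L → L × L × L) :
    Color d × L → List (Color d × L) → Color d × L → List (Color d × L) → Prop
  | eq (x : Color d × L) (A B : List (Color d × L)) (h : BraidEq φ A B) : HeadRel φ x A x B
  | dist (i j : Color d) (a b : L) (A B C : List (Color d × L)) (h : Distant i j)
      (hA : BraidEq φ A ((j, b) :: C)) (hB : BraidEq φ B ((i, a) :: C)) :
      HeadRel φ (i, a) A (j, b) B
  | adj (i j : Color d) (a f e b c g : L) (A B C : List (Color d × L)) (h : Adjacent i j)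
      (hφ : φ (a, f, e) = (b, c, g))
      (hA : BraidEq φ A ((j, f) :: (i, e) :: C)) (hB : BraidEq φ B ((i, c) :: (j, g) :: C)) :
      HeadRel φ (i, a) A (j, b) B

theorem HeadRel.symm (hinv : ∀ x, φ (φ x) = x) {x y : Color d × L} {A B : List (Color d × L)}
    (h : HeadRel φ x A y B) : HeadRel φ y B x A := by
  cases h with
  | eq x A B h => exact .eq _ _ _ h.symm
  | dist i j a b A B C h hA hB => exact .dist _ _ _ _ _ _ C h.symm hB hA
  | adj i j a f e b c g A B C h hφ hA hB =>
    exact .adj _ _ _ _ _ _ _ _ _ _ C h.symm (by rw [← hφ, hinv]) hB hA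

theorem HeadRel.congr {x y : Color d × L} {A B A' B' : List (Color d × L)}
    (h : HeadRel φ x A y B) (hA' : BraidEq φ A' A) (hB' : BraidEq φ B' B) :
    HeadRel φ x A' y B' := by
  cases h with
  | eq x A B h => exact .eq _ _ _ ((hA'.trans h).trans hB'.symm)
  | dist i j a b A B C h hA hB => exact .dist _ _ _ _ _ _ C h (hA'.trans hA) (hB'.trans hB)
  | adj i j a f e b c g A B C h hφ hA hB =>
    exact .adj _ _ _ _ _ _ _ _ _ _ C h hφ (hA'.trans hA) (hB'.trans hB)

theorem color_trichotomy (i j : Color d) : i = j ∨ Distant i j ∨ Adjacent i j := by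
  obtain ⟨i, hi⟩ := i
  obtain ⟨j, hj⟩ := j
  simp only [Subtype.mk.injEq, Distant, Adjacent]
  omega

theorem HeadRel.of_eq {i : Color d} {a b : L} {A B : List (Color d × L)}
    (h : HeadRel φ (i, a) A (i, b) B) : a = b ∧ BraidEq φ A B := by
  cases h with
  | eq _ _ _ h => exact ⟨rfl, h⟩
  | dist _ _ _ _ _ _ _ h => simp [Distant] at h
  | adj _ _ _ _ _ _ _ _ _ _ _ h => simp [Adjacent] at h

theorem HeadRel.of_distant {i j : Color d} (hij : Distant i j) {a b : L}
    {A B : List (Color d × L)} (h : HeadRel φ (i, a) A (j, b) B) :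
    ∃ C, BraidEq φ A ((j, b) :: C) ∧ BraidEq φ B ((i, a) :: C) := by
  cases h with
  | eq _ _ _ h => simp [Distant] at hij
  | dist _ _ _ _ _ _ C h hA hB => exact ⟨C, hA, hB⟩
  | adj _ _ _ _ _ _ _ _ _ _ _ h => simp only [Distant, Adjacent] at h hij; omega

theorem HeadRel.of_adjacent {i j : Color d} (hij : Adjacent i j) {a b : L}
    {A B : List (Color d × L)} (h : HeadRel φ (i, a) A (j, b) B) :
    ∃ f e c g C, φ (a, f, e) = (b, c, g) ∧ BraidEq φ A ((j, f) :: (i, e) :: C) ∧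
      BraidEq φ B ((i, c) :: (j, g) :: C) := by
  cases h with
  | eq _ _ _ h => simp [Adjacent] at hij
  | dist _ _ _ _ _ _ C h hA hB => simp only [Distant, Adjacent] at h hij; omega
  | adj _ _ _ f e _ c g _ _ C h hφ hA hB => exact ⟨f, e, c, g, C, hφ, hA, hB⟩

/-- The transitivity of `HeadRel`, for words `E` such that the tails of words that are equal up to
braid moves to `E` satisfy the theorem. -/
theorem HeadRel.trans (hinv : ∀ x, φ (φ x) = x) (htet : RankThreeCoherent φ) (n : ℕ)
    (IH : ∀ (x y : Color d × L) (A B : List (Color d × L)), A.length < n →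
      BraidEq φ (x :: A) (y :: B) → HeadRel φ x A y B)
    {x z y : Color d × L} {A E B : List (Color d × L)} (hE : E.length = n)
    (h₁ : HeadRel φ x A z E) (h₂ : HeadRel φ z E y B) : HeadRel φ x A y B := by
  -- The three first colors generate a parabolic subgroup of rank at most three. This covers `A₁ ×
  -- A₂` and the case of `A₃` in which the middle node is `j`; the reflected case is reduced to it
  -- by symmetry.
  have dist_adj : ∀ {i k j : Color d} {a b c : L} {A B E : List (Color d × L)}, E.length = n →
      Distant i k → Adjacent k j → HeadRel φ (i, a) A (k, b) E → HeadRel φ (k, b) E (j, c) B →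
      HeadRel φ (i, a) A (j, c) B := by
    intro i k j a b c A B E hE hik hkj h₁ h₂
    obtain ⟨C₁, hA, hE₁⟩ := h₁.of_distant hik
    obtain ⟨f, e, f', e', C₂, hφ, hE₂, hB⟩ := h₂.of_adjacent hkj
    have l1 := hE₁.length_eq
    have l2 := hE₂.length_eq
    simp only [List.length_cons] at l1 l2
    have key := IH _ _ _ _ (by omega) (hE₁.symm.trans hE₂)
    rcases color_trichotomy i j with rfl | hij | hij
    · simp only [Distant, Adjacent] at hik hkj; omega
    · obtain ⟨P, hC₁, hP⟩ := key.of_distant hij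
      have l3 := hP.length_eq
      simp only [List.length_cons] at l3
      obtain ⟨Q, hC₂, hPQ⟩ := (IH _ _ _ _ (by omega) hP).of_distant hik.symm
      refine .dist _ _ _ _ _ _ ((k, f') :: (j, e') :: Q) hij ?_ ?_
      · exact (hA.trans ((hC₁.trans (hPQ.cons _)).cons _)).trans (.six hkj hφ _)
      · exact (hB.trans ((hC₂.cons _).cons _)).trans
          (((BraidEq.four hij.symm _ _ _).cons _).trans (.four hik.symm _ _ _))
    · obtain ⟨g, h, g', h', P, hφ', hC₁, hP⟩ := key.of_adjacent hij
      have l3 := hC₁.length_eq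
      have l4 := hP.length_eq
      simp only [List.length_cons] at l3 l4
      obtain ⟨Q, hC₂, hPQ⟩ := (IH _ _ _ _ (by omega) hP).of_distant hik.symm
      have l5 := hPQ.length_eq
      simp only [List.length_cons] at l5
      obtain ⟨m, n', m', n'', R, hφ'', hPR, hQ⟩ :=
        (IH _ _ _ _ (by omega) hPQ).of_adjacent hkj.symm
      -- The cycle of eight moves in `A₃` is known only on one side. The involution `φ` supplies
      -- preimages for the missing labels, and `htet` then says that the cycle closes.
      obtain ⟨⟨y₂, u₂, x₆⟩, hv⟩ : ∃ w, φ w = (e', g', m') := ⟨_, hinv _⟩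
      obtain ⟨⟨y₃, x₄, x₅⟩, hu⟩ : ∃ w, φ w = (f', u₂, n'') := ⟨_, hinv _⟩
      obtain ⟨⟨x₁, x₂, x₃⟩, hy⟩ : ∃ w, φ w = (c, y₂, y₃) := ⟨_, hinv _⟩
      obtain ⟨⟨q₁, q₂, q₃⟩, hq⟩ : ∃ w, φ (b, g, m) = w := ⟨_, rfl⟩
      obtain ⟨⟨r₁, r₂, r₃⟩, hr⟩ : ∃ w, φ (q₃, h, n') = w := ⟨_, rfl⟩
      have hs : φ (c, f', e') = (b, f, e) := by rw [← hφ, hinv]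
      have ht : φ (e, m', n'') = (h', m, n') := by rw [← hφ'', hinv]
      have hp : φ (f, g', h') = (a, g, h) := by rw [← hφ', hinv]
      obtain ⟨e1, e2, e3, e4, e5, e6⟩ :=
        htet _ _ _ _ _ _ _ _ _ _ _ _ _ _ _ _ _ _ _ _ _ _ _ _ _ _ _ _ _ _ hy hu hv hs ht hp hq hr
      subst e1 e2 e3 e4 e5 e6
      refine .adj _ _ _ _ _ _ _ _ _ _ ((k, q₂) :: (j, r₂) :: (i, r₃) :: R) hij hy ?_ ?_
      · refine (hA.trans ((hC₁.trans ((hPR.cons _).cons _)).cons _)).trans ?_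
        refine (((BraidEq.four hik _ _ _).cons _).cons _).trans ?_
        refine (BraidEq.six hkj hq _).trans ?_
        refine (((BraidEq.six hij.symm hr _).cons _).cons _).trans ?_
        exact (BraidEq.four hik.symm _ _ _).cons _
      · refine (hB.trans (((hC₂.trans (hQ.cons _)).cons _).cons _)).trans ?_
        have hv' : φ (e', g', m') = (y₂, u₂, r₃) := by rw [← hv, hinv]
        have hu' : φ (f', u₂, n'') = (y₃, q₂, r₂) := by rw [← hu, hinv]
        refine ((BraidEq.six hij.symm hv' _).cons _).trans ?_
        refine (BraidEq.four hik.symm _ _ _).trans ?_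
        refine ((((BraidEq.four hik _ _ _).cons _).cons _).cons _).trans ?_
        exact (BraidEq.six hkj hu' _).cons _
  cases h₁ with
  | eq x A E h => exact h₂.congr h (.refl _)
  | dist i k a b A E C₁ hik hA hE₁ =>
    cases h₂ with
    | eq _ _ _ h => exact .dist _ _ _ _ _ _ C₁ hik hA (h.symm.trans hE₁)
    | adj _ j _ f e c f' e' _ _ C₂ hkj hφ hE₂ hB =>
      exact dist_adj hE hik hkj (.dist _ _ _ _ _ _ C₁ hik hA hE₁)
        (.adj _ _ _ _ _ _ _ _ _ _ C₂ hkj hφ hE₂ hB)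
    | dist _ j _ c _ _ C₂ hkj hE₂ hB =>
      have l1 := hE₁.length_eq
      simp only [List.length_cons] at l1
      have key := IH _ _ _ _ (by omega) (hE₁.symm.trans hE₂)
      rcases color_trichotomy i j with rfl | hij | hij
      · obtain ⟨rfl, hC⟩ := key.of_eq
        exact .eq _ _ _ ((hA.trans (hC.cons _)).trans hB.symm)
      · obtain ⟨P, hC₁, hC₂⟩ := key.of_distant hij
        exact .dist _ _ _ _ _ _ ((k, b) :: P) hij
          ((hA.trans (hC₁.cons _)).trans (.four hkj _ _ _))
          ((hB.trans (hC₂.cons _)).trans (.four hik.symm _ _ _))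
      · obtain ⟨f, e, f', e', P, hφ, hC₁, hC₂⟩ := key.of_adjacent hij
        refine .adj _ _ _ _ _ _ _ _ _ _ ((k, b) :: P) hij hφ ?_ ?_
        · exact (hA.trans (hC₁.cons _)).trans ((BraidEq.four hkj _ _ _).trans
            ((BraidEq.four hik.symm _ _ _).cons _))
        · exact (hB.trans (hC₂.cons _)).trans ((BraidEq.four hik.symm _ _ _).trans
            ((BraidEq.four hkj _ _ _).cons _))
  | adj i k a f e b c₁ d₁ A E C₁ hik hφ₁ hA hE₁ =>
    cases h₂ with
    | eq _ _ _ h => exact .adj _ _ _ _ _ _ _ _ _ _ C₁ hik hφ₁ hA (h.symm.trans hE₁)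
    | dist _ j _ c _ _ C₂ hkj hE₂ hB =>
      exact (dist_adj hE hkj.symm hik.symm
        ((HeadRel.dist _ _ _ _ _ _ C₂ hkj hE₂ hB).symm hinv)
        ((HeadRel.adj _ _ _ _ _ _ _ _ _ _ C₁ hik hφ₁ hA hE₁).symm hinv)).symm hinv
    | adj _ j _ g h c g' h' _ _ C₂ hkj hφ₂ hE₂ hB =>
      have l1 := hE₁.length_eq
      have l2 := hE₂.length_eq
      simp only [List.length_cons] at l1 l2
      have key := IH _ _ _ _ (by simp; omega) (hE₁.symm.trans hE₂)
      rcases color_trichotomy i j with rfl | hij | hij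
      · obtain ⟨rfl, hC⟩ := key.of_eq
        obtain ⟨rfl, hC'⟩ := (IH _ _ _ _ (by omega) hC).of_eq
        have : (a, f, e) = (c, g', h') := by rw [← hφ₂, ← hφ₁, hinv]
        simp only [Prod.mk.injEq] at this
        obtain ⟨rfl, rfl, rfl⟩ := this
        exact .eq _ _ _ ((hA.trans ((hC'.cons _).cons _)).trans hB.symm)
      · obtain ⟨P, hC₁, hC₂⟩ := key.of_distant hij
        have l3 := hC₁.length_eq
        have l4 := hC₂.length_eq
        simp only [List.length_cons] at l3 l4
        obtain ⟨q, r, u₂, u₃, Q, hφ₃, hC₁, hPQ⟩ :=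
          (IH _ _ _ _ (by omega) hC₁).of_adjacent hkj
        obtain ⟨s, t, w₂, w₃, S, hφ₄, hC₂, hPS⟩ :=
          (IH _ _ _ _ (by omega) hC₂).of_adjacent hik.symm
        have l5 := hPQ.length_eq
        simp only [List.length_cons] at l5
        have key2 := IH _ _ _ _ (by simp; omega) (hPQ.symm.trans hPS)
        obtain ⟨rfl, key3⟩ := key2.of_eq
        obtain ⟨T, hQ, hS⟩ := (IH _ _ _ _ (by omega) key3).of_distant hij.symm
        -- Type `A₃` with middle node `k`: the second half of the cycle of eight moves is computed
        -- forwards, starting from the labels on the side of `B`.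
        obtain ⟨⟨t₁, t₂, t₃⟩, ht⟩ : ∃ w, φ (h', t, u₃) = w := ⟨_, rfl⟩
        obtain ⟨⟨p₁, p₂, p₃⟩, hp⟩ : ∃ w, φ (g', s, t₁) = w := ⟨_, rfl⟩
        obtain ⟨⟨q₁, q₂, q₃⟩, hq⟩ : ∃ w, φ (c, p₂, t₂) = w := ⟨_, rfl⟩
        obtain ⟨⟨r₁, r₂, r₃⟩, hr⟩ : ∃ w, φ (q₃, p₃, t₃) = w := ⟨_, rfl⟩
        have hv : φ (c₁, u₂, w₃) = (h, s, t) := by rw [← hφ₄, hinv]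
        obtain ⟨e1, e2, e3, e4, e5, e6⟩ :=
          htet _ _ _ _ _ _ _ _ _ _ _ _ _ _ _ _ _ _ _ _ _ _ _ _ _ _ _ _ _ _
            hφ₁ hφ₃ hv hφ₂ ht hp hq hr
        subst e1 e2 e3 e4 e5 e6
        have hr' : φ (r₁, r₂, r₃) = (q₃, p₃, t₃) := by rw [← hr, hinv]
        have hq' : φ (q₁, q₂, q₃) = (c, p₂, t₂) := by rw [← hq, hinv]
        refine .dist _ _ _ _ _ _ ((k, p₂) :: (j, t₂) :: (i, p₃) :: (k, t₃) :: T) hij ?_ ?_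
        · refine (hA.trans (((hC₁.trans ((hQ.cons _).cons _)).cons _).cons _)).trans ?_
          refine ((BraidEq.four hij _ _ _).cons _).trans ?_
          refine (((BraidEq.six hik hr' _).cons _).cons _).trans ?_
          exact BraidEq.six hkj hq' _
        · refine (hB.trans (((hC₂.trans ((hS.cons _).cons _)).cons _).cons _)).trans ?_
          refine ((BraidEq.four hij.symm _ _ _).cons _).trans ?_
          refine (((BraidEq.six hkj.symm ht _).cons _).cons _).trans ?_
          refine (BraidEq.six hik.symm hp _).trans ?_
          exact ((BraidEq.four hij _ _ _).cons _).cons _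
      -- Three colors cannot be pairwise adjacent.
      · simp only [Adjacent] at hik hkj hij; omega

/-- Garside's argument for cancellation in positive braid monoids, with labels. Inside an induction
on the length, a single braid move has the required form by inspection, and chains of moves are
handled by `HeadRel.trans`. -/
theorem BraidEq.headRel (hinv : ∀ x, φ (φ x) = x) (htet : RankThreeCoherent φ) :
    ∀ (n : ℕ) (x y : Color d × L) (A B : List (Color d × L)), A.length = n →
      BraidEq φ (x :: A) (y :: B) → HeadRel φ x A y B := by
  intro n
  induction n using Nat.strong_induction_on with
  | _ n ih =>
    intro x y A B hA h
    have IH : ∀ (x y : Color d × L) (A B : List (Color d × L)), A.length < n →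
      BraidEq φ (x :: A) (y :: B) → HeadRel φ x A y B := fun x y A B hl h => ih _ hl x y A B rfl h
    generalize hX : x :: A = X at h
    generalize hY : y :: B = Y at h
    induction h generalizing x y A B with
    | rel X Y h =>
      cases h with
      | four u v i j a b h =>
        cases u with
        | nil =>
          simp only [List.nil_append, List.cons.injEq] at hX hY
          obtain ⟨rfl, rfl⟩ := hX
          obtain ⟨rfl, rfl⟩ := hY
          exact .dist _ _ _ _ _ _ v h (.refl _) (.refl _)
        | cons z u =>
          simp only [List.cons_append, List.cons.injEq] at hX hY
          obtain ⟨rfl, rfl⟩ := hX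
          obtain ⟨rfl, rfl⟩ := hY
          exact .eq _ _ _ (.rel _ _ (.four u v i j a b h))
      | six u v i j a f e b c g h hφ =>
        cases u with
        | nil =>
          simp only [List.nil_append, List.cons.injEq] at hX hY
          obtain ⟨rfl, rfl⟩ := hX
          obtain ⟨rfl, rfl⟩ := hY
          exact .adj _ _ _ _ _ _ _ _ _ _ v h hφ (.refl _) (.refl _)
        | cons z u =>
          simp only [List.cons_append, List.cons.injEq] at hX hY
          obtain ⟨rfl, rfl⟩ := hX
          obtain ⟨rfl, rfl⟩ := hY
          exact .eq _ _ _ (.rel _ _ (.six u v i j a f e b c g h hφ))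
    | refl X =>
      obtain ⟨rfl, rfl⟩ := List.cons.inj (hX.trans hY.symm)
      exact .eq _ _ _ (.refl _)
    | symm X Y h ih' =>
      have hl := BraidEq.length_eq h
      rw [← hX, ← hY] at hl
      simp only [List.length_cons] at hl
      exact (ih' y x B A (by omega) hY hX).symm hinv
    | trans X Z Y h h' ih₁ ih₂ =>
      have hl := BraidEq.length_eq h
      have hl' := BraidEq.length_eq h'
      cases Z with
      | nil => rw [← hX] at hl; simp at hl
      | cons z E =>
        rw [← hX] at hl
        simp only [List.length_cons] at hl
        exact HeadRel.trans hinv htet n IH (z := z) (E := E) (by omega) (ih₁ x z A E hA hX rfl)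
          (ih₂ z y E B (by omega) rfl hY)

/-- Labelled words with the same colors that agree up to braid moves are equal. -/
theorem BraidEq.eq_of_map_fst (hinv : ∀ x, φ (φ x) = x) (htet : RankThreeCoherent φ) :
    ∀ {X Y : List (Color d × L)}, BraidEq φ X Y → X.map Prod.fst = Y.map Prod.fst → X = Y := by
  intro X
  induction X with
  | nil =>
    intro Y _ hc
    simpa using hc
  | cons x A ih =>
    intro Y h hc
    cases Y with
    | nil => simp at hc
    | cons y B =>
      simp only [List.map_cons, List.cons.injEq] at hc
      obtain ⟨i, a⟩ := x
      obtain ⟨j, b⟩ := y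
      obtain ⟨h1, hc⟩ := hc
      simp only at h1
      subst h1
      -- Cancellation: equal first colors force equal first labels and equivalent tails.
      obtain ⟨rfl, hAB⟩ := (BraidEq.headRel hinv htet _ _ _ _ _ rfl h).of_eq
      rw [ih hAB hc]

end Labelled

/-! ### The labels of decorated words -/

section Labels

variable {N : Type*}

-- The integers are the values of a single cycle along the eight braid moves. Each minimum is given
-- by its two linear relations and an alternative with disjoint cases, so that on each consistent
-- combination of cases the claim is linear.
set_option maxHeartbeats 4000000 in
theorem tropical_rank_three (x1 x2 x3 x4 x5 x6 y1 y2 y3 u1 u2 u3 v1 v2 v3 s1 s2 s3 t1 t2 t3 p1 p2 p3 q1 q2 q3 r1 r2 r3 : ℤ)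
 (hy1 : y1 + y2 = x2 + x3) (hy3 : y2 + y3 = x1 + x2) (hy2 : (y2 = x1 ∧ x1 ≤ x3) ∨ (y2 = x3 ∧ x3 < x1))
 (hu1 : u1 + u2 = x4 + x5) (hu3 : u2 + u3 = y3 + x4) (hu2 : (u2 = y3 ∧ y3 ≤ x5) ∨ (u2 = x5 ∧ x5 < y3))
 (hv1 : v1 + v2 = u2 + x6) (hv3 : v2 + v3 = y2 + u2) (hv2 : (v2 = y2 ∧ y2 ≤ x6) ∨ (v2 = x6 ∧ x6 < y2))
 (hs1 : s1 + s2 = u1 + v1) (hs3 : s2 + s3 = y1 + u1) (hs2 : (s2 = y1 ∧ y1 ≤ v1) ∨ (s2 = v1 ∧ v1 < y1))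
 (ht1 : t1 + t2 = v3 + u3) (ht3 : t2 + t3 = s3 + v3) (ht2 : (t2 = s3 ∧ s3 ≤ u3) ∨ (t2 = u3 ∧ u3 < s3))
 (hp1 : p1 + p2 = v2 + t1) (hp3 : p2 + p3 = s2 + v2) (hp2 : (p2 = s2 ∧ s2 ≤ t1) ∨ (p2 = t1 ∧ t1 < s2))
 (hq1 : q1 + q2 = p2 + t2) (hq3 : q2 + q3 = s1 + p2) (hq2 : (q2 = s1 ∧ s1 ≤ t2) ∨ (q2 = t2 ∧ t2 < s1))
 (hr1 : r1 + r2 = p3 + t3) (hr3 : r2 + r3 = q3 + p3) (hr2 : (r2 = q3 ∧ q3 ≤ t3) ∨ (r2 = t3 ∧ t3 < q3)) :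
 p1 = x1 ∧ q1 = x2 ∧ r1 = x3 ∧ q2 = x4 ∧ r2 = x5 ∧ r3 = x6 := by
  obtain rfl : y1 = x2 + x3 - y2 := by omega
  obtain rfl : y3 = x1 + x2 - y2 := by omega
  obtain rfl : u1 = x4 + x5 - u2 := by omega
  obtain rfl : u3 = x1 + x2 - y2 + x4 - u2 := by omega
  obtain rfl : v1 = u2 + x6 - v2 := by omega
  obtain rfl : v3 = y2 + u2 - v2 := by omega
  clear hy1 hy3 hu1 hu3 hv1 hv3
  obtain rfl : s1 = x4 + x5 - u2 + (u2 + x6 - v2) - s2 := by omega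
  obtain rfl : s3 = x2 + x3 - y2 + (x4 + x5 - u2) - s2 := by omega
  clear hs1 hs3
  rcases hy2 with ⟨rfl, a1⟩ | ⟨rfl, a1⟩ <;>
  rcases hu2 with ⟨rfl, a2⟩ | ⟨rfl, a2⟩
  all_goals rcases hv2 with ⟨rfl, a3⟩ | ⟨rfl, a3⟩
  all_goals rcases hs2 with ⟨rfl, a4⟩ | ⟨rfl, a4⟩
  all_goals try (exfalso; omega)
  all_goals rcases ht2 with ⟨rfl, a5⟩ | ⟨rfl, a5⟩
  all_goals try (exfalso; omega)
  all_goals rcases hp2 with ⟨rfl, a6⟩ | ⟨rfl, a6⟩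
  all_goals try (exfalso; omega)
  all_goals rcases hq2 with ⟨rfl, a7⟩ | ⟨rfl, a7⟩
  all_goals try (exfalso; omega)
  all_goals rcases hr2 with ⟨rfl, a8⟩ | ⟨rfl, a8⟩
  all_goals try (exfalso; omega)

  all_goals (refine ⟨?_, ?_, ?_, ?_, ?_, ?_⟩ <;> omega)

/-- Capital letters are crossing values, lower case letters are coordinates. The crossing values are
already known to return to `X1, …, X6`. Nothing else is used about the middle crossing value of each
move, so this is an identity of rational functions and no minima occur. -/
theorem coordinates_rank_three {K : Type*} [Field K] (x1 x2 x3 x4 x5 x6 y1 y2 y3 u1 u2 u3 v1 v2 v3 s1 s2 s3 t1 t2 t3 p1 p2 p3 q1 q2 q3 r1 r2 r3 : K)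
 (X1 X2 X3 X4 X5 X6 Y1 Y2 Y3 U1 U2 U3 V1 V2 V3 S1 S2 S3 T1 T2 T3 P2 P3 Q3 : K)
 (hX1 : X1 ≠ 0) (hX2 : X2 ≠ 0) (hX3 : X3 ≠ 0) (hX4 : X4 ≠ 0) (hX5 : X5 ≠ 0) (hX6 : X6 ≠ 0) 
 (hY2 : Y2 ≠ 0) (hU2 : U2 ≠ 0) (hV2 : V2 ≠ 0) (hS2 : S2 ≠ 0) (hT2 : T2 ≠ 0) (hP2 : P2 ≠ 0) 
 (hy1 : Y1 = X2 * X3 / Y2) (hy3 : Y3 = X1 * X2 / Y2)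
 (hu1 : U1 = X4 * X5 / U2) (hu3 : U3 = Y3 * X4 / U2)
 (hv1 : V1 = U2 * X6 / V2) (hv3 : V3 = Y2 * U2 / V2)
 (hs1 : S1 = U1 * V1 / S2) (hs3 : S3 = Y1 * U1 / S2)
 (ht1 : T1 = V3 * U3 / T2) (ht3 : T3 = S3 * V3 / T2)
 (hp1 : X1 = V2 * T1 / P2) (hp3 : P3 = S2 * V2 / P2)
 (hq1 : X2 = P2 * T2 / X4) (hq3 : Q3 = S1 * P2 / X4)
 (hr1 : X3 = P3 * T3 / X5) (hr3 : X6 = Q3 * P3 / X5)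
 (zy : y1 = X1 * x3 / Y2 ∧ y2 = x1 * x3 - X3 * x2 / X1 ∧ y3 = Y2 * x1 / X3)
 (zu : u1 = Y3 * x5 / U2 ∧ u2 = y3 * x5 - X5 * x4 / Y3 ∧ u3 = U2 * y3 / X5)
 (zv : v1 = Y2 * x6 / V2 ∧ v2 = y2 * x6 - X6 * u2 / Y2 ∧ v3 = V2 * y2 / X6)
 (zs : s1 = Y1 * v1 / S2 ∧ s2 = y1 * v1 - V1 * u1 / Y1 ∧ s3 = S2 * y1 / V1)
 (zt : t1 = S3 * u3 / T2 ∧ t2 = s3 * u3 - U3 * v3 / S3 ∧ t3 = T2 * s3 / U3)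
 (zp : p1 = S2 * t1 / P2 ∧ p2 = s2 * t1 - T1 * v2 / S2 ∧ p3 = P2 * s2 / T1)
 (zq : q1 = S1 * t2 / X4 ∧ q2 = s1 * t2 - T2 * p2 / S1 ∧ q3 = X4 * s1 / T2)
 (zr : r1 = Q3 * t3 / X5 ∧ r2 = q3 * t3 - T3 * p3 / Q3 ∧ r3 = X5 * q3 / T3) :
 p1 = x1 ∧ q1 = x2 ∧ r1 = x3 ∧ q2 = x4 ∧ r2 = x5 ∧ r3 = x6 := by
  have e1 : P2 = X2 * X4 / T2 := by rw [hq1]; field_simp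
  subst e1
  obtain ⟨rfl, rfl, rfl⟩ := zy
  obtain ⟨rfl, rfl, rfl⟩ := zu
  obtain ⟨rfl, rfl, rfl⟩ := zv
  obtain ⟨rfl, rfl, rfl⟩ := zs
  obtain ⟨rfl, rfl, rfl⟩ := zt
  obtain ⟨rfl, rfl, rfl⟩ := zp
  obtain ⟨rfl, rfl, rfl⟩ := zq
  obtain ⟨rfl, rfl, rfl⟩ := zr
  subst hy1 hy3 hu1 hu3 hv1 hv3 hs1 hs3 ht1 ht3 hp3 hq3
  clear hq1
  field_simp at hp1 hr1 hr3
  refine ⟨?_, ?_, ?_, ?_, ?_, ?_⟩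
  all_goals field_simp
  all_goals ring

/-- The weights below a 6-valent vertex. -/
def sixWeights (w : (N → ℕ) × (N → ℕ) × (N → ℕ)) : (N → ℕ) × (N → ℕ) × (N → ℕ) :=
  (w.2.1 + w.2.2 - w.1 ⊓ w.2.2, w.1 ⊓ w.2.2, w.1 + w.2.1 - w.1 ⊓ w.2.2)

theorem sixWeights_sixWeights (w : (N → ℕ) × (N → ℕ) × (N → ℕ)) :
    sixWeights (sixWeights w) = w := by
  obtain ⟨a, f, e⟩ := w
  simp only [sixWeights, Prod.mk.injEq]
  refine ⟨?_, ?_, ?_⟩ <;> funext n <;>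
    simp only [Pi.add_apply, Pi.sub_apply, Pi.inf_apply] <;> omega

variable [Fintype N] {K : Type*} [Field K]

/-- The crossing value of a weave line on which the cycles take the values `a`. -/
def weightValue (Δ : N → K) (a : N → ℕ) : K := ∏ n, Δ n ^ a n

theorem weightValue_add (Δ : N → K) (a b : N → ℕ) :
    weightValue Δ (a + b) = weightValue Δ a * weightValue Δ b := by
  simp [weightValue, pow_add, Finset.prod_mul_distrib]

theorem weightValue_ne_zero {Δ : N → K} (hΔ : ∀ n, Δ n ≠ 0) (a : N → ℕ) : weightValue Δ a ≠ 0 :=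
  Finset.prod_ne_zero_iff.2 fun n _ => pow_ne_zero _ (hΔ n)

theorem weightValue_sub {Δ : N → K} (hΔ : ∀ n, Δ n ≠ 0) {a b : N → ℕ} (h : b ≤ a) :
    weightValue Δ (a - b) = weightValue Δ a / weightValue Δ b := by
  rw [eq_div_iff (weightValue_ne_zero hΔ b), ← weightValue_add, tsub_add_cancel_of_le h]

/-- The transformation of labels at a 6-valent vertex. -/
def sixLabels (Δ : N → K) (x : ((N → ℕ) × K) × ((N → ℕ) × K) × ((N → ℕ) × K)) :
    ((N → ℕ) × K) × ((N → ℕ) × K) × ((N → ℕ) × K) :=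
  let w := sixWeights (x.1.1, x.2.1.1, x.2.2.1)
  ((w.1, weightValue Δ x.1.1 * x.2.2.2 / weightValue Δ w.2.1),
    (w.2.1, x.1.2 * x.2.2.2 - weightValue Δ x.2.2.1 * x.2.1.2 / weightValue Δ x.1.1),
    (w.2.2, weightValue Δ w.2.1 * x.1.2 / weightValue Δ x.2.2.1))

theorem weightValue_sixWeights {Δ : N → K} (hΔ : ∀ n, Δ n ≠ 0) (a f e : N → ℕ) :
    weightValue Δ (f + e - a ⊓ e) = weightValue Δ f * weightValue Δ e / weightValue Δ (a ⊓ e) ∧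
    weightValue Δ (a + f - a ⊓ e) = weightValue Δ a * weightValue Δ f / weightValue Δ (a ⊓ e) := by
  constructor
  · rw [weightValue_sub hΔ, weightValue_add]
    exact inf_le_right.trans le_add_self
  · rw [weightValue_sub hΔ, weightValue_add]
    exact inf_le_left.trans le_self_add

/-- The coordinates in `sixLabels` are those of `crossFrame_braid`, whose middle crossing value is
taken to be the value of the minimum of the outer weights. Applied twice, the formulas cancel by
`weightValue_sixWeights`. -/
theorem sixLabels_sixLabels {Δ : N → K} (hΔ : ∀ n, Δ n ≠ 0)
    (x : ((N → ℕ) × K) × ((N → ℕ) × K) × ((N → ℕ) × K)) : sixLabels Δ (sixLabels Δ x) = x := by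
  obtain ⟨⟨a, x⟩, ⟨f, y⟩, ⟨e, z⟩⟩ := x
  have h := sixWeights_sixWeights (a, f, e)
  have hv := weightValue_sixWeights hΔ a f e
  have n1 := weightValue_ne_zero hΔ (a ⊓ e)
  have n2 := weightValue_ne_zero hΔ a
  have n3 := weightValue_ne_zero hΔ f
  have n4 := weightValue_ne_zero hΔ e
  unfold sixLabels
  simp only [Prod.mk.eta, h]
  simp only [sixWeights, hv, Prod.mk.injEq, true_and]
  refine ⟨?_, ?_, ?_⟩ <;> field_simp
  ring

/-- The weights close up separately for each cycle, by the tropical statement. Afterwards the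
crossing values close up as well, which is the hypothesis needed for the coordinates. -/
theorem rankThreeCoherent_sixLabels {Δ : N → K} (hΔ : ∀ n, Δ n ≠ 0) :
    RankThreeCoherent (sixLabels Δ) := by
  intro x₁ x₂ x₃ x₄ x₅ x₆ y₁ y₂ y₃ u₁ u₂ u₃ v₁ v₂ v₃ s₁ s₂ s₃ t₁ t₂ t₃ p₁ p₂ p₃ q₁ q₂ q₃ r₁ r₂ r₃
    hy hu hv hs ht hp hq hr
  have split : ∀ {a f e b c g : (N → ℕ) × K}, sixLabels Δ (a, f, e) = (b, c, g) →
      (b.1 = f.1 + e.1 - a.1 ⊓ e.1 ∧ c.1 = a.1 ⊓ e.1 ∧ g.1 = a.1 + f.1 - a.1 ⊓ e.1) ∧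
      (b.2 = weightValue Δ a.1 * e.2 / weightValue Δ c.1 ∧
        c.2 = a.2 * e.2 - weightValue Δ e.1 * f.2 / weightValue Δ a.1 ∧
        g.2 = weightValue Δ c.1 * a.2 / weightValue Δ e.1) ∧
      weightValue Δ b.1 = weightValue Δ f.1 * weightValue Δ e.1 / weightValue Δ c.1 ∧
      weightValue Δ g.1 = weightValue Δ a.1 * weightValue Δ f.1 / weightValue Δ c.1 := by
    intro a f e b c g h
    simp only [sixLabels, Prod.mk.injEq] at h
    obtain ⟨rfl, rfl, rfl⟩ := h
    exact ⟨⟨rfl, rfl, rfl⟩, ⟨rfl, rfl, rfl⟩, weightValue_sixWeights hΔ _ _ _⟩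
  obtain ⟨⟨wy1, wy2, wy3⟩, zy, vy1, vy3⟩ := split hy
  obtain ⟨⟨wu1, wu2, wu3⟩, zu, vu1, vu3⟩ := split hu
  obtain ⟨⟨wv1, wv2, wv3⟩, zv, vv1, vv3⟩ := split hv
  obtain ⟨⟨ws1, ws2, ws3⟩, zs, vs1, vs3⟩ := split hs
  obtain ⟨⟨wt1, wt2, wt3⟩, zt, vt1, vt3⟩ := split ht
  obtain ⟨⟨wp1, wp2, wp3⟩, zp, vp1, vp3⟩ := split hp
  obtain ⟨⟨wq1, wq2, wq3⟩, zq, vq1, vq3⟩ := split hq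
  obtain ⟨⟨wr1, wr2, wr3⟩, zr, vr1, vr3⟩ := split hr
  have lin : ∀ {a f e b c g : N → ℕ}, b = f + e - a ⊓ e → c = a ⊓ e → g = a + f - a ⊓ e →
      ∀ n, (b n : ℤ) + c n = f n + e n ∧ (c n : ℤ) + g n = a n + f n ∧
        (((c n : ℤ) = a n ∧ (a n : ℤ) ≤ e n) ∨ ((c n : ℤ) = e n ∧ (e n : ℤ) < a n)) := by
    rintro a f e b c g rfl rfl rfl n
    simp only [Pi.add_apply, Pi.sub_apply, Pi.inf_apply]
    omega
  have hw : p₁.1 = x₁.1 ∧ q₁.1 = x₂.1 ∧ r₁.1 = x₃.1 ∧ q₂.1 = x₄.1 ∧ r₂.1 = x₅.1 ∧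
      r₃.1 = x₆.1 := by
    have main := fun n =>
      tropical_rank_three (x₁.1 n) (x₂.1 n) (x₃.1 n) (x₄.1 n) (x₅.1 n) (x₆.1 n)
        (y₁.1 n) (y₂.1 n) (y₃.1 n) (u₁.1 n) (u₂.1 n) (u₃.1 n) (v₁.1 n) (v₂.1 n) (v₃.1 n)
        (s₁.1 n) (s₂.1 n) (s₃.1 n) (t₁.1 n) (t₂.1 n) (t₃.1 n) (p₁.1 n) (p₂.1 n) (p₃.1 n)
        (q₁.1 n) (q₂.1 n) (q₃.1 n) (r₁.1 n) (r₂.1 n) (r₃.1 n)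
        (lin wy1 wy2 wy3 n).1 (lin wy1 wy2 wy3 n).2.1 (lin wy1 wy2 wy3 n).2.2
        (lin wu1 wu2 wu3 n).1 (lin wu1 wu2 wu3 n).2.1 (lin wu1 wu2 wu3 n).2.2
        (lin wv1 wv2 wv3 n).1 (lin wv1 wv2 wv3 n).2.1 (lin wv1 wv2 wv3 n).2.2
        (lin ws1 ws2 ws3 n).1 (lin ws1 ws2 ws3 n).2.1 (lin ws1 ws2 ws3 n).2.2
        (lin wt1 wt2 wt3 n).1 (lin wt1 wt2 wt3 n).2.1 (lin wt1 wt2 wt3 n).2.2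
        (lin wp1 wp2 wp3 n).1 (lin wp1 wp2 wp3 n).2.1 (lin wp1 wp2 wp3 n).2.2
        (lin wq1 wq2 wq3 n).1 (lin wq1 wq2 wq3 n).2.1 (lin wq1 wq2 wq3 n).2.2
        (lin wr1 wr2 wr3 n).1 (lin wr1 wr2 wr3 n).2.1 (lin wr1 wr2 wr3 n).2.2
    simp only [Nat.cast_inj] at main
    exact ⟨funext fun n => (main n).1, funext fun n => (main n).2.1,
      funext fun n => (main n).2.2.1, funext fun n => (main n).2.2.2.1,
      funext fun n => (main n).2.2.2.2.1, funext fun n => (main n).2.2.2.2.2⟩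
  -- The weights that return to their initial values are inserted into the relations of the last
  -- three moves.
  obtain ⟨h1, h2, h3, h4, h5, h6⟩ := hw
  rw [h1] at vp1
  rw [h2, h4] at vq1
  rw [h4] at vq3 zq
  rw [h3, h5] at vr1
  rw [h6, h5] at vr3
  rw [h5] at zr
  have nz := weightValue_ne_zero hΔ
  obtain ⟨k1, k2, k3, k4, k5, k6⟩ := coordinates_rank_three _ _ _ _ _ _ _ _ _ _ _ _ _ _ _ _ _ _ _
    _ _ _ _ _ _ _ _ _ _ _ _ _ _ _ _ _ _ _ _ _ _ _ _ _ _ _ _ _ _ _ _ _ _ _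
    (nz _) (nz _) (nz _) (nz _) (nz _) (nz _) (nz _) (nz _) (nz _) (nz _) (nz _) (nz _)
    vy1 vy3 vu1 vu3 vv1 vv3 vs1 vs3 vt1 vt3 vp1 vp3 vq1 vq3 vr1 vr3 zy zu zv zs zt zp zq zr
  exact ⟨Prod.ext h1 k1, Prod.ext h2 k2, Prod.ext h3 k3, Prod.ext h4 k4, Prod.ext h5 k5,
    Prod.ext h6 k6⟩

end Labels

/-! ### Frames of decorated flags -/

section Frames

variable {K : Type*} [Field K] {d : ℕ}

open ExteriorAlgebra

/-- The product of the first `k` vectors of a sequence. -/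
noncomputable def wedge (g : ℕ → Fin d → K) : ℕ → ExteriorAlgebra K (Fin d → K)
  | 0 => 1
  | k + 1 => wedge g k * ι K (g k)

/-- The vectors number `0, …, d - 1` of `g` are a frame of the decorated flag `F`. -/
def IsFrame (g : ℕ → Fin d → K) (F : DecoratedFlag K d) : Prop := ∀ k ≤ d, F.level k = wedge g k

theorem wedge_congr {g h : ℕ → Fin d → K} {k : ℕ} (H : ∀ m < k, g m = h m) :
    wedge g k = wedge h k := by
  induction k with
  | zero => rfl
  | succ k ih =>
    rw [wedge, wedge, ih fun m hm => H m (by omega), H k (by omega)]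

theorem wedge_eq_ιMulti (g : ℕ → Fin d → K) (k : ℕ) :
    wedge g k = ιMulti K k fun i : Fin k => g i := by
  induction k with
  | zero => simp [wedge]
  | succ k ih =>
    rw [wedge, ih, ιMulti_apply, ιMulti_apply, List.ofFn_succ', List.prod_concat]
    rfl

theorem wedge_mem (g : ℕ → Fin d → K) (k : ℕ) : wedge g k ∈ ⋀[K]^k (Fin d → K) := by
  rw [wedge_eq_ιMulti]
  exact ιMulti_range K k ⟨_, rfl⟩

theorem ι_anticomm (u v : Fin d → K) : ι K u * ι K v = -(ι K v * ι K u) :=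
  eq_neg_of_add_eq_zero_left (ι_add_mul_swap u v)

theorem ι_mul_wedge (u : Fin d → K) (g : ℕ → Fin d → K) (k : ℕ) :
    ι K u * wedge g k = (-1 : K) ^ k • (wedge g k * ι K u) := by
  induction k with
  | zero => simp [wedge]
  | succ k ih =>
    rw [wedge, ← mul_assoc, ih, smul_mul_assoc, mul_assoc, ι_anticomm, pow_succ, mul_neg,
      ← mul_assoc, mul_neg_one, neg_smul, smul_neg]

theorem wedge_mul_ι_self (g : ℕ → Fin d → K) {k m : ℕ} (h : m < k) :
    wedge g k * ι K (g m) = 0 := by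
  induction k with
  | zero => omega
  | succ k ih =>
    rcases Nat.lt_succ_iff_lt_or_eq.1 h with h | rfl
    · rw [wedge, mul_assoc, ι_anticomm, mul_neg, ← mul_assoc, ih h, zero_mul, neg_zero]
    · rw [wedge, mul_assoc, ι_sq_zero, mul_zero]

theorem wedge_ne_zero_of_le {g : ℕ → Fin d → K} {k m : ℕ} (h : k ≤ m) (hm : wedge g m ≠ 0) :
    wedge g k ≠ 0 := by
  induction m, h using Nat.le_induction with
  | base => exact hm
  | succ m h ih => exact ih fun h0 => hm (by rw [wedge, h0, zero_mul])

/-- Products of subfamilies of `k` independent vectors are independent in the exterior power; the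
subfamily used here is the full one. -/
theorem ιMulti_ne_zero {k : ℕ} {v : Fin k → Fin d → K} (hv : LinearIndependent K v) :
    ιMulti K k v ≠ 0 := by
  have h := (exteriorPower.ιMulti_family_linearIndependent_field (n := k) hv).ne_zero
    ⟨Finset.univ, by simp [Set.powersetCard]⟩
  intro h0
  apply h
  apply Subtype.ext
  rw [exteriorPower.ιMulti_family, exteriorPower.ιMulti_apply_coe, ZeroMemClass.coe_zero, ← h0]
  congr 1
  funext i
  simp only [Function.comp]
  congr 1
  -- The increasing enumeration of the full index set is the identity.
  have : Set.powersetCard.ofFinEmbEquiv.symm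
      (⟨Finset.univ, by simp [Set.powersetCard]⟩ : Set.powersetCard (Fin k) k) =
      RelEmbedding.refl _ := by
    apply DFunLike.coe_injective
    refine (StrictMono.range_inj (OrderEmbedding.strictMono _) (OrderEmbedding.strictMono _)).1 ?_
    rw [(Finite.surjective_of_injective (RelEmbedding.injective _)).range_eq,
      (Finite.surjective_of_injective (RelEmbedding.injective _)).range_eq]
  rw [this]
  rfl

theorem image_Iio_eq_range (g : ℕ → Fin d → K) (k : ℕ) :
    g '' Set.Iio k = Set.range fun i : Fin k => g i := by
  ext x
  simp only [Set.mem_range, Set.mem_image, Set.mem_Iio]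
  exact ⟨fun ⟨i, hi, h⟩ => ⟨⟨i, hi⟩, h⟩, fun ⟨i, hi⟩ => ⟨i, i.2, hi⟩⟩

theorem linearIndependent_of_wedge_ne_zero {g : ℕ → Fin d → K} {k : ℕ} (h : wedge g k ≠ 0) :
    LinearIndependent K fun i : Fin k => g i := by
  by_contra hd
  rw [wedge_eq_ιMulti] at h
  exact h (AlternatingMap.map_linearDependent _ _ hd)

/-- A vector whose product with an extensor vanishes is in the span of its factors. -/
theorem mem_span_of_wedge_mul_ι_eq_zero {g : ℕ → Fin d → K} {k : ℕ} (h : wedge g k ≠ 0)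
    {v : Fin d → K} (hv : wedge g k * ι K v = 0) :
    v ∈ Submodule.span K (g '' Set.Iio k) := by
  by_contra hs
  have hli := linearIndependent_of_wedge_ne_zero h
  have h2 : LinearIndependent K (Fin.snoc (fun i : Fin k => g i) v : Fin (k + 1) → Fin d → K) := by
    rw [linearIndependent_finSnoc, ← image_Iio_eq_range]
    exact ⟨hli, hs⟩
  let g' : ℕ → Fin d → K := fun n => if n = k then v else g n
  have h3 : (Fin.snoc (fun i : Fin k => g i) v : Fin (k + 1) → Fin d → K) =
      fun i : Fin (k + 1) => g' i := by
    funext i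
    refine Fin.lastCases ?_ (fun j => ?_) i
    · simp [g']
    · simp [g', j.2.ne]
  apply ιMulti_ne_zero h2
  rw [h3, ← wedge_eq_ιMulti, wedge, wedge_congr (g := g') (h := g) (k := k)
    fun m hm => by simp [g', hm.ne]]
  simpa [g'] using hv

theorem wedge_mul_ι_of_mem_span {g : ℕ → Fin d → K} {k : ℕ} {v : Fin d → K}
    (hv : v ∈ Submodule.span K (g '' Set.Iio k)) : wedge g k * ι K v = 0 := by
  induction hv using Submodule.span_induction with
  | mem x hx =>
    obtain ⟨m, hm, rfl⟩ := hx
    exact wedge_mul_ι_self g hm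
  | zero => simp
  | add x y _ _ hx hy => rw [map_add, mul_add, hx, hy, add_zero]
  | smul c x _ hx => rw [map_smul, mul_smul_comm, hx, smul_zero]

theorem mem_span_Iio_succ {g : ℕ → Fin d → K} {k : ℕ} {v : Fin d → K}
    (hv : v ∈ Submodule.span K (g '' Set.Iio (k + 1))) :
    ∃ c : K, v - c • g k ∈ Submodule.span K (g '' Set.Iio k) := by
  have : Set.Iio (k + 1) = insert k (Set.Iio k) := by ext; simp only [Set.mem_Iio, Set.mem_insert_iff]; omega
  rw [this, Set.image_insert_eq, Submodule.mem_span_insert] at hv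
  obtain ⟨c, z, hz, rfl⟩ := hv
  exact ⟨c, by simpa using hz⟩

theorem volumeForm_eq_wedge :
    volumeForm K d = wedge (fun n i => if (i : ℕ) = n then 1 else 0) d := by
  rw [wedge_eq_ιMulti, volumeForm]
  congr 1
  funext i j
  simp [Pi.single_apply, Fin.ext_iff]

theorem volumeForm_ne_zero : volumeForm K d ≠ 0 := by
  refine ιMulti_ne_zero ?_
  have := (Pi.basisFun K (Fin d)).linearIndependent
  convert this using 1
  funext i
  simp

/-- Some vector is not in the span of the given ones, since their number is less than the dimension.
The top exterior power is a line, so a multiple of this vector gives the volume form. -/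
theorem exists_mul_ι_eq_volumeForm {g : ℕ → Fin d → K} {k : ℕ} (hk : k + 1 = d)
    (h : wedge g k ≠ 0) : ∃ v, wedge g k * ι K v = volumeForm K d := by
  subst hk
  have hli := linearIndependent_of_wedge_ne_zero h
  obtain ⟨v, hv⟩ : ∃ v, wedge g k * ι K v ≠ 0 := by
    by_contra hall
    push Not at hall
    have htop : Submodule.span K (g '' Set.Iio k) = ⊤ :=
      Submodule.eq_top_iff'.2 fun v => mem_span_of_wedge_mul_ι_eq_zero h (hall v)
    have h1 := finrank_span_eq_card hli
    rw [← image_Iio_eq_range, htop, finrank_top] at h1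
    simp at h1
  let g' : ℕ → Fin (k + 1) → K := fun n => if n = k then v else g n
  have e : wedge g' (k + 1) = wedge g k * ι K v := by
    rw [wedge, wedge_congr (g := g') (h := g) (k := k) fun m hm => by simp [g', hm.ne]]
    simp [g']
  have hli' := linearIndependent_of_wedge_ne_zero (e ▸ hv)
  let b := basisOfLinearIndependentOfCardEqFinrank hli' (by simp)
  have hb : (b : Fin (k + 1) → Fin (k + 1) → K) = fun i : Fin (k + 1) => g' i := by simp [b]
  -- An alternating map in top degree is its value at a basis times the determinant with respect to
  -- this basis.
  have key : ιMulti K (k + 1) (M := Fin (k + 1) → K) =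
      (LinearMap.toSpanSingleton K _ (ιMulti K (k + 1) b)).compAlternatingMap b.det := by
    refine Module.Basis.ext_alternating b fun i hi => ?_
    let σ : Equiv.Perm (Fin (k + 1)) :=
      Equiv.ofBijective i (Finite.injective_iff_bijective.1 hi)
    change ιMulti K (k + 1) (b ∘ σ) = (LinearMap.toSpanSingleton K _ (ιMulti K (k + 1) b))
      (b.det (b ∘ σ))
    rw [AlternatingMap.map_perm, AlternatingMap.map_perm, Module.Basis.det_self]
    rw [Units.smul_def, Units.smul_def, map_zsmul, LinearMap.toSpanSingleton_apply, one_smul]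
  refine ⟨b.det (fun i => Pi.single i 1) • v, ?_⟩
  rw [map_smul, mul_smul_comm, ← e, wedge_eq_ιMulti, ← hb, volumeForm, key]
  simp [Module.Basis.det_self]

theorem DecoratedFlag.level_zero (F : DecoratedFlag K d) : F.level 0 = 1 := by
  simp [DecoratedFlag.level]

theorem DecoratedFlag.level_color (F : DecoratedFlag K d) (k : Color d) :
    F.level k = F.extensor k := by
  rw [DecoratedFlag.level, dif_pos k.2]

theorem DecoratedFlag.level_self (F : DecoratedFlag K d) : F.level d = volumeForm K d := by
  rw [DecoratedFlag.level, dif_neg (by omega)]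
  split_ifs with h
  · subst h
    simp [volumeForm]
  · rfl

theorem DecoratedFlag.ext_level {F G : DecoratedFlag K d}
    (h : ∀ k : Color d, F.level k = G.level k) : F = G := by
  cases F
  cases G
  congr 1
  funext k
  have := h k
  rwa [DecoratedFlag.level_color, DecoratedFlag.level_color] at this

theorem IsFrame.unique {g : ℕ → Fin d → K} {F G : DecoratedFlag K d} (hF : IsFrame g F)
    (hG : IsFrame g G) : F = G :=
  DecoratedFlag.ext_level fun k => by rw [hF k k.2.2.le, hG k k.2.2.le]

theorem IsFrame.wedge_ne_zero {g : ℕ → Fin d → K} {F : DecoratedFlag K d} (hF : IsFrame g F)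
    {k : ℕ} (hk : k ≤ d) : wedge g k ≠ 0 :=
  wedge_ne_zero_of_le hk (by rw [← hF d le_rfl, F.level_self]; exact volumeForm_ne_zero)

theorem exists_flag {g : ℕ → Fin d → K} (hg : wedge g d = volumeForm K d) :
    ∃ F : DecoratedFlag K d, IsFrame g F := by
  refine ⟨⟨fun k => wedge g k, fun k => wedge_mem g k, fun k => wedge_ne_zero_of_le k.2.2.le
    (hg ▸ volumeForm_ne_zero), fun k k' h => ⟨g k, by rw [h, wedge]⟩⟩, fun k hk => ?_⟩
  unfold DecoratedFlag.level
  split_ifs with h1 h2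
  · rfl
  · subst h2
    rfl
  · obtain rfl : k = d := by omega
    exact hg.symm

/-- The vectors are chosen degree by degree. The condition `nested` only relates consecutive colors:
in degree one the extensor itself is a vector, and the step to degree `d` completes the frame to the
volume form. -/
theorem exists_frame (F : DecoratedFlag K d) : ∃ g, IsFrame g F := by
  have step : ∀ n ≤ d, ∃ g : ℕ → Fin d → K, ∀ k ≤ n, F.level k = wedge g k := by
    intro n
    induction n with
    | zero => exact fun _ => ⟨fun _ => 0, fun k hk => by
        obtain rfl : k = 0 := by omega
        rw [F.level_zero, wedge]⟩
    | succ n ih =>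
      intro hn
      obtain ⟨g, hg⟩ := ih (by omega)
      obtain ⟨v, hv⟩ : ∃ v, F.level (n + 1) = wedge g n * ι K v := by
        by_cases htop : n + 1 = d
        · have h0 : wedge g n ≠ 0 := by
            rw [← hg n le_rfl]
            by_cases hn0 : n = 0
            · rw [hn0, F.level_zero]
              exact one_ne_zero
            · rw [F.level_color ⟨n, by omega, by omega⟩]
              exact F.ne_zero _
          obtain ⟨v, hv⟩ := exists_mul_ι_eq_volumeForm htop h0
          refine ⟨v, ?_⟩
          rw [hv, htop, F.level_self]
        · by_cases hn0 : n = 0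
          · subst hn0
            have h1 := F.mem ⟨0 + 1, by omega, by omega⟩
            rw [exteriorPower] at h1
            simp only [zero_add, pow_one] at h1
            obtain ⟨v, hv⟩ := h1
            refine ⟨v, ?_⟩
            rw [F.level_color ⟨0 + 1, by omega, by omega⟩, wedge, one_mul]
            exact hv.symm
          · obtain ⟨v, hv⟩ := F.nested ⟨n, by omega, by omega⟩ ⟨n + 1, by omega, by omega⟩ rfl
            refine ⟨v, ?_⟩
            rw [← hg n le_rfl, F.level_color ⟨n + 1, by omega, by omega⟩, hv,
              F.level_color ⟨n, by omega, by omega⟩]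
      refine ⟨fun m => if m = n then v else g m, fun k hk => ?_⟩
      rcases Nat.lt_succ_iff_lt_or_eq.1 (Nat.lt_succ_of_le hk) with hk | rfl
      · rw [hg k (by omega)]
        exact wedge_congr fun m hm => by simp [show m ≠ n by omega]
      · rw [hv, wedge, if_pos rfl]
        congr 1
        exact wedge_congr fun m hm => by simp [show m ≠ n by omega]
  exact step d le_rfl

/-- The change of frames between two flags that differ in the extensor of degree `p + 1`. -/
def crossFrame (p : ℕ) (z μ : K) (g : ℕ → Fin d → K) : ℕ → Fin d → K := fun n =>
  if n = p then z • g p + μ • g (p + 1) else if n = p + 1 then -(μ⁻¹ • g p) else g n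

theorem wedge_crossFrame_of_le {p k : ℕ} (h : k ≤ p) (z μ : K) (g : ℕ → Fin d → K) :
    wedge (crossFrame p z μ g) k = wedge g k :=
  wedge_congr fun m hm => by simp [crossFrame, show m ≠ p by omega, show m ≠ p + 1 by omega]

theorem wedge_crossFrame_succ (p : ℕ) (z μ : K) (g : ℕ → Fin d → K) :
    wedge (crossFrame p z μ g) (p + 1) =
      z • wedge g (p + 1) + μ • (wedge g p * ι K (g (p + 1))) := by
  rw [wedge, wedge_crossFrame_of_le le_rfl, wedge]
  simp [crossFrame, mul_add]

/-- The change of frames has determinant one on the vectors number `p` and `p + 1`. -/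
theorem wedge_crossFrame_of_ge {p k : ℕ} (h : p + 2 ≤ k) (z : K) {μ : K} (hμ : μ ≠ 0)
    (g : ℕ → Fin d → K) : wedge (crossFrame p z μ g) k = wedge g k := by
  induction k, h using Nat.le_induction with
  | base =>
    rw [wedge, wedge_crossFrame_succ]
    simp only [crossFrame, Nat.add_eq_left, one_ne_zero, if_false, if_true, wedge, map_neg,
      map_smul, mul_neg, add_mul, mul_smul_comm, smul_mul_assoc]
    rw [mul_assoc, ι_sq_zero, mul_assoc, ι_anticomm, mul_neg, ← mul_assoc]
    simp [smul_smul, hμ]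
  | succ k h ih =>
    rw [wedge, ih, wedge]
    simp [crossFrame, show k ≠ p by omega, show k ≠ p + 1 by omega]

theorem wedge_crossFrame_of_ne {p k : ℕ} (h : k ≠ p + 1) (z : K) {μ : K} (hμ : μ ≠ 0)
    (g : ℕ → Fin d → K) : wedge (crossFrame p z μ g) k = wedge g k := by
  rcases Nat.lt_or_gt_of_ne h with h | h
  · exact wedge_crossFrame_of_le (by omega) _ _ _
  · exact wedge_crossFrame_of_ge (by omega) _ hμ _

/-- Multiplication by one of the two vectors isolates the coefficient of the other. This proves the
uniqueness of the coordinates, and later that they are rational in the Plücker coordinates. -/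
theorem combination_mul_ι (g : ℕ → Fin d → K) (p : ℕ) (z μ : K) :
    (z • wedge g (p + 1) + μ • (wedge g p * ι K (g (p + 1)))) * ι K (g (p + 1)) =
      z • wedge g (p + 2) ∧
    (z • wedge g (p + 1) + μ • (wedge g p * ι K (g (p + 1)))) * ι K (g p) =
      -(μ • wedge g (p + 2)) := by
  simp only [wedge, add_mul, smul_mul_assoc]
  constructor
  · rw [mul_assoc _ (ι K (g (p + 1))) (ι K (g (p + 1))), ι_sq_zero]
    simp
  · rw [mul_assoc _ (ι K (g p)) (ι K (g p)), ι_sq_zero, mul_assoc _ (ι K (g (p + 1))),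
      ι_anticomm (g (p + 1)), mul_neg, ← mul_assoc]
    simp

theorem combination_injective {g : ℕ → Fin d → K} {p : ℕ} (h : wedge g (p + 2) ≠ 0)
    {z μ z' μ' : K} (e : z • wedge g (p + 1) + μ • (wedge g p * ι K (g (p + 1))) =
      z' • wedge g (p + 1) + μ' • (wedge g p * ι K (g (p + 1)))) : z = z' ∧ μ = μ' := by
  have h1 := combination_mul_ι g p z μ
  have h2 := combination_mul_ι g p z' μ'
  rw [e] at h1
  exact ⟨smul_left_injective K h (h1.1.symm.trans h2.1),
    smul_left_injective K h (neg_injective (h1.2.symm.trans h2.2))⟩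

theorem level_eq_of_extensor_eq {F G : DecoratedFlag K d} {k : Color d}
    (h : ∀ i, i ≠ k → F.extensor i = G.extensor i) {n : ℕ} (hn : n ≠ k) :
    F.level n = G.level n := by
  unfold DecoratedFlag.level
  split_ifs with h1 h2
  · exact h _ fun h2 => hn (congrArg Subtype.val h2)
  · rfl
  · rfl

theorem isFrame_crossFrame {g : ℕ → Fin d → K} {F G : DecoratedFlag K d} (hF : IsFrame g F)
    {k : Color d} {p : ℕ} (hp : (k : ℕ) = p + 1) (h : ∀ i, i ≠ k → F.extensor i = G.extensor i)
    {z μ : K} (hμ : μ ≠ 0)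
    (hG : G.level (p + 1) = z • wedge g (p + 1) + μ • (wedge g p * ι K (g (p + 1)))) :
    IsFrame (crossFrame p z μ g) G := by
  intro n hn
  by_cases hnp : n = p + 1
  · rw [hnp, hG, wedge_crossFrame_succ]
  · rw [wedge_crossFrame_of_ne hnp _ hμ, ← hF n hn,
      level_eq_of_extensor_eq h (by omega)]

/-- The flags share their extensors in degrees `p` and `p + 2`. So the new vector is in the span of
the first `p + 2` vectors of `g`, and modulo the first `p` it is a combination of `g p` and `g (p +
1)`. If `μ` were zero, the extensors in degree `p + 1` would be proportional. -/
theorem exists_crossFrame {g : ℕ → Fin d → K} {F G : DecoratedFlag K d} (hF : IsFrame g F)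
    {k : Color d} {p : ℕ} (hp : (k : ℕ) = p + 1) (h : RelativePosition F G k) :
    ∃ z μ : K, μ ≠ 0 ∧ IsFrame (crossFrame p z μ g) G := by
  have hpd : p + 2 ≤ d := by have := k.2.2; omega
  obtain ⟨g', hG⟩ := exists_frame G
  have e0 : wedge g' p = wedge g p := by
    rw [← hG p (by omega), ← hF p (by omega), level_eq_of_extensor_eq h.1 (by omega)]
  have e2 : wedge g' (p + 2) = wedge g (p + 2) := by
    rw [← hG _ hpd, ← hF _ hpd, level_eq_of_extensor_eq h.1 (by omega)]
  have h0 : wedge g (p + 2) * ι K (g' p) = 0 := by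
    rw [← e2]
    exact wedge_mul_ι_self g' (by omega)
  obtain ⟨μ, hμ⟩ := mem_span_Iio_succ
    (mem_span_of_wedge_mul_ι_eq_zero (hF.wedge_ne_zero hpd) h0)
  obtain ⟨z, hz⟩ := mem_span_Iio_succ hμ
  have e1 : G.level (p + 1) = z • wedge g (p + 1) + μ • (wedge g p * ι K (g (p + 1))) := by
    rw [hG _ (by omega), wedge, e0, wedge]
    have := wedge_mul_ι_of_mem_span hz
    simp only [map_sub, map_smul, mul_sub, mul_smul_comm] at this
    rw [sub_eq_zero, sub_eq_iff_eq_add] at this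
    exact this
  have hμ0 : μ ≠ 0 := by
    rintro rfl
    rw [zero_smul, add_zero, ← hF _ (by omega), ← hp, G.level_color, F.level_color] at e1
    have hz : z ≠ 0 := by
      rintro rfl
      exact G.ne_zero k (by rw [e1, zero_smul])
    refine h.2 z⁻¹ ?_
    rw [e1, smul_smul, inv_mul_cancel₀ hz, one_smul]
  exact ⟨z, μ, hμ0, isFrame_crossFrame hF hp (fun i hi => (h.1 i hi)) hμ0 e1⟩

theorem relativePosition_of_crossFrame {g : ℕ → Fin d → K} {F G : DecoratedFlag K d}
    (hF : IsFrame g F) {k : Color d} {p : ℕ} (hp : (k : ℕ) = p + 1) {z μ : K} (hμ : μ ≠ 0)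
    (hG : IsFrame (crossFrame p z μ g) G) :
    RelativePosition F G k ∧ HasCrossingValue F G k μ := by
  have hpd : p + 2 ≤ d := by have := k.2.2; omega
  -- The sign moves the vector from the right end of the extensor, where frames put it, to the left
  -- end, where the crossing value expects it.
  refine ⟨⟨fun i hi => ?_, fun c hc => ?_⟩,
    (-1 : K) ^ p • g p, crossFrame p z μ g p, ?_, ?_, ?_⟩
  · have hi' : (i : ℕ) ≠ p + 1 := fun h => hi (Subtype.ext (h.trans hp.symm))
    rw [← F.level_color, ← G.level_color, hF _ i.2.2.le, hG _ i.2.2.le,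
      wedge_crossFrame_of_ne hi' _ hμ]
  · rw [← F.level_color, ← G.level_color, hF _ k.2.2.le, hG _ k.2.2.le, hp,
      wedge_crossFrame_succ] at hc
    have h1 := combination_injective (z := 1) (μ := 0) (z' := c * z) (μ' := c * μ)
      (hF.wedge_ne_zero hpd)
      (by rw [one_smul, zero_smul, add_zero, ← smul_smul, ← smul_smul, ← smul_add, ← hc])
    have hc0 : c = 0 := by simpa [hμ] using h1.2.symm
    simp [hc0] at h1
  · rw [hp, Nat.add_sub_cancel, hF _ (by omega), hF _ (by omega), map_smul, smul_mul_assoc,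
      ι_mul_wedge, smul_smul, ← mul_pow]
    simp [wedge]
  · rw [hp, Nat.add_sub_cancel, hF _ (by omega), hG _ (by omega), wedge,
      wedge_crossFrame_of_le le_rfl]
  · rw [hp, Nat.add_sub_cancel, hF _ (by omega), hF _ (by omega), map_smul, smul_mul_assoc,
      ι_mul_wedge, smul_smul, ← mul_pow]
    simp [crossFrame, wedge, mul_add, mul_assoc]

/-- The vector `v` from the definition of the crossing value agrees with `μ' • g (p + 1)` modulo the
first `p + 1` vectors of the frame, so `μ'` is a coefficient of the extensor of `G`. -/
theorem eq_of_hasCrossingValue {g : ℕ → Fin d → K} {F G : DecoratedFlag K d}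
    (hF : IsFrame g F) {k : Color d} {p : ℕ} (hp : (k : ℕ) = p + 1) {z μ μ' : K}
    (hG : IsFrame (crossFrame p z μ g) G) (h : HasCrossingValue F G k μ') : μ = μ' := by
  have hpd : p + 2 ≤ d := by have := k.2.2; omega
  obtain ⟨u, v, h1, h2, h3⟩ := h
  rw [hp, Nat.add_sub_cancel] at h1 h2 h3
  rw [← h1, hF _ (by omega), hF _ (by omega)] at h3
  rw [hF _ (by omega), hG _ (by omega), wedge_crossFrame_succ] at h2
  have h4 : wedge g (p + 1) * ι K (v - μ' • g (p + 1)) = 0 := by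
    rw [map_sub, mul_sub, h3, map_smul, mul_smul_comm, sub_eq_zero]
    rfl
  obtain ⟨z', hz'⟩ := mem_span_Iio_succ
    (mem_span_of_wedge_mul_ι_eq_zero (hF.wedge_ne_zero (by omega)) h4)
  have h5 := wedge_mul_ι_of_mem_span hz'
  simp only [map_sub, map_smul, mul_sub, mul_smul_comm] at h5
  rw [sub_eq_zero, sub_eq_iff_eq_add, ← h2] at h5
  exact (combination_injective (hF.wedge_ne_zero hpd) (z := z) (z' := z') h5).2

theorem exists_crossFrame_of_hasCrossingValue {g : ℕ → Fin d → K} {F G : DecoratedFlag K d}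
    (hF : IsFrame g F) {k : Color d} {p : ℕ} (hp : (k : ℕ) = p + 1) {μ : K}
    (h : RelativePosition F G k) (hμ : HasCrossingValue F G k μ) :
    μ ≠ 0 ∧ ∃ z : K, IsFrame (crossFrame p z μ g) G := by
  obtain ⟨z, μ', hμ', hG⟩ := exists_crossFrame hF hp h
  obtain rfl := eq_of_hasCrossingValue hF hp hG hμ
  exact ⟨hμ', z, hG⟩

theorem color_eq_succ (k : Color d) : ∃ p, (k : ℕ) = p + 1 :=
  ⟨(k : ℕ) - 1, by have := k.2.1; omega⟩

theorem HasCrossingValue.unique {F G : DecoratedFlag K d} {k : Color d} {μ μ' : K}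
    (h : RelativePosition F G k) (hμ : HasCrossingValue F G k μ)
    (hμ' : HasCrossingValue F G k μ') : μ = μ' := by
  obtain ⟨p, hp⟩ := color_eq_succ k
  obtain ⟨g, hF⟩ := exists_frame F
  obtain ⟨_, z, hG⟩ := exists_crossFrame_of_hasCrossingValue hF hp h hμ
  exact eq_of_hasCrossingValue hF hp hG hμ'

theorem exists_flag_crossFrame {g : ℕ → Fin d → K} {F : DecoratedFlag K d}
    (hF : IsFrame g F) {p : ℕ} (hp : p + 1 < d) (z : K) {μ : K} (hμ : μ ≠ 0) :
    ∃ G : DecoratedFlag K d, IsFrame (crossFrame p z μ g) G :=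
  exists_flag (by rw [wedge_crossFrame_of_ge (by omega) _ hμ, ← hF d le_rfl, F.level_self])

end Frames

/-! ### Decorated flags around a vertex -/

section LocalFlags

variable {K : Type*} [Field K] {d : ℕ}

open ExteriorAlgebra

theorem crossFrame_comm {p q : ℕ} (h : p + 1 < q ∨ q + 1 < p) (z μ z' μ' : K)
    (g : ℕ → Fin d → K) :
    crossFrame q z' μ' (crossFrame p z μ g) = crossFrame p z μ (crossFrame q z' μ' g) := by
  funext n
  simp only [crossFrame]
  split_ifs <;> first | rfl | (exfalso; omega)

/-- The braid relation of matrices that act on three consecutive vectors. The middle crossing value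
`c` on the right is free; in a weave it is prescribed by the minimum of the weights. -/
theorem crossFrame_braid {p q : ℕ} (h : q = p + 1 ∨ p = q + 1) {z₁ z₂ z₃ a f e c : K}
    (ha : a ≠ 0) (hf : f ≠ 0) (he : e ≠ 0) (hc : c ≠ 0) (g : ℕ → Fin d → K) :
    crossFrame p z₃ e (crossFrame q z₂ f (crossFrame p z₁ a g)) =
      crossFrame q (c * z₁ / e) (a * f / c) (crossFrame p (z₁ * z₃ - e * z₂ / a) c
        (crossFrame q (a * z₃ / c) (f * e / c) g)) := by
  have n1 : ∀ n : ℕ, ¬ n = n + 1 + 1 := fun n => by omega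
  have n2 : ∀ n : ℕ, ¬ n + 1 + 1 = n := fun n => by omega
  have main : ∀ m n : ℕ, n = m ∨ n = m + 1 ∨ n = m + 1 + 1 ∨
      (n ≠ m ∧ n ≠ m + 1 ∧ n ≠ m + 1 + 1) := fun m n => by omega
  rcases h with rfl | rfl
  · funext n i
    rcases main p n with rfl | rfl | rfl | ⟨h1, h2, h3⟩
    · simp [crossFrame, n1, n2]
      field_simp
      ring
    · simp [crossFrame, n1, n2]
      field_simp
      ring
    · simp [crossFrame, n1, n2]
      field_simp
    · simp [crossFrame, h1, h2, h3]
  · funext n i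
    rcases main q n with rfl | rfl | rfl | ⟨h1, h2, h3⟩
    · simp [crossFrame, n1, n2]
      field_simp
      ring
    · simp [crossFrame, n1, n2]
      field_simp
      ring
    · simp [crossFrame, n1, n2]
      field_simp
    · simp [crossFrame, h1, h2, h3]

theorem mul_ι_swap (T : ExteriorAlgebra K (Fin d → K)) (u v : Fin d → K) :
    T * ι K u * ι K v = -(T * ι K v * ι K u) := by
  rw [mul_assoc, ι_anticomm, mul_neg, mul_assoc]

theorem mul_ι_self (T : ExteriorAlgebra K (Fin d → K)) (u : Fin d → K) :
    T * ι K u * ι K u = 0 := by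
  rw [mul_assoc, ι_sq_zero, mul_zero]

theorem eq_zero_of_smul_add_mem_span {g : ℕ → Fin d → K} {k : ℕ} (h : wedge g (k + 1) ≠ 0)
    {c : K} {v : Fin d → K} (hv : v ∈ Submodule.span K (g '' Set.Iio k))
    (hc : c • g k + v ∈ Submodule.span K (g '' Set.Iio k)) : c = 0 := by
  by_contra h0
  have h1 : c • g k ∈ Submodule.span K (g '' Set.Iio k) := by
    have := Submodule.sub_mem _ hc hv
    simpa using this
  rw [Submodule.smul_mem_iff _ h0] at h1
  exact h (wedge_mul_ι_of_mem_span h1)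

/-- At a 6-valent vertex, an inner extensor describes a line or a plane in a space of dimension
three, depending on which of the two colors is larger. This is the case of lines, and
`planes_injective` is the other one. -/
theorem lines_injective {g : ℕ → Fin d → K} {p : ℕ} (h : wedge g (p + 3) ≠ 0)
    {α β γ : K} (e : wedge g p * ι K (α • g p + β • g (p + 1) + γ • g (p + 2)) = 0) :
    α = 0 ∧ β = 0 ∧ γ = 0 := by
  have hv := mem_span_of_wedge_mul_ι_eq_zero (wedge_ne_zero_of_le (by omega) h) e
  have mono : ∀ {m n : ℕ}, m ≤ n → Submodule.span K (g '' Set.Iio m) ≤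
      Submodule.span K (g '' Set.Iio n) := fun hmn =>
    Submodule.span_mono (Set.image_mono (Set.Iio_subset_Iio hmn))
  have hg : ∀ {m n : ℕ}, m < n → ∀ c : K, c • g m ∈ Submodule.span K (g '' Set.Iio n) :=
    fun hmn c => Submodule.smul_mem _ _ (Submodule.subset_span ⟨_, hmn, rfl⟩)
  have hγ : γ = 0 := by
    refine eq_zero_of_smul_add_mem_span (k := p + 2) h
      (Submodule.add_mem _ (hg (show p < p + 2 by omega) α)
        (hg (show p + 1 < p + 2 by omega) β)) ?_
    rw [add_comm (γ • _)]
    exact mono (Nat.le_add_right p 2) hv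
  subst hγ
  rw [zero_smul, add_zero] at hv
  have hβ : β = 0 := by
    refine eq_zero_of_smul_add_mem_span (k := p + 1) (wedge_ne_zero_of_le (by omega) h)
      (hg (show p < p + 1 by omega) α) ?_
    rw [add_comm (β • _)]
    exact mono (Nat.le_add_right p 1) hv
  subst hβ
  rw [zero_smul, add_zero] at hv
  exact ⟨eq_zero_of_smul_add_mem_span (k := p) (wedge_ne_zero_of_le (by omega) h)
    (Submodule.zero_mem _) (by rwa [add_zero]), rfl, rfl⟩

theorem planes_injective {g : ℕ → Fin d → K} {p : ℕ} (h : wedge g (p + 3) ≠ 0)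
    {α β γ α' β' γ' : K} (e : α • (wedge g p * ι K (g p) * ι K (g (p + 1))) +
      β • (wedge g p * ι K (g p) * ι K (g (p + 2))) +
      γ • (wedge g p * ι K (g (p + 1)) * ι K (g (p + 2))) =
      α' • (wedge g p * ι K (g p) * ι K (g (p + 1))) +
      β' • (wedge g p * ι K (g p) * ι K (g (p + 2))) +
      γ' • (wedge g p * ι K (g (p + 1)) * ι K (g (p + 2)))) : α = α' ∧ β = β' ∧ γ = γ' := by
  set W := wedge g p
  have hw : wedge g (p + 3) = W * ι K (g p) * ι K (g (p + 1)) * ι K (g (p + 2)) := rfl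
  have key : ∀ a b c : K,
      (a • (W * ι K (g p) * ι K (g (p + 1))) + b • (W * ι K (g p) * ι K (g (p + 2))) +
        c • (W * ι K (g (p + 1)) * ι K (g (p + 2)))) * ι K (g (p + 2)) =
        a • wedge g (p + 3) ∧
      (a • (W * ι K (g p) * ι K (g (p + 1))) + b • (W * ι K (g p) * ι K (g (p + 2))) +
        c • (W * ι K (g (p + 1)) * ι K (g (p + 2)))) * ι K (g (p + 1)) =
        -(b • wedge g (p + 3)) ∧
      (a • (W * ι K (g p) * ι K (g (p + 1))) + b • (W * ι K (g p) * ι K (g (p + 2))) +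
        c • (W * ι K (g (p + 1)) * ι K (g (p + 2)))) * ι K (g p) =
        c • wedge g (p + 3) := by
    intro a b c
    simp only [add_mul, smul_mul_assoc, mul_ι_self, smul_zero, add_zero, hw]
    refine ⟨trivial, ?_, ?_⟩
    · rw [mul_ι_swap (W * ι K (g p)) (g (p + 2)), mul_ι_swap W (g (p + 1)) (g (p + 2)),
        neg_mul, mul_ι_self]
      simp
    · rw [mul_ι_swap W (g p) (g (p + 1)), mul_ι_swap W (g p) (g (p + 2)), neg_mul, neg_mul,
        mul_ι_self, mul_ι_self, mul_ι_swap (W * ι K (g (p + 1))) (g (p + 2)),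
        mul_ι_swap W (g (p + 1)) (g p)]
      simp
  have k := key α β γ
  have k' := key α' β' γ'
  rw [e] at k
  exact ⟨smul_left_injective K h (k.1.symm.trans k'.1),
    smul_left_injective K h (neg_injective (k.2.1.symm.trans k'.2.1)),
    smul_left_injective K h (k.2.2.symm.trans k'.2.2)⟩

/-- The flags inside a 6-valent vertex are determined by the outer flags and a crossing value. -/
theorem crossFrame_braid_injective {p q : ℕ} (h : q = p + 1 ∨ p = q + 1) {g : ℕ → Fin d → K}
    (hg : wedge g (min p q + 3) ≠ 0) {z₁ z₂ b z₁' z₂' b' c : K} (hc : c ≠ 0)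
    (hb : b ≠ 0) (hb' : b' ≠ 0)
    (e : wedge (crossFrame p z₂ c (crossFrame q z₁ b g)) (p + 1) =
      wedge (crossFrame p z₂' c (crossFrame q z₁' b' g)) (p + 1)) :
    z₁ = z₁' ∧ z₂ = z₂' ∧ b = b' := by
  rw [wedge_crossFrame_succ, wedge_crossFrame_succ] at e
  rcases h with rfl | rfl
  · rw [min_eq_left (by omega)] at hg
    rw [wedge_crossFrame_of_le le_rfl, wedge_crossFrame_of_le le_rfl,
      wedge_crossFrame_of_le (by omega), wedge_crossFrame_of_le (by omega)] at e
    simp only [crossFrame, if_true] at e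
    have e2 : wedge g p * ι K ((z₂ - z₂') • g p + (c * z₁ - c * z₁') • g (p + 1) +
        (c * b - c * b') • g (p + 2)) = 0 := by
      simp only [wedge, map_add, map_smul, mul_add, mul_smul_comm] at e ⊢
      simp only [smul_add, smul_smul] at e
      rw [show g (p + 1 + 1) = g (p + 2) from rfl, ← sub_eq_zero] at e
      rw [← e]
      module
    obtain ⟨h1, h2, h3⟩ := lines_injective hg e2
    refine ⟨?_, sub_eq_zero.1 h1, ?_⟩
    · exact mul_left_cancel₀ hc (sub_eq_zero.1 h2)
    · exact mul_left_cancel₀ hc (sub_eq_zero.1 h3)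
  · rw [min_eq_right (by omega)] at hg
    have key : ∀ z₁ z₂ b : K, b ≠ 0 →
        z₂ • wedge (crossFrame q z₁ b g) (q + 1 + 1) + c • (wedge (crossFrame q z₁ b g) (q + 1) *
          ι K (crossFrame q z₁ b g (q + 1 + 1))) =
        z₂ • (wedge g q * ι K (g q) * ι K (g (q + 1))) +
          (c * z₁) • (wedge g q * ι K (g q) * ι K (g (q + 2))) +
          (c * b) • (wedge g q * ι K (g (q + 1)) * ι K (g (q + 2))) := by
      intro z₁ z₂ b hb
      rw [wedge_crossFrame_of_ge le_rfl _ hb, wedge_crossFrame_succ]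
      have : crossFrame q z₁ b g (q + 1 + 1) = g (q + 2) := by
        simp [crossFrame, show q + 1 + 1 ≠ q by omega]
      rw [this, wedge, wedge]
      simp only [add_mul, smul_mul_assoc, smul_add, smul_smul]
      abel
    rw [key _ _ _ hb, key _ _ _ hb'] at e
    obtain ⟨h1, h2, h3⟩ := planes_injective hg e
    exact ⟨mul_left_cancel₀ hc h2, h1, mul_left_cancel₀ hc h3⟩

/-- The product of two braid matrices of the same color. Its second coefficient shows that the outer
flags are in relative position exactly if `z₂` is nonzero, with crossing value `μ₁ * z₂`. -/
theorem wedge_crossFrame_crossFrame (g : ℕ → Fin d → K) (p : ℕ) (z₁ μ₁ z₂ μ₂ : K) :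
    wedge (crossFrame p z₂ μ₂ (crossFrame p z₁ μ₁ g)) (p + 1) =
      (z₁ * z₂ - μ₂ / μ₁) • wedge g (p + 1) +
        (μ₁ * z₂) • (wedge g p * ι K (g (p + 1))) := by
  rw [wedge_crossFrame_succ, wedge_crossFrame_succ, wedge_crossFrame_of_le le_rfl]
  have : crossFrame p z₁ μ₁ g (p + 1) = -(μ₁⁻¹ • g p) := by simp [crossFrame]
  rw [this]
  simp only [map_neg, map_smul, mul_neg, mul_smul_comm, wedge, smul_add, smul_smul, smul_neg,
    sub_smul, div_eq_mul_inv, mul_comm z₂]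
  abel

/-- The flags on both sides of the weave line below a trivalent vertex. -/
theorem isFrame_tri {g : ℕ → Fin d → K} {F₀ F₁ F₂ : DecoratedFlag K d} (h₀ : IsFrame g F₀)
    {k : Color d} {p : ℕ} (hp : (k : ℕ) = p + 1) {z₁ μ₁ z₂ μ₂ : K} (hμ₁ : μ₁ ≠ 0) (hμ₂ : μ₂ ≠ 0)
    (h₁ : IsFrame (crossFrame p z₁ μ₁ g) F₁)
    (h₂ : IsFrame (crossFrame p z₂ μ₂ (crossFrame p z₁ μ₁ g)) F₂) (hz : z₂ ≠ 0) :
    IsFrame (crossFrame p (z₁ * z₂ - μ₂ / μ₁) (μ₁ * z₂) g) F₂ := by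
  refine isFrame_crossFrame h₀ hp (fun i hi => ?_) (mul_ne_zero hμ₁ hz) ?_
  · rw [(relativePosition_of_crossFrame h₀ hp hμ₁ h₁).1.1 i hi,
      (relativePosition_of_crossFrame h₁ hp hμ₂ h₂).1.1 i hi]
  · rw [h₂ _ (by have := k.2.2; omega), wedge_crossFrame_crossFrame]

theorem ne_zero_of_tri {g : ℕ → Fin d → K} {F₀ F₂ : DecoratedFlag K d} (h₀ : IsFrame g F₀)
    {k : Color d} {p : ℕ} (hp : (k : ℕ) = p + 1) {z₁ μ₁ z₂ μ₂ : K} (hμ₁ : μ₁ ≠ 0) (hμ₂ : μ₂ ≠ 0)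
    (h₂ : IsFrame (crossFrame p z₂ μ₂ (crossFrame p z₁ μ₁ g)) F₂)
    (h : RelativePosition F₀ F₂ k) : z₂ ≠ 0 := by
  rintro rfl
  have e := h₂ (p + 1) (by have := k.2.2; omega)
  rw [wedge_crossFrame_crossFrame, ← h₀ _ (by have := k.2.2; omega), ← hp, F₀.level_color,
    F₂.level_color, mul_zero, mul_zero, zero_smul, add_zero, zero_sub] at e
  refine h.2 (-(μ₂ / μ₁))⁻¹ ?_
  rw [e, smul_smul, inv_mul_cancel₀ (neg_ne_zero.2 (div_ne_zero hμ₂ hμ₁)), one_smul]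

/-- The three-term relation for four flags that differ in one degree. -/
theorem three_term_relation {F₀ F₁ F₂ F₃ : DecoratedFlag K d} {k : Color d}
    {a₀₁ a₁₂ a₂₃ a₀₂ a₁₃ a₀₃ : K}
    (r₀₁ : RelativePosition F₀ F₁ k) (h₀₁ : HasCrossingValue F₀ F₁ k a₀₁)
    (r₁₂ : RelativePosition F₁ F₂ k) (h₁₂ : HasCrossingValue F₁ F₂ k a₁₂)
    (r₂₃ : RelativePosition F₂ F₃ k) (h₂₃ : HasCrossingValue F₂ F₃ k a₂₃)
    (r₀₂ : RelativePosition F₀ F₂ k) (h₀₂ : HasCrossingValue F₀ F₂ k a₀₂)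
    (r₁₃ : RelativePosition F₁ F₃ k) (h₁₃ : HasCrossingValue F₁ F₃ k a₁₃)
    (r₀₃ : RelativePosition F₀ F₃ k) (h₀₃ : HasCrossingValue F₀ F₃ k a₀₃) :
    a₀₂ * a₁₃ = a₀₁ * a₂₃ + a₀₃ * a₁₂ := by
  obtain ⟨p, hp⟩ := color_eq_succ k
  have hpd : p + 2 ≤ d := by have := k.2.2; omega
  obtain ⟨g, g₀⟩ := exists_frame F₀
  obtain ⟨n₀₁, z₁, g₁⟩ := exists_crossFrame_of_hasCrossingValue g₀ hp r₀₁ h₀₁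
  obtain ⟨n₁₂, z₂, g₂⟩ := exists_crossFrame_of_hasCrossingValue g₁ hp r₁₂ h₁₂
  obtain ⟨n₂₃, z₃, g₃⟩ := exists_crossFrame_of_hasCrossingValue g₂ hp r₂₃ h₂₃
  obtain rfl := eq_of_hasCrossingValue g₀ hp (isFrame_tri g₀ hp n₀₁ n₁₂ g₁ g₂
    (ne_zero_of_tri g₀ hp n₀₁ n₁₂ g₂ r₀₂)) h₀₂
  obtain rfl := eq_of_hasCrossingValue g₁ hp (isFrame_tri g₁ hp n₁₂ n₂₃ g₂ g₃
    (ne_zero_of_tri g₁ hp n₁₂ n₂₃ g₃ r₁₃)) h₁₃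
  -- The extensor of the last flag is computed both from the single crossing and from the product of
  -- three crossings. The comparison of coefficients is the claim.
  obtain ⟨_, z, g₀₃⟩ := exists_crossFrame_of_hasCrossingValue g₀ hp r₀₃ h₀₃
  have e := g₃ (p + 1) (by omega)
  rw [g₀₃ (p + 1) (by omega), wedge_crossFrame_crossFrame, wedge_crossFrame_succ,
    wedge_crossFrame_succ, wedge_crossFrame_of_le le_rfl] at e
  have : crossFrame p z₁ a₀₁ g (p + 1) = -(a₀₁⁻¹ • g p) := by simp [crossFrame]
  rw [this] at e
  have e2 : z • wedge g (p + 1) + a₀₃ • (wedge g p * ι K (g (p + 1))) =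
      ((z₂ * z₃ - a₂₃ / a₁₂) * z₁ - a₁₂ * z₃ * a₀₁⁻¹) • wedge g (p + 1) +
        ((z₂ * z₃ - a₂₃ / a₁₂) * a₀₁) • (wedge g p * ι K (g (p + 1))) := by
    rw [e]
    simp only [map_neg, map_smul, mul_neg, mul_smul_comm, wedge, smul_add, smul_smul, smul_neg,
      sub_smul]
    abel
  obtain ⟨-, rfl⟩ := combination_injective (g₀.wedge_ne_zero hpd) e2
  field_simp
  ring

end LocalFlags

/-! ### Decorated rows and runs of weaves -/

section Rows

variable {K : Type*} [Field K] {d : ℕ} {N : Type*}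

/-- A letter of a decorated row: the color of a weave line, the values of all cycles on it, and
the decorated flag to its right. -/
structure Letter (K : Type*) [Field K] (d : ℕ) (N : Type*) where
  col : Color d
  wt : N → ℕ
  flag : DecoratedFlag K d

/-- The rightmost flag of a row that begins with the flag `F`. -/
def endFlag : DecoratedFlag K d → List (Letter K d N) → DecoratedFlag K d
  | F, [] => F
  | _, x :: X => endFlag x.flag X

theorem endFlag_append (F : DecoratedFlag K d) (X Y : List (Letter K d N)) :
    endFlag F (X ++ Y) = endFlag (endFlag F X) Y := by
  induction X generalizing F with
  | nil => rfl
  | cons x X ih => exact ih _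

/-- The local pairing at a 6-valent vertex with the values `a, f, e` above it. -/
def sixPairing (a f e : N → ℕ) (c c' : N) : ℤ :=
  (tripleDet (a c) ((a ⊓ e) c) (e c) (a c') ((a ⊓ e) c') (e c') +
    tripleDet ((f + e - a ⊓ e) c) ((a + f - a ⊓ e) c) (f c)
      ((f + e - a ⊓ e) c') ((a + f - a ⊓ e) c') (f c')) / 2

/-- The local pairing at a trivalent vertex with the values `a, b` above it and `m` below it. -/
def triPairing (a m b : N → ℕ) (c c' : N) : ℤ :=
  tripleDet (a c) (m c) (b c) (a c') (m c') (b c')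

open Classical in
/-- The transformation of the letters at a vertex, with the local pairings. The name `n` is given
to the cycle that begins at a trivalent vertex. -/
def KindStep : VertexKind d → Option N → List (Letter K d N) → List (Letter K d N) →
    (N → N → ℤ) → Prop
  | .tri i, o, T, T', P => ∃ n a b F₁ F₂, o = some n ∧ T = [⟨i, a, F₁⟩, ⟨i, b, F₂⟩] ∧
      T' = [⟨i, Function.update (a ⊓ b) n 1, F₂⟩] ∧
      P = triPairing a (Function.update (a ⊓ b) n 1) b
  | .four i j _, o, T, T', P => ∃ a b F₁ F₂ G, o = none ∧ T = [⟨i, a, F₁⟩, ⟨j, b, F₂⟩] ∧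
      T' = [⟨j, b, G⟩, ⟨i, a, F₂⟩] ∧ P = 0
  | .six i j _, o, T, T', P => ∃ a f e F₁ F₂ F₃ G₁ G₂, o = none ∧
      T = [⟨i, a, F₁⟩, ⟨j, f, F₂⟩, ⟨i, e, F₃⟩] ∧
      T' = [⟨j, f + e - a ⊓ e, G₁⟩, ⟨i, a ⊓ e, G₂⟩, ⟨j, a + f - a ⊓ e, F₃⟩] ∧
      P = sixPairing a f e

/-- The transformation of a row at a vertex. -/
def RowStep (v : Vertex d) (o : Option N) (X X' : List (Letter K d N)) (P : N → N → ℤ) : Prop :=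
  ∃ L T T' R, X = L ++ T ++ R ∧ X' = L ++ T' ++ R ∧ L.map Letter.col = v.left ∧
    R.map Letter.col = v.right ∧ KindStep v.kind o T T' P

theorem KindStep.map_col {k : VertexKind d} {o : Option N} {T T' : List (Letter K d N)}
    {P : N → N → ℤ} (h : KindStep k o T T' P) :
    T.map Letter.col = k.top ∧ T'.map Letter.col = k.bot := by
  cases k with
  | tri i => obtain ⟨n, a, b, F₁, F₂, -, rfl, rfl, -⟩ := h; exact ⟨rfl, rfl⟩
  | four i j _ => obtain ⟨a, b, F₁, F₂, G, -, rfl, rfl, -⟩ := h; exact ⟨rfl, rfl⟩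
  | six i j _ =>
    obtain ⟨a, f, e, F₁, F₂, F₃, G₁, G₂, -, rfl, rfl, -⟩ := h
    exact ⟨rfl, rfl⟩

theorem KindStep.endFlag {k : VertexKind d} {o : Option N} {T T' : List (Letter K d N)}
    {P : N → N → ℤ} (h : KindStep k o T T' P) (F : DecoratedFlag K d) :
    endFlag F T' = endFlag F T := by
  cases k with
  | tri i => obtain ⟨n, a, b, F₁, F₂, -, rfl, rfl, -⟩ := h; rfl
  | four i j _ => obtain ⟨a, b, F₁, F₂, G, -, rfl, rfl, -⟩ := h; rfl
  | six i j _ =>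
    obtain ⟨a, f, e, F₁, F₂, F₃, G₁, G₂, -, rfl, rfl, -⟩ := h
    rfl

theorem KindStep.wt_eq_zero {k : VertexKind d} {o : Option N} {T T' : List (Letter K d N)}
    {P : N → N → ℤ} (h : KindStep k o T T' P) {n : N} (hn : o ≠ some n)
    (hT : ∀ x ∈ T, x.wt n = 0) : ∀ x ∈ T', x.wt n = 0 := by
  cases k with
  | tri i =>
    obtain ⟨m, a, b, F₁, F₂, rfl, rfl, rfl, -⟩ := h
    have : n ≠ m := fun h => hn (by rw [h])
    simpa [this] using Or.inl (hT _ (List.mem_cons_self ..))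
  | four i j _ =>
    obtain ⟨a, b, F₁, F₂, G, -, rfl, rfl, -⟩ := h
    simp only [List.mem_cons, List.not_mem_nil, or_false, forall_eq_or_imp, forall_eq] at hT ⊢
    exact hT.symm
  | six i j _ =>
    obtain ⟨a, f, e, F₁, F₂, F₃, G₁, G₂, -, rfl, rfl, -⟩ := h
    simp only [List.mem_cons, List.not_mem_nil, or_false, forall_eq_or_imp, forall_eq] at hT ⊢
    simp [hT]

theorem RowStep.map_col {v : Vertex d} {o : Option N} {X X' : List (Letter K d N)}
    {P : N → N → ℤ} (h : RowStep v o X X' P) :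
    X.map Letter.col = v.top ∧ X'.map Letter.col = v.bot := by
  obtain ⟨L, T, T', R, rfl, rfl, hL, hR, hT⟩ := h
  simp [hL, hR, hT.map_col, Vertex.top, Vertex.bot]

theorem RowStep.endFlag {v : Vertex d} {o : Option N} {X X' : List (Letter K d N)}
    {P : N → N → ℤ} (h : RowStep v o X X' P) (F : DecoratedFlag K d) :
    endFlag F X' = endFlag F X := by
  obtain ⟨L, T, T', R, rfl, rfl, hL, hR, hT⟩ := h
  simp only [endFlag_append, hT.endFlag]

theorem RowStep.wt_eq_zero {v : Vertex d} {o : Option N} {X X' : List (Letter K d N)}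
    {P : N → N → ℤ} (h : RowStep v o X X' P) {n : N} (hn : o ≠ some n)
    (hX : ∀ x ∈ X, x.wt n = 0) : ∀ x ∈ X', x.wt n = 0 := by
  obtain ⟨L, T, T', R, rfl, rfl, hL, hR, hT⟩ := h
  simp only [List.mem_append] at hX ⊢
  have := hT.wt_eq_zero hn fun x hx => hX x (Or.inl (Or.inr hx))
  rintro x ((hx | hx) | hx)
  · exact hX x (Or.inl (Or.inl hx))
  · exact this x hx
  · exact hX x (Or.inr hx)

/-- The parts of a step of a row are determined by the vertex. -/
theorem rowStep_append_iff {v : Vertex d} {o : Option N} {L T R X' : List (Letter K d N)}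
    {P : N → N → ℤ} (hL : L.length = v.left.length) (hT : T.length = v.kind.top.length) :
    RowStep v o (L ++ T ++ R) X' P ↔ L.map Letter.col = v.left ∧ R.map Letter.col = v.right ∧
      ∃ T', X' = L ++ T' ++ R ∧ KindStep v.kind o T T' P := by
  constructor
  · rintro ⟨L', T', T'', R', h, rfl, hL', hR', hK⟩
    have e1 : L.length = L'.length := by rw [hL, ← hL', List.length_map]
    have e2 : T.length = T'.length := by rw [hT, ← hK.map_col.1, List.length_map]
    rw [List.append_assoc, List.append_assoc] at h
    obtain ⟨rfl, h'⟩ := List.append_inj h e1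
    obtain ⟨rfl, rfl⟩ := List.append_inj h' e2
    exact ⟨hL', hR', T'', rfl, hK⟩
  · rintro ⟨h1, h2, T', rfl, h⟩
    exact ⟨L, T, T', R, rfl, rfl, h1, h2, h⟩

/-- The names of the cycles that begin at the vertices of a weave. -/
def names (W : List (Vertex d × Option N)) : List N := W.filterMap Prod.snd

theorem names_append (W W' : List (Vertex d × Option N)) :
    names (W ++ W') = names W ++ names W' := List.filterMap_append

variable [Fintype N]

/-- The flags of a row are in the prescribed relative positions. -/
def ValidRow (Δ : N → K) : DecoratedFlag K d → List (Letter K d N) → Prop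
  | _, [] => True
  | F, x :: X => (RelativePosition F x.flag x.col ∧
      HasCrossingValue F x.flag x.col (weightValue Δ x.wt)) ∧ ValidRow Δ x.flag X

theorem validRow_append {Δ : N → K} {F : DecoratedFlag K d} {X Y : List (Letter K d N)} :
    ValidRow Δ F (X ++ Y) ↔ ValidRow Δ F X ∧ ValidRow Δ (endFlag F X) Y := by
  induction X generalizing F with
  | nil => simp [ValidRow, endFlag]
  | cons x X ih =>
    simp only [List.cons_append, ValidRow, ih, endFlag]
    tauto

/-- The weave with the list `W` of vertices and names of cycles, decorated by the crossing
values `Δ`, transforms the decorated row `X` into `Z`, and the pairings of its cycles are `P`. -/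
def Run (Δ : N → K) (F : DecoratedFlag K d) : List (Vertex d × Option N) →
    List (Letter K d N) → List (Letter K d N) → (N → N → ℤ) → Prop
  | [], X, Z, P => Z = X ∧ P = 0
  | w :: W, X, Z, P => ∃ X' p P', RowStep w.1 w.2 X X' p ∧ ValidRow Δ F X' ∧
      Run Δ F W X' Z P' ∧ P = p + P'

theorem run_append {Δ : N → K} {F : DecoratedFlag K d} {W W' : List (Vertex d × Option N)}
    {X Z : List (Letter K d N)} {P : N → N → ℤ} :
    Run Δ F (W ++ W') X Z P ↔ ∃ Y P₁ P₂, Run Δ F W X Y P₁ ∧ Run Δ F W' Y Z P₂ ∧ P = P₁ + P₂ := by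
  induction W generalizing X P with
  | nil =>
    simp only [List.nil_append, Run]
    constructor
    · exact fun h => ⟨X, 0, P, ⟨rfl, rfl⟩, h, by simp⟩
    · rintro ⟨Y, P₁, P₂, ⟨rfl, rfl⟩, h, rfl⟩
      simpa using h
  | cons w W ih =>
    simp only [List.cons_append, Run, ih]
    constructor
    · rintro ⟨X', p, P', h, hV, ⟨Y, P₁, P₂, h₁, h₂, rfl⟩, rfl⟩
      exact ⟨Y, p + P₁, P₂, ⟨X', p, P₁, h, hV, h₁, rfl⟩, h₂, (add_assoc _ _ _).symm⟩
    · rintro ⟨Y, P₁, P₂, ⟨X', p, P', h, hV, h₁, rfl⟩, h₂, rfl⟩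
      exact ⟨X', p, P' + P₂, h, hV, ⟨Y, P', P₂, h₁, h₂, rfl⟩, add_assoc _ _ _⟩

theorem Run.valid {Δ : N → K} {F : DecoratedFlag K d} {W : List (Vertex d × Option N)}
    {X Z : List (Letter K d N)} {P : N → N → ℤ} (h : Run Δ F W X Z P) (hX : ValidRow Δ F X) :
    ValidRow Δ F Z := by
  induction W generalizing X P with
  | nil => rw [h.1]; exact hX
  | cons w W ih =>
    obtain ⟨X', p, P', -, hV, h, -⟩ := h
    exact ih h hV

/-- A cycle does not appear before it begins. This keeps the names of lower vertices fresh. -/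
theorem Run.wt_eq_zero {Δ : N → K} {F : DecoratedFlag K d} {W : List (Vertex d × Option N)}
    {X Z : List (Letter K d N)} {P : N → N → ℤ} (h : Run Δ F W X Z P) {n : N} (hn : n ∉ names W)
    (hX : ∀ x ∈ X, x.wt n = 0) : ∀ x ∈ Z, x.wt n = 0 := by
  induction W generalizing X P with
  | nil => rw [h.1]; exact hX
  | cons w W ih =>
    obtain ⟨X', p, P', hs, hV, h, -⟩ := h
    refine ih h (fun h' => hn ?_) (hs.wt_eq_zero (fun h' => hn ?_) hX)
    · rw [names, List.mem_filterMap] at h' ⊢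
      obtain ⟨a, ha, ha'⟩ := h'
      exact ⟨a, List.mem_cons_of_mem _ ha, ha'⟩
    · rw [names, List.mem_filterMap]
      exact ⟨w, List.mem_cons_self .., h'⟩

theorem Run.isWeave {Δ : N → K} {F : DecoratedFlag K d} {W : List (Vertex d × Option N)}
    {X Z : List (Letter K d N)} {P : N → N → ℤ} (h : Run Δ F W X Z P) :
    IsWeave (X.map Letter.col) (W.map Prod.fst) (Z.map Letter.col) := by
  induction W generalizing X P with
  | nil => rw [h.1]; rfl
  | cons w W ih =>
    obtain ⟨X', p, P', hs, hV, h, -⟩ := h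
    refine ⟨hs.map_col.1.symm, ?_⟩
    rw [← hs.map_col.2]
    exact ih h

/-- A vertex with additional weave lines to the left and to the right. -/
def Vertex.extend (l r : List (Color d)) (v : Vertex d) : Vertex d :=
  ⟨l ++ v.left, v.kind, v.right ++ r⟩

/-- The passage to additional weave lines does not change runs. -/
theorem run_extend {Δ : N → K} {F : DecoratedFlag K d} {W : List (Vertex d × Option N)}
    {L X R Z : List (Letter K d N)} {P : N → N → ℤ} (hV : ValidRow Δ F (L ++ X ++ R)) :
    Run Δ F (W.map (Prod.map (Vertex.extend (L.map Letter.col) (R.map Letter.col)) id))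
      (L ++ X ++ R) Z P ↔ ∃ Z', Z = L ++ Z' ++ R ∧ Run Δ (endFlag F L) W X Z' P := by
  induction W generalizing X P with
  | nil =>
    simp only [List.map_nil, Run]
    constructor
    · rintro ⟨rfl, rfl⟩
      exact ⟨X, rfl, rfl, rfl⟩
    · rintro ⟨Z', rfl, rfl, rfl⟩
      exact ⟨rfl, rfl⟩
  | cons w W ih =>
    rw [validRow_append, validRow_append] at hV
    simp only [List.map_cons, Run]
    constructor
    · rintro ⟨X', p, P', ⟨L₁, T, T', R₁, h1, rfl, hL₁, hR₁, hK⟩, hV', h, rfl⟩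
      have e1 := congrArg List.length hL₁
      have e2 := congrArg List.length hR₁
      have e3 := congrArg List.length h1
      simp only [Vertex.extend, List.length_append, List.length_map, Prod.map] at e1 e2 e3
      -- An extended vertex has at least the lines of `L` to its left, so it leaves these letters
      -- alone. The same holds for `R` on the other side.
      obtain ⟨L₂, rfl⟩ : ∃ L₂, L₁ = L ++ L₂ := by
        rw [List.append_assoc, List.append_assoc] at h1
        obtain ⟨A, rfl, -⟩ | ⟨A, rfl, -⟩ := List.append_eq_append_iff.1 h1
        · exact ⟨A, rfl⟩
        · simp only [List.length_append] at e1
          have : A = [] := List.length_eq_zero_iff.1 (by omega)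
          exact ⟨[], by simp [this]⟩
      obtain ⟨R₂, rfl⟩ : ∃ R₂, R₁ = R₂ ++ R := by
        obtain ⟨A, -, rfl⟩ | ⟨A, -, rfl⟩ := List.append_eq_append_iff.1 h1
        · simp only [List.length_append] at e2
          have : A = [] := List.length_eq_zero_iff.1 (by omega)
          exact ⟨[], by simp [this]⟩
        · exact ⟨A, rfl⟩
      have hX : X = L₂ ++ T ++ R₂ := by
        simp only [List.append_assoc] at h1
        have h2 := List.append_cancel_left h1
        rw [← List.append_assoc, ← List.append_assoc] at h2
        exact List.append_cancel_right h2
      simp only [Vertex.extend, List.map_append, Prod.map, List.append_cancel_left_eq] at hL₁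
      simp only [Vertex.extend, List.map_append, Prod.map, List.append_cancel_right_eq] at hR₁
      have hX' : L ++ L₂ ++ T' ++ (R₂ ++ R) = L ++ (L₂ ++ T' ++ R₂) ++ R := by simp
      rw [hX'] at hV' h
      have hst : RowStep w.1 w.2 X (L₂ ++ T' ++ R₂) p := ⟨L₂, T, T', R₂, hX, rfl, hL₁, hR₁, hK⟩
      obtain ⟨Z', rfl, h'⟩ := (ih hV').1 h
      rw [validRow_append, validRow_append] at hV'
      exact ⟨Z', rfl, _, p, P', hst, hV'.1.2, h', rfl⟩
    · rintro ⟨Z', rfl, X', p, P', hst, hV', h, rfl⟩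
      have hVX : ValidRow Δ F (L ++ X' ++ R) := by
        rw [validRow_append, validRow_append]
        refine ⟨⟨hV.1.1, hV'⟩, ?_⟩
        rw [endFlag_append, hst.endFlag, ← endFlag_append]
        exact hV.2
      refine ⟨L ++ X' ++ R, p, P', ?_, hVX, (ih hVX).2 ⟨Z', rfl, h⟩, rfl⟩
      obtain ⟨L₂, T, T', R₂, rfl, rfl, hL, hR, hK⟩ := hst
      exact ⟨L ++ L₂, T, T', R₂ ++ R, by simp, by simp, by simp [Vertex.extend, hL],
        by simp [Vertex.extend, hR], hK⟩

end Rows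

/-! ### Weaves without trivalent vertices -/

section Braid

variable {K : Type*} [Field K] {d : ℕ} {N : Type*} [Fintype N]

/-- The row `X` of decorated flags has the coordinates `Z` with respect to the frame `g`. -/
def HasCoordinates (Δ : N → K) : (ℕ → Fin d → K) → List (Color d × ((N → ℕ) × K)) →
    List (Letter K d N) → Prop
  | _, [], X => X = []
  | g, z :: Z, X => ∃ F X', X = ⟨z.1, z.2.1, F⟩ :: X' ∧
      IsFrame (crossFrame ((z.1 : ℕ) - 1) z.2.2 (weightValue Δ z.2.1) g) F ∧
      HasCoordinates Δ (crossFrame ((z.1 : ℕ) - 1) z.2.2 (weightValue Δ z.2.1) g) Z X'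

/-- The frame at the end of a row with given coordinates. -/
noncomputable def endFrame (Δ : N → K) : (ℕ → Fin d → K) → List (Color d × ((N → ℕ) × K)) →
    (ℕ → Fin d → K)
  | g, [] => g
  | g, z :: Z => endFrame Δ (crossFrame ((z.1 : ℕ) - 1) z.2.2 (weightValue Δ z.2.1) g) Z

/-- Colors are counted from one and the vectors of a frame from zero, so the color `i` belongs to
the index `i - 1` of `crossFrame`. -/
theorem color_pred_add (i : Color d) : (i : ℕ) = (i : ℕ) - 1 + 1 := by have := i.2.1; omega

variable {Δ : N → K}

theorem HasCoordinates.map_fst {g : ℕ → Fin d → K} {Z : List (Color d × ((N → ℕ) × K))}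
    {X : List (Letter K d N)} (h : HasCoordinates Δ g Z X) :
    Z.map Prod.fst = X.map Letter.col := by
  induction Z generalizing g X with
  | nil => obtain rfl := h; rfl
  | cons z Z ih =>
    obtain ⟨F, X', rfl, -, h⟩ := h
    simp [ih h]

theorem HasCoordinates.eq {g : ℕ → Fin d → K} {Z : List (Color d × ((N → ℕ) × K))}
    {X Y : List (Letter K d N)} (h : HasCoordinates Δ g Z X) (h' : HasCoordinates Δ g Z Y) :
    X = Y := by
  induction Z generalizing g X Y with
  | nil => exact Eq.trans h h'.symm
  | cons z Z ih =>
    obtain ⟨F, X', rfl, hF, h⟩ := h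
    obtain ⟨F', Y', rfl, hF', h'⟩ := h'
    rw [hF.unique hF', ih h h']

theorem HasCoordinates.valid (hΔ : ∀ n, Δ n ≠ 0) {g : ℕ → Fin d → K} {F : DecoratedFlag K d}
    (hF : IsFrame g F) {Z : List (Color d × ((N → ℕ) × K))} {X : List (Letter K d N)}
    (h : HasCoordinates Δ g Z X) : ValidRow Δ F X := by
  induction Z generalizing g F X with
  | nil => obtain rfl := h; trivial
  | cons z Z ih =>
    obtain ⟨G, X', rfl, hG, h⟩ := h
    exact ⟨relativePosition_of_crossFrame hF (color_pred_add _) (weightValue_ne_zero hΔ _) hG,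
      ih hG h⟩

theorem exists_hasCoordinates {g : ℕ → Fin d → K} {F : DecoratedFlag K d}
    (hF : IsFrame g F) {X : List (Letter K d N)} (h : ValidRow Δ F X) :
    ∃ Z, HasCoordinates Δ g Z X := by
  induction X generalizing g F with
  | nil => exact ⟨[], rfl⟩
  | cons x X ih =>
    obtain ⟨-, z, hz⟩ :=
      exists_crossFrame_of_hasCrossingValue hF (color_pred_add x.col) h.1.1 h.1.2
    obtain ⟨Z, hZ⟩ := ih hz h.2
    exact ⟨(x.col, (x.wt, z)) :: Z, x.flag, X, rfl, hz, hZ⟩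

theorem hasCoordinates_append {g : ℕ → Fin d → K} {Z Z' : List (Color d × ((N → ℕ) × K))}
    {X : List (Letter K d N)} : HasCoordinates Δ g (Z ++ Z') X ↔
      ∃ X₁ X₂, X = X₁ ++ X₂ ∧ HasCoordinates Δ g Z X₁ ∧
        HasCoordinates Δ (endFrame Δ g Z) Z' X₂ := by
  induction Z generalizing g X with
  | nil =>
    simp only [List.nil_append, HasCoordinates, endFrame]
    constructor
    · exact fun h => ⟨[], X, rfl, rfl, h⟩
    · rintro ⟨_, X₂, rfl, rfl, h⟩
      exact h
  | cons z Z ih =>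
    simp only [List.cons_append, HasCoordinates, endFrame, ih]
    constructor
    · rintro ⟨F, X', rfl, hF, X₁, X₂, rfl, h₁, h₂⟩
      exact ⟨_, X₂, (List.cons_append ..).symm, ⟨F, X₁, rfl, hF, h₁⟩, h₂⟩
    · rintro ⟨_, X₂, rfl, ⟨F, X₁, rfl, hF, h₁⟩, h₂⟩
      exact ⟨F, X₁ ++ X₂, rfl, hF, X₁, X₂, rfl, h₁, h₂⟩

theorem endFlag_eq_of_isFrame {g : ℕ → Fin d → K} {F : DecoratedFlag K d} (hF : IsFrame g F)
    {Z : List (Color d × ((N → ℕ) × K))} {X : List (Letter K d N)}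
    (h : HasCoordinates Δ g Z X) : IsFrame (endFrame Δ g Z) (endFlag F X) := by
  induction Z generalizing g F X with
  | nil => obtain rfl := h; exact hF
  | cons z Z ih =>
    obtain ⟨G, X', rfl, hG, h⟩ := h
    exact ih hG h

theorem adjacent_pred {i j : Color d} (h : Adjacent i j) :
    (j : ℕ) - 1 = (i : ℕ) - 1 + 1 ∨ (i : ℕ) - 1 = (j : ℕ) - 1 + 1 := by
  have h1 := i.2.1
  have h2 := j.2.1
  rcases h with h | h <;> omega

/-- The flags inside a 6-valent vertex are uniquely determined. -/
theorem six_unique {i j : Color d} (h : Adjacent i j) {F : DecoratedFlag K d}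
    {b c g b' g' : N → ℕ} {F₃ G₁ G₂ G₁' G₂' : DecoratedFlag K d}
    (hV : ValidRow Δ F [⟨j, b, G₁⟩, ⟨i, c, G₂⟩, ⟨j, g, F₃⟩])
    (hV' : ValidRow Δ F [⟨j, b', G₁'⟩, ⟨i, c, G₂'⟩, ⟨j, g', F₃⟩]) : G₁ = G₁' ∧ G₂ = G₂' := by
  obtain ⟨f, hf⟩ := exists_frame F
  obtain ⟨⟨r1, v1⟩, ⟨r2, v2⟩, ⟨r3, v3⟩, -⟩ := hV
  obtain ⟨⟨r1', v1'⟩, ⟨r2', v2'⟩, ⟨r3', v3'⟩, -⟩ := hV'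
  obtain ⟨n1, z1, f1⟩ := exists_crossFrame_of_hasCrossingValue hf (color_pred_add j) r1 v1
  obtain ⟨n2, z2, f2⟩ := exists_crossFrame_of_hasCrossingValue f1 (color_pred_add i) r2 v2
  obtain ⟨n1', z1', f1'⟩ := exists_crossFrame_of_hasCrossingValue hf (color_pred_add j) r1' v1'
  obtain ⟨n2', z2', f2'⟩ := exists_crossFrame_of_hasCrossingValue f1' (color_pred_add i) r2' v2'
  have hij : i ≠ j := by rintro rfl; simp [Adjacent] at h
  have e : G₂.level i = G₂'.level i := by
    rw [G₂.level_color, G₂'.level_color, r3.1 i hij, r3'.1 i hij]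
  rw [f2 _ i.2.2.le, f2' _ i.2.2.le, color_pred_add i] at e
  obtain ⟨rfl, rfl, e3⟩ := crossFrame_braid_injective (adjacent_pred h)
    (hf.wedge_ne_zero (by
      have := i.2
      have := j.2
      simp only [Adjacent] at h
      omega)) n2 n1 n1' e
  rw [e3] at f1 f2
  exact ⟨f1.unique f1', f2.unique f2'⟩

/-- The relation `crossFrame_braid` with the value of `a ⊓ e` as middle crossing value. The outer
crossing values are then the ones of the transported weights. The frame to the right does not
change, so the rest of the row keeps its coordinates. -/
theorem exists_six (hΔ : ∀ n, Δ n ≠ 0) {i j : Color d} (h : Adjacent i j)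
    {g : ℕ → Fin d → K} {F : DecoratedFlag K d} (hF : IsFrame g F) {a f e : N → ℕ}
    {z₁ z₂ z₃ : K} {F₁ F₂ F₃ : DecoratedFlag K d}
    (hX : HasCoordinates Δ g [(i, (a, z₁)), (j, (f, z₂)), (i, (e, z₃))]
      [⟨i, a, F₁⟩, ⟨j, f, F₂⟩, ⟨i, e, F₃⟩]) :
    ∃ b c g' G₁ G₂, sixLabels Δ ((a, z₁), (f, z₂), (e, z₃)) = (b, c, g') ∧
      HasCoordinates Δ g [(j, b), (i, c), (j, g')]
        [⟨j, f + e - a ⊓ e, G₁⟩, ⟨i, a ⊓ e, G₂⟩, ⟨j, a + f - a ⊓ e, F₃⟩] ∧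
      endFrame Δ g [(j, b), (i, c), (j, g')] =
        endFrame Δ g [(i, (a, z₁)), (j, (f, z₂)), (i, (e, z₃))] := by
  simp only [HasCoordinates, List.cons.injEq, Letter.mk.injEq, true_and] at hX
  obtain ⟨_, _, ⟨rfl, rfl⟩, h1, _, _, ⟨rfl, rfl⟩, h2, _, _, ⟨rfl, rfl⟩, h3, -⟩ := hX
  have hv := weightValue_sixWeights hΔ a f e
  have hb := crossFrame_braid (adjacent_pred h) (z₁ := z₁) (z₂ := z₂) (z₃ := z₃)
    (weightValue_ne_zero hΔ a) (weightValue_ne_zero hΔ f)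
    (weightValue_ne_zero hΔ e) (weightValue_ne_zero hΔ (a ⊓ e)) g
  rw [← hv.1, ← hv.2] at hb
  obtain ⟨G₁, hG₁⟩ := exists_flag_crossFrame hF (p := (j : ℕ) - 1)
    (by rw [← color_pred_add]; exact j.2.2)
    (weightValue Δ a * z₃ / weightValue Δ (a ⊓ e)) (weightValue_ne_zero hΔ (f + e - a ⊓ e))
  obtain ⟨G₂, hG₂⟩ := exists_flag_crossFrame hG₁ (p := (i : ℕ) - 1)
    (by rw [← color_pred_add]; exact i.2.2)
    (z₁ * z₃ - weightValue Δ e * z₂ / weightValue Δ a) (weightValue_ne_zero hΔ (a ⊓ e))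
  exact ⟨_, _, _, G₁, G₂, rfl,
    ⟨G₁, _, rfl, hG₁, G₂, _, rfl, hG₂, _, [], rfl, hb ▸ h3, rfl⟩, hb.symm⟩

theorem exists_four (hΔ : ∀ n, Δ n ≠ 0) {i j : Color d} (h : Distant i j)
    {g : ℕ → Fin d → K} {F : DecoratedFlag K d} (hF : IsFrame g F) {a f : (N → ℕ) × K}
    {F₁ F₂ : DecoratedFlag K d}
    (hX : HasCoordinates Δ g [(i, a), (j, f)] [⟨i, a.1, F₁⟩, ⟨j, f.1, F₂⟩]) :
    ∃ G, HasCoordinates Δ g [(j, f), (i, a)] [⟨j, f.1, G⟩, ⟨i, a.1, F₂⟩] ∧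
      endFrame Δ g [(j, f), (i, a)] = endFrame Δ g [(i, a), (j, f)] := by
  simp only [HasCoordinates, List.cons.injEq, Letter.mk.injEq, true_and] at hX
  obtain ⟨_, _, ⟨rfl, rfl⟩, h1, _, _, ⟨rfl, rfl⟩, h2, -⟩ := hX
  have hd : (i : ℕ) - 1 + 1 < (j : ℕ) - 1 ∨ (j : ℕ) - 1 + 1 < (i : ℕ) - 1 := by
    have h1 := i.2.1
    have h2 := j.2.1
    rcases h with h | h <;> omega
  have hc := crossFrame_comm hd a.2 (weightValue Δ a.1) f.2 (weightValue Δ f.1) g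
  obtain ⟨G, hG⟩ := exists_flag_crossFrame hF (p := (j : ℕ) - 1)
    (by rw [← color_pred_add]; exact j.2.2) f.2 (weightValue_ne_zero hΔ f.1)
  exact ⟨G, ⟨G, _, rfl, hG, _, [], rfl, hc ▸ h2, rfl⟩, hc.symm⟩

theorem four_unique {i j : Color d} {F : DecoratedFlag K d} {b c b' c' : N → ℕ}
    {F₂ G G' : DecoratedFlag K d} (h : i ≠ j)
    (hV : ValidRow Δ F [⟨j, b, G⟩, ⟨i, c, F₂⟩])
    (hV' : ValidRow Δ F [⟨j, b', G'⟩, ⟨i, c', F₂⟩]) : G = G' := by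
  obtain ⟨⟨r1, v1⟩, ⟨r2, v2⟩, -⟩ := hV
  obtain ⟨⟨r1', v1'⟩, ⟨r2', v2'⟩, -⟩ := hV'
  refine DecoratedFlag.ext_level fun k => ?_
  rw [G.level_color, G'.level_color]
  by_cases hk : k = j
  · subst hk
    rw [r2.1 _ h.symm, r2'.1 _ h.symm]
  · rw [← r1.1 k hk, ← r1'.1 k hk]

theorem hasCoordinates_split {g : ℕ → Fin d → K} {Z : List (Color d × ((N → ℕ) × K))}
    {X Y : List (Letter K d N)} (h : HasCoordinates Δ g Z (X ++ Y)) :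
    ∃ Z₁ Z₂, Z = Z₁ ++ Z₂ ∧ HasCoordinates Δ g Z₁ X ∧
      HasCoordinates Δ (endFrame Δ g Z₁) Z₂ Y := by
  induction X generalizing g Z with
  | nil => exact ⟨[], Z, rfl, rfl, h⟩
  | cons x X ih =>
    cases Z with
    | nil => simp [HasCoordinates] at h
    | cons z Z =>
      obtain ⟨F, X', e, hF, h⟩ := h
      rw [List.cons_append, List.cons.injEq] at e
      obtain ⟨rfl, rfl⟩ := e
      obtain ⟨Z₁, Z₂, rfl, h₁, h₂⟩ := ih h
      exact ⟨z :: Z₁, Z₂, rfl, ⟨F, X, rfl, hF, h₁⟩, h₂⟩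

theorem HasCoordinates.cons_inv {g : ℕ → Fin d → K} {Z : List (Color d × ((N → ℕ) × K))}
    {x : Letter K d N} {X : List (Letter K d N)} (h : HasCoordinates Δ g Z (x :: X)) :
    ∃ z Z', Z = (x.col, (x.wt, z)) :: Z' ∧
      IsFrame (crossFrame ((x.col : ℕ) - 1) z (weightValue Δ x.wt) g) x.flag ∧
      HasCoordinates Δ (crossFrame ((x.col : ℕ) - 1) z (weightValue Δ x.wt) g) Z' X := by
  cases Z with
  | nil => simp [HasCoordinates] at h
  | cons z Z =>
    obtain ⟨F, X', e, hF, h⟩ := h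
    rw [List.cons.injEq] at e
    obtain ⟨rfl, rfl⟩ := e
    exact ⟨z.2.2, Z, rfl, hF, h⟩

/-- A step of a valid row at a 4- or 6-valent vertex exists, and is a labelled braid move of the
coordinates. -/
theorem exists_rowStep (hΔ : ∀ n, Δ n ≠ 0) {v : Vertex d} (hv : v.kind.isTri = false)
    {g : ℕ → Fin d → K} {F : DecoratedFlag K d} (hF : IsFrame g F)
    {Z : List (Color d × ((N → ℕ) × K))} {X : List (Letter K d N)}
    (hZ : HasCoordinates Δ g Z X) (hX : X.map Letter.col = v.top) :
    ∃ X' P Z', RowStep v none X X' P ∧ BraidEq (sixLabels Δ) Z Z' ∧ HasCoordinates Δ g Z' X' := by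
  obtain ⟨l, k, r⟩ := v
  rw [Vertex.top, List.map_eq_append_iff] at hX
  obtain ⟨Y, R, rfl, hY, rfl⟩ := hX
  rw [List.map_eq_append_iff] at hY
  obtain ⟨L, T, rfl, rfl, hT⟩ := hY
  obtain ⟨Z₁, Z₃, rfl, hZ₁, hZR⟩ := hasCoordinates_split hZ
  obtain ⟨ZL, ZT, rfl, hZL, hZT⟩ := hasCoordinates_split hZ₁
  have hFL := endFlag_eq_of_isFrame hF hZL
  have endFrame_append : ∀ (g : ℕ → Fin d → K) (A B : List (Color d × ((N → ℕ) × K))),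
      endFrame Δ g (A ++ B) = endFrame Δ (endFrame Δ g A) B := by
    intro g A B
    induction A generalizing g with
    | nil => rfl
    | cons a A ih => exact ih _
  have main : ∃ T' P ZT', KindStep k none T T' P ∧
      BraidEq (sixLabels Δ) (ZL ++ ZT ++ Z₃) (ZL ++ ZT' ++ Z₃) ∧
      HasCoordinates Δ (endFrame Δ g ZL) ZT' T' ∧
      endFrame Δ (endFrame Δ g ZL) ZT' = endFrame Δ (endFrame Δ g ZL) ZT := by
    cases k with
    | tri i => simp [VertexKind.isTri] at hv
    | four i j h =>
      obtain ⟨⟨c1, a, F₁⟩, T₁, rfl, rfl, hT₁⟩ := List.map_eq_cons_iff.1 hT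
      obtain ⟨⟨c2, b, F₂⟩, T₂, rfl, rfl, hT₂⟩ := List.map_eq_cons_iff.1 hT₁
      obtain rfl := List.map_eq_nil_iff.1 hT₂
      obtain ⟨z₁, Z', rfl, h1, h2⟩ := hZT.cons_inv
      obtain ⟨z₂, Z'', rfl, h3, h4⟩ := h2.cons_inv
      cases Z'' with
      | cons _ _ => obtain ⟨_, _, e, -⟩ := h4; simp at e
      | nil =>
        obtain ⟨G, hG, hE⟩ := exists_four hΔ h hFL (a := (a, z₁)) (f := (b, z₂)) hZT
        refine ⟨_, _, _, ⟨a, b, F₁, F₂, G, rfl, rfl, rfl, rfl⟩, ?_, hG, hE⟩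
        rw [List.append_assoc, List.append_assoc]
        exact .rel _ _ (.four _ _ _ _ _ _ h)
    | six i j h =>
      obtain ⟨⟨c1, a, F₁⟩, T₁, rfl, rfl, hT₁⟩ := List.map_eq_cons_iff.1 hT
      obtain ⟨⟨c2, f, F₂⟩, T₂, rfl, rfl, hT₂⟩ := List.map_eq_cons_iff.1 hT₁
      obtain ⟨⟨c3, e, F₃⟩, T₃, rfl, hc3, hT₃⟩ := List.map_eq_cons_iff.1 hT₂
      obtain rfl := List.map_eq_nil_iff.1 hT₃
      simp only at hc3 h
      subst hc3
      obtain ⟨z₁, Z', rfl, h1, h2⟩ := hZT.cons_inv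
      obtain ⟨z₂, Z'', rfl, h3, h4⟩ := h2.cons_inv
      obtain ⟨z₃, Z''', rfl, h5, h6⟩ := h4.cons_inv
      cases Z''' with
      | cons _ _ => obtain ⟨_, _, e, -⟩ := h6; simp at e
      | nil =>
        obtain ⟨b, c, g', G₁, G₂, hφ, hG, hE⟩ := exists_six hΔ h hFL hZT
        refine ⟨_, _, _, ⟨a, f, e, F₁, F₂, F₃, G₁, G₂, rfl, rfl, rfl, rfl⟩, ?_, hG, hE⟩
        rw [List.append_assoc, List.append_assoc]
        exact .rel _ _ (.six _ _ _ _ _ _ _ _ _ _ h hφ)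
  obtain ⟨T', P, ZT', hK, hB, hC, hE⟩ := main
  refine ⟨L ++ T' ++ R, P, ZL ++ ZT' ++ Z₃, ⟨L, T, T', R, rfl, rfl, rfl, rfl, hK⟩, hB, ?_⟩
  rw [hasCoordinates_append]
  refine ⟨L ++ T', R, rfl, hasCoordinates_append.2 ⟨L, T', rfl, hZL, hC⟩, ?_⟩
  rw [endFrame_append, hE, ← endFrame_append]
  exact hZR

/-- Steps at 4- and 6-valent vertices are unique. -/
theorem RowStep.unique {v : Vertex d} (hv : v.kind.isTri = false) {o o' : Option N}
    {F : DecoratedFlag K d} {X X' X'' : List (Letter K d N)} {P P' : N → N → ℤ}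
    (h : RowStep v o X X' P) (h' : RowStep v o' X X'' P') (hV : ValidRow Δ F X')
    (hV' : ValidRow Δ F X'') : X' = X'' ∧ P = P' := by
  obtain ⟨L, T, T', R, rfl, rfl, hL, hR, hK⟩ := h
  rw [rowStep_append_iff (by rw [← hL, List.length_map])
    (by rw [← hK.map_col.1, List.length_map])] at h'
  obtain ⟨-, -, T'', rfl, hK'⟩ := h'
  rw [validRow_append, validRow_append] at hV hV'
  obtain ⟨l, k, r⟩ := v
  cases k with
  | tri i => simp [VertexKind.isTri] at hv
  | four i j h =>
    obtain ⟨a, b, F₁, F₂, G, -, rfl, rfl, rfl⟩ := hK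
    obtain ⟨a', b', F₁', F₂', G', -, hT, rfl, rfl⟩ := hK'
    simp only [List.cons.injEq, Letter.mk.injEq, true_and, and_true] at hT
    obtain ⟨⟨rfl, rfl⟩, rfl, rfl⟩ := hT
    have hij : i ≠ j := by rintro rfl; simp [Distant] at h
    obtain rfl := four_unique hij hV.1.2 hV'.1.2
    exact ⟨rfl, rfl⟩
  | six i j h =>
    obtain ⟨a, f, e, F₁, F₂, F₃, G₁, G₂, -, rfl, rfl, rfl⟩ := hK
    obtain ⟨a', f', e', F₁', F₂', F₃', G₁', G₂', -, hT, rfl, rfl⟩ := hK'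
    simp only [List.cons.injEq, Letter.mk.injEq, true_and, and_true] at hT
    obtain ⟨⟨rfl, rfl⟩, ⟨rfl, rfl⟩, rfl, rfl⟩ := hT
    obtain ⟨rfl, rfl⟩ := six_unique h hV.1.2 hV'.1.2
    exact ⟨rfl, rfl⟩

theorem exists_run_of_braid (hΔ : ∀ n, Δ n ≠ 0) {x : List (Vertex d)}
    (hx : ∀ v ∈ x, v.kind.isTri = false) {α α' : List (Color d)} (hw : IsWeave α x α')
    {g : ℕ → Fin d → K} {F : DecoratedFlag K d} (hF : IsFrame g F)
    {Z : List (Color d × ((N → ℕ) × K))} {X : List (Letter K d N)}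
    (hZ : HasCoordinates Δ g Z X) (hX : X.map Letter.col = α) :
    ∃ X' P Z', Run Δ F (x.map fun v => (v, none)) X X' P ∧ BraidEq (sixLabels Δ) Z Z' ∧
      HasCoordinates Δ g Z' X' ∧ X'.map Letter.col = α' := by
  induction x generalizing α X Z with
  | nil => exact ⟨X, 0, Z, ⟨rfl, rfl⟩, .refl _, hZ, by rw [hX]; exact hw⟩
  | cons v x ih =>
    obtain ⟨hα, hw⟩ := hw
    obtain ⟨X₁, P₁, Z₁, hs, hB, hZ₁⟩ := exists_rowStep hΔ (hx v (List.mem_cons_self ..)) hF hZ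
      (hX.trans hα.symm)
    obtain ⟨X', P, Z', hr, hB', hZ', hX'⟩ := ih (fun v hv => hx v (List.mem_cons_of_mem _ hv)) hw
      hZ₁ hs.map_col.2
    exact ⟨X', _, Z', ⟨X₁, P₁, P, hs, hZ₁.valid hΔ hF, hr, rfl⟩, hB.trans hB', hZ', hX'⟩

theorem Run.unique_of_braid {W W' : List (Vertex d × Option N)} (h : W.map Prod.fst = W'.map Prod.fst)
    (hx : ∀ v ∈ W.map Prod.fst, v.kind.isTri = false) {F : DecoratedFlag K d}
    {X Z Z' : List (Letter K d N)} {P P' : N → N → ℤ} (hr : Run Δ F W X Z P)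
    (hr' : Run Δ F W' X Z' P') : Z = Z' ∧ P = P' := by
  induction W generalizing X P P' W' with
  | nil =>
    obtain rfl : W' = [] := by simpa using h.symm
    exact ⟨hr.1.trans hr'.1.symm, hr.2.trans hr'.2.symm⟩
  | cons w W ih =>
    cases W' with
    | nil => simp at h
    | cons w' W' =>
      simp only [List.map_cons, List.cons.injEq] at h
      obtain ⟨X₁, p, P₁, hs, hV, hr, rfl⟩ := hr
      obtain ⟨X₂, p', P₂, hs', hV', hr', rfl⟩ := hr'
      rw [← h.1] at hs'
      obtain ⟨rfl, rfl⟩ := hs.unique (hx _ (List.mem_cons_self ..)) hs' hV hV'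
      obtain ⟨rfl, rfl⟩ := ih h.2 (fun v hv => hx v (List.mem_cons_of_mem _ hv)) hr hr'
      exact ⟨rfl, rfl⟩

/-- Two runs without trivalent vertices, from the same row to rows with the same colors, lead to
the same row. -/
theorem Run.eq_of_braid (hΔ : ∀ n, Δ n ≠ 0) {W W' : List (Vertex d × Option N)}
    (hx : ∀ v ∈ W.map Prod.fst, v.kind.isTri = false)
    (hx' : ∀ v ∈ W'.map Prod.fst, v.kind.isTri = false) {F : DecoratedFlag K d}
    {X Z Z' : List (Letter K d N)} {P P' : N → N → ℤ} (hX : ValidRow Δ F X)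
    (hr : Run Δ F W X Z P) (hr' : Run Δ F W' X Z' P')
    (hc : Z.map Letter.col = Z'.map Letter.col) : Z = Z' := by
  obtain ⟨g, hF⟩ := exists_frame F
  obtain ⟨C, hC⟩ := exists_hasCoordinates hF hX
  obtain ⟨Z₁, P₁, C₁, h1, hB, hC₁, -⟩ := exists_run_of_braid hΔ hx hr.isWeave hF hC rfl
  obtain ⟨Z₂, P₂, C₂, h2, hB', hC₂, -⟩ := exists_run_of_braid hΔ hx' hr'.isWeave hF hC rfl
  obtain ⟨rfl, -⟩ := hr.unique_of_braid (by simp) hx h1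
  obtain ⟨rfl, -⟩ := hr'.unique_of_braid (by simp) hx' h2
  -- Both final rows have coordinates with respect to the same initial frame, and these are
  -- connected by labelled braid moves. Coherence makes them equal.
  have := (hB.symm.trans hB').eq_of_map_fst (sixLabels_sixLabels hΔ)
    (rankThreeCoherent_sixLabels hΔ) (by rw [hC₁.map_fst, hC₂.map_fst, hc])
  subst this
  exact hC₁.eq hC₂

end Braid

/-! ### The pairing at vertices that are not trivalent -/

section Pairing

variable {K : Type*} [Field K] {d : ℕ} {N : Type*}

/-- The combination of the roots of a word, with the values of a cycle as coefficients. -/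
def rootSum (c : N) : List (Letter K d N) → ℕ → ℤ
  | [], _ => 0
  | x :: X, n =>
    if n = x.col then x.wt c + rootSum c X (x.col + 1)
    else if n = x.col + 1 then rootSum c X x.col - x.wt c else rootSum c X n

/-- The boundary pairing of two cycles on a row. -/
def rowPairing (c c' : N) : List (Letter K d N) → ℤ
  | [] => 0
  | x :: X => rowPairing c c' X
      - x.wt c * (rootSum c' X x.col - rootSum c' X (x.col + 1))
      + x.wt c' * (rootSum c X x.col - rootSum c X (x.col + 1))

/-- `rootSum` reflects the sum for the remaining letters and adds a multiple of a simple root. A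
letter therefore sees what lies to its right only through the root sums, and the difference of two
row pairings is not affected by common letters on the left. -/
theorem rowPairing_append_congr {c c' : N} {X Y : List (Letter K d N)}
    (h : rootSum c X = rootSum c Y) (h' : rootSum c' X = rootSum c' Y)
    (L : List (Letter K d N)) :
    rootSum c (L ++ X) = rootSum c (L ++ Y) ∧ rootSum c' (L ++ X) = rootSum c' (L ++ Y) ∧
    rowPairing c c' (L ++ X) - rowPairing c c' (L ++ Y) =
      rowPairing c c' X - rowPairing c c' Y := by
  induction L with
  | nil => exact ⟨h, h', rfl⟩
  | cons x L ih =>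
    obtain ⟨h1, h2, h3⟩ := ih
    refine ⟨?_, ?_, ?_⟩
    · funext n
      simp only [List.cons_append, rootSum, h1]
    · funext n
      simp only [List.cons_append, rootSum, h2]
    · simp only [List.cons_append, rowPairing, h1, h2]
      linarith

theorem tripleDet_eq (x₁ x₂ x₃ y₁ y₂ y₃ : ℤ) : tripleDet x₁ x₂ x₃ y₁ y₂ y₃ =
    (x₂ * y₃ - x₃ * y₂) - (x₁ * y₃ - x₃ * y₁) + (x₁ * y₂ - x₂ * y₁) := by
  simp [tripleDet, Matrix.det_fin_three]
  ring

/-- This gives the local pairing the shape top minus bottom, in which contributions telescope. -/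
theorem two_mul_sixPairing (a f e : N → ℕ) (c c' : N) :
    2 * sixPairing a f e c c' = tripleDet (a c) (f c) (e c) (a c') (f c') (e c') -
      tripleDet ((f + e - a ⊓ e) c) ((a ⊓ e) c) ((a + f - a ⊓ e) c)
        ((f + e - a ⊓ e) c') ((a ⊓ e) c') ((a + f - a ⊓ e) c') := by
  have e1 : ∀ n, (((f + e - a ⊓ e) n : ℕ) : ℤ) = f n + e n - min (a n : ℤ) (e n) := by
    intro n; simp only [Pi.add_apply, Pi.sub_apply, Pi.inf_apply]; omega
  have e2 : ∀ n, (((a + f - a ⊓ e) n : ℕ) : ℤ) = a n + f n - min (a n : ℤ) (e n) := by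
    intro n; simp only [Pi.add_apply, Pi.sub_apply, Pi.inf_apply]; omega
  have e3 : ∀ n, (((a ⊓ e) n : ℕ) : ℤ) = min (a n : ℤ) (e n) := by
    intro n; simp only [Pi.inf_apply]; omega
  have h2 := two_dvd_six (a c) (f c) (e c) (a c') (f c') (e c')
  rw [sixPairing]
  simp only [e1, e2, e3]
  rw [Int.mul_ediv_cancel' h2]
  simp only [tripleDet_eq]
  rcases le_total (a c : ℤ) (e c) with h | h <;> rcases le_total (a c' : ℤ) (e c') with h' | h' <;>
    simp only [min_eq_left, min_eq_right, h, h'] <;> ring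

/-- The braid relations of reflections preserve the root sums, and the loss of boundary pairing is
twice the local pairing. So pairings of weaves without trivalent vertices depend only on the two
boundary rows. -/
theorem RowStep.two_mul_pairing {v : Vertex d} (hv : v.kind.isTri = false) {o : Option N}
    {X X' : List (Letter K d N)} {P : N → N → ℤ} (h : RowStep v o X X' P) (c c' : N) :
    rootSum c X = rootSum c X' ∧
      2 * P c c' = rowPairing c c' X - rowPairing c c' X' := by
  obtain ⟨L, T, T', R, rfl, rfl, hL, hR, hK⟩ := h
  rw [List.append_assoc, List.append_assoc]
  have main : (∀ c, rootSum c (T ++ R) = rootSum c (T' ++ R)) ∧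
      2 * P c c' = rowPairing c c' (T ++ R) - rowPairing c c' (T' ++ R) := by
    obtain ⟨l, k, r⟩ := v
    cases k with
    | tri i => simp [VertexKind.isTri] at hv
    | four i j h =>
      obtain ⟨a, b, F₁, F₂, G, -, rfl, rfl, rfl⟩ := hK
      simp only [Distant] at h
      constructor
      · intro c
        funext n
        simp only [List.cons_append, List.nil_append, rootSum]
        split_ifs <;> (try omega)
      · simp only [List.cons_append, List.nil_append, rowPairing, rootSum]
        split_ifs <;> (try omega)
        simp only [Pi.zero_apply]
        ring
    | six i j h =>
      obtain ⟨a, f, e, F₁, F₂, F₃, G₁, G₂, -, rfl, rfl, rfl⟩ := hK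
      have e1 : ∀ n, (((f + e - a ⊓ e) n : ℕ) : ℤ) = f n + e n - ((a ⊓ e) n : ℕ) := by
        intro n; simp only [Pi.add_apply, Pi.sub_apply, Pi.inf_apply]; omega
      have e2 : ∀ n, (((a + f - a ⊓ e) n : ℕ) : ℤ) = a n + f n - ((a ⊓ e) n : ℕ) := by
        intro n; simp only [Pi.add_apply, Pi.sub_apply, Pi.inf_apply]; omega
      have n1 : ∀ n : ℕ, ¬ n = n + 1 + 1 := by omega
      have n2 : ∀ n : ℕ, ¬ n + 1 + 1 = n := by omega
      constructor
      · intro c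
        funext n
        simp only [List.cons_append, List.nil_append, rootSum, e1, e2]
        rcases h with h | h
        · rw [← h]
          by_cases h1 : n = i
          · subst h1; simp [n1, n2]
            ring
          · by_cases h2 : n = i + 1
            · subst h2; simp [n1, n2]
              ring
            · by_cases h3 : n = i + 1 + 1
              · subst h3; simp [n1, n2]
                ring
              · simp [h1, h2, h3]
        · rw [← h]
          by_cases h1 : n = j
          · subst h1; simp [n1, n2]
            ring
          · by_cases h2 : n = j + 1
            · subst h2; simp [n1, n2]
              ring
            · by_cases h3 : n = j + 1 + 1
              · subst h3; simp [n1, n2]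
                ring
              · simp [h1, h2, h3]
      · rw [two_mul_sixPairing]
        simp only [List.cons_append, List.nil_append, rowPairing, rootSum, tripleDet_eq, e1, e2]
        rcases h with h | h
        · rw [← h]
          simp [n1, n2]
          ring
        · rw [← h]
          simp [n1, n2]
          ring
  obtain ⟨h1, h2, h3⟩ := rowPairing_append_congr (main.1 c) (main.1 c') L
  exact ⟨h1, by rw [main.2, h3]⟩

variable [Fintype N] {Δ : N → K}

theorem Run.two_mul_pairing {W : List (Vertex d × Option N)}
    (hx : ∀ v ∈ W.map Prod.fst, v.kind.isTri = false) {F : DecoratedFlag K d}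
    {X Z : List (Letter K d N)} {P : N → N → ℤ} (hr : Run Δ F W X Z P) (c c' : N) :
    2 * P c c' = rowPairing c c' X - rowPairing c c' Z := by
  induction W generalizing X P with
  | nil =>
    rw [hr.1, hr.2]
    simp
  | cons w W ih =>
    obtain ⟨X₁, p, P₁, hs, hV, hr, rfl⟩ := hr
    have h1 := (hs.two_mul_pairing (hx _ (List.mem_cons_self ..)) c c').2
    have h2 := ih (fun v hv => hx v (List.mem_cons_of_mem _ hv)) hr
    simp only [Pi.add_apply]
    linarith

end Pairing

/-! ### Trivalent vertices pass through 4- and 6-valent vertices -/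

section Transfer

variable {K : Type*} [Field K] {d : ℕ} {N : Type*} [Fintype N] {Δ : N → K}

theorem exists_valid_six (hΔ : ∀ n, Δ n ≠ 0) {i j : Color d} (h : Adjacent i j)
    {F F₁ F₂ F₃ : DecoratedFlag K d} {a f e : N → ℕ}
    (hX : ValidRow Δ F [⟨i, a, F₁⟩, ⟨j, f, F₂⟩, ⟨i, e, F₃⟩]) :
    ∃ G₁ G₂, ValidRow Δ F [⟨j, f + e - a ⊓ e, G₁⟩, ⟨i, a ⊓ e, G₂⟩, ⟨j, a + f - a ⊓ e, F₃⟩] := by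
  obtain ⟨g, hF⟩ := exists_frame F
  obtain ⟨Z, hZ⟩ := exists_hasCoordinates hF hX
  obtain ⟨z₁, Z, rfl, -, h1⟩ := hZ.cons_inv
  obtain ⟨z₂, Z, rfl, -, h2⟩ := h1.cons_inv
  obtain ⟨z₃, Z, rfl, -, h3⟩ := h2.cons_inv
  cases Z with
  | cons _ _ => obtain ⟨_, _, e, -⟩ := h3; simp at e
  | nil =>
    obtain ⟨b, c, g', G₁, G₂, -, hG, -⟩ := exists_six hΔ h hF hZ
    exact ⟨G₁, G₂, hG.valid hΔ hF⟩

theorem exists_valid_four (hΔ : ∀ n, Δ n ≠ 0) {i j : Color d} (h : Distant i j)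
    {F F₁ F₂ : DecoratedFlag K d} {a b : N → ℕ}
    (hX : ValidRow Δ F [⟨i, a, F₁⟩, ⟨j, b, F₂⟩]) :
    ∃ G, ValidRow Δ F [⟨j, b, G⟩, ⟨i, a, F₂⟩] := by
  obtain ⟨g, hF⟩ := exists_frame F
  obtain ⟨Z, hZ⟩ := exists_hasCoordinates hF hX
  obtain ⟨z₁, Z, rfl, -, h1⟩ := hZ.cons_inv
  obtain ⟨z₂, Z, rfl, -, h2⟩ := h1.cons_inv
  cases Z with
  | cons _ _ => obtain ⟨_, _, e, -⟩ := h2; simp at e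
  | nil =>
    obtain ⟨G, hG, -⟩ := exists_four hΔ h hF (a := (a, z₁)) (f := (b, z₂)) hZ
    exact ⟨G, hG.valid hΔ hF⟩

/-- The crossing value below a trivalent vertex. -/
theorem tri_iff {g : ℕ → Fin d → K} {F₀ F₁ F₂ : DecoratedFlag K d} (h₀ : IsFrame g F₀)
    {k : Color d} {z₁ μ₁ z₂ μ₂ : K} (hμ₁ : μ₁ ≠ 0) (hμ₂ : μ₂ ≠ 0)
    (h₁ : IsFrame (crossFrame ((k : ℕ) - 1) z₁ μ₁ g) F₁)
    (h₂ : IsFrame (crossFrame ((k : ℕ) - 1) z₂ μ₂ (crossFrame ((k : ℕ) - 1) z₁ μ₁ g)) F₂) {μ : K} :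
    RelativePosition F₀ F₂ k ∧ HasCrossingValue F₀ F₂ k μ ↔ μ ≠ 0 ∧ μ = μ₁ * z₂ := by
  have hk := color_pred_add k
  constructor
  · rintro ⟨h, hμ⟩
    have hz := ne_zero_of_tri h₀ hk hμ₁ hμ₂ h₂ h
    have := eq_of_hasCrossingValue h₀ hk (isFrame_tri h₀ hk hμ₁ hμ₂ h₁ h₂ hz) hμ
    exact ⟨this ▸ mul_ne_zero hμ₁ hz, this.symm⟩
  · rintro ⟨hμ, rfl⟩
    have hz := right_ne_zero_of_mul hμ
    exact relativePosition_of_crossFrame h₀ hk hμ (isFrame_tri h₀ hk hμ₁ hμ₂ h₁ h₂ hz)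

/-- The trivalent vertex is below the 6-valent vertex on the left, and on the right it is between
two 6-valent vertices. In both weaves its crossing value is a multiple of the coordinate of the
fourth letter, with factors that are related by `ht`. -/
theorem tri_transfer (hΔ : ∀ n, Δ n ≠ 0) {i j : Color d} (h : Adjacent i j)
    {F₀ F₁ F₂ F₃ F₄ G₁ G₂ H₁ H₂ : DecoratedFlag K d} {a b c e t t' : N → ℕ}
    (hX : ValidRow Δ F₀ [⟨i, a, F₁⟩, ⟨j, b, F₂⟩, ⟨i, c, F₃⟩, ⟨j, e, F₄⟩])
    (hG : ValidRow Δ F₀ [⟨j, b + c - a ⊓ c, G₁⟩, ⟨i, a ⊓ c, G₂⟩, ⟨j, a + b - a ⊓ c, F₃⟩])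
    (hH : ValidRow Δ F₁ [⟨i, c + e - b ⊓ e, H₁⟩, ⟨j, b ⊓ e, H₂⟩, ⟨i, b + c - b ⊓ e, F₄⟩])
    (ht : t' + (a + b - a ⊓ c) + b ⊓ e = a + b + t) :
    RelativePosition G₂ F₄ j ∧ HasCrossingValue G₂ F₄ j (weightValue Δ t) ↔
      RelativePosition F₀ H₁ i ∧ HasCrossingValue F₀ H₁ i (weightValue Δ t') := by
  obtain ⟨g, hF⟩ := exists_frame F₀
  obtain ⟨Z, hZ⟩ := exists_hasCoordinates hF hX
  obtain ⟨z₁, Z, rfl, f₁, h1⟩ := hZ.cons_inv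
  obtain ⟨z₂, Z, rfl, f₂, h2⟩ := h1.cons_inv
  obtain ⟨z₃, Z, rfl, f₃, h3⟩ := h2.cons_inv
  obtain ⟨z₄, Z, rfl, f₄, h4⟩ := h3.cons_inv
  obtain ⟨x₁, x₂, x₃, G₁', G₂', hx, hG', hE⟩ := exists_six hΔ h hF (F₁ := F₁) (F₂ := F₂) (F₃ := F₃)
    (a := a) (f := b) (e := c) (z₁ := z₁) (z₂ := z₂) (z₃ := z₃)
    ⟨F₁, _, rfl, f₁, F₂, _, rfl, f₂, F₃, [], rfl, f₃, rfl⟩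
  obtain ⟨y₁, y₂, y₃, H₁', H₂', hy, hH', -⟩ := exists_six hΔ h.symm f₁ (F₁ := F₂) (F₂ := F₃)
    (F₃ := F₄) (a := b) (f := c) (e := e) (z₁ := z₂) (z₂ := z₃) (z₃ := z₄)
    ⟨F₂, _, rfl, f₂, F₃, _, rfl, f₃, F₄, [], rfl, f₄, rfl⟩
  obtain ⟨rfl, rfl⟩ := six_unique h hG (hG'.valid hΔ hF)
  obtain ⟨rfl, rfl⟩ := six_unique h.symm hH (hH'.valid hΔ f₁)
  simp only [sixLabels, sixWeights, Prod.mk.injEq] at hx hy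
  obtain ⟨rfl, rfl, rfl⟩ := hx
  obtain ⟨rfl, rfl, rfl⟩ := hy
  obtain ⟨_, -, -, k₁⟩ := hG'.cons_inv
  obtain ⟨_, Z', eZ, k₂, k₃⟩ := hG'.cons_inv
  simp only [List.cons.injEq, Prod.mk.injEq, true_and] at eZ
  obtain ⟨rfl, rfl⟩ := eZ
  obtain ⟨_, Z', eZ, k₄, k₅⟩ := k₃.cons_inv
  simp only [List.cons.injEq, Prod.mk.injEq, true_and] at eZ
  obtain ⟨rfl, rfl⟩ := eZ
  obtain ⟨_, Z', eZ, k₆, -⟩ := k₅.cons_inv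
  simp only [List.cons.injEq, Prod.mk.injEq, true_and] at eZ
  obtain ⟨rfl, rfl⟩ := eZ
  obtain ⟨_, Z', eZ, k₇, -⟩ := hH'.cons_inv
  simp only [List.cons.injEq, Prod.mk.injEq, true_and] at eZ
  obtain ⟨rfl, rfl⟩ := eZ
  simp only [endFrame] at hE
  rw [← hE] at f₄
  have nz := weightValue_ne_zero hΔ
  -- Only `z₄` remains: one side prescribes its product with the value of `a + b - a ⊓ c`, the other
  -- its product with the values of `a` and `b` divided by that of `b ⊓ e`.
  rw [tri_iff k₄ (nz _) (nz _) k₆ f₄, tri_iff hF (nz _) (nz _) f₁ k₇]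
  have e1 := congrArg (weightValue Δ) ht
  simp only [weightValue_add] at e1
  have n1 := nz (a + b - a ⊓ c)
  have n2 := nz (b ⊓ e)
  have n3 := nz a
  have n4 := nz b
  simp only [nz, ne_eq, not_false_eq_true, true_and]
  rw [← mul_div_assoc, mul_comm (weightValue Δ a), eq_div_iff n2]
  constructor
  · intro h5
    refine mul_right_cancel₀ n1 ?_
    linear_combination e1 + weightValue Δ a * weightValue Δ b * h5
  · intro h5
    refine mul_left_cancel₀ (mul_ne_zero n3 n4) ?_
    linear_combination -e1 + weightValue Δ (a + b - a ⊓ c) * h5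

/-- A linear relation between the values of cycles for a trivalent vertex that passes through a
6-valent vertex. -/
theorem exists_tri_weights {a b c e : N → ℕ} {n : N} (ha : a n = 0) (hb : b n = 0) (hc : c n = 0)
    (he : e n = 0) [DecidableEq N] :
    let t := Function.update ((a + b - a ⊓ c) ⊓ e) n 1
    let t' := Function.update (a ⊓ (c + e - b ⊓ e)) n 1
    let w := b + c - b ⊓ e
    (t' + (a + b - a ⊓ c) + b ⊓ e = a + b + t) ∧ b ⊓ e + w - t' ⊓ w = b + c - a ⊓ c ∧
      t' ⊓ w = a ⊓ c ∧ t' + b ⊓ e - t' ⊓ w = t := by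
  intro t t' w
  refine ⟨?_, ?_, ?_, ?_⟩ <;> funext k <;> by_cases hk : k = n
  all_goals first
    | subst hk; simp [t, t', w, ha, hb, hc, he]
    | (simp only [t, t', w, Function.update_of_ne hk, Pi.add_apply, Pi.sub_apply, Pi.inf_apply]
       omega)

/-- The pairings are piecewise polynomial in the values of the two cycles. The new cycle `n` is an
extra case, because it has the value one below the trivalent vertex and is absent above. -/
theorem tri_pairing {a b c e : N → ℕ} {n : N} (ha : a n = 0) (hb : b n = 0) (hc : c n = 0)
    (he : e n = 0) [DecidableEq N] :
    let t := Function.update ((a + b - a ⊓ c) ⊓ e) n 1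
    let t' := Function.update (a ⊓ (c + e - b ⊓ e)) n 1
    let w := b + c - b ⊓ e
    sixPairing a b c + triPairing (a + b - a ⊓ c) t e =
      sixPairing b c e + (triPairing a t' (c + e - b ⊓ e) + sixPairing t' (b ⊓ e) w) := by
  intro t t' w
  obtain ⟨-, h2, h3, h4⟩ : t' + (a + b - a ⊓ c) + b ⊓ e = a + b + t ∧
    b ⊓ e + w - t' ⊓ w = b + c - a ⊓ c ∧ t' ⊓ w = a ⊓ c ∧ t' + b ⊓ e - t' ⊓ w = t :=
      exists_tri_weights ha hb hc he
  -- The first alternative is the cycle that begins at the vertex; the others list the ways in which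
  -- the minima can be attained. On each pair of alternatives the identity is polynomial.
  have region : ∀ k, ∃ x m s : ℤ, ((a ⊓ c) k : ℤ) = x ∧ ((b ⊓ e) k : ℤ) = m ∧ (t k : ℤ) = s ∧
      (t' k : ℤ) = s + x - m ∧ ((a + b - a ⊓ c) k : ℤ) = a k + b k - x ∧
      ((b + c - a ⊓ c) k : ℤ) = b k + c k - x ∧ ((c + e - b ⊓ e) k : ℤ) = c k + e k - m ∧
      (w k : ℤ) = b k + c k - m ∧ ((b + c - b ⊓ e) k : ℤ) = b k + c k - m ∧
      (((a k : ℤ) = 0 ∧ (b k : ℤ) = 0 ∧ (c k : ℤ) = 0 ∧ (e k : ℤ) = 0 ∧ x = 0 ∧ m = 0 ∧ s = 1) ∨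
        (x = a k ∧ m = b k ∧ s = b k) ∨ (x = a k ∧ m = e k ∧ s = e k) ∨
        (x = c k ∧ m = b k ∧ s = a k + b k - c k) ∨ (x = c k ∧ m = b k ∧ s = e k) ∨
        (x = c k ∧ m = e k ∧ s = e k)) := by
    intro k
    refine ⟨_, _, _, rfl, rfl, rfl, ?_⟩
    by_cases hk : k = n
    · subst hk
      simp [t, t', w, ha, hb, hc, he]
    · simp only [t, t', w, Function.update_of_ne hk, Pi.add_apply, Pi.sub_apply, Pi.inf_apply]
      omega
  clear_value t t' w
  funext k k'
  -- Doubling removes the division in the pairing of 6-valent vertices.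
  have key : 2 * (sixPairing a b c k k' + triPairing (a + b - a ⊓ c) t e k k') =
      2 * (sixPairing b c e k k' + (triPairing a t' (c + e - b ⊓ e) k k' +
        sixPairing t' (b ⊓ e) w k k')) := by
    simp only [mul_add, two_mul_sixPairing, triPairing]
    rw [h2, h4, h3]
    obtain ⟨x, m, s, r1, r2, r3, r4, r5, r6, r7, r8, r9, R⟩ := region k
    obtain ⟨x', m', s', r1', r2', r3', r4', r5', r6', r7', r8', r9', R'⟩ := region k'
    simp only [tripleDet_eq, r1, r2, r3, r4, r5, r6, r7, r8, r9, r1', r2', r3', r4', r5', r6', r7', r8', r9']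
    rcases R with ⟨q1, q2, q3, q4, rfl, rfl, rfl⟩ | R | R | R | R | R <;>
      rcases R' with ⟨q1', q2', q3', q4', rfl, rfl, rfl⟩ | R' | R' | R' | R' | R' <;>
      simp only [*] <;> ring
  simpa using key

end Transfer

/-! ### Equivalence moves of decorated weaves -/

section Simulation

variable {K : Type*} [Field K] {d : ℕ} {N : Type*}

theorem names_cons_none (v : Vertex d) (W : List (Vertex d × Option N)) :
    names ((v, none) :: W) = names W := rfl

theorem names_map_prodMap (f : Vertex d → Vertex d) (W : List (Vertex d × Option N)) :
    names (W.map (Prod.map f id)) = names W := by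
  simp [names, List.filterMap_map]

theorem exists_of_map_fst_eq_map {f : Vertex d → Vertex d} {W : List (Vertex d × Option N)}
    {x : List (Vertex d)} (h : W.map Prod.fst = x.map f) :
    ∃ W₀ : List (Vertex d × Option N), W = W₀.map (Prod.map f id) ∧ W₀.map Prod.fst = x := by
  induction x generalizing W with
  | nil => exact ⟨[], by simpa using h, rfl⟩
  | cons v x ih =>
    obtain ⟨⟨_, o⟩, W', rfl, rfl, h'⟩ := List.map_eq_cons_iff.1 h
    obtain ⟨W₀, rfl, rfl⟩ := ih h'
    exact ⟨(v, o) :: W₀, rfl, rfl⟩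

variable [Fintype N]

/-- Each run of the weave `x`, from a row with the colors `α`, gives a run of the weave `y` with
the same result. -/
def Simulates (Δ : N → K) (α : List (Color d)) (x y : List (Vertex d)) : Prop :=
  ∀ (F : DecoratedFlag K d) (W : List (Vertex d × Option N)) (X Z : List (Letter K d N))
    (P : N → N → ℤ), W.map Prod.fst = x → X.map Letter.col = α → (names W).Nodup →
    (∀ n ∈ names W, ∀ a ∈ X, a.wt n = 0) → ValidRow Δ F X → Run Δ F W X Z P →
    ∃ W', W'.map Prod.fst = y ∧ (names W').Perm (names W) ∧ Run Δ F W' X Z P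

variable {Δ : N → K}

theorem Simulates.refl (α : List (Color d)) (x : List (Vertex d)) : Simulates Δ α x x :=
  fun _ W _ _ _ hW _ _ _ _ h => ⟨W, hW, .refl _, h⟩

theorem Simulates.trans {α : List (Color d)} {x y z : List (Vertex d)} (h : Simulates Δ α x y)
    (h' : Simulates Δ α y z) : Simulates Δ α x z := by
  intro F W X Z P hW hX hN hfr hV hr
  obtain ⟨W₁, h1, h2, h3⟩ := h F W X Z P hW hX hN hfr hV hr
  obtain ⟨W₂, h4, h5, h6⟩ := h' F W₁ X Z P h1 hX (h2.nodup_iff.2 hN)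
    (fun n hn => hfr n (h2.subset hn)) hV h3
  exact ⟨W₂, h4, h5.trans h2, h6⟩

theorem Simulates.extend {α : List (Color d)} {x y : List (Vertex d)} (h : Simulates Δ α x y)
    (l r : List (Color d)) :
    Simulates Δ (l ++ α ++ r) (x.map (Vertex.extend l r)) (y.map (Vertex.extend l r)) := by
  intro F W X Z P hW hX hN hfr hV hr
  obtain ⟨W₀, rfl, rfl⟩ := exists_of_map_fst_eq_map hW
  rw [List.map_eq_append_iff] at hX
  obtain ⟨Y, R, rfl, hY, rfl⟩ := hX
  rw [List.map_eq_append_iff] at hY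
  obtain ⟨L, X, rfl, rfl, rfl⟩ := hY
  obtain ⟨Z', rfl, hr'⟩ := (run_extend hV).1 hr
  rw [names_map_prodMap] at hN hfr
  rw [validRow_append, validRow_append] at hV
  obtain ⟨W', rfl, h2, h3⟩ := h _ W₀ X Z' P rfl rfl hN (fun n hn a ha => hfr n hn a (by simp [ha]))
    hV.1.2 hr'
  refine ⟨W'.map (Prod.map (Vertex.extend (L.map Letter.col) (R.map Letter.col)) id), ?_, ?_, ?_⟩
  · simp [Function.comp_def]
  · rwa [names_map_prodMap, names_map_prodMap]
  · rw [run_extend (by rw [validRow_append, validRow_append]; exact hV)]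
    exact ⟨Z', rfl, h3⟩

/-- The names of the lower part are still fresh on the row in between, because they differ from the
names used above it. -/
theorem Simulates.append {α α' : List (Color d)} {x y u v : List (Vertex d)}
    (hx : IsWeave α x α') (h : Simulates Δ α x y) (h' : Simulates Δ α' u v) :
    Simulates Δ α (x ++ u) (y ++ v) := by
  intro F W X Z P hW hX hN hfr hV hr
  obtain ⟨W₁, W₂, rfl, rfl, rfl⟩ := List.map_eq_append_iff.1 hW
  obtain ⟨Y, P₁, P₂, h₁, h₂, rfl⟩ := run_append.1 hr
  rw [names_append] at hN hfr
  obtain ⟨hN₁, hN₂, hd⟩ := List.nodup_append.1 hN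
  obtain ⟨W₁', rfl, p₁, r₁⟩ := h F W₁ X Y P₁ rfl hX hN₁
    (fun n hn => hfr n (List.mem_append_left _ hn)) hV h₁
  have hY : Y.map Letter.col = α' := by
    have := h₁.isWeave
    rw [hX] at this
    have aux : ∀ (x : List (Vertex d)) (α β γ : List (Color d)), IsWeave α x β → IsWeave α x γ →
        β = γ := by
      intro x
      induction x with
      | nil => exact fun α β γ h h' => Eq.trans (Eq.symm h) h'
      | cons v x ih => exact fun α β γ h h' => ih _ _ _ h.2 h'.2
    exact aux _ _ _ _ this hx
  obtain ⟨W₂', rfl, p₂, r₂⟩ := h' F W₂ Y Z P₂ rfl hY hN₂ (fun n hn => h₁.wt_eq_zero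
    (fun h => hd n h n hn rfl) (hfr n (List.mem_append_right _ hn))) (h₁.valid hV) h₂
  refine ⟨W₁' ++ W₂', by simp, ?_, run_append.2 ⟨Y, P₁, P₂, r₁, r₂, rfl⟩⟩
  rw [names_append, names_append]
  exact p₁.append p₂

theorem Run.names_eq_nil {W : List (Vertex d × Option N)} {F : DecoratedFlag K d}
    {X Z : List (Letter K d N)} {P : N → N → ℤ}
    (hx : ∀ v ∈ W.map Prod.fst, v.kind.isTri = false) (h : Run Δ F W X Z P) : names W = [] := by
  induction W generalizing X P with
  | nil => rfl
  | cons w W ih =>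
    obtain ⟨X', p, P', hs, -, h, -⟩ := h
    obtain ⟨⟨l, k, r⟩, o⟩ := w
    have hk := hx _ (List.mem_cons_self ..)
    obtain ⟨L, T, T', R, -, -, -, -, hK⟩ := hs
    have ho : o = none := by
      cases k with
      | tri i => simp [VertexKind.isTri] at hk
      | four i j _ => obtain ⟨a, b, F₁, F₂, G, h, -⟩ := hK; exact h
      | six i j _ => obtain ⟨a, f, e, F₁, F₂, F₃, G₁, G₂, h, -⟩ := hK; exact h
    subst ho
    rw [names_cons_none, ih (fun v hv => hx v (List.mem_cons_of_mem _ hv)) h]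

/-- Weaves without trivalent vertices are exchanged. -/
theorem simulates_braid (hΔ : ∀ n, Δ n ≠ 0) {α α' : List (Color d)} {x y : List (Vertex d)}
    (hx : ∀ v ∈ x, v.kind.isTri = false) (hy : ∀ v ∈ y, v.kind.isTri = false)
    (hwx : IsWeave α x α') (hwy : IsWeave α y α') : Simulates Δ α x y := by
  rintro F W X Z P rfl hX - - hV hr
  obtain ⟨g, hF⟩ := exists_frame F
  obtain ⟨C, hC⟩ := exists_hasCoordinates hF hV
  obtain ⟨Z', P', -, hr', -, -, hZ'⟩ := exists_run_of_braid hΔ hy hwy hF hC hX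
  obtain ⟨Z'', P'', -, hr'', -, -, hZ''⟩ := exists_run_of_braid hΔ hx hwx hF hC hX
  obtain ⟨rfl, rfl⟩ := hr''.unique_of_braid (by simp) (by simpa using hx) hr
  have hy' : ∀ v ∈ (y.map fun v => (v, (none : Option N))).map Prod.fst, v.kind.isTri = false := by
    simpa using hy
  obtain rfl : Z'' = Z' := hr.eq_of_braid hΔ hx hy' hV hr' (hZ''.trans hZ'.symm)
  -- Both pairings are determined by the same pair of boundary rows.
  obtain rfl : P'' = P' := by
    funext c c'
    have h1 := hr.two_mul_pairing hx c c'
    have h2 := hr'.two_mul_pairing hy' c c'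
    linarith
  refine ⟨_, by simp [Function.comp_def], ?_, hr'⟩
  rw [hr.names_eq_nil hx, hr'.names_eq_nil hy']

/-- Horizontally separated vertices are exchanged. -/
theorem simulates_isotopy (k₁ k₂ : VertexKind d) (l m r : List (Color d)) :
    Simulates Δ (l ++ k₁.top ++ m ++ k₂.top ++ r)
      [⟨l, k₁, m ++ k₂.top ++ r⟩, ⟨l ++ k₁.bot ++ m, k₂, r⟩]
      [⟨l ++ k₁.top ++ m, k₂, r⟩, ⟨l, k₁, m ++ k₂.bot ++ r⟩] ∧
    Simulates Δ (l ++ k₁.top ++ m ++ k₂.top ++ r)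
      [⟨l ++ k₁.top ++ m, k₂, r⟩, ⟨l, k₁, m ++ k₂.bot ++ r⟩]
      [⟨l, k₁, m ++ k₂.top ++ r⟩, ⟨l ++ k₁.bot ++ m, k₂, r⟩] := by
  constructor
  all_goals
    intro F W X Z P hW hX hN hfr hV hr
    obtain ⟨⟨_, o₁⟩, W₁, rfl, rfl, hW₁⟩ := List.map_eq_cons_iff.1 hW
    obtain ⟨⟨_, o₂⟩, W₂, rfl, rfl, hW₂⟩ := List.map_eq_cons_iff.1 hW₁
    obtain rfl := List.map_eq_nil_iff.1 hW₂
    obtain ⟨X₁, P₁, _, s₁, v₁, ⟨X₂, P₂, _, s₂, v₂, ⟨rfl, rfl⟩, rfl⟩, rfl⟩ := hr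
    obtain ⟨Y, R, rfl, hY, rfl⟩ := List.map_eq_append_iff.1 hX
    obtain ⟨Y₁, T₂, rfl, hY₁, hT₂⟩ := List.map_eq_append_iff.1 hY
    obtain ⟨Y₂, M, rfl, hY₂, rfl⟩ := List.map_eq_append_iff.1 hY₁
    obtain ⟨L, T₁, rfl, rfl, hT₁⟩ := List.map_eq_append_iff.1 hY₂
    have l₁ : T₁.length = k₁.top.length := by rw [← hT₁, List.length_map]
    have l₂ : T₂.length = k₂.top.length := by rw [← hT₂, List.length_map]
  · rw [show L ++ T₁ ++ M ++ T₂ ++ R = L ++ T₁ ++ (M ++ T₂ ++ R) by simp,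
      rowStep_append_iff (by simp) l₁] at s₁
    obtain ⟨-, -, T₁', rfl, K₁⟩ := s₁
    have c₁ := K₁.map_col.2
    simp only at c₁
    rw [show L ++ T₁' ++ (M ++ T₂ ++ R) = L ++ T₁' ++ M ++ T₂ ++ R by simp,
      rowStep_append_iff (by simp [← c₁]) l₂] at s₂
    obtain ⟨-, -, T₂', rfl, K₂⟩ := s₂
    have c₂ := K₂.map_col.2
    simp only at c₂
    refine ⟨[(⟨L.map Letter.col ++ k₁.top ++ M.map Letter.col, k₂, R.map Letter.col⟩, o₂),
      (⟨L.map Letter.col, k₁, M.map Letter.col ++ k₂.bot ++ R.map Letter.col⟩, o₁)], rfl, ?_,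
      L ++ T₁ ++ M ++ T₂' ++ R, P₂, P₁, ?_, ?_,
      ⟨L ++ T₁' ++ M ++ T₂' ++ R, P₁, 0, ?_, v₂, ⟨rfl, rfl⟩, by simp⟩, by simp [add_comm]⟩
    · cases o₁ <;> cases o₂ <;> simp [names, List.Perm.swap]
    · exact ⟨L ++ T₁ ++ M, T₂, T₂', R, by simp, by simp, by simp [hT₁], rfl, K₂⟩
    · simp only [validRow_append, endFlag_append, K₁.endFlag, K₂.endFlag] at hV v₂ ⊢
      tauto
    · exact ⟨L, T₁, T₁', M ++ T₂' ++ R, by simp, by simp, rfl, by simp [c₂], K₁⟩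
  · rw [rowStep_append_iff (by simp [l₁]) l₂] at s₁
    obtain ⟨-, -, T₂', rfl, K₂⟩ := s₁
    have c₂ := K₂.map_col.2
    simp only at c₂
    rw [show L ++ T₁ ++ M ++ T₂' ++ R = L ++ T₁ ++ (M ++ T₂' ++ R) by simp,
      rowStep_append_iff (by simp) l₁] at s₂
    obtain ⟨-, -, T₁', rfl, K₁⟩ := s₂
    have c₁ := K₁.map_col.2
    simp only at c₁
    refine ⟨[(⟨L.map Letter.col, k₁, M.map Letter.col ++ k₂.top ++ R.map Letter.col⟩, o₂),
      (⟨L.map Letter.col ++ k₁.bot ++ M.map Letter.col, k₂, R.map Letter.col⟩, o₁)], rfl, ?_,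
      L ++ T₁' ++ M ++ T₂ ++ R, P₂, P₁, ?_, ?_,
      ⟨L ++ T₁' ++ (M ++ T₂' ++ R), P₁, 0, ?_, v₂, ⟨rfl, rfl⟩, by simp⟩, by simp [add_comm]⟩
    · cases o₁ <;> cases o₂ <;> simp [names, List.Perm.swap]
    · exact ⟨L, T₁, T₁', M ++ T₂ ++ R, by simp, by simp, rfl, by simp [hT₂], K₁⟩
    · simp only [validRow_append, endFlag_append, K₁.endFlag, K₂.endFlag] at hV v₂ ⊢
      tauto
    · exact ⟨L ++ T₁' ++ M, T₂, T₂', R, by simp, by simp, by simp [c₁], rfl, K₂⟩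

end Simulation

/-! ### Direct verification of two moves with a trivalent vertex -/

section Cores

variable {K : Type*} [Field K] {d : ℕ} {N : Type*} [Fintype N] {Δ : N → K}

theorem exists_letters_three {i j k : Color d} {X : List (Letter K d N)}
    (h : X.map Letter.col = [i, j, k]) :
    ∃ a b c F₁ F₂ F₃, X = [⟨i, a, F₁⟩, ⟨j, b, F₂⟩, ⟨k, c, F₃⟩] := by
  obtain ⟨⟨_, a, F₁⟩, X₁, rfl, rfl, h₁⟩ := List.map_eq_cons_iff.1 h
  obtain ⟨⟨_, b, F₂⟩, X₂, rfl, rfl, h₂⟩ := List.map_eq_cons_iff.1 h₁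
  obtain ⟨⟨_, c, F₃⟩, X₃, rfl, rfl, h₃⟩ := List.map_eq_cons_iff.1 h₂
  obtain rfl := List.map_eq_nil_iff.1 h₃
  exact ⟨a, b, c, F₁, F₂, F₃, rfl⟩

theorem exists_letters_four {i j k l : Color d} {X : List (Letter K d N)}
    (h : X.map Letter.col = [i, j, k, l]) :
    ∃ a b c e F₁ F₂ F₃ F₄, X = [⟨i, a, F₁⟩, ⟨j, b, F₂⟩, ⟨k, c, F₃⟩, ⟨l, e, F₄⟩] := by
  obtain ⟨⟨_, a, F₁⟩, X₁, rfl, rfl, h₁⟩ := List.map_eq_cons_iff.1 h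
  obtain ⟨b, c, e, F₂, F₃, F₄, rfl⟩ := exists_letters_three h₁
  exact ⟨a, b, c, e, F₁, F₂, F₃, F₄, rfl⟩

theorem exists_run_two {v₁ v₂ : Vertex d} {F : DecoratedFlag K d} {W : List (Vertex d × Option N)}
    (hW : W.map Prod.fst = [v₁, v₂]) {X Z : List (Letter K d N)} {P : N → N → ℤ}
    (h : Run Δ F W X Z P) : ∃ o₁ o₂ X₁ P₁ P₂, W = [(v₁, o₁), (v₂, o₂)] ∧ RowStep v₁ o₁ X X₁ P₁ ∧
      ValidRow Δ F X₁ ∧ RowStep v₂ o₂ X₁ Z P₂ ∧ ValidRow Δ F Z ∧ P = P₁ + P₂ := by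
  obtain ⟨⟨_, o₁⟩, W₁, rfl, rfl, h₁⟩ := List.map_eq_cons_iff.1 hW
  obtain ⟨⟨_, o₂⟩, W₂, rfl, rfl, h₂⟩ := List.map_eq_cons_iff.1 h₁
  obtain rfl := List.map_eq_nil_iff.1 h₂
  obtain ⟨X₁, P₁, _, s₁, V₁, ⟨X₂, P₂, _, s₂, V₂, ⟨rfl, rfl⟩, rfl⟩, rfl⟩ := h
  exact ⟨o₁, o₂, X₁, P₁, P₂, rfl, s₁, V₁, s₂, V₂, by simp⟩

theorem exists_run_three {v₁ v₂ v₃ : Vertex d} {F : DecoratedFlag K d}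
    {W : List (Vertex d × Option N)}
    (hW : W.map Prod.fst = [v₁, v₂, v₃]) {X Z : List (Letter K d N)} {P : N → N → ℤ}
    (h : Run Δ F W X Z P) : ∃ o₁ o₂ o₃ X₁ X₂ P₁ P₂ P₃, W = [(v₁, o₁), (v₂, o₂), (v₃, o₃)] ∧
      RowStep v₁ o₁ X X₁ P₁ ∧ ValidRow Δ F X₁ ∧ RowStep v₂ o₂ X₁ X₂ P₂ ∧ ValidRow Δ F X₂ ∧
      RowStep v₃ o₃ X₂ Z P₃ ∧ ValidRow Δ F Z ∧ P = P₁ + (P₂ + P₃) := by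
  obtain ⟨⟨_, o₁⟩, W₁, rfl, rfl, h₁⟩ := List.map_eq_cons_iff.1 hW
  obtain ⟨X₁, P₁, P', s₁, V₁, h', rfl⟩ := h
  obtain ⟨o₂, o₃, X₂, P₂, P₃, rfl, s₂, V₂, s₃, V₃, rfl⟩ := exists_run_two h₁ h'
  exact ⟨o₁, o₂, o₃, X₁, X₂, P₁, P₂, P₃, rfl, s₁, V₁, s₂, V₂, s₃, V₃, rfl⟩

/-- The flag in a row of two distant letters is determined by its neighbors. -/
theorem eq_of_distant {i j : Color d} (h : Distant i j) {F G G' H H' : DecoratedFlag K d}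
    (r : RelativePosition F G j) (r' : RelativePosition F G' j) (s : RelativePosition G H i)
    (s' : RelativePosition G' H' i) (hH : H.extensor j = H'.extensor j) : G = G' := by
  have hij : j ≠ i := by rintro rfl; simp [Distant] at h
  refine DecoratedFlag.ext_level fun k => ?_
  rw [G.level_color, G'.level_color]
  by_cases hk : k = j
  · subst hk
    rw [s.1 _ hij, s'.1 _ hij, hH]
  · rw [← r.1 k hk, ← r'.1 k hk]

/-- At 4-valent vertices the weights pass straight through and the pairing is zero, and the inner
flag is determined by its neighbors. Both weaves thus have the same trivalent contribution. -/
theorem simulates_passThrough (hΔ : ∀ n, Δ n ≠ 0) (i j : Color d) (h : Distant i j) :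
    Simulates Δ [i, j, i]
      [⟨[i], .four j i h.symm, []⟩, ⟨[], .tri i, [j]⟩, ⟨[], .four i j h, []⟩]
      [⟨[], .four i j h, [i]⟩, ⟨[j], .tri i, []⟩] ∧
    Simulates Δ [i, j, i] [⟨[], .four i j h, [i]⟩, ⟨[j], .tri i, []⟩]
      [⟨[i], .four j i h.symm, []⟩, ⟨[], .tri i, [j]⟩, ⟨[], .four i j h, []⟩] := by
  classical
  have hij : j ≠ i := by rintro rfl; simp [Distant] at h
  constructor <;> intro F W X Z P hW hX hN hfr hV hr <;>
    obtain ⟨a, b, c, F₁, F₂, F₃, rfl⟩ := exists_letters_three hX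
  · obtain ⟨o₁, o₂, o₃, X₁, X₂, P₁, P₂, P₃, rfl, s₁, V₁, s₂, V₂, s₃, V₃, rfl⟩ :=
      exists_run_three hW hr
    obtain ⟨-, -, _, rfl, b', c', F₂', F₃', G, rfl, e, rfl, rfl⟩ :=
      (rowStep_append_iff (L := [⟨i, a, F₁⟩]) (T := [⟨j, b, F₂⟩, ⟨i, c, F₃⟩]) (R := []) rfl rfl).1 s₁
    simp only [List.cons.injEq, Letter.mk.injEq, true_and, and_true] at e
    obtain ⟨⟨rfl, rfl⟩, rfl, rfl⟩ := e
    obtain ⟨-, -, _, rfl, n, a', c', F₁', F₂', rfl, e, rfl, rfl⟩ :=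
      (rowStep_append_iff (L := []) (T := [⟨i, a, F₁⟩, ⟨i, c, G⟩]) (R := [⟨j, b, F₃⟩]) rfl rfl).1 s₂
    simp only [List.cons.injEq, Letter.mk.injEq, true_and, and_true] at e
    obtain ⟨⟨rfl, rfl⟩, rfl, rfl⟩ := e
    obtain ⟨-, -, _, rfl, t, b', F₂', F₃', H, rfl, e, rfl, rfl⟩ :=
      (rowStep_append_iff (L := []) (T := [⟨i, _, G⟩, ⟨j, b, F₃⟩]) (R := []) rfl rfl).1 s₃
    simp only [List.cons.injEq, Letter.mk.injEq, true_and, and_true] at e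
    obtain ⟨⟨rfl, rfl⟩, rfl, rfl⟩ := e
    obtain ⟨H', hH'⟩ := exists_valid_four hΔ h (F := F) (F₁ := F₁) (F₂ := F₂) (a := a) (b := b)
      ⟨hV.1, hV.2.1, trivial⟩
    obtain rfl : H' = H := eq_of_distant h hH'.1.1 V₃.1.1 hH'.2.1.1 V₃.2.1.1
      (hV.2.2.1.1.1 j hij)
    refine ⟨[(⟨[], .four i j h, [i]⟩, none), (⟨[j], .tri i, []⟩, some n)], rfl, ?_,
      [⟨j, b, H'⟩, ⟨i, a, F₂⟩, ⟨i, c, F₃⟩], 0, _, ?_, ?_,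
      ⟨_, triPairing a (Function.update (a ⊓ c) n 1) c, 0, ?_, V₃, ⟨rfl, rfl⟩, rfl⟩, ?_⟩
    · simp [names]
    · exact ⟨[], _, _, [⟨i, c, F₃⟩], rfl, rfl, rfl, rfl, a, b, F₁, F₂, H', rfl, rfl, rfl, rfl⟩
    · exact ⟨hH'.1, hH'.2.1, hV.2.2.1, trivial⟩
    · exact ⟨[⟨j, b, H'⟩], _, _, [], rfl, rfl, rfl, rfl, n, a, c, F₂, F₃, rfl, rfl, rfl, rfl⟩
    · simp
  · obtain ⟨o₁, o₂, X₁, P₁, P₂, rfl, s₁, V₁, s₂, V₂, rfl⟩ := exists_run_two hW hr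
    obtain ⟨-, -, _, rfl, a', b', F₂', F₃', H, rfl, e, rfl, rfl⟩ :=
      (rowStep_append_iff (L := []) (T := [⟨i, a, F₁⟩, ⟨j, b, F₂⟩]) (R := [⟨i, c, F₃⟩]) rfl rfl).1 s₁
    simp only [List.cons.injEq, Letter.mk.injEq, true_and, and_true] at e
    obtain ⟨⟨rfl, rfl⟩, rfl, rfl⟩ := e
    obtain ⟨-, -, _, rfl, n, a', c', F₁', F₂', rfl, e, rfl, rfl⟩ :=
      (rowStep_append_iff (L := [⟨j, b, H⟩]) (T := [⟨i, a, F₂⟩, ⟨i, c, F₃⟩]) (R := []) rfl rfl).1 s₂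
    simp only [List.cons.injEq, Letter.mk.injEq, true_and, and_true] at e
    obtain ⟨⟨rfl, rfl⟩, rfl, rfl⟩ := e
    obtain ⟨G, hG⟩ := exists_valid_four hΔ h.symm (F := F₁) (F₁ := F₂) (F₂ := F₃) (a := b) (b := c)
      ⟨hV.2.1, hV.2.2.1, trivial⟩
    obtain ⟨G', hG'⟩ := exists_valid_four hΔ h.symm V₂
    obtain rfl : G' = G := by
      refine DecoratedFlag.ext_level fun k => ?_
      rw [G'.level_color, G.level_color]
      by_cases hk : k = j
      · subst hk
        rw [← hG'.1.1.1 _ hij, ← hG.1.1.1 _ hij, hV.1.1.1 _ hij]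
      · rw [hG'.2.1.1.1 k hk, hG.2.1.1.1 k hk]
    refine ⟨[(⟨[i], .four j i h.symm, []⟩, none), (⟨[], .tri i, [j]⟩, some n),
      (⟨[], .four i j h, []⟩, none)], rfl, ?_,
      [⟨i, a, F₁⟩, ⟨i, c, G'⟩, ⟨j, b, F₃⟩], 0, _, ?_, ?_, ⟨[⟨i, _, G'⟩, ⟨j, b, F₃⟩],
        triPairing a (Function.update (a ⊓ c) n 1) c, _, ?_, hG', ⟨_, 0, 0, ?_, V₂, ⟨rfl, rfl⟩, rfl⟩, rfl⟩, ?_⟩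
    · simp [names]
    · exact ⟨[⟨i, a, F₁⟩], _, _, [], rfl, rfl, rfl, rfl, b, c, F₂, F₃, G', rfl, rfl, rfl, rfl⟩
    · exact ⟨hV.1, hG⟩
    · exact ⟨[], _, _, [⟨j, b, F₃⟩], rfl, rfl, rfl, rfl, n, a, c, F₁, G', rfl, rfl, rfl, rfl⟩
    · exact ⟨[], _, _, [], rfl, rfl, rfl, rfl, _, b, G', F₃, H, rfl, rfl, rfl, rfl⟩
    · simp

/-- The only push move that is verified by calculation. The name of its trivalent vertex is kept.
Weights, crossing values and pairings are compared by `exists_tri_weights`, `tri_transfer` and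
`tri_pairing`. -/
theorem simulates_pushBelow (hΔ : ∀ n, Δ n ≠ 0) (i j : Color d) (h : Adjacent i j) :
    Simulates Δ [i, j, i, j] [⟨[], .six i j h, [j]⟩, ⟨[j, i], .tri j, []⟩]
      [⟨[i], .six j i h.symm, []⟩, ⟨[], .tri i, [j, i]⟩, ⟨[], .six i j h, []⟩] ∧
    Simulates Δ [i, j, i, j]
      [⟨[i], .six j i h.symm, []⟩, ⟨[], .tri i, [j, i]⟩, ⟨[], .six i j h, []⟩]
      [⟨[], .six i j h, [j]⟩, ⟨[j, i], .tri j, []⟩] := by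
  classical
  constructor <;> intro F W X Z P hW hX hN hfr hV hr <;>
    obtain ⟨a, b, c, e, F₁, F₂, F₃, F₄, rfl⟩ := exists_letters_four hX
  · obtain ⟨o₁, o₂, X₁, P₁, P₂, rfl, s₁, V₁, s₂, V₂, rfl⟩ := exists_run_two hW hr
    obtain ⟨-, -, _, rfl, a', b', c', _, _, _, G₁, G₂, rfl, E, rfl, rfl⟩ :=
      (rowStep_append_iff (L := []) (T := [⟨i, a, F₁⟩, ⟨j, b, F₂⟩, ⟨i, c, F₃⟩]) (R := [⟨j, e, F₄⟩])
        rfl rfl).1 s₁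
    simp only [List.cons.injEq, Letter.mk.injEq, true_and, and_true] at E
    obtain ⟨⟨rfl, rfl⟩, ⟨rfl, rfl⟩, rfl, rfl⟩ := E
    obtain ⟨-, -, _, rfl, n, a', c', F₁', F₂', rfl, E, rfl, rfl⟩ :=
      (rowStep_append_iff (L := [⟨j, _, G₁⟩, ⟨i, _, G₂⟩]) (T := [⟨j, _, F₃⟩, ⟨j, e, F₄⟩]) (R := [])
        rfl rfl).1 s₂
    simp only [List.cons.injEq, Letter.mk.injEq, true_and, and_true] at E
    obtain ⟨⟨rfl, rfl⟩, rfl, rfl⟩ := E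
    have fr := hfr n (by simp [names])
    simp only [List.mem_cons, List.not_mem_nil, or_false, forall_eq_or_imp, forall_eq] at fr
    obtain ⟨f₁, f₂, f₃, f₄⟩ := fr
    obtain ⟨w₁, w₂, w₃, w₄⟩ := exists_tri_weights f₁ f₂ f₃ f₄
    have tp := tri_pairing f₁ f₂ f₃ f₄
    obtain ⟨H₁, H₂, hH⟩ := exists_valid_six hΔ h.symm (F := F₁) hV.2
    -- The trivalent vertex of the new weave exists with the prescribed crossing value, because the
    -- one of the old weave does.
    have tt := (tri_transfer hΔ h hV ⟨V₁.1, V₁.2.1, V₁.2.2.1, trivial⟩ hH w₁).1 V₂.2.2.1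
    obtain ⟨G₁', G₂', hG'⟩ := exists_valid_six hΔ h (F := F) (F₁ := H₁)
      (a := Function.update (a ⊓ (c + e - b ⊓ e)) n 1) ⟨tt, hH.2⟩
    rw [w₂, w₄, w₃] at hG'
    replace V₂ : ValidRow Δ F [⟨j, _, G₁⟩, ⟨i, _, G₂⟩, ⟨j, _, F₄⟩] := V₂
    obtain ⟨rfl, rfl⟩ := six_unique h hG' V₂
    refine ⟨[(⟨[i], .six j i h.symm, []⟩, none), (⟨[], .tri i, [j, i]⟩, some n),
      (⟨[], .six i j h, []⟩, none)], rfl, ?_,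
      [⟨i, a, F₁⟩, ⟨i, c + e - b ⊓ e, H₁⟩, ⟨j, b ⊓ e, H₂⟩, ⟨i, b + c - b ⊓ e, F₄⟩],
      sixPairing b c e, _, ?_, ⟨hV.1, hH⟩, ⟨[⟨i, Function.update (a ⊓ (c + e - b ⊓ e)) n 1, H₁⟩, ⟨j, b ⊓ e, H₂⟩,
        ⟨i, b + c - b ⊓ e, F₄⟩],
        triPairing a (Function.update (a ⊓ (c + e - b ⊓ e)) n 1) (c + e - b ⊓ e), _, ?_, ⟨tt, hH.2⟩,
        ⟨_, sixPairing (Function.update (a ⊓ (c + e - b ⊓ e)) n 1) (b ⊓ e) (b + c - b ⊓ e), 0, ?_, V₂, ⟨rfl, rfl⟩, rfl⟩, rfl⟩, ?_⟩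
    · simp [names]
    · exact ⟨[⟨i, a, F₁⟩], _, _, [], rfl, rfl, rfl, rfl, b, c, e, F₂, F₃, F₄, H₁, H₂,
        rfl, rfl, rfl, rfl⟩
    · exact ⟨[], _, _, [⟨j, b ⊓ e, H₂⟩, ⟨i, b + c - b ⊓ e, F₄⟩], rfl, rfl, rfl, rfl, n, a, _, F₁, H₁,
        rfl, rfl, rfl, rfl⟩
    · refine ⟨[], _, [⟨j, _, G₁'⟩, ⟨i, _, G₂'⟩, ⟨j, _, F₄⟩], [], rfl, rfl, rfl, rfl, _, _, _, H₁, H₂, F₄,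
        G₁', G₂', rfl, rfl, ?_, rfl⟩
      rw [w₂, w₄, w₃]
    · rw [add_zero (sixPairing (Function.update _ _ _) _ _)]
      exact tp
  · obtain ⟨o₁, o₂, o₃, X₁, X₂, P₁, P₂, P₃, rfl, s₁, V₁, s₂, V₂, s₃, V₃, rfl⟩ :=
      exists_run_three hW hr
    obtain ⟨-, -, _, rfl, a', b', c', _, _, _, H₁, H₂, rfl, E, rfl, rfl⟩ :=
      (rowStep_append_iff (L := [⟨i, a, F₁⟩]) (T := [⟨j, b, F₂⟩, ⟨i, c, F₃⟩, ⟨j, e, F₄⟩]) (R := [])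
        rfl rfl).1 s₁
    simp only [List.cons.injEq, Letter.mk.injEq, true_and, and_true] at E
    obtain ⟨⟨rfl, rfl⟩, ⟨rfl, rfl⟩, rfl, rfl⟩ := E
    obtain ⟨-, -, _, rfl, n, a', c', F₁', F₂', rfl, E, rfl, rfl⟩ :=
      (rowStep_append_iff (L := []) (T := [⟨i, a, F₁⟩, ⟨i, _, H₁⟩]) (R := [⟨j, _, H₂⟩, ⟨i, _, F₄⟩])
        rfl rfl).1 s₂
    simp only [List.cons.injEq, Letter.mk.injEq, true_and, and_true] at E
    obtain ⟨⟨rfl, rfl⟩, rfl, rfl⟩ := E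
    obtain ⟨-, -, _, rfl, a', b', c', _, _, _, G₁, G₂, rfl, E, rfl, rfl⟩ :=
      (rowStep_append_iff (L := []) (T := [⟨i, _, H₁⟩, ⟨j, _, H₂⟩, ⟨i, _, F₄⟩]) (R := [])
        rfl rfl).1 s₃
    simp only [List.cons.injEq, Letter.mk.injEq, true_and, and_true] at E
    obtain ⟨⟨rfl, rfl⟩, ⟨rfl, rfl⟩, rfl, rfl⟩ := E
    have fr := hfr n (by simp [names])
    simp only [List.mem_cons, List.not_mem_nil, or_false, forall_eq_or_imp, forall_eq] at fr
    obtain ⟨f₁, f₂, f₃, f₄⟩ := fr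
    obtain ⟨w₁, w₂, w₃, w₄⟩ := exists_tri_weights f₁ f₂ f₃ f₄
    have tp := tri_pairing f₁ f₂ f₃ f₄
    obtain ⟨G₁', G₂', hG⟩ := exists_valid_six hΔ h (F := F) (F₁ := F₁) (F₂ := F₂) (F₃ := F₃)
      ⟨hV.1, hV.2.1, hV.2.2.1, trivial⟩
    have tt := (tri_transfer hΔ h hV hG V₁.2 w₁).2 V₂.1
    replace V₃ : ValidRow Δ F [⟨j, _, G₁⟩, ⟨i, _, G₂⟩, ⟨j, _, F₄⟩] := V₃
    rw [w₂, w₄, w₃] at V₃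
    obtain ⟨rfl, rfl⟩ := six_unique h V₃ ⟨hG.1, hG.2.1, tt, trivial⟩
    refine ⟨[(⟨[], .six i j h, [j]⟩, none), (⟨[j, i], .tri j, []⟩, some n)], rfl, ?_,
      [⟨j, b + c - a ⊓ c, G₁⟩, ⟨i, a ⊓ c, G₂⟩, ⟨j, a + b - a ⊓ c, F₃⟩, ⟨j, e, F₄⟩],
      sixPairing a b c, _, ?_, ⟨hG.1, hG.2.1, hG.2.2.1, hV.2.2.2⟩,
      ⟨_, triPairing (a + b - a ⊓ c) (Function.update ((a + b - a ⊓ c) ⊓ e) n 1) e, 0, ?_, V₃, ⟨?_, rfl⟩, rfl⟩, ?_⟩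
    · simp [names]
    · exact ⟨[], _, _, [⟨j, e, F₄⟩], rfl, rfl, rfl, rfl, a, b, c, F₁, F₂, F₃, G₁, G₂,
        rfl, rfl, rfl, rfl⟩
    · exact ⟨[⟨j, _, G₁⟩, ⟨i, _, G₂⟩], _, _, [], rfl, rfl, rfl, rfl, n, _, e, F₃, F₄,
        rfl, rfl, rfl, rfl⟩
    · rw [w₂, w₄, w₃]
      rfl
    · rw [add_zero]
      exact tp.symm

end Cores

/-! ### Two-sided simulation and all equivalence moves -/

section Sim

variable {K : Type*} [Field K] {d : ℕ} {N : Type*} [Fintype N]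

theorem IsWeave.bot_unique {x : List (Vertex d)} {α β γ : List (Color d)} (h : IsWeave α x β)
    (h' : IsWeave α x γ) : β = γ := by
  induction x generalizing α with
  | nil => exact Eq.trans (Eq.symm h) h'
  | cons v x ih => exact ih h.2 h'.2

theorem isWeave_append {x y : List (Vertex d)} {α γ : List (Color d)} :
    IsWeave α (x ++ y) γ ↔ ∃ β, IsWeave α x β ∧ IsWeave β y γ := by
  induction x generalizing α with
  | nil =>
    constructor
    · exact fun h => ⟨α, rfl, h⟩
    · rintro ⟨_, rfl, h⟩
      exact h
  | cons v x ih =>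
    simp only [List.cons_append, IsWeave, ih]
    constructor
    · rintro ⟨h, β, h1, h2⟩
      exact ⟨β, ⟨h, h1⟩, h2⟩
    · rintro ⟨β, ⟨h, h1⟩, h2⟩
      exact ⟨h, β, h1, h2⟩

theorem IsWeave.extend {x : List (Vertex d)} {α β : List (Color d)} (h : IsWeave α x β)
    (l r : List (Color d)) : IsWeave (l ++ α ++ r) (x.map (Vertex.extend l r)) (l ++ β ++ r) := by
  induction x generalizing α with
  | nil => obtain rfl : α = β := h; rfl
  | cons v x ih =>
    obtain ⟨rfl, h⟩ := h
    refine ⟨by simp [Vertex.top, Vertex.extend], ?_⟩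
    have := ih h
    simpa [Vertex.bot, Vertex.extend] using this

/-- Partial weaves from the word `α` to the word `γ` that simulate each other. -/
structure Sim (Δ : N → K) (α γ : List (Color d)) (x y : List (Vertex d)) : Prop where
  left : IsWeave α x γ
  right : IsWeave α y γ
  forward : Simulates Δ α x y
  backward : Simulates Δ α y x

variable {Δ : N → K} {α γ : List (Color d)} {x y z : List (Vertex d)}

theorem Sim.refl (h : IsWeave α x γ) : Sim Δ α γ x x := ⟨h, h, .refl _ _, .refl _ _⟩

theorem Sim.symm (h : Sim Δ α γ x y) : Sim Δ α γ y x := ⟨h.right, h.left, h.backward, h.forward⟩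

theorem Sim.trans (h : Sim Δ α γ x y) (h' : Sim Δ α γ y z) : Sim Δ α γ x z :=
  ⟨h.left, h'.right, h.forward.trans h'.forward, h'.backward.trans h.backward⟩

theorem Sim.extend (h : Sim Δ α γ x y) (l r : List (Color d)) :
    Sim Δ (l ++ α ++ r) (l ++ γ ++ r) (x.map (Vertex.extend l r)) (y.map (Vertex.extend l r)) :=
  ⟨h.left.extend l r, h.right.extend l r, h.forward.extend l r, h.backward.extend l r⟩

theorem Sim.append {β : List (Color d)} {u v : List (Vertex d)} (h : Sim Δ α β x y)
    (h' : Sim Δ β γ u v) : Sim Δ α γ (x ++ u) (y ++ v) :=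
  ⟨isWeave_append.2 ⟨_, h.left, h'.left⟩, isWeave_append.2 ⟨_, h.right, h'.right⟩,
    h.forward.append h.left h'.forward, h.backward.append h.right h'.backward⟩

theorem Sim.context {α' γ' : List (Color d)} {u v : List (Vertex d)} (hu : IsWeave α' u α)
    (h : Sim Δ α γ x y) (hv : IsWeave γ v γ') : Sim Δ α' γ' (u ++ x ++ v) (u ++ y ++ v) :=
  ((Sim.refl hu).append h).append (.refl hv)

theorem sim_braid (hΔ : ∀ n, Δ n ≠ 0) (hx : ∀ v ∈ x, v.kind.isTri = false)
    (hy : ∀ v ∈ y, v.kind.isTri = false) (hwx : IsWeave α x γ) (hwy : IsWeave α y γ) :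
    Sim Δ α γ x y :=
  ⟨hwx, hwy, simulates_braid hΔ hx hy hwx hwy, simulates_braid hΔ hy hx hwy hwx⟩

theorem sim_six_six (hΔ : ∀ n, Δ n ≠ 0) (i j : Color d) (h : Adjacent i j) (r : List (Color d)) :
    Sim Δ ([i, j, i] ++ r) ([i, j, i] ++ r) [⟨[], .six i j h, r⟩, ⟨[], .six j i h.symm, r⟩] [] :=
  sim_braid hΔ (by simp [VertexKind.isTri]) (by simp) ⟨rfl, rfl, rfl⟩ rfl

theorem sim_pushBelow (hΔ : ∀ n, Δ n ≠ 0) (i j : Color d) (h : Adjacent i j) :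
    Sim Δ [i, j, i, j] [j, i, j] [⟨[], .six i j h, [j]⟩, ⟨[j, i], .tri j, []⟩]
      [⟨[i], .six j i h.symm, []⟩, ⟨[], .tri i, [j, i]⟩, ⟨[], .six i j h, []⟩] :=
  ⟨⟨rfl, rfl, rfl⟩, ⟨rfl, rfl, rfl, rfl⟩, (simulates_pushBelow hΔ i j h).1,
    (simulates_pushBelow hΔ i j h).2⟩

/-- A canceling pair of 6-valent vertices is inserted at the top, the move `sim_pushBelow` with
exchanged colors is applied, and a pair at the bottom is canceled. The two mirror images arise by
the same kind of conjugation. -/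
theorem sim_pushAbove (hΔ : ∀ n, Δ n ≠ 0) (i j : Color d) (h : Adjacent i j) :
    Sim Δ [i, j, i, i] [j, i, j] [⟨[i, j], .tri i, []⟩, ⟨[], .six i j h, []⟩]
      [⟨[], .six i j h, [i]⟩, ⟨[j], .six i j h, []⟩, ⟨[], .tri j, [i, j]⟩] := by
  have h1 := ((sim_six_six hΔ i j h [i]).symm.append
    (Sim.refl (x := [⟨[i, j], .tri i, []⟩, ⟨[], .six i j h, []⟩]) (γ := [j, i, j]) ⟨rfl, rfl, rfl⟩))
  have h2 := (sim_pushBelow hΔ j i h.symm).context (u := [⟨[], .six i j h, [i]⟩])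
    (v := [⟨[], .six i j h, []⟩]) (α' := [i, j, i, i]) (γ' := [j, i, j]) ⟨rfl, rfl⟩ ⟨rfl, rfl⟩
  have h3 := (sim_six_six hΔ j i h.symm []).context (α' := [i, j, i, i]) (γ' := [j, i, j])
    (u := [⟨[], .six i j h, [i]⟩, ⟨[j], .six i j h, []⟩, ⟨[], .tri j, [i, j]⟩]) (v := [])
    ⟨rfl, rfl, rfl, rfl⟩ rfl
  exact h1.trans (h2.trans h3)

theorem sim_pushAboveMirror (hΔ : ∀ n, Δ n ≠ 0) (i j : Color d) (h : Adjacent i j) :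
    Sim Δ [i, i, j, i] [j, i, j] [⟨[], .tri i, [j, i]⟩, ⟨[], .six i j h, []⟩]
      [⟨[i], .six i j h, []⟩, ⟨[], .six i j h, [j]⟩, ⟨[j, i], .tri j, []⟩] := by
  have h1 : Sim Δ [i, i, j, i] [i, i, j, i] [⟨[i], .six i j h, []⟩, ⟨[i], .six j i h.symm, []⟩] [] :=
    sim_braid hΔ (by simp [VertexKind.isTri]) (by simp) ⟨rfl, rfl, rfl⟩ rfl
  have h2 := h1.symm.append
    (Sim.refl (x := [⟨[], .tri i, [j, i]⟩, ⟨[], .six i j h, []⟩]) (γ := [j, i, j]) ⟨rfl, rfl, rfl⟩)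
  have h3 := (sim_pushBelow hΔ i j h).symm.context (u := [⟨[i], .six i j h, []⟩])
    (v := []) (α' := [i, i, j, i]) (γ' := [j, i, j]) ⟨rfl, rfl⟩ rfl
  exact h2.trans h3

theorem sim_pushBelowMirror (hΔ : ∀ n, Δ n ≠ 0) (i j : Color d) (h : Adjacent i j) :
    Sim Δ [j, i, j, i] [j, i, j] [⟨[j], .six i j h, []⟩, ⟨[], .tri j, [i, j]⟩]
      [⟨[], .six j i h.symm, [i]⟩, ⟨[i, j], .tri i, []⟩, ⟨[], .six i j h, []⟩] := by
  have h1 := ((sim_six_six hΔ j i h.symm [i]).symm.append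
    (Sim.refl (x := [⟨[j], .six i j h, []⟩, ⟨[], .tri j, [i, j]⟩]) (γ := [j, i, j]) ⟨rfl, rfl, rfl⟩))
  have h2 := (sim_pushAbove hΔ i j h).symm.context (u := [⟨[], .six j i h.symm, [i]⟩])
    (v := []) (α' := [j, i, j, i]) (γ' := [j, i, j]) ⟨rfl, rfl⟩ rfl
  exact h1.trans h2

theorem sim_passThrough (hΔ : ∀ n, Δ n ≠ 0) (i j : Color d) (h : Distant i j) :
    Sim Δ [i, j, i] [j, i]
      [⟨[i], .four j i h.symm, []⟩, ⟨[], .tri i, [j]⟩, ⟨[], .four i j h, []⟩]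
      [⟨[], .four i j h, [i]⟩, ⟨[j], .tri i, []⟩] :=
  ⟨⟨rfl, rfl, rfl, rfl⟩, ⟨rfl, rfl, rfl⟩, (simulates_passThrough hΔ i j h).1,
    (simulates_passThrough hΔ i j h).2⟩

theorem sim_passThroughMirror (hΔ : ∀ n, Δ n ≠ 0) (i j : Color d) (h : Distant i j) :
    Sim Δ [i, j, i] [i, j]
      [⟨[], .four i j h, [i]⟩, ⟨[j], .tri i, []⟩, ⟨[], .four j i h.symm, []⟩]
      [⟨[i], .four j i h.symm, []⟩, ⟨[], .tri i, [j]⟩] := by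
  have h1 := (sim_passThrough hΔ i j h).symm.context (u := [])
    (v := [⟨[], .four j i h.symm, []⟩]) (α' := [i, j, i]) (γ' := [i, j]) rfl ⟨rfl, rfl⟩
  have h2 : Sim Δ [i, j] [i, j] [⟨[], .four i j h, []⟩, ⟨[], .four j i h.symm, []⟩] [] :=
    sim_braid hΔ (by simp [VertexKind.isTri]) (by simp) ⟨rfl, rfl, rfl⟩ rfl
  have h3 := h2.context (α' := [i, j, i]) (γ' := [i, j])
    (u := [⟨[i], .four j i h.symm, []⟩, ⟨[], .tri i, [j]⟩]) (v := []) ⟨rfl, rfl, rfl⟩ rfl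
  exact h1.trans h3

theorem sim_isotopy (k₁ k₂ : VertexKind d) (l m r : List (Color d)) :
    Sim Δ (l ++ k₁.top ++ m ++ k₂.top ++ r) (l ++ k₁.bot ++ m ++ k₂.bot ++ r)
      [⟨l, k₁, m ++ k₂.top ++ r⟩, ⟨l ++ k₁.bot ++ m, k₂, r⟩]
      [⟨l ++ k₁.top ++ m, k₂, r⟩, ⟨l, k₁, m ++ k₂.bot ++ r⟩] := by
  refine ⟨?_, ?_, (simulates_isotopy k₁ k₂ l m r).1, (simulates_isotopy k₁ k₂ l m r).2⟩ <;>
    simp [IsWeave, Vertex.top, Vertex.bot]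

/-- The equivalence moves are simulated. -/
theorem sim_of_equivMove (hΔ : ∀ n, Δ n ≠ 0) (h : EquivMove x y) (hx : IsWeave α x γ)
    (hy : IsWeave α y γ) : Sim Δ α γ x y := by
  -- A nonempty list of vertices determines its top word, and with it the bottom word. An empty list
  -- occurs only in the move without trivalent vertices, which is treated separately.
  have aux : ∀ {α' γ'}, x ≠ [] → Sim Δ α' γ' x y → Sim Δ α γ x y := by
    intro α' γ' h0 h
    have h1 := h.left
    cases x with
    | nil => exact absurd rfl h0
    | cons v x =>
      obtain rfl : α' = α := h1.1.symm.trans hx.1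
      obtain rfl : γ' = γ := h1.bot_unique hx
      exact h
  cases h with
  | isotopy l m r k₁ k₂ => exact aux (by simp) (sim_isotopy k₁ k₂ l m r)
  | braid _ _ _ _ _ _ hx' hy' => exact sim_braid hΔ hx' hy' hx hy
  | pushBelow l r i j h =>
    refine aux (by simp) (?_ : Sim Δ (l ++ [i, j, i, j] ++ r) (l ++ [j, i, j] ++ r) _ _)
    simpa [Vertex.extend] using (sim_pushBelow hΔ i j h).extend l r
  | pushBelowMirror l r i j h =>
    refine aux (by simp) (?_ : Sim Δ (l ++ [j, i, j, i] ++ r) (l ++ [j, i, j] ++ r) _ _)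
    simpa [Vertex.extend] using (sim_pushBelowMirror hΔ i j h).extend l r
  | pushAbove l r i j h =>
    refine aux (by simp) (?_ : Sim Δ (l ++ [i, j, i, i] ++ r) (l ++ [j, i, j] ++ r) _ _)
    simpa [Vertex.extend] using (sim_pushAbove hΔ i j h).extend l r
  | pushAboveMirror l r i j h =>
    refine aux (by simp) (?_ : Sim Δ (l ++ [i, i, j, i] ++ r) (l ++ [j, i, j] ++ r) _ _)
    simpa [Vertex.extend] using (sim_pushAboveMirror hΔ i j h).extend l r
  | passThrough l r i j h =>
    refine aux (by simp) (?_ : Sim Δ (l ++ [i, j, i] ++ r) (l ++ [j, i] ++ r) _ _)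
    simpa [Vertex.extend] using (sim_passThrough hΔ i j h).extend l r
  | passThroughMirror l r i j h =>
    refine aux (by simp) (?_ : Sim Δ (l ++ [i, j, i] ++ r) (l ++ [i, j] ++ r) _ _)
    simpa [Vertex.extend] using (sim_passThroughMirror hΔ i j h).extend l r

end Sim

/-! ### Decorations of weaves as runs -/

section ToRow

variable {K : Type*} [Field K] {d : ℕ} {N : Type*}

/-- The row with given colors, values of cycles, and flags. -/
def toRow : List (Color d) → (ℕ → N → ℕ) → (ℕ → DecoratedFlag K d) → List (Letter K d N)
  | [], _, _ => []
  | c :: α, wt, fl => ⟨c, wt 0, fl 1⟩ :: toRow α (fun p => wt (p + 1)) fun p => fl (p + 1)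

theorem toRow_map_col (α : List (Color d)) (wt : ℕ → N → ℕ) (fl : ℕ → DecoratedFlag K d) :
    (toRow α wt fl).map Letter.col = α := by
  induction α generalizing wt fl with
  | nil => rfl
  | cons c α ih => simp [toRow, ih]

theorem toRow_append (α α' : List (Color d)) (wt : ℕ → N → ℕ) (fl : ℕ → DecoratedFlag K d) :
    toRow (α ++ α') wt fl = toRow α wt fl ++
      toRow α' (fun p => wt (p + α.length)) fun p => fl (p + α.length) := by
  induction α generalizing wt fl with
  | nil => rfl
  | cons c α ih => simp [toRow, ih, Nat.add_comm, Nat.add_left_comm]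

theorem toRow_congr {α : List (Color d)} {wt wt' : ℕ → N → ℕ} {fl fl' : ℕ → DecoratedFlag K d}
    (h : ∀ p < α.length, wt p = wt' p) (h' : ∀ p < α.length, fl (p + 1) = fl' (p + 1)) :
    toRow α wt fl = toRow α wt' fl' := by
  induction α generalizing wt wt' fl fl' with
  | nil => rfl
  | cons c α ih =>
    rw [List.length_cons] at h h'
    rw [toRow, toRow, h 0 (by omega), h' 0 (by omega),
      ih (wt := fun p => wt (p + 1)) (wt' := fun p => wt' (p + 1)) (fl := fun p => fl (p + 1))
        (fl' := fun p => fl' (p + 1)) (fun p hp => h (p + 1) (by omega))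
        (fun p hp => h' (p + 1) (by omega))]

theorem exists_mem_toRow {α : List (Color d)} {wt : ℕ → N → ℕ} {fl : ℕ → DecoratedFlag K d}
    {Q : (N → ℕ) → Prop} : (∃ x ∈ toRow α wt fl, Q x.wt) ↔ ∃ p < α.length, Q (wt p) := by
  induction α generalizing wt fl with
  | nil => simp [toRow]
  | cons c α ih =>
    simp only [toRow, List.mem_cons, exists_eq_or_imp, ih, List.length_cons]
    constructor
    · rintro (h | ⟨p, hp, h⟩)
      · exact ⟨0, by omega, h⟩
      · exact ⟨p + 1, by omega, h⟩
    · rintro ⟨p, hp, h⟩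
      cases p with
      | zero => exact Or.inl h
      | succ p => exact Or.inr ⟨p, by omega, h⟩

theorem validRow_toRow [Fintype N] {Δ : N → K} {α : List (Color d)} {wt : ℕ → N → ℕ}
    {fl : ℕ → DecoratedFlag K d} : ValidRow Δ (fl 0) (toRow α wt fl) ↔
      ∀ p : Fin α.length, RelativePosition (fl p) (fl (p + 1)) (α.get p) ∧
        HasCrossingValue (fl p) (fl (p + 1)) (α.get p) (weightValue Δ (wt p)) := by
  induction α generalizing wt fl with
  | nil => simp [toRow, ValidRow]
  | cons c α ih =>
    have := ih (wt := fun p => wt (p + 1)) (fl := fun p => fl (p + 1))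
    simp only [Nat.zero_add] at this
    rw [toRow, ValidRow, this]
    exact (Fin.forall_fin_succ (P := fun p : Fin (α.length + 1) =>
      RelativePosition (fl p) (fl (p + 1)) ((c :: α).get p) ∧
        HasCrossingValue (fl p) (fl (p + 1)) ((c :: α).get p) (weightValue Δ (wt p)))).symm

/-- A vertex acts on rows in agreement with the transport of cycles and with the faces. -/
theorem rowStep_toRow {v : Vertex d} {o : Option N} (ho : o.isSome = v.kind.isTri)
    {wt wt' : ℕ → N → ℕ} {fl fl' : ℕ → DecoratedFlag K d}
    (hfr : ∀ n, o = some n → ∀ p, wt p n = 0)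
    (hn : ∀ n, o = some n → ∀ p, wt' p n = if p = v.left.length then 1 else 0)
    (hw : ∀ n, o ≠ some n → ∀ p, wt' p n = v.transport (fun p => wt p n) p)
    (hfl : v.FacesAgree fl fl') :
    RowStep v o (toRow v.top wt fl) (toRow v.bot wt' fl') (fun n n' =>
      v.pairing (fun p => wt p n) (fun p => wt' p n) (fun p => wt p n') (fun p => wt' p n')) := by
  classical
  obtain ⟨l, k, r⟩ := v
  have hw2 : ∀ p, p < l.length → wt p = wt' p := by
    intro p hp
    funext n
    by_cases h : o = some n
    · rw [hfr n h, hn n h, if_neg (ne_of_lt hp)]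
    · rw [hw n h]
      cases k <;> simp only [Vertex.transport] <;> split_ifs <;> first | rfl | omega
  have hf2 : ∀ p, p ≤ l.length → fl p = fl' p := by
    intro p hp
    cases k with
    | tri i => exact (hfl.1 p hp).symm
    | four i j _ => exact (hfl p (by change p ≠ l.length + 1; omega)).symm
    | six i j _ =>
      exact (hfl p (by change p ≠ l.length + 1; omega) (by change p ≠ l.length + 2; omega)).symm
  have hw3 : ∀ p, wt (p + (l.length + k.top.length)) = wt' (p + (l.length + k.bot.length)) := by
    intro p
    funext n
    by_cases h : o = some n
    · rw [hfr n h, hn n h, if_neg]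
      cases k <;> simp only [VertexKind.bot, List.length] <;> omega
    · rw [hw n h]
      cases k with
      | tri i =>
        exact ((if_neg (show ¬ p + (l.length + 1) < l.length by omega)).trans
          (if_neg (show ¬ p + (l.length + 1) = l.length by omega))).symm
      | four i j _ =>
        exact ((if_neg (show ¬ p + (l.length + 2) = l.length by omega)).trans
          (if_neg (show ¬ p + (l.length + 2) = l.length + 1 by omega))).symm
      | six i j _ =>
        exact ((if_neg (show ¬ p + (l.length + 3) = l.length by omega)).trans
          ((if_neg (show ¬ p + (l.length + 3) = l.length + 1 by omega)).trans
          (if_neg (show ¬ p + (l.length + 3) = l.length + 2 by omega)))).symm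
  have hf3 : ∀ p, fl (p + 1 + (l.length + k.top.length)) =
      fl' (p + 1 + (l.length + k.bot.length)) := by
    intro p
    cases k with
    | tri i =>
      exact (hfl.2 (p + 1 + (l.length + 1)) (by change l.length < _; omega)).symm
    | four i j _ => exact (hfl (p + 1 + (l.length + 2)) (by change _ ≠ l.length + 1; omega)).symm
    | six i j _ =>
      exact (hfl (p + 1 + (l.length + 3)) (by change _ ≠ l.length + 1; omega)
        (by change _ ≠ l.length + 2; omega)).symm
  refine ⟨toRow l wt fl, toRow k.top (fun p => wt (p + l.length)) (fun p => fl (p + l.length)),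
    toRow k.bot (fun p => wt' (p + l.length)) (fun p => fl' (p + l.length)),
    toRow r (fun p => wt (p + (l.length + k.top.length)))
      (fun p => fl (p + (l.length + k.top.length))), ?_, ?_, toRow_map_col _ _ _,
    toRow_map_col _ _ _, ?_⟩
  · rw [Vertex.top, toRow_append, toRow_append, List.length_append]
  · rw [Vertex.bot, toRow_append, toRow_append, List.length_append]
    congr 1
    · rw [toRow_congr (fun p hp => hw2 p hp) fun p hp => hf2 (p + 1) hp]
    · exact toRow_congr (fun p _ => (hw3 p).symm) fun p _ => (hf3 p).symm
  · cases k with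
    | tri i =>
      obtain ⟨n, rfl⟩ : ∃ n, o = some n := Option.isSome_iff_exists.1 ho
      have e : wt' l.length = Function.update (wt l.length ⊓ wt (1 + l.length)) n 1 := by
        funext m
        by_cases hm : m = n
        · subst hm
          rw [hn m rfl, if_pos rfl, Function.update_self]
        · rw [hw m (fun h => hm (Option.some.inj h).symm), Function.update_of_ne hm]
          simp [Vertex.transport, add_comm]
      refine ⟨n, wt l.length, wt (1 + l.length), fl (1 + l.length), fl (1 + 1 + l.length), rfl, ?_,
        ?_, ?_⟩
      · simp [toRow, VertexKind.top]
      · simp only [toRow, VertexKind.bot, Nat.zero_add]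
        rw [e, hfl.2 (1 + l.length) (by change l.length < _; omega),
          show 1 + l.length + 1 = 1 + 1 + l.length by omega]
      · funext m m'
        simp only [Vertex.pairing, triPairing, ← e]
        rw [add_comm 1]
    | four i j h =>
      have ho : o = none := by simpa [VertexKind.isTri] using ho
      subst ho
      have e1 : wt' l.length = wt (1 + l.length) := by
        funext m
        rw [hw m (by simp)]
        simp [Vertex.transport, add_comm]
      have e2 : wt' (1 + l.length) = wt l.length := by
        funext m
        rw [hw m (by simp)]
        simp [Vertex.transport, add_comm]
      refine ⟨wt l.length, wt (1 + l.length), fl (1 + l.length), fl (1 + 1 + l.length),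
        fl' (1 + l.length), rfl, ?_, ?_, ?_⟩
      · simp [toRow, VertexKind.top]
      · simp only [toRow, VertexKind.bot, Nat.zero_add]
        rw [e1, e2, hfl (1 + 1 + l.length) (by change _ ≠ l.length + 1; omega)]
      · funext m m'
        rfl
    | six i j h =>
      have ho : o = none := by simpa [VertexKind.isTri] using ho
      subst ho
      have e1 : wt' l.length = wt (1 + l.length) + wt (1 + 1 + l.length) -
          wt l.length ⊓ wt (1 + 1 + l.length) := by
        funext m
        rw [hw m (by simp)]
        simp [Vertex.transport, add_comm]
      have e2 : wt' (1 + l.length) = wt l.length ⊓ wt (1 + 1 + l.length) := by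
        funext m
        rw [hw m (by simp)]
        simp [Vertex.transport, add_comm]
      have e3 : wt' (1 + 1 + l.length) = wt l.length + wt (1 + l.length) -
          wt l.length ⊓ wt (1 + 1 + l.length) := by
        funext m
        rw [hw m (by simp)]
        simp [Vertex.transport, add_comm]
      refine ⟨wt l.length, wt (1 + l.length), wt (1 + 1 + l.length), fl (1 + l.length),
        fl (1 + 1 + l.length), fl (1 + 1 + 1 + l.length), fl' (1 + l.length),
        fl' (1 + 1 + l.length), rfl, ?_, ?_, ?_⟩
      · simp [toRow, VertexKind.top]
      · simp only [toRow, VertexKind.bot, Nat.zero_add]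
        rw [e1, e2, e3, hfl (1 + 1 + 1 + l.length) (by change _ ≠ l.length + 1; omega)
          (by change _ ≠ l.length + 2; omega)]
      · funext m m'
        rw [show 1 + l.length = l.length + 1 by omega, show 1 + 1 + l.length = l.length + 2 by omega]
          at *
        simp only [Vertex.pairing, sixPairing, e1, e2, e3]

end ToRow

/-! ### From decorations of weaves to runs -/

section DecorationRun

variable {K : Type*} [Field K] {d : ℕ} {N : Type*} {β β' : List (Color d)}
  {M : Finset (Fin β.length)}

theorem DemazureWeave.isWeave_drop (w : DemazureWeave β β') {t : ℕ} (ht : t ≤ w.vertices.length) :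
    IsWeave (w.rowWord t) (w.vertices.drop t) β' := by
  induction t with
  | zero => exact w.isWeave
  | succ t ih =>
    have h := ih (by omega)
    rw [List.drop_eq_getElem_cons (by omega)] at h
    simp only [DemazureWeave.rowWord, List.getElem?_eq_getElem (show t < w.vertices.length by omega)]
    exact h.2

theorem DemazureWeave.rowWord_eq_top (w : DemazureWeave β β') {t : ℕ} (ht : t < w.vertices.length) :
    w.rowWord t = w.vertices[t].top := by
  have h := w.isWeave_drop ht.le
  rw [List.drop_eq_getElem_cons ht] at h
  exact h.1.symm

theorem DemazureWeave.rowWord_succ (w : DemazureWeave β β') {t : ℕ} (ht : t < w.vertices.length) :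
    w.rowWord (t + 1) = w.vertices[t].bot := by
  simp only [DemazureWeave.rowWord, List.getElem?_eq_getElem ht]

theorem DemazureWeave.rowWord_length (w : DemazureWeave β β') :
    w.rowWord w.vertices.length = β' := by
  have := w.isWeave_drop le_rfl
  rwa [List.drop_length] at this

/-- The vertices of a weave with the names of the cycles that begin at them. -/
def DemazureWeave.labels (w : DemazureWeave β β') (ν : Cycle M w → N) :
    List (Vertex d × Option N) :=
  List.ofFn fun t : Fin w.vertices.length => (w.vertices.get t,
    if h : (w.vertices.get t).kind.isTri = true then some (ν (.inr ⟨t, h⟩)) else none)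

theorem DemazureWeave.labels_map_fst (w : DemazureWeave β β') (ν : Cycle M w → N) :
    (w.labels ν).map Prod.fst = w.vertices := by
  rw [labels, List.map_ofFn]
  exact List.ofFn_get _

theorem DemazureWeave.length_labels (w : DemazureWeave β β') (ν : Cycle M w → N) :
    (w.labels ν).length = w.vertices.length := by simp [labels]

theorem DemazureWeave.mem_names_labels {w : DemazureWeave β β'} {ν : Cycle M w → N} {n : N} :
    n ∈ names (w.labels ν) ↔ ∃ t, n = ν (.inr t) := by
  simp only [names, List.mem_filterMap, labels, List.mem_ofFn]
  constructor
  · rintro ⟨_, ⟨t, rfl⟩, h⟩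
    simp only [Option.dite_none_right_eq_some, Option.some.injEq] at h
    obtain ⟨ht, h⟩ := h
    exact ⟨⟨t, ht⟩, h.symm⟩
  · rintro ⟨t, rfl⟩
    exact ⟨_, ⟨t.1, rfl⟩, dif_pos t.2⟩

theorem DemazureWeave.nodup_names_labels (w : DemazureWeave β β') {ν : Cycle M w → N}
    (hν : Function.Injective ν) : (names (w.labels ν)).Nodup := by
  rw [names, labels, List.ofFn_eq_map, List.filterMap_map]
  refine (List.nodup_finRange _).filterMap fun t t' n h h' => ?_
  simp only [Function.comp, Option.mem_def, Option.dite_none_right_eq_some, Option.some.injEq]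
    at h h'
  obtain ⟨ht, h⟩ := h
  obtain ⟨ht', h'⟩ := h'
  have := hν (h.trans h'.symm)
  simpa using this

open Classical in
/-- The decorated row on top of a weave. -/
noncomputable def topRow (β : List (Color d)) (M : Finset (Fin β.length)) (μ : {q // q ∈ M} → N)
    (fl : ℕ → DecoratedFlag K d) : List (Letter K d N) :=
  toRow β (fun p n => if ∃ q, μ q = n ∧ (q.1 : ℕ) = p then 1 else 0) fl

theorem Cycle.weight_startsAt {w : DemazureWeave β β'} {t : ℕ} (ht : t < w.vertices.length)
    {c : Cycle M w} (hc : c.startsAt t = true) (p : ℕ) : Cycle.weight c (t + 1) p =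
      if p = (w.vertices[t]).left.length then 1 else 0 := by
  rw [Cycle.weight]
  simp [List.getElem?_eq_getElem ht, hc]

theorem Cycle.weight_succ {w : DemazureWeave β β'} {t : ℕ} (ht : t < w.vertices.length)
    {c : Cycle M w} (hc : c.startsAt t = false) :
    Cycle.weight c (t + 1) = (w.vertices[t]).transport (Cycle.weight c t) := by
  funext p
  rw [Cycle.weight]
  simp [List.getElem?_eq_getElem ht, hc]

theorem Vertex.transport_zero (v : Vertex d) : v.transport (fun _ => 0) = fun _ => 0 := by
  funext p
  obtain ⟨l, k, r⟩ := v
  cases k <;> simp [Vertex.transport]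

theorem Cycle.weight_eq_zero {w : DemazureWeave β β'}
    (s : {t : Fin w.vertices.length // (w.vertices.get t).kind.isTri = true}) {t : ℕ}
    (ht : t ≤ s.1) : Cycle.weight (M := M) (.inr s) t = fun _ => 0 := by
  induction t with
  | zero => rfl
  | succ t ih =>
    rw [Cycle.weight_succ (by omega), ih (by omega), Vertex.transport_zero]
    simp only [Cycle.startsAt, decide_eq_false_iff_not]
    omega

/-- On the top row only the cycles of marked letters are nonzero. This identifies the initial
weights of `w` with a row that does not mention `w`, so that different weaves can be run from the
same row. -/
theorem topRow_eq {w : DemazureWeave β β'} (ν : Cycle M w ≃ N) (fl : ℕ → DecoratedFlag K d) :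
    topRow β M (ν ∘ .inl) fl = toRow β (fun p n => Cycle.weight (ν.symm n) 0 p) fl := by
  refine congrArg (fun f => toRow β f fl) ?_
  funext p n
  rcases hn : ν.symm n with q | s
  · obtain rfl : ν (.inl q) = n := by rw [← hn, Equiv.apply_symm_apply]
    simp only [Cycle.weight, Function.comp_apply,
      ν.injective.eq_iff, Sum.inl.injEq]
    refine if_congr ?_ rfl rfl
    constructor
    · rintro ⟨_, rfl, h⟩
      exact h.symm
    · exact fun h => ⟨q, rfl, h.symm⟩
  · obtain rfl : ν (.inr s) = n := by rw [← hn, Equiv.apply_symm_apply]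
    simp only [Cycle.weight, Function.comp_apply,
      ν.injective.eq_iff, reduceCtorEq, false_and, exists_false, if_false]

/-- A vertex of a weave acts on the rows given by the values of the cycles. -/
theorem DemazureWeave.rowStep_labels (w : DemazureWeave β β') (ν : Cycle M w ≃ N) {t : ℕ}
    (ht : t < w.vertices.length) {fl fl' : ℕ → DecoratedFlag K d}
    (hfl : (w.vertices.get ⟨t, ht⟩).FacesAgree fl fl') :
    RowStep ((w.labels ν)[t]'(by rw [w.length_labels]; exact ht)).1
      ((w.labels ν)[t]'(by rw [w.length_labels]; exact ht)).2
      (toRow (w.rowWord t) (fun p n => Cycle.weight (ν.symm n) t p) fl)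
      (toRow (w.rowWord (t + 1)) (fun p n => Cycle.weight (ν.symm n) (t + 1) p) fl')
      (fun n n' => w.vertices[t].pairing (Cycle.weight (ν.symm n) t)
        (Cycle.weight (ν.symm n) (t + 1)) (Cycle.weight (ν.symm n') t)
        (Cycle.weight (ν.symm n') (t + 1))) := by
  rw [w.rowWord_eq_top ht, w.rowWord_succ ht]
  simp only [DemazureWeave.labels, List.getElem_ofFn]
  have hs : ∀ n, (if h : (w.vertices.get ⟨t, ht⟩).kind.isTri = true then
      some (ν (.inr ⟨⟨t, ht⟩, h⟩)) else none) = some n ↔ (ν.symm n).startsAt t = true := by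
    intro n
    simp only [Option.dite_none_right_eq_some, Option.some.injEq]
    constructor
    · rintro ⟨h, rfl⟩
      simp [Cycle.startsAt]
    · intro h
      rcases hn : ν.symm n with q | ⟨s, h'⟩
      · rw [hn] at h
        simp [Cycle.startsAt] at h
      · rw [hn] at h
        simp only [Cycle.startsAt, decide_eq_true_eq] at h
        obtain rfl : s = ⟨t, ht⟩ := Fin.ext h
        exact ⟨h', by rw [← hn, Equiv.apply_symm_apply]⟩
  refine rowStep_toRow ?_ ?_ ?_ ?_ hfl
  · by_cases h : (w.vertices.get ⟨t, ht⟩).kind.isTri = true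
    · rw [dif_pos h]
      exact h.symm
    · rw [dif_neg h]
      exact (Bool.not_eq_true _ ▸ h).symm
  · intro n hn p
    rw [hs] at hn
    rcases hn' : ν.symm n with q | s
    · rw [hn'] at hn
      simp [Cycle.startsAt] at hn
    · rw [hn'] at hn
      simp only [Cycle.startsAt, decide_eq_true_eq] at hn
      simp only [Cycle.weight_eq_zero s hn.ge]
  · intro n hn p
    rw [hs] at hn
    exact Cycle.weight_startsAt ht hn p
  · intro n hn p
    rw [ne_eq, hs, Bool.not_eq_true] at hn
    exact congrFun (Cycle.weight_succ ht hn) p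

variable [Fintype N]

/-- Crossing values of flags in relative position are nonzero, and the variable of a cycle divides
the crossing value of the edge at which the cycle begins. -/
theorem Decoration.Δ_ne_zero {w : DemazureWeave β β'} (D : Decoration K M w) (c : Cycle M w) :
    D.Δ c ≠ 0 := by
  have key : ∀ t ≤ w.vertices.length, ∀ p : Fin (w.rowWord t).length,
      Cycle.weight c t p = 1 → D.Δ c ≠ 0 := by
    intro t ht p hp
    obtain ⟨h1, h2⟩ := D.edge t ht p
    obtain ⟨g, hg⟩ := exists_frame (D.flag t p)
    have := (exists_crossFrame_of_hasCrossingValue hg (color_pred_add _) h1 h2).1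
    have := (Finset.prod_ne_zero_iff.1 this) c (Finset.mem_univ _)
    rwa [hp, pow_one] at this
  rcases c with q | ⟨t, h⟩
  · exact key 0 (Nat.zero_le _) q.1 (by simp [Cycle.weight])
  · have ht : (t : ℕ) < w.vertices.length := t.2
    have e := w.rowWord_succ ht
    refine key (t + 1) ht ⟨(w.vertices[(t : ℕ)]).left.length, ?_⟩ ?_
    · rw [e, Vertex.bot]
      change (w.vertices[(t : ℕ)]).kind.isTri = true at h
      cases hk : (w.vertices[(t : ℕ)]).kind with
      | tri i => simp [VertexKind.bot]
      | four i j _ => rw [hk] at h; simp [VertexKind.isTri] at h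
      | six i j _ => rw [hk] at h; simp [VertexKind.isTri] at h
    · rw [Cycle.weight_startsAt ht (by simp [Cycle.startsAt]), if_pos rfl]

theorem Decoration.valid_topRow {w : DemazureWeave β β'} (D : Decoration K M w)
    (ν : Cycle M w ≃ N) : ValidRow (D.Δ ∘ ν.symm) (D.flag 0 0)
      (topRow β M (ν ∘ .inl) (D.flag 0)) := by
  rw [topRow_eq, validRow_toRow]
  intro p
  have e := D.edge 0 (Nat.zero_le _) p
  have e2 : weightValue (D.Δ ∘ ν.symm) (fun n => Cycle.weight (ν.symm n) 0 p) =
      ∏ c : Cycle M w, D.Δ c ^ Cycle.weight c 0 p := by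
    rw [weightValue, ← ν.prod_comp]
    simp
  rw [e2]
  exact e

/-- A decorated weave as a run. -/
theorem Decoration.run {w : DemazureWeave β β'} (D : Decoration K M w) (ν : Cycle M w ≃ N) :
    ∃ Z P, Run (D.Δ ∘ ν.symm) (D.flag 0 0) (w.labels ν) (topRow β M (ν ∘ .inl) (D.flag 0)) Z P ∧
      (∀ c e, P (ν c) (ν e) = Cycle.pairing c e) ∧ Z.map Letter.col = β' ∧
      ∀ c, (∃ z ∈ Z, z.wt (ν c) ≠ 0) ↔ ∃ p < β'.length, Cycle.weight c w.vertices.length p ≠ 0 := by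
  let wt : ℕ → ℕ → N → ℕ := fun t p n => Cycle.weight (ν.symm n) t p
  let P : ℕ → N → N → ℤ := fun t n n' => match w.vertices[t]? with
    | some v => v.pairing (fun p => wt t p n) (fun p => wt (t + 1) p n) (fun p => wt t p n')
        (fun p => wt (t + 1) p n')
    | none => 0
  have valid : ∀ t ≤ w.vertices.length, ValidRow (D.Δ ∘ ν.symm) (D.flag t 0)
      (toRow (w.rowWord t) (wt t) (D.flag t)) := by
    intro t ht
    rw [validRow_toRow]
    intro p
    convert D.edge t ht p using 2
    rw [weightValue, ← ν.prod_comp]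
    simp [wt]
  have flag0 : ∀ t ≤ w.vertices.length, D.flag t 0 = D.flag 0 0 := by
    intro t ht
    induction t with
    | zero => rfl
    | succ t ih =>
      rw [← ih (by omega)]
      have h := D.faces ⟨t, ht⟩
      revert h
      generalize w.vertices.get ⟨t, ht⟩ = v
      obtain ⟨l, k, r⟩ := v
      cases k with
      | tri i => exact fun h => h.1 0 (Nat.zero_le _)
      | four i j _ => exact fun h => h 0 (by simp)
      | six i j _ => exact fun h => h 0 (by simp) (by simp)
  have step : ∀ t (ht : t < w.vertices.length), RowStep ((w.labels ν)[t]'(by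
      rw [w.length_labels]; exact ht)).1 ((w.labels ν)[t]'(by rw [w.length_labels]; exact ht)).2
      (toRow (w.rowWord t) (wt t) (D.flag t))
      (toRow (w.rowWord (t + 1)) (wt (t + 1)) (D.flag (t + 1))) (P t) := by
    intro t ht
    simp only [P, List.getElem?_eq_getElem ht]
    exact w.rowStep_labels ν ht (D.faces ⟨t, ht⟩)
  have main : ∀ t ≤ w.vertices.length, Run (D.Δ ∘ ν.symm) (D.flag 0 0) ((w.labels ν).take t)
      (toRow (w.rowWord 0) (wt 0) (D.flag 0)) (toRow (w.rowWord t) (wt t) (D.flag t))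
      (∑ s ∈ Finset.range t, P s) := by
    intro t ht
    induction t with
    | zero => exact ⟨rfl, rfl⟩
    | succ t ih =>
      rw [List.take_add_one, List.getElem?_eq_getElem (by rw [w.length_labels]; exact ht),
        run_append]
      refine ⟨_, _, P t, ih (by omega), ⟨_, P t, 0, step t ht, ?_, ⟨rfl, rfl⟩, by simp⟩,
        Finset.sum_range_succ _ _⟩
      rw [← flag0 (t + 1) ht]
      exact valid (t + 1) ht
  have h := main _ le_rfl
  rw [List.take_of_length_le (w.length_labels ν).le] at h
  refine ⟨toRow (w.rowWord w.vertices.length) (wt w.vertices.length) (D.flag w.vertices.length),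
    ∑ s ∈ Finset.range w.vertices.length, P s, ?_, ?_, ?_, ?_⟩
  · rw [topRow_eq]
    exact h
  · intro c e
    rw [Finset.sum_apply, Finset.sum_apply, Cycle.pairing, Finset.sum_range]
    refine Finset.sum_congr rfl fun t _ => ?_
    simp [P, wt]
  · rw [toRow_map_col, w.rowWord_length]
  · intro c
    rw [exists_mem_toRow (Q := fun a => a (ν c) ≠ 0), w.rowWord_length]
    simp [wt]

end DecorationRun

/-! ### Variables, arrows and frozen vertices from the top row -/

section Uniqueness

variable {K : Type*} [Field K] {d : ℕ} {N : Type*} [Fintype N] {Δ Δ' : N → K}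

theorem weightValue_congr {a : N → ℕ} (h : ∀ n, a n ≠ 0 → Δ n = Δ' n) :
    weightValue Δ a = weightValue Δ' a := by
  refine Finset.prod_congr rfl fun n _ => ?_
  by_cases hn : a n = 0
  · rw [hn, pow_zero, pow_zero]
  · rw [h n hn]

theorem ValidRow.congr {F : DecoratedFlag K d} {X : List (Letter K d N)}
    (h : ∀ x ∈ X, ∀ n, x.wt n ≠ 0 → Δ n = Δ' n) (hX : ValidRow Δ F X) : ValidRow Δ' F X := by
  induction X generalizing F with
  | nil => trivial
  | cons x X ih =>
    refine ⟨⟨hX.1.1, ?_⟩, ih (fun x hx => h x (List.mem_cons_of_mem _ hx)) hX.2⟩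
    rw [← weightValue_congr (h x (List.mem_cons_self ..))]
    exact hX.1.2

theorem weightValue_update [DecidableEq N] (Δ : N → K) (a : N → ℕ) (n : N) :
    weightValue Δ (Function.update a n 1) = Δ n * weightValue Δ (Function.update a n 0) := by
  rw [weightValue, weightValue, ← Finset.mul_prod_erase _ _ (Finset.mem_univ n),
    ← Finset.mul_prod_erase _ (fun i => Δ i ^ Function.update a n 0 i) (Finset.mem_univ n)]
  simp only [Function.update_self, pow_one, pow_zero, one_mul]
  congr 1
  refine Finset.prod_congr rfl fun m hm => ?_
  rw [Function.update_of_ne (Finset.ne_of_mem_erase hm),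
    Function.update_of_ne (Finset.ne_of_mem_erase hm)]

/-- The crossing values of a run are uniquely determined by its first row. -/
theorem Run.unique (hΔ : ∀ n, Δ n ≠ 0) {F : DecoratedFlag K d} {W : List (Vertex d × Option N)}
    {X Z Z' : List (Letter K d N)} {P P' : N → N → ℤ} {S : Set N} (hS : ∀ n ∈ S, Δ n = Δ' n)
    (hX : ∀ n ∉ S, ∀ x ∈ X, x.wt n = 0) (h : Run Δ F W X Z P) (h' : Run Δ' F W X Z' P') :
    Z = Z' ∧ P = P' ∧ ∀ n ∈ names W, Δ n = Δ' n := by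
  classical
  induction W generalizing X P P' S with
  | nil => exact ⟨h.1.trans h'.1.symm, h.2.trans h'.2.symm, by simp [names]⟩
  | cons w W ih =>
    obtain ⟨X₁, p, P₁, s, V, h, rfl⟩ := h
    obtain ⟨X₂, p', P₂, s', V', h', rfl⟩ := h'
    obtain ⟨⟨l, k, r⟩, o⟩ := w
    have main : X₁ = X₂ ∧ p = p' ∧ ∀ n, o = some n → Δ n = Δ' n := by
      by_cases hk : k.isTri = true
      · cases k with
        | tri i =>
          obtain ⟨L, T, T', R, rfl, rfl, hL, hR, hK⟩ := s
          rw [rowStep_append_iff (by rw [← hL, List.length_map])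
            (by rw [← hK.map_col.1, List.length_map])] at s'
          obtain ⟨-, -, T'', rfl, hK'⟩ := s'
          obtain ⟨n, a, b, F₁, F₂, rfl, rfl, rfl, rfl⟩ := hK
          obtain ⟨n', a', b', F₁', F₂', hn, hT, rfl, rfl⟩ := hK'
          simp only [List.cons.injEq, Letter.mk.injEq, true_and, and_true] at hT
          obtain ⟨⟨rfl, rfl⟩, rfl, rfl⟩ := hT
          obtain rfl := Option.some.inj hn
          refine ⟨rfl, rfl, fun m hm => ?_⟩
          obtain rfl := Option.some.inj hm
          by_cases hnS : n ∈ S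
          · exact hS n hnS
          rw [validRow_append, validRow_append] at V V'
          -- The flags around the edge below the vertex agree in both runs. In its crossing value
          -- the new name has the exponent one, and all other names that occur are in `S`, where the
          -- values are already known to agree.
          have e := HasCrossingValue.unique V.1.2.1.1 V.1.2.1.2 V'.1.2.1.2
          simp only [weightValue_update] at e
          rw [weightValue_congr (Δ := Δ') (Δ' := Δ)] at e
          · exact mul_right_cancel₀ (weightValue_ne_zero hΔ _) e
          · intro m hm
            refine (hS m (by_contra fun hmS => hm ?_)).symm
            by_cases hmn : m = n
            · rw [hmn, Function.update_self]
            · rw [Function.update_of_ne hmn, Pi.inf_apply,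
                show a m = 0 from hX m hmS ⟨i, a, F₁⟩ (by simp)]
              simp
        | four i j _ => simp [VertexKind.isTri] at hk
        | six i j _ => simp [VertexKind.isTri] at hk
      · rw [Bool.not_eq_true] at hk
        have ho : o = none := by
          obtain ⟨L, T, T', R, -, -, -, -, hK⟩ := s
          cases k with
          | tri i => simp [VertexKind.isTri] at hk
          | four i j _ => obtain ⟨a, b, F₁, F₂, G, h, -⟩ := hK; exact h
          | six i j _ => obtain ⟨a, f, e, F₁, F₂, F₃, G₁, G₂, h, -⟩ := hK; exact h
        -- Only names in `S` occur on this row, so it is valid for both assignments of values and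
        -- the uniqueness of steps applies.
        have V₂ : ValidRow Δ F X₂ := V'.congr fun x hx n hn =>
          (hS n (by_contra fun hnS => hn (s'.wt_eq_zero (by simp [ho]) (hX n hnS) x hx))).symm
        obtain ⟨e1, e2⟩ := s.unique hk s' V V₂
        exact ⟨e1, e2, by simp [ho]⟩
    obtain ⟨rfl, rfl, hn⟩ := main
    -- The name that begins at this vertex joins those with known values.
    obtain ⟨e1, e2, e3⟩ := ih (S := S ∪ {n | o = some n})
      (fun n hn' => hn'.elim (hS n) (hn n)) (fun n hn' => s.wt_eq_zero
        (fun h => hn' (Or.inr h)) (hX n fun h => hn' (Or.inl h))) h h'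
    refine ⟨e1, by rw [e2], fun n hn' => ?_⟩
    rw [names, List.mem_filterMap] at hn'
    obtain ⟨v, hv, hvn⟩ := hn'
    rcases List.mem_cons.1 hv with rfl | hv
    · exact hn n hvn
    · exact e3 n (List.mem_filterMap.2 ⟨v, hv, hvn⟩)

theorem Run.isSome_eq {F : DecoratedFlag K d} {W : List (Vertex d × Option N)}
    {X Z : List (Letter K d N)} {P : N → N → ℤ} (h : Run Δ F W X Z P) :
    ∀ w ∈ W, w.2.isSome = w.1.kind.isTri := by
  induction W generalizing X P with
  | nil => simp
  | cons w W ih =>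
    obtain ⟨X₁, p, P₁, ⟨L, T, T', R, -, -, -, -, hK⟩, V, h, rfl⟩ := h
    refine List.forall_mem_cons.2 ⟨?_, ih h⟩
    revert hK
    cases w.1.kind with
    | tri i => rintro ⟨n, a, b, F₁, F₂, ho, -⟩; rw [ho]; rfl
    | four i j _ => rintro ⟨a, b, F₁, F₂, G, ho, -⟩; rw [ho]; rfl
    | six i j _ => rintro ⟨a, f, e, F₁, F₂, F₃, G₁, G₂, ho, -⟩; rw [ho]; rfl

variable {β β' : List (Color d)} {M : Finset (Fin β.length)}

/-- The names of the vertices of a run name the cycles of a weave. -/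
theorem exists_labels {w : DemazureWeave β β'} {μ : {q // q ∈ M} → N} (hμ : Function.Injective μ)
    {W : List (Vertex d × Option N)} (hW : W.map Prod.fst = w.vertices)
    (hs : ∀ w ∈ W, w.2.isSome = w.1.kind.isTri) (hN : (names W).Nodup)
    (hd : ∀ q, μ q ∉ names W) (hc : ∀ n, (∃ q, μ q = n) ∨ n ∈ names W) :
    ∃ ν : Cycle M w ≃ N, ν ∘ .inl = μ ∧ w.labels ν = W := by
  obtain ⟨V, hV⟩ := w
  subst hW
  have hlen : (W.map Prod.fst).length = W.length := List.length_map _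
  have hsome : ∀ t : {t : Fin (W.map Prod.fst).length //
      ((W.map Prod.fst).get t).kind.isTri = true}, (W[(t.1 : ℕ)]'(hlen ▸ t.1.2)).2.isSome := by
    intro t
    rw [hs _ (List.getElem_mem _)]
    simpa using t.2
  have hmem : ∀ t, ((W[(t.1 : ℕ)]'(hlen ▸ t.1.2)).2.get (hsome t)) ∈ names W := fun t =>
    List.mem_filterMap.2 ⟨_, List.getElem_mem _, (Option.some_get _).symm⟩
  let f : Cycle M (⟨W.map Prod.fst, hV⟩ : DemazureWeave β β') → N
    | .inl q => μ q
    | .inr t => (W[(t.1 : ℕ)]'(hlen ▸ t.1.2)).2.get (hsome t)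
  have hf : Function.Bijective f := by
    constructor
    · have hp := hN
      rw [names, List.Nodup, List.pairwise_filterMap, List.pairwise_iff_getElem] at hp
      rintro (q | t) (q' | t') h
      · rw [hμ h]
      · exact absurd ((show μ q = _ from h) ▸ hmem t') (hd q)
      · exact absurd ((show _ = μ q' from h) ▸ hmem t) (hd q')
      · have e1 := Option.some_get (hsome t)
        have e2 := Option.some_get (hsome t')
        change (W[(t.1 : ℕ)]'(hlen ▸ t.1.2)).2.get (hsome t) =
          (W[(t'.1 : ℕ)]'(hlen ▸ t'.1.2)).2.get (hsome t') at h
        congr 1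
        refine Subtype.ext (Fin.ext ?_)
        by_contra hne
        rcases Nat.lt_or_gt_of_ne hne with hlt | hlt
        · exact hp _ _ _ _ hlt _ e1.symm _ e2.symm h
        · exact hp _ _ _ _ hlt _ e2.symm _ e1.symm h.symm
    · intro n
      rcases hc n with ⟨q, rfl⟩ | hn
      · exact ⟨.inl q, rfl⟩
      · obtain ⟨v, hv, hvn⟩ := List.mem_filterMap.1 hn
        obtain ⟨t, ht, rfl⟩ := List.getElem_of_mem hv
        refine ⟨.inr ⟨⟨t, hlen ▸ ht⟩, ?_⟩, ?_⟩
        · have := hs _ hv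
          rw [hvn] at this
          simpa using this.symm
        · simp only [f]
          exact Option.get_of_eq_some _ hvn
  refine ⟨Equiv.ofBijective f hf, rfl, List.ext_getElem (by simp [DemazureWeave.labels]) ?_⟩
  intro t ht ht'
  simp only [DemazureWeave.labels, List.getElem_ofFn]
  refine Prod.ext (by simp) ?_
  have hst := hs _ (List.getElem_mem ht')
  by_cases hk : (W[t]).1.kind.isTri = true
  · rw [hk] at hst
    refine (dif_pos (by simpa using hk)).trans ?_
    exact Option.some_get hst
  · refine (dif_neg (by simpa using hk)).trans ?_
    rw [Bool.not_eq_true] at hk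
    rw [hk, Option.isSome_eq_false_iff, Option.isNone_iff_eq_none] at hst
    exact hst.symm

/-- The variables at the marked letters are determined by the decoration of the word. -/
theorem topRow_marked_eq {w : DemazureWeave β β'} (ν : Cycle M w ≃ N) {F : DecoratedFlag K d}
    {fl : ℕ → DecoratedFlag K d} (hV : ValidRow Δ F (topRow β M (ν ∘ .inl) fl))
    (hV' : ValidRow Δ' F (topRow β M (ν ∘ .inl) fl)) (hF : F = fl 0) (q : {q // q ∈ M}) :
    Δ (ν (.inl q)) = Δ' (ν (.inl q)) := by
  subst hF
  rw [topRow_eq, validRow_toRow] at hV hV'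
  have e := HasCrossingValue.unique (hV q.1).1 (hV q.1).2 (hV' q.1).2
  have key : ∀ Δ : N → K, weightValue Δ (fun n => Cycle.weight (ν.symm n) 0 q.1) =
      Δ (ν (.inl q)) := by
    intro Δ
    rw [weightValue, ← ν.prod_comp, Finset.prod_eq_single (.inl q)]
    · simp [Cycle.weight]
    · rintro (q' | t) - hq
      · have : (q.1 : ℕ) ≠ q'.1 := fun h => hq (by
          congr 1
          exact Subtype.ext (Fin.ext h.symm))
        simp [Cycle.weight, this]
      · simp [Cycle.weight]
    · simp
  rwa [key, key] at e

theorem topRow_wt_eq_zero {w : DemazureWeave β β'} (ν : Cycle M w ≃ N)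
    (fl : ℕ → DecoratedFlag K d) {n : N} (hn : ¬∃ q, ν (.inl q) = n) :
    ∀ x ∈ topRow β M (ν ∘ .inl) fl, x.wt n = 0 := by
  intro x hx
  by_contra h0
  rw [topRow_eq] at hx
  obtain ⟨p, hp, h⟩ := (exists_mem_toRow (Q := fun a => a n ≠ 0)).1 ⟨x, hx, h0⟩
  rcases hc : ν.symm n with q | t
  · exact hn ⟨q, by rw [← hc, Equiv.apply_symm_apply]⟩
  · rw [hc] at h
    exact h rfl

/-- The variables, arrows and frozen vertices of a decorated weave are determined by a run. -/
theorem Decoration.eq_of_run {w : DemazureWeave β β'} (D : Decoration K M w) (ν : Cycle M w ≃ N)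
    {Z : List (Letter K d N)} {P : N → N → ℤ}
    (hV : ValidRow Δ (D.flag 0 0) (topRow β M (ν ∘ .inl) (D.flag 0)))
    (hr : Run Δ (D.flag 0 0) (w.labels ν) (topRow β M (ν ∘ .inl) (D.flag 0)) Z P) :
    (∀ c, D.Δ c = Δ (ν c)) ∧ (∀ c e, Cycle.pairing c e = P (ν c) (ν e)) ∧
      (∀ c : Cycle M w, c.IsFrozen ↔ (∃ q, ν (.inl q) = ν c) ∨ ∃ z ∈ Z, z.wt (ν c) ≠ 0) ∧
      Z.map Letter.col = β' := by
  obtain ⟨Z', P', h1, h2, h3, h4⟩ := D.run ν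
  have hS : ∀ n ∈ {n | ∃ q, ν (.inl q) = n}, (D.Δ ∘ ν.symm) n = Δ n := by
    rintro _ ⟨q, rfl⟩
    exact topRow_marked_eq ν (D.valid_topRow ν) hV rfl q
  have hX : ∀ n ∉ {n | ∃ q, ν (.inl q) = n}, ∀ x ∈ topRow β M (ν ∘ .inl) (D.flag 0),
      x.wt n = 0 := fun n hn => topRow_wt_eq_zero ν _ hn
  obtain ⟨rfl, rfl, h5⟩ := Run.unique (fun n => D.Δ_ne_zero _) hS hX h1 hr
  refine ⟨?_, fun c e => (h2 c e).symm, ?_, h3⟩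
  · intro c
    rcases c with q | t
    · simpa using hS _ ⟨q, rfl⟩
    · simpa using h5 (ν (.inr t)) (DemazureWeave.mem_names_labels.2 ⟨t, rfl⟩)
  · intro c
    rw [h4, Cycle.IsFrozen]
    refine or_congr ?_ Iff.rfl
    rcases c with q | t <;> simp

end Uniqueness

/-! ### Seeds -/

section Seeds

variable {F : Type*}

theorem Seed.Same.symm {S T : Seed F} (h : S.Same T) : T.Same S := by
  obtain ⟨f, h1, h2, h3⟩ := h
  exact ⟨f.symm, fun i => by rw [h1, f.apply_symm_apply],
    fun i j => by rw [h2, f.apply_symm_apply, f.apply_symm_apply],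
    fun i => by rw [h3, f.apply_symm_apply]⟩

theorem Seed.Same.trans {S T U : Seed F} (h : S.Same T) (h' : T.Same U) : S.Same U := by
  obtain ⟨f, h1, h2, h3⟩ := h
  obtain ⟨g, h4, h5, h6⟩ := h'
  exact ⟨f.trans g, fun i => (h1 i).trans (h4 _), fun i j => (h2 i j).trans (h5 _ _),
    fun i => (h3 i).trans (h6 _)⟩

variable [Field F]

/-- The mutation of a skew-symmetric matrix. -/
def mutateArrows {I : Type*} [DecidableEq I] (b : I → I → ℤ) (k i j : I) : ℤ :=
  if i = k ∨ j = k then -b i j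
  else b i j + max (b i k) 0 * max (b k j) 0 - min (b i k) 0 * min (b k j) 0

/-- The exchange transformation of the variables of a seed. -/
def mutateVar {I : Type*} [Fintype I] [DecidableEq I] (b : I → I → ℤ) (x : I → F) (k i : I) : F :=
  if i = k then (∏ j, x j ^ (b j k).toNat + ∏ j, x j ^ (b k j).toNat) / x k else x i

theorem mutateArrows_comp {I J : Type*} [DecidableEq I] [DecidableEq J] {b : I → I → ℤ}
    {c : J → J → ℤ} (f : I ≃ J) (h : ∀ i j, b i j = c (f i) (f j)) (k i j : I) :
    mutateArrows b k i j = mutateArrows c (f k) (f i) (f j) := by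
  simp only [mutateArrows, h, f.injective.eq_iff]

theorem mutateVar_comp {I J : Type*} [DecidableEq I] [DecidableEq J] [Fintype I] [Fintype J]
    {b : I → I → ℤ} {c : J → J → ℤ} {x : I → F} {y : J → F} (f : I ≃ J)
    (h : ∀ i j, b i j = c (f i) (f j)) (h' : ∀ i, x i = y (f i)) (k i : I) :
    mutateVar b x k i = mutateVar c y (f k) (f i) := by
  simp only [mutateVar, h, h', f.injective.eq_iff]
  rw [f.prod_comp (fun j => y j ^ (c j (f k)).toNat), f.prod_comp (fun j => y j ^ (c (f k) j).toNat)]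

theorem mutateArrows_mutateArrows {I : Type*} [DecidableEq I] (b : I → I → ℤ) (k i j : I) :
    mutateArrows (mutateArrows b k) k i j = b i j := by
  have e1 : ∀ x : ℤ, max (-x) 0 = -min x 0 := by intro x; omega
  have e2 : ∀ x : ℤ, min (-x) 0 = -max x 0 := by intro x; omega
  by_cases h : i = k ∨ j = k
  · simp [mutateArrows, h]
  · simp only [mutateArrows, h, if_false, or_true, true_or, if_true, e1, e2]
    ring

/-- The exchange polynomial does not involve the variable at `k`, so it is the same in both
mutations. Since algebraic independence is not required, it might vanish, and then the old variable
would be lost; `hk` excludes this. -/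
theorem mutateVar_mutateVar {I : Type*} [Fintype I] [DecidableEq I] {b : I → I → ℤ}
    (hb : ∀ i j, b i j = -b j i) {x : I → F} {k : I} (hk : mutateVar b x k k ≠ 0) (i : I) :
    mutateVar (mutateArrows b k) (mutateVar b x k) k i = x i := by
  have hkk : b k k = 0 := by
    have := hb k k
    omega
  by_cases h : i = k
  · subst h
    have e : ∀ c : I → ℕ, c i = 0 →
        ∏ j, mutateVar b x i j ^ c j = ∏ j, x j ^ c j := by
      intro c hc
      refine Finset.prod_congr rfl fun j _ => ?_
      by_cases hj : j = i
      · rw [hj, hc, pow_zero, pow_zero]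
      · rw [mutateVar, if_neg hj]
    rw [mutateVar, if_pos rfl, e _ (by simp [mutateArrows, hkk]), e _ (by simp [mutateArrows, hkk])]
    simp only [mutateArrows, or_true, true_or, if_true]
    simp only [← hb]
    simp only [mutateVar, if_true] at hk ⊢
    rw [add_comm, div_div_eq_mul_div]
    exact mul_div_cancel_left₀ _ (div_ne_zero_iff.1 hk).1
  · simp [mutateVar, h]

theorem Seed.Same.mutate {S T : Seed F} {f : S.I ≃ T.I} (h1 : ∀ i, S.frozen i ↔ T.frozen (f i))
    (h2 : ∀ i j, S.arrows i j = T.arrows (f i) (f j)) (h3 : ∀ i, S.var i = T.var (f i)) (k : S.I) :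
    (S.mutate k).Same (T.mutate (f k)) :=
  ⟨f, h1, mutateArrows_comp f h2 k, mutateVar_comp f h2 h3 k⟩

theorem Seed.Same.mutationEquivalent_trans {S T U : Seed F} (h : S.Same T)
    (h' : T.MutationEquivalent U) : S.MutationEquivalent U := by
  induction h' generalizing S with
  | same h' => exact .same (h.trans h')
  | @mutate T U k hk h' ih =>
    obtain ⟨f, h1, h2, h3⟩ := h
    refine .mutate (f.symm k) (by rwa [h1, f.apply_symm_apply]) (ih ?_)
    have := Seed.Same.mutate h1 h2 h3 (f.symm k)
    rwa [f.apply_symm_apply] at this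

theorem Seed.MutationEquivalent.trans {S T U : Seed F} (h : S.MutationEquivalent T)
    (h' : T.MutationEquivalent U) : S.MutationEquivalent U := by
  induction h with
  | same h => exact h.mutationEquivalent_trans h'
  | mutate k hk _ ih => exact .mutate k hk (ih h')

/-- Mutation is an involution. -/
theorem Seed.mutate_mutate_same (S : Seed F) (k : S.I) (hk : mutateVar S.arrows S.var k k ≠ 0) :
    ((S.mutate k).mutate k).Same S :=
  ⟨Equiv.refl S.I, fun _ => Iff.rfl, mutateArrows_mutateArrows S.arrows k,
    mutateVar_mutateVar S.skew hk⟩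

theorem Seed.clusterAlgebra_le [Algebra ℂ F] {S T : Seed F} (h : S.MutationEquivalent T) :
    T.clusterAlgebra ≤ S.clusterAlgebra := by
  refine Algebra.adjoin_mono ?_
  rintro x ⟨U, hU, hx⟩
  exact ⟨U, h.trans hU, hx⟩

/-- Mutation need not be invertible where an exchange polynomial vanishes, so both directions are
assumed. For seeds of decorated weaves both are available. -/
theorem Seed.clusterAlgebra_eq [Algebra ℂ F] {S T : Seed F} (h : S.MutationEquivalent T)
    (h' : T.MutationEquivalent S) : S.clusterAlgebra = T.clusterAlgebra :=
  le_antisymm (clusterAlgebra_le h') (clusterAlgebra_le h)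

end Seeds

/-! ### Decorations of a weave and of equivalent weaves -/

section Equivalence

variable {K : Type*} [Field K] {d : ℕ} {β β' : List (Color d)} {M : Finset (Fin β.length)}
  {𝔡 : Fin (β.length + 1) → DecoratedFlag K d}

theorem Decoration.Extends.flag_eq {γ γ' : List (Color d)} {w : DemazureWeave β γ}
    {w' : DemazureWeave β γ'} {D : Decoration K M w} {D' : Decoration K M w'} (h : D.Extends 𝔡)
    (h' : D'.Extends 𝔡) : D.flag 0 0 = D'.flag 0 0 := (h 0).trans (h' 0).symm

theorem Decoration.Extends.topRow_eq {γ γ' : List (Color d)} {w : DemazureWeave β γ}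
    {w' : DemazureWeave β γ'} {D : Decoration K M w} {D' : Decoration K M w'} (h : D.Extends 𝔡)
    (h' : D'.Extends 𝔡) {N : Type*} (μ : {q // q ∈ M} → N) :
    topRow β M μ (D.flag 0) = topRow β M μ (D'.flag 0) :=
  toRow_congr (fun _ _ => rfl) fun p hp =>
    (h ⟨p + 1, by omega⟩).trans (h' ⟨p + 1, by omega⟩).symm

/-- The variables of a decorated weave are determined by the decoration of its top word. -/
theorem Decoration.Extends.Δ_eq {w : DemazureWeave β β'} {D D' : Decoration K M w}
    (h : D.Extends 𝔡) (h' : D'.Extends 𝔡) : D.Δ = D'.Δ := by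
  obtain ⟨Z, P, hr, -⟩ := D'.run (Equiv.refl _)
  have hV := D'.valid_topRow (Equiv.refl _)
  rw [h'.flag_eq h, h'.topRow_eq h] at hr hV
  exact funext (D.eq_of_run (Equiv.refl _) hV hr).1

/-- A run along another weave names the cycles of that weave. -/
theorem Decoration.exists_equiv_of_run {N : Type*} [Fintype N] {Δ : N → K} {γ γ' : List (Color d)}
    {w : DemazureWeave β γ} {w' : DemazureWeave β γ'} {D : Decoration K M w}
    {D' : Decoration K M w'} (h : D.Extends 𝔡) (h' : D'.Extends 𝔡) (ν : Cycle M w ≃ N)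
    {W : List (Vertex d × Option N)} (hW : W.map Prod.fst = w'.vertices)
    (hN : (names W).Perm (names (w.labels ν)))
    (hV : ValidRow Δ (D.flag 0 0) (topRow β M (ν ∘ .inl) (D.flag 0)))
    {Z : List (Letter K d N)} {P : N → N → ℤ}
    (hr : Run Δ (D.flag 0 0) W (topRow β M (ν ∘ .inl) (D.flag 0)) Z P) :
    ∃ ν' : Cycle M w' ≃ N, (∀ q, ν' (.inl q) = ν (.inl q)) ∧ w'.labels ν' = W ∧
      (∀ c, D'.Δ c = Δ (ν' c)) ∧ (∀ c e, Cycle.pairing c e = P (ν' c) (ν' e)) ∧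
      (∀ c : Cycle M w', c.IsFrozen ↔ (∃ q, ν (.inl q) = ν' c) ∨ ∃ z ∈ Z, z.wt (ν' c) ≠ 0) ∧
      Z.map Letter.col = γ' := by
  have hinj : Function.Injective (ν ∘ Sum.inl) := ν.injective.comp Sum.inl_injective
  obtain ⟨ν', e1, e2⟩ := exists_labels (w := w') hinj hW hr.isSome_eq
    (hN.nodup_iff.2 (w.nodup_names_labels ν.injective))
    (fun q hq => by
      obtain ⟨t, ht⟩ := DemazureWeave.mem_names_labels.1 (hN.subset hq)
      simp at ht)
    (fun n => by
      rcases hc : ν.symm n with q | t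
      · exact Or.inl ⟨q, by simp [← hc]⟩
      · exact Or.inr (hN.symm.subset (DemazureWeave.mem_names_labels.2 ⟨t, by simp [← hc]⟩)))
  refine ⟨ν', congrFun e1, e2, ?_⟩
  rw [h.flag_eq h', h.topRow_eq h', ← e1] at hr hV
  rw [← e2] at hr
  have := D'.eq_of_run ν' hV hr
  have e3 : ∀ q, ν' (.inl q) = ν (.inl q) := congrFun e1
  simp only [e3] at this
  exact this

theorem sim_of_localStep {N : Type*} [Fintype N] {Δ : N → K} (hΔ : ∀ n, Δ n ≠ 0)
    {w w' : DemazureWeave β β'} (h : LocalStep EquivMove w w') :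
    Sim Δ β β' w.vertices w'.vertices := by
  obtain ⟨u, x, y, v, e, e', h⟩ := h
  have h1 := w.isWeave
  have h2 := w'.isWeave
  rw [e, isWeave_append] at h1
  rw [e', isWeave_append] at h2
  obtain ⟨γ, h1, hv⟩ := h1
  obtain ⟨γ', h2, hv'⟩ := h2
  obtain ⟨α, hu, hx⟩ := isWeave_append.1 h1
  obtain ⟨α', hu', hy⟩ := isWeave_append.1 h2
  obtain rfl := hu.bot_unique hu'
  obtain rfl : γ = γ' := by
    cases v with
    | nil => exact Eq.trans hv hv'.symm
    | cons v _ => exact hv.1.symm.trans hv'.1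
  rw [e, e']
  exact (sim_of_equivMove hΔ h hx hy).context hu hv

theorem DemazureWeave.Equivalent.sim {N : Type*} [Fintype N] {Δ : N → K} (hΔ : ∀ n, Δ n ≠ 0)
    {w w' : DemazureWeave β β'} (h : w.Equivalent w') : Sim Δ β β' w.vertices w'.vertices := by
  induction h with
  | rel w w' h => exact sim_of_localStep hΔ h
  | refl w => exact .refl w.isWeave
  | symm _ _ _ ih => exact ih.symm
  | trans _ _ _ _ _ ih ih' => exact ih.trans ih'

theorem DemazureWeave.topRow_fresh {N : Type*} [Fintype N] {w : DemazureWeave β β'}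
    (ν : Cycle M w ≃ N) (fl : ℕ → DecoratedFlag K d) {n : N} (hn : n ∈ names (w.labels ν)) :
    ∀ x ∈ topRow β M (ν ∘ .inl) fl, x.wt n = 0 :=
  topRow_wt_eq_zero ν fl <| by
    rintro ⟨q, rfl⟩
    obtain ⟨t, ht⟩ := mem_names_labels.1 hn
    simp at ht

/-- Decorated weaves that simulate each other have the same seeds. -/
theorem Decoration.Extends.seed_same {w w' : DemazureWeave β β'} {D : Decoration K M w}
    {D' : Decoration K M w'} (h : D.Extends 𝔡) (h' : D'.Extends 𝔡)
    (hs : Sim D.Δ β β' w.vertices w'.vertices) : D.seed.Same D'.seed := by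
  obtain ⟨Z, P, hr, hP, hZ, hf⟩ := D.run (Equiv.refl _)
  have hV := D.valid_topRow (Equiv.refl _)
  obtain ⟨W, hW, hN, hr'⟩ := hs.forward _ _ _ Z P (w.labels_map_fst _) (toRow_map_col _ _ _)
    (w.nodup_names_labels (Equiv.injective _)) (fun n hn => w.topRow_fresh _ _ hn) hV hr
  obtain ⟨ν, e0, -, e1, e2, e3, -⟩ := exists_equiv_of_run h h' (Equiv.refl _) hW hN hV hr'
  have e4 := (D.eq_of_run (Equiv.refl _) hV hr).2.2.1
  have f1 : ∀ c : Cycle M w, c.IsFrozen ↔ (ν.symm c).IsFrozen := fun c => by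
    rw [e4, e3, ν.apply_symm_apply]
    rfl
  have f2 : ∀ c e : Cycle M w, Cycle.pairing c e = Cycle.pairing (ν.symm c) (ν.symm e) := by
    intro c e
    rw [e2, ν.apply_symm_apply, ν.apply_symm_apply, ← hP]
    rfl
  have f3 : ∀ c : Cycle M w, D.Δ c = D'.Δ (ν.symm c) := fun c => by
    rw [e1, ν.apply_symm_apply]
    rfl
  exact ⟨ν.symm, f1, f2, f3⟩

theorem Decoration.Extends.seed_same_of_equivalent {w w' : DemazureWeave β β'}
    {D : Decoration K M w} {D' : Decoration K M w'} (h : D.Extends 𝔡) (h' : D'.Extends 𝔡)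
    (hw : w.Equivalent w') : D.seed.Same D'.seed :=
  h.seed_same h' (hw.sim D.Δ_ne_zero)

end Equivalence

/-! ### The mutation move -/

section Mutation

variable {K : Type*} [Field K] {d : ℕ} {N : Type*}

theorem RowStep.pairing_eq_zero {v : Vertex d} {o : Option N} {X X' : List (Letter K d N)}
    {P : N → N → ℤ} (h : RowStep v o X X' P) {n : N} (hn : o ≠ some n)
    (hX : ∀ x ∈ X, x.wt n = 0) (c : N) : P n c = 0 ∧ P c n = 0 := by
  obtain ⟨l, k, r⟩ := v
  obtain ⟨L, T, T', R, rfl, -, -, -, hK⟩ := h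
  have hT : ∀ x ∈ T, x.wt n = 0 := fun x hx => hX x (by simp [hx])
  cases k with
  | tri i =>
    obtain ⟨m, a, b, F₁, F₂, rfl, rfl, -, rfl⟩ := hK
    have : n ≠ m := fun h => hn (by rw [h])
    simp only [List.mem_cons, List.not_mem_nil, or_false, forall_eq_or_imp, forall_eq] at hT
    simp [triPairing, tripleDet_eq, hT, this]
  | four i j _ =>
    obtain ⟨a, b, F₁, F₂, G, -, -, -, rfl⟩ := hK
    simp
  | six i j _ =>
    obtain ⟨a, f, e, F₁, F₂, F₃, G₁, G₂, -, rfl, -, rfl⟩ := hK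
    simp only [List.mem_cons, List.not_mem_nil, or_false, forall_eq_or_imp, forall_eq] at hT
    simp [sixPairing, tripleDet_eq, hT]

/-- For a mutation move, this confines the pairings with the mutated cycle to the two trivalent
vertices of the move. -/
theorem Run.pairing_eq_zero [Fintype N] {Δ : N → K} {F : DecoratedFlag K d}
    {W : List (Vertex d × Option N)} {X Z : List (Letter K d N)} {P : N → N → ℤ}
    (h : Run Δ F W X Z P) {n : N} (hn : n ∉ names W) (hX : ∀ x ∈ X, x.wt n = 0) (c : N) :
    P n c = 0 ∧ P c n = 0 := by
  induction W generalizing X P with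
  | nil => simp [h.2]
  | cons w W ih =>
    obtain ⟨X', p, P', hs, hV, h, rfl⟩ := h
    have h1 : w.2 ≠ some n := fun e => hn (List.mem_filterMap.2 ⟨w, by simp, e⟩)
    have h2 : n ∉ names W := fun e => by
      obtain ⟨a, ha, e⟩ := List.mem_filterMap.1 e
      exact hn (List.mem_filterMap.2 ⟨a, by simp [ha], e⟩)
    obtain ⟨e1, e2⟩ := hs.pairing_eq_zero h1 hX c
    obtain ⟨e3, e4⟩ := ih h h2 (hs.wt_eq_zero h1 hX)
    simp [e1, e2, e3, e4]

/-- The local pairings before and after a mutation move. -/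
theorem mutation_pairing [DecidableEq N] {a b c : N → ℕ} {n₁ n₂ : N} (hn : n₁ ≠ n₂)
    (h₁ : a n₁ = 0 ∧ b n₁ = 0 ∧ c n₁ = 0) (h₂ : a n₂ = 0 ∧ b n₂ = 0 ∧ c n₂ = 0)
    {P₁ P₂ : N → N → ℤ} (hP₁ : ∀ k, P₁ n₁ k = 0 ∧ P₁ k n₁ = 0)
    (hP₂ : ∀ k, P₂ n₁ k = 0 ∧ P₂ k n₁ = 0) :
    let t := Function.update (a ⊓ b) n₁ 1
    let t' := Function.update (b ⊓ c) n₁ 1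
    let s := Function.update (t ⊓ c) n₂ 1
    let P := P₁ + (triPairing a t b + triPairing t s c + P₂)
    Function.update (a ⊓ t') n₂ 1 = s ∧ s n₁ = 0 ∧
      P₁ + (triPairing b t' c + triPairing a s t' + P₂) = mutateArrows P n₁ ∧
      (∀ k, P k n₁ = a k + c k - (b k + s k)) ∧ ∀ k, P n₁ k = b k + s k - (a k + c k) := by
  intro t t' s P
  -- The cycle `n₁` ends at the second vertex, where its minimum with `c n₁ = 0` is zero. The result
  -- is symmetric in the order in which the three lines are merged.
  have hs : s = Function.update (a ⊓ b ⊓ c) n₂ 1 := by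
    funext k
    by_cases h : k = n₂
    · simp [s, h]
    · by_cases h' : k = n₁
      · subst h'
        simp [s, t, hn, h₁]
      · simp [s, t, h, h']
  have hs1 : s n₁ = 0 := by simp [hs, hn, h₁]
  have e1 : ∀ k, P k n₁ = a k + c k - (b k + s k) := by
    intro k
    simp only [P, Pi.add_apply, triPairing, tripleDet_eq, h₁, hs1, hP₁, hP₂, t,
      Function.update_self]
    push_cast
    ring
  have e2 : ∀ k, P n₁ k = b k + s k - (a k + c k) := by
    intro k
    simp only [P, Pi.add_apply, triPairing, tripleDet_eq, h₁, hs1, hP₁, hP₂, t,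
      Function.update_self]
    push_cast
    ring
  refine ⟨?_, hs1, ?_, e1, e2⟩
  · rw [hs]
    funext k
    by_cases h : k = n₂
    · simp [h]
    · by_cases h' : k = n₁
      · subst h'
        simp [t', hn, h₁]
      · simp [t', h, h', inf_assoc]
  · funext k k'
    -- The first alternative is the cycle `n₂`, the others are the orders of the three values. The
    -- numbers `p` and `m` are the positive and negative part of the arrows between `k` and `n₁`,
    -- which enter the mutation formula.
    have region : ∀ k ≠ n₁, ∃ τ τ' σ p m : ℤ, (t k : ℤ) = τ ∧ (t' k : ℤ) = τ' ∧ (s k : ℤ) = σ ∧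
        max (a k + c k - (b k + s k) : ℤ) 0 = p ∧ min (a k + c k - (b k + s k) : ℤ) 0 = m ∧
        max (b k + s k - (a k + c k) : ℤ) 0 = -m ∧ min (b k + s k - (a k + c k) : ℤ) 0 = -p ∧
        (((a k : ℤ) = 0 ∧ (b k : ℤ) = 0 ∧ (c k : ℤ) = 0 ∧ τ = 0 ∧ τ' = 0 ∧ σ = 1 ∧ p = 0 ∧
            m = -1) ∨
          (τ = a k ∧ τ' = b k ∧ σ = a k ∧ p = c k - b k ∧ m = 0) ∨
          (τ = a k ∧ τ' = c k ∧ σ = a k ∧ p = 0 ∧ m = c k - b k) ∨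
          (τ = b k ∧ τ' = b k ∧ σ = b k ∧ p = a k + c k - 2 * b k ∧ m = 0) ∨
          (τ = a k ∧ τ' = c k ∧ σ = c k ∧ p = 0 ∧ m = a k - b k) ∨
          (τ = b k ∧ τ' = c k ∧ σ = c k ∧ p = a k - b k ∧ m = 0)) := by
      intro k h'
      refine ⟨_, _, _, _, _, rfl, rfl, rfl, rfl, rfl, by omega, by omega, ?_⟩
      by_cases h : k = n₂
      · subst h
        simp [t, t', s, h₂, h']
      · simp only [t, t', hs, Function.update_of_ne h, Function.update_of_ne h', Pi.inf_apply]
        omega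
    by_cases hk : k = n₁
    · subst hk
      simp [mutateArrows, P, hP₁, hP₂, triPairing, tripleDet_eq, h₁, hs1, t, t']
      ring
    by_cases hk' : k' = n₁
    · subst hk'
      simp [mutateArrows, P, hP₁, hP₂, triPairing, tripleDet_eq, h₁, hs1, t, t']
      ring
    simp only [mutateArrows, e1, e2, hk, hk', or_self, if_false]
    obtain ⟨τ, τ', σ, p, m, r1, r2, r3, r4, r5, r6, r7, R⟩ := region k hk
    obtain ⟨μ, μ', ρ, p', m', q1, q2, q3, q4, q5, q6, q7, Q⟩ := region k' hk'
    rw [r4, r5, q6, q7]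
    simp only [P, Pi.add_apply, triPairing, tripleDet_eq, r1, r2, r3, q1, q2, q3]
    clear r1 r2 r3 r4 r5 r6 r7 q1 q2 q3 q4 q5 q6 q7 e1 e2 region
    rcases R with ⟨x, y, z, rfl, rfl, rfl, rfl, rfl⟩ | R | R | R | R | R <;>
      rcases Q with ⟨x', y', z', rfl, rfl, rfl, rfl, rfl⟩ | Q | Q | Q | Q | Q <;>
      simp only [*] <;> ring

/-- The exchange relation. -/
theorem mutation_var [Fintype N] [DecidableEq N] {Δ Δ' : N → K} (hΔ : ∀ n, Δ n ≠ 0)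
    {a b c : N → ℕ} {n₁ n₂ : N} (hn : n₁ ≠ n₂)
    (h₁ : a n₁ = 0 ∧ b n₁ = 0 ∧ c n₁ = 0) (h₂ : a n₂ = 0 ∧ b n₂ = 0 ∧ c n₂ = 0)
    (h : ∀ n ≠ n₁, Δ' n = Δ n) {P : N → N → ℤ}
    (e : weightValue Δ (Function.update (a ⊓ b) n₁ 1) *
      weightValue Δ' (Function.update (b ⊓ c) n₁ 1) = weightValue Δ a * weightValue Δ c +
        weightValue Δ (Function.update (Function.update (a ⊓ b) n₁ 1 ⊓ c) n₂ 1) * weightValue Δ b)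
    (hP : ∀ k, P k n₁ = a k + c k -
      (b k + Function.update (Function.update (a ⊓ b) n₁ 1 ⊓ c) n₂ 1 k))
    (hP' : ∀ k, P n₁ k = b k + Function.update (Function.update (a ⊓ b) n₁ 1 ⊓ c) n₂ 1 k -
      (a k + c k)) : Δ' n₁ = mutateVar P Δ n₁ n₁ := by
  set s := Function.update (Function.update (a ⊓ b) n₁ 1 ⊓ c) n₂ 1 with hs
  have u1 : Function.update (a ⊓ b) n₁ 0 = a ⊓ b := by
    rw [Function.update_eq_self_iff]; simp [h₁]
  have u2 : Function.update (b ⊓ c) n₁ 0 = b ⊓ c := by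
    rw [Function.update_eq_self_iff]; simp [h₁]
  have u3 : weightValue Δ' (b ⊓ c) = weightValue Δ (b ⊓ c) :=
    weightValue_congr fun n hn => h n fun e => hn (by simp [e, h₁])
  rw [weightValue_update, weightValue_update, u1, u2, u3] at e
  -- The three-term relation has the common monomial with exponents `a ⊓ b + b ⊓ c`. What remains of
  -- its two summands are the monomials of the arrows to and from `n₁`.
  have key : ∀ k, (P k n₁).toNat + (a ⊓ b) k + (b ⊓ c) k = a k + c k ∧
      (P n₁ k).toNat + (a ⊓ b) k + (b ⊓ c) k = s k + b k := by
    intro k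
    have e3 := hP k
    have e4 := hP' k
    have e5 : (k = n₂ ∧ a k = 0 ∧ b k = 0 ∧ c k = 0 ∧ s k = 1) ∨
        s k = min (min (a k) (b k)) (c k) := by
      by_cases h : k = n₂
      · subst h
        simp [hs, h₂]
      · by_cases h' : k = n₁
        · subst h'
          simp [hs, hn, h₁]
        · simp [hs, h, h']
    simp only [Pi.inf_apply]
    omega
  have k1 : weightValue Δ (fun k => (P k n₁).toNat) * weightValue Δ (a ⊓ b) *
      weightValue Δ (b ⊓ c) = weightValue Δ a * weightValue Δ c := by
    rw [← weightValue_add, ← weightValue_add, ← weightValue_add]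
    exact congrArg _ (funext fun k => (key k).1)
  have k2 : weightValue Δ (fun k => (P n₁ k).toNat) * weightValue Δ (a ⊓ b) *
      weightValue Δ (b ⊓ c) = weightValue Δ s * weightValue Δ b := by
    rw [← weightValue_add, ← weightValue_add, ← weightValue_add]
    exact congrArg _ (funext fun k => (key k).2)
  rw [mutateVar, if_pos rfl, eq_div_iff (hΔ n₁)]
  change _ = weightValue Δ (fun k => (P k n₁).toNat) + weightValue Δ (fun k => (P n₁ k).toNat)
  refine mul_right_cancel₀ (mul_ne_zero (weightValue_ne_zero hΔ (a ⊓ b))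
    (weightValue_ne_zero hΔ (b ⊓ c))) ?_
  linear_combination e - k1 - k2

variable [Fintype N]

/-- Runs of two weaves that are related by a mutation move. -/
theorem run_mutation [DecidableEq N] {Δ Δ' : N → K} (hΔ : ∀ n, Δ n ≠ 0) {F : DecoratedFlag K d}
    {n₁ n₂ : N} {A B : List (Vertex d × Option N)} {l r : List (Color d)} {i : Color d}
    {X Z Z' : List (Letter K d N)} {P P' : N → N → ℤ}
    (hV : ValidRow Δ F X) (hX : ∀ n ∈ names A ++ [n₁, n₂] ++ names B, ∀ x ∈ X, x.wt n = 0)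
    (hN : (names A ++ [n₁, n₂] ++ names B).Nodup)
    (hS : ∀ n ∉ names A ++ [n₁, n₂] ++ names B, Δ n = Δ' n)
    (h : Run Δ F (A ++ [(⟨l, .tri i, i :: r⟩, some n₁), (⟨l, .tri i, r⟩, some n₂)] ++ B) X Z P)
    (h' : Run Δ' F (A ++ [(⟨l ++ [i], .tri i, r⟩, some n₁), (⟨l, .tri i, r⟩, some n₂)] ++ B)
      X Z' P') :
    Z = Z' ∧ (∀ z ∈ Z, z.wt n₁ = 0) ∧ (∀ n ≠ n₁, Δ' n = Δ n) ∧ P' = mutateArrows P n₁ ∧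
      Δ' n₁ = mutateVar P Δ n₁ n₁ := by
  rename_i inst
  -- `KindStep` is stated with classical decidability of equality of names.
  obtain rfl : inst = fun a b => Classical.propDecidable _ := Subsingleton.elim _ _
  have hA1 : n₁ ∉ names A := fun h => by
    rw [List.append_assoc, List.nodup_append] at hN
    exact hN.2.2 _ h _ (by simp) rfl
  have hA2 : n₂ ∉ names A := fun h => by
    rw [List.append_assoc, List.nodup_append] at hN
    exact hN.2.2 _ h _ (by simp) rfl
  have hB1 : n₁ ∉ names B := fun h => by
    rw [List.nodup_append] at hN
    exact hN.2.2 _ (by simp) _ h rfl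
  have hB2 : n₂ ∉ names B := fun h => by
    rw [List.nodup_append] at hN
    exact hN.2.2 _ (by simp) _ h rfl
  have hn : n₁ ≠ n₂ := by
    rw [List.append_assoc, List.nodup_append, List.nodup_append] at hN
    simpa using hN.2.1.1
  rw [run_append, ] at h h'
  obtain ⟨Y₂, P₁, P₃, h, hB, rfl⟩ := h
  obtain ⟨Y₂', P₁', P₃', h', hB', rfl⟩ := h'
  rw [run_append] at h h'
  obtain ⟨Y, PA, PT, hA, hT, rfl⟩ := h
  obtain ⟨Y', PA', PT', hA', hT', rfl⟩ := h'
  -- The runs agree above the move.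
  obtain ⟨rfl, rfl, eA⟩ := Run.unique hΔ (S := {n | n ∉ names A ++ [n₁, n₂] ++ names B}) hS
    (fun n hn => hX n (not_not.1 hn)) hA hA'
  have hY := hA.valid hV
  have hY1 := hA.wt_eq_zero hA1 (hX n₁ (by simp))
  have hY2 := hA.wt_eq_zero hA2 (hX n₂ (by simp))
  obtain ⟨Y₁, p, p', s, hV₁, ⟨_, q, _, s₂, hV₂, ⟨rfl, rfl⟩, rfl⟩, rfl⟩ := hT
  obtain ⟨Y₁', u, u', s', hV₁', ⟨_, v, _, s₂', hV₂', ⟨rfl, rfl⟩, rfl⟩, rfl⟩ := hT'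
  obtain ⟨L, T, T', R, rfl, rfl, hL, hR, n, a, b, F₁, F₂, hn', rfl, rfl, rfl⟩ := s
  obtain rfl := Option.some.inj hn'
  obtain ⟨⟨i, c, F₃⟩, R, rfl, rfl, hR⟩ := List.map_eq_cons_iff.1 hR
  have hl : L.length = l.length := by simpa using congrArg List.length hL
  classical
  have x1 : ∀ (x y : Letter K d N), L ++ [x] ++ y :: R = L ++ [x, y] ++ R := by simp
  rw [x1, rowStep_append_iff (by simp [hl]) rfl] at s₂
  obtain ⟨-, -, T', rfl, n, a₁, b₁, F₁', F₂', hn', hT, rfl, rfl⟩ := s₂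
  obtain rfl := Option.some.inj hn'
  simp only [List.cons.injEq, Letter.mk.injEq, true_and, and_true] at hT
  obtain ⟨⟨rfl, rfl⟩, rfl, rfl⟩ := hT
  have x2 : ∀ (x y z : Letter K d N), L ++ [x, y] ++ z :: R = (L ++ [x]) ++ [y, z] ++ R := by simp
  rw [x2, rowStep_append_iff (by simp [hl]) rfl] at s'
  obtain ⟨-, -, T', rfl, n, a₁, b₁, F₁', F₂', hn', hT, rfl, rfl⟩ := s'
  obtain rfl := Option.some.inj hn'
  simp only [List.cons.injEq, Letter.mk.injEq, true_and, and_true] at hT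
  obtain ⟨⟨rfl, rfl⟩, rfl, rfl⟩ := hT
  have x3 : ∀ (x y : Letter K d N), L ++ [x] ++ [y] ++ R = L ++ [x, y] ++ R := by simp
  rw [x3, rowStep_append_iff (by simp [hl]) rfl] at s₂'
  obtain ⟨-, -, T', rfl, n, a₁, b₁, F₁', F₂', hn', hT, rfl, rfl⟩ := s₂'
  obtain rfl := Option.some.inj hn'
  simp only [List.cons.injEq, Letter.mk.injEq, true_and, and_true] at hT
  obtain ⟨⟨rfl, rfl⟩, rfl, rfl⟩ := hT
  have h₁ : a n₁ = 0 ∧ b n₁ = 0 ∧ c n₁ = 0 :=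
    ⟨hY1 ⟨i, a, F₁⟩ (by simp), hY1 ⟨i, b, F₂⟩ (by simp), hY1 ⟨i, c, F₃⟩ (by simp)⟩
  have h₂ : a n₂ = 0 ∧ b n₂ = 0 ∧ c n₂ = 0 :=
    ⟨hY2 ⟨i, a, F₁⟩ (by simp), hY2 ⟨i, b, F₂⟩ (by simp), hY2 ⟨i, c, F₃⟩ (by simp)⟩
  have hLR : ∀ x ∈ L ++ R, x.wt n₁ = 0 := fun x hx => hY1 x (by
    rw [List.mem_append] at hx
    rcases hx with hx | hx <;> simp [hx])
  obtain ⟨m1, m2, -⟩ := mutation_pairing (P₁ := 0) (P₂ := 0) hn h₁ h₂ (by simp) (by simp)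
  rw [m1] at hB' hV₂'
  have hY3 : ∀ x ∈ L ++ [(⟨i, Function.update (Function.update (a ⊓ b) n₁ 1 ⊓ c) n₂ 1, F₃⟩ :
      Letter K d N)] ++ R, x.wt n₁ = 0 := by
    intro x hx
    simp only [List.mem_append, List.mem_singleton] at hx
    rcases hx with (hx | rfl) | hx
    · exact hLR x (by simp [hx])
    · exact m2
    · exact hLR x (by simp [hx])
  have hAS : ∀ n, n ≠ n₁ → n ≠ n₂ → n ∉ names B → Δ n = Δ' n := by
    intro n e1 e2 e3
    by_cases hA : n ∈ names A
    · exact eA n hA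
    · exact hS n (by simp [hA, e1, e2, e3])
  have hwt : ∀ x ∈ [(⟨i, a, F₁⟩ : Letter K d N), ⟨i, b, F₂⟩, ⟨i, c, F₃⟩], ∀ n ∈ names B,
      x.wt n = 0 := fun x hx n hn => hA.wt_eq_zero
        (fun h => by
          rw [List.append_assoc, List.nodup_append] at hN
          exact hN.2.2 _ h _ (by simp [hn]) rfl)
        (hX n (by simp [hn])) x (by
          simp only [List.mem_append, List.mem_cons] at hx ⊢
          tauto)
  simp only [List.mem_cons, List.not_mem_nil, or_false, forall_eq_or_imp, forall_eq] at hwt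
  obtain ⟨w1, w2, w3⟩ := hwt
  rw [show L ++ [(⟨i, a, F₁⟩ : Letter K d N), ⟨i, b, F₂⟩] ++ ⟨i, c, F₃⟩ :: R =
    L ++ [⟨i, a, F₁⟩, ⟨i, b, F₂⟩, ⟨i, c, F₃⟩] ++ R by simp] at hY
  rw [validRow_append, validRow_append] at hY hV₁ hV₂ hV₁' hV₂'
  have v1 := hY.1.2
  have v2 := hV₁.1.2
  have v3 := hV₂.1.2
  have v4 := hV₁'.1
  have v5 := hV₂'.1.2
  rw [validRow_append, endFlag_append] at v4
  simp only [ValidRow, endFlag, and_true] at v1 v2 v3 v4 v5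
  -- The edge below the move separates the same two flags with the same weights in both weaves, and
  -- `n₁` does not occur on it.
  have hS2 : Δ n₂ = Δ' n₂ := by
    have e := HasCrossingValue.unique v3.1 v3.2 v5.2
    rw [weightValue_update, weightValue_update] at e
    rw [weightValue_congr (Δ := Δ') (Δ' := Δ)] at e
    · exact mul_right_cancel₀ (weightValue_ne_zero hΔ _) e
    · intro n h
      by_cases e1 : n = n₁
      · subst e1
        simp [hn, h₁] at h
      · by_cases e2 : n = n₂
        · simp [e2] at h
        · refine (hAS n e1 e2 fun h' => h ?_).symm
          simp [e1, e2, w1 n h', w3 n h']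
  -- The runs agree below the move as well: the values at `n₁` may differ, but `n₁` has the weight
  -- zero on the row where these runs start.
  obtain ⟨rfl, rfl, eB⟩ := Run.unique hΔ (S := {n | n ≠ n₁ ∧ n ∉ names B})
    (fun n hn => by
      by_cases e : n = n₂
      · rw [e, hS2]
      · exact hAS n hn.1 e hn.2)
    (fun n hn x hx => by
      by_cases e : n = n₁
      · rw [e]
        exact hY3 x hx
      · have hnB : n ∈ names B := by
          by_contra h
          exact hn ⟨e, h⟩
        have e2 : n ≠ n₂ := fun h => hB2 (h ▸ hnB)
        have h0 := hA.wt_eq_zero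
          (fun h => by
            rw [List.append_assoc, List.nodup_append] at hN
            exact hN.2.2 _ h _ (by simp [hnB]) rfl)
          (hX n (by simp [hnB]))
        simp only [List.mem_append, List.mem_singleton] at hx
        rcases hx with (hx | rfl) | hx
        · exact h0 x (by simp [hx])
        · simp [e, e2, w1 n hnB, w3 n hnB]
        · exact h0 x (by simp [hx])) hB hB'
  have hne : ∀ n ≠ n₁, Δ' n = Δ n := by
    intro n e
    by_cases h : n ∈ names B
    · exact (eB n h).symm
    · by_cases e2 : n = n₂
      · rw [e2, hS2]
      · exact (hAS n e e2 h).symm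
  obtain ⟨-, -, m3, m4, m5⟩ := mutation_pairing hn h₁ h₂ (hA.pairing_eq_zero hA1 (hX n₁ (by simp)))
    (hB.pairing_eq_zero hB1 hY3)
  have z1 : ∀ p q s : N → N → ℤ, p + (q + (s + 0)) + P₃ = p + (q + s + P₃) := fun p q s => by
    rw [add_zero, add_assoc]
  rw [z1, z1, m1]
  refine ⟨rfl, hB.wt_eq_zero hB1 hY3, hne, m3, ?_⟩
  exact mutation_var hΔ hn h₁ h₂ hne
    (three_term_relation v1.1.1 v1.1.2 v1.2.1.1 v1.2.1.2 v1.2.2.1 v1.2.2.2 v2.1 v2.2 v4.2.1 v4.2.2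
      v3.1 v3.2) m4 m5

end Mutation

/-! ### Mutation equivalence of seeds from mutation equivalence of weaves -/

section MutationEquivalence

variable {K : Type*} [Field K] {d : ℕ} {β β' : List (Color d)} {M : Finset (Fin β.length)}
  {𝔡 : Fin (β.length + 1) → DecoratedFlag K d}

/-- A mutation move of the weave mutates the seed. -/
theorem Decoration.Extends.exists_mutate_same {w w' : DemazureWeave β β'} {D : Decoration K M w}
    {D' : Decoration K M w'} (h : D.Extends 𝔡) (h' : D'.Extends 𝔡)
    (hw : LocalStep MutationMove w w') :
    ∃ k : D.seed.I, ¬D.seed.frozen k ∧ mutateVar D.seed.arrows D.seed.var k k ≠ 0 ∧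
      (D.seed.mutate k).Same D'.seed := by
  obtain ⟨A₀, _, _, B₀, e, e', ⟨l, r, i⟩⟩ := hw
  let ν := Equiv.refl (Cycle M w)
  obtain ⟨Z, P, hr, hP, hZ, hf⟩ := D.run ν
  have hV := D.valid_topRow ν
  obtain ⟨W, hW⟩ : ∃ W, W = w.labels ν := ⟨_, rfl⟩
  have hW₀ := w.labels_map_fst ν
  have hnd := w.nodup_names_labels ν.injective
  have hmem := fun n => DemazureWeave.mem_names_labels (ν := ν) (n := n)
  have hfr := fun n hn => w.topRow_fresh ν (D.flag 0) (n := n) hn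
  have hsome := hr.isSome_eq
  rw [← hW] at hr hW₀ hnd hmem hsome hfr
  rw [e] at hW₀
  obtain ⟨W, B, rfl, hW₁, hB⟩ := List.map_eq_append_iff.1 hW₀
  obtain ⟨A, T, rfl, hA, hT⟩ := List.map_eq_append_iff.1 hW₁
  obtain ⟨⟨_, o₁⟩, T₁, rfl, rfl, hT₁⟩ := List.map_eq_cons_iff.1 hT
  obtain ⟨⟨_, o₂⟩, T₂, rfl, rfl, hT₂⟩ := List.map_eq_cons_iff.1 hT₁
  obtain rfl := List.map_eq_nil_iff.1 hT₂
  obtain ⟨n₁, rfl⟩ : ∃ n₁, o₁ = some n₁ :=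
    Option.isSome_iff_exists.1 (hsome (⟨l, .tri i, i :: r⟩, o₁) (by simp))
  obtain ⟨n₂, rfl⟩ : ∃ n₂, o₂ = some n₂ :=
    Option.isSome_iff_exists.1 (hsome (⟨l, .tri i, r⟩, o₂) (by simp))
  have hnames : ∀ v₁ v₂ : Vertex d, names (A ++ [(v₁, some n₁), (v₂, some n₂)] ++ B) =
      names A ++ [n₁, n₂] ++ names B := fun v₁ v₂ => by
    rw [names_append, names_append]
    rfl
  rw [hnames] at hnd hmem hfr
  -- The cycles of `w'` receive the names of the cycles of `w`. The upper vertex of the move is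
  -- called `n₁` in both weaves, and the lower one `n₂`.
  obtain ⟨ν', hν, hW'⟩ := exists_labels (w := w') (μ := ν ∘ .inl)
    (W := A ++ [(⟨l ++ [i], .tri i, r⟩, some n₁), (⟨l, .tri i, r⟩, some n₂)] ++ B)
    (ν.injective.comp Sum.inl_injective) (by simp [e', hA, hB])
    (fun u hu => by
      simp only [List.mem_append, List.mem_cons, List.not_mem_nil, or_false] at hu
      rcases hu with (hu | rfl | rfl) | hu
      · exact hsome u (by simp [hu])
      · rfl
      · rfl
      · exact hsome u (by simp [hu]))
    (by rwa [hnames])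
    (fun q hq => by
      rw [hnames, hmem] at hq
      obtain ⟨t, ht⟩ := hq
      simp [ν] at ht)
    (fun n => by
      rw [hnames, hmem]
      rcases n with q | t
      · exact Or.inl ⟨q, rfl⟩
      · exact Or.inr ⟨t, rfl⟩)
  obtain ⟨Z', P', hr', hP', hZ', hf'⟩ := D'.run ν'
  have hV' := D'.valid_topRow ν'
  rw [hW', hν, h'.flag_eq h, h'.topRow_eq h] at hr'
  rw [hν, h'.flag_eq h, h'.topRow_eq h] at hV'
  obtain ⟨rfl, z1, z2, rfl, z3⟩ := run_mutation (fun n => D.Δ_ne_zero _) hV hfr hnd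
    (fun n hn => by
      rcases n with q | t
      · exact topRow_marked_eq ν hV hV' rfl q
      · exact absurd ((hmem (.inr t)).2 ⟨t, rfl⟩) hn) hr hr'
  have hn₁ : ¬∃ q, ν (.inl q) = n₁ := by
    rintro ⟨q, hq⟩
    obtain ⟨t, ht⟩ := (hmem n₁).1 (by simp)
    rw [← hq] at ht
    simp at ht
  have hPP : P = Cycle.pairing := funext fun c => funext fun e => hP c e
  have f1 : ∀ c : Cycle M w, c.IsFrozen ↔ (ν'.symm c).IsFrozen := fun c => by
    have e1 := hf c
    have e2 := hf' (ν'.symm c)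
    rw [ν'.apply_symm_apply] at e2
    rw [Cycle.IsFrozen, Cycle.IsFrozen, ← e1, ← e2]
    refine or_congr ?_ Iff.rfl
    have hinl : ∀ q, ν'.symm (.inl q) = .inl q := fun q => by
      rw [Equiv.symm_apply_eq]
      exact (congrFun hν q).symm
    rcases c with q | t
    · simp [hinl]
    · rcases ht : ν'.symm (.inr t) with q | t'
      · rw [← hinl, ν'.symm.injective.eq_iff] at ht
        simp at ht
      · rfl
  have f2 : ∀ c e : Cycle M w, mutateArrows Cycle.pairing n₁ c e =
      Cycle.pairing (ν'.symm c) (ν'.symm e) := fun c e => by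
    rw [← hP', ν'.apply_symm_apply, ν'.apply_symm_apply, hPP]
  have f3 : ∀ c : Cycle M w, mutateVar Cycle.pairing D.Δ n₁ c = D'.Δ (ν'.symm c) := fun c => by
    by_cases hc : c = n₁
    · subst hc
      rw [← hPP]
      exact z3.symm
    · rw [mutateVar, if_neg hc]
      exact (z2 c hc).symm
  refine ⟨n₁, ?_, ?_, ν'.symm, f1, f2, f3⟩
  · rintro (hc | hc)
    · rcases n₁ with q | t
      · exact hn₁ ⟨q, rfl⟩
      · simp at hc
    · obtain ⟨z, hz, hz'⟩ := (hf n₁).2 hc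
      exact hz' (z1 z hz)
  -- The mutated variable is a variable of the decorated weave `w'` and hence nonzero, so this
  -- mutation can be reversed.
  · exact fun hc => D'.Δ_ne_zero (ν'.symm n₁) ((f3 n₁).symm.trans hc)

theorem Decoration.Extends.mutationEquivalent_of_localStep {w w' : DemazureWeave β β'}
    {D : Decoration K M w} {D' : Decoration K M w'} (h : D.Extends 𝔡) (h' : D'.Extends 𝔡)
    (hw : LocalStep EquivMove w w' ∨ LocalStep MutationMove w w') :
    D.seed.MutationEquivalent D'.seed ∧ D'.seed.MutationEquivalent D.seed := by
  rcases hw with hw | hw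
  · have := h.seed_same h' (sim_of_localStep D.Δ_ne_zero hw)
    exact ⟨.same this, .same this.symm⟩
  · obtain ⟨k, hk, hk', hs⟩ := h.exists_mutate_same h' hw
    refine ⟨.mutate k hk (.same hs), hs.symm.mutationEquivalent_trans (.mutate k hk (.same ?_))⟩
    exact Seed.mutate_mutate_same _ k hk'

/-- Mutation equivalent weaves have mutation equivalent seeds. -/
theorem IsExtendable.mutationEquivalent (hE : IsExtendable M 𝔡) {w w' : DemazureWeave β β'}
    (hw : w.MutationEquivalent w') {D : Decoration K M w} {D' : Decoration K M w'}
    (h : D.Extends 𝔡) (h' : D'.Extends 𝔡) :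
    D.seed.MutationEquivalent D'.seed ∧ D'.seed.MutationEquivalent D.seed := by
  induction hw with
  | rel w w' hw => exact h.mutationEquivalent_of_localStep h' hw
  | refl w =>
    have := h.seed_same_of_equivalent h' (.refl w)
    exact ⟨.same this, .same this.symm⟩
  | symm _ _ _ ih => exact (ih h' h).symm
  | trans _ u _ _ _ ih ih' =>
    -- Extendability is needed here: the intermediate weave must have a seed.
    obtain ⟨D'', h''⟩ := hE _ u
    exact ⟨(ih h h'').1.trans (ih' h'' h').1, (ih' h'' h').2.trans (ih h h'').2⟩

end MutationEquivalence

/-! ### Calculus of mutation equivalent weaves -/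

section Calculus

variable {d : ℕ}

/-- The lists of vertices `x` and `y` are mutation equivalent weaves. -/
def WeaveEquiv (α γ : List (Color d)) (x y : List (Vertex d)) : Prop :=
  ∃ (hx : IsWeave α x γ) (hy : IsWeave α y γ),
    (⟨x, hx⟩ : DemazureWeave α γ).MutationEquivalent ⟨y, hy⟩

variable {α γ δ : List (Color d)} {x y z : List (Vertex d)}

theorem WeaveEquiv.left (h : WeaveEquiv α γ x y) : IsWeave α x γ := h.1

theorem WeaveEquiv.right (h : WeaveEquiv α γ x y) : IsWeave α y γ := h.2.1

theorem WeaveEquiv.refl (h : IsWeave α x γ) : WeaveEquiv α γ x x := ⟨h, h, .refl _⟩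

theorem WeaveEquiv.symm (h : WeaveEquiv α γ x y) : WeaveEquiv α γ y x :=
  ⟨h.2.1, h.1, .symm _ _ h.2.2⟩

theorem WeaveEquiv.trans (h : WeaveEquiv α γ x y) (h' : WeaveEquiv α γ y z) :
    WeaveEquiv α γ x z :=
  ⟨h.1, h'.2.1, .trans _ _ _ h.2.2 h'.2.2⟩

theorem WeaveEquiv.context {a b : List (Vertex d)} {α₀ γ₀ : List (Color d)}
    (h : WeaveEquiv α γ x y) (ha : IsWeave α₀ a α) (hb : IsWeave γ b γ₀) :
    WeaveEquiv α₀ γ₀ (a ++ x ++ b) (a ++ y ++ b) := by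
  have key : ∀ z, IsWeave α z γ → IsWeave α₀ (a ++ z ++ b) γ₀ := fun z hz =>
    isWeave_append.2 ⟨γ, isWeave_append.2 ⟨α, ha, hz⟩, hb⟩
  obtain ⟨hx, hy, h⟩ := h
  refine ⟨key x hx, key y hy, ?_⟩
  have main : ∀ w w' : DemazureWeave α γ, w.MutationEquivalent w' →
      (⟨_, key _ w.isWeave⟩ : DemazureWeave α₀ γ₀).MutationEquivalent ⟨_, key _ w'.isWeave⟩ := by
    intro w w' h
    induction h with
    | rel w w' h =>
      refine .rel _ _ (h.imp ?_ ?_) <;>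
      · rintro ⟨u, x, y, v, e, e', h⟩
        exact ⟨a ++ u, x, y, v ++ b, by simp [e], by simp [e'], h⟩
    | refl w => exact .refl _
    | symm _ _ _ ih => exact .symm _ _ ih
    | trans _ _ _ _ _ ih ih' => exact .trans _ _ _ ih ih'
  exact main _ _ h

theorem WeaveEquiv.append {x' y' : List (Vertex d)} (h : WeaveEquiv α γ x y)
    (h' : WeaveEquiv γ δ x' y') : WeaveEquiv α δ (x ++ x') (y ++ y') := by
  have h1 := h.context (a := []) rfl h'.left
  have h2 := h'.context (b := []) h.right rfl
  simp only [List.nil_append, List.append_nil] at h1 h2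
  exact h1.trans h2

theorem weaveEquiv_of_move (h : EquivMove x y ∨ MutationMove x y) (hx : IsWeave α x γ)
    (hy : IsWeave α y γ) : WeaveEquiv α γ x y :=
  ⟨hx, hy, .rel _ _ (h.imp (fun h => ⟨[], x, y, [], by simp, by simp, h⟩)
    fun h => ⟨[], x, y, [], by simp, by simp, h⟩)⟩

theorem EquivMove.extend (h : EquivMove x y) (l r : List (Color d)) :
    EquivMove (x.map (Vertex.extend l r)) (y.map (Vertex.extend l r)) := by
  cases h with
  | isotopy l' m r' k₁ k₂ =>
    simpa [Vertex.extend] using EquivMove.isotopy (l ++ l') m (r' ++ r) k₁ k₂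
  | braid x y α α' hx hy hx' hy' =>
    refine .braid _ _ (l ++ α ++ r) (l ++ α' ++ r) (hx.extend l r) (hy.extend l r) ?_ ?_
    · simpa [Vertex.extend] using hx'
    · simpa [Vertex.extend] using hy'
  | pushBelow l' r' i j h =>
    simpa [Vertex.extend] using EquivMove.pushBelow (l ++ l') (r' ++ r) i j h
  | pushBelowMirror l' r' i j h =>
    simpa [Vertex.extend] using EquivMove.pushBelowMirror (l ++ l') (r' ++ r) i j h
  | pushAbove l' r' i j h =>
    simpa [Vertex.extend] using EquivMove.pushAbove (l ++ l') (r' ++ r) i j h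
  | pushAboveMirror l' r' i j h =>
    simpa [Vertex.extend] using EquivMove.pushAboveMirror (l ++ l') (r' ++ r) i j h
  | passThrough l' r' i j h =>
    simpa [Vertex.extend] using EquivMove.passThrough (l ++ l') (r' ++ r) i j h
  | passThroughMirror l' r' i j h =>
    simpa [Vertex.extend] using EquivMove.passThroughMirror (l ++ l') (r' ++ r) i j h

theorem MutationMove.extend (h : MutationMove x y) (l r : List (Color d)) :
    MutationMove (x.map (Vertex.extend l r)) (y.map (Vertex.extend l r)) := by
  obtain ⟨l', r', i⟩ := h
  simpa [Vertex.extend] using MutationMove.mk (l ++ l') (r' ++ r) i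

theorem WeaveEquiv.extend (h : WeaveEquiv α γ x y) (l r : List (Color d)) :
    WeaveEquiv (l ++ α ++ r) (l ++ γ ++ r) (x.map (Vertex.extend l r))
      (y.map (Vertex.extend l r)) := by
  obtain ⟨hx, hy, h⟩ := h
  refine ⟨hx.extend l r, hy.extend l r, ?_⟩
  have main : ∀ w w' : DemazureWeave α γ, w.MutationEquivalent w' →
      (⟨_, w.isWeave.extend l r⟩ : DemazureWeave (l ++ α ++ r) (l ++ γ ++ r)).MutationEquivalent
        ⟨_, w'.isWeave.extend l r⟩ := by
    intro w w' h
    induction h with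
    | rel w w' h =>
      refine .rel _ _ (h.imp ?_ ?_)
      · rintro ⟨u, x, y, v, e, e', h⟩
        exact ⟨u.map (Vertex.extend l r), _, _, v.map (Vertex.extend l r), by simp only [e, List.map_append], by simp only [e', List.map_append],
          h.extend l r⟩
      · rintro ⟨u, x, y, v, e, e', h⟩
        exact ⟨u.map (Vertex.extend l r), _, _, v.map (Vertex.extend l r), by simp only [e, List.map_append], by simp only [e', List.map_append],
          h.extend l r⟩
    | refl w => exact .refl _
    | symm _ _ _ ih => exact .symm _ _ ih
    | trans _ _ _ _ _ ih ih' => exact .trans _ _ _ ih ih'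
  exact main _ _ h

theorem map_extend_extend (l l' r r' : List (Color d)) (x : List (Vertex d)) :
    (x.map (Vertex.extend l r)).map (Vertex.extend l' r') =
      x.map (Vertex.extend (l' ++ l) (r ++ r')) := by
  simp [Vertex.extend, Function.comp_def]

/-- A vertex moves past a weave to its left. -/
theorem weaveEquiv_isotopy (hx : IsWeave α x γ) (k : VertexKind d) :
    WeaveEquiv (α ++ k.top) (γ ++ k.bot) (⟨α, k, []⟩ :: x.map (Vertex.extend [] k.bot))
      (x.map (Vertex.extend [] k.top) ++ [⟨γ, k, []⟩]) := by
  induction x generalizing α with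
  | nil =>
    obtain rfl := hx
    exact .refl ⟨by simp [Vertex.top], by simp [Vertex.bot, IsWeave]⟩
  | cons v x ih =>
    obtain ⟨rfl, hx⟩ := hx
    have h1 : WeaveEquiv (v.top ++ k.top) (v.bot ++ k.bot)
        [⟨v.top, k, []⟩, v.extend [] k.bot] [v.extend [] k.top, ⟨v.bot, k, []⟩] := by
      refine (weaveEquiv_of_move (.inl ?_) ?_ ?_).symm
      · simpa [Vertex.extend, Vertex.top, Vertex.bot] using
          EquivMove.isotopy v.left v.right [] v.kind k
      · simp [IsWeave, Vertex.extend, Vertex.top, Vertex.bot]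
      · simp [IsWeave, Vertex.extend, Vertex.top, Vertex.bot]
    have h2 := h1.append (.refl (hx.extend [] k.bot))
    have h3 := (ih hx).context (a := [v.extend [] k.top]) (b := []) (α₀ := v.top ++ k.top)
      ⟨by simp [Vertex.extend, Vertex.top], by simp [Vertex.extend, Vertex.bot, IsWeave]⟩ rfl
    simp only [List.cons_append, List.nil_append, List.append_nil, List.map_cons] at h2 h3 ⊢
    exact h2.trans h3

/-- Weaves without trivalent vertices between the words `ρ` and `σ`. -/
def IsBraid (ρ : List (Color d)) (x : List (Vertex d)) (σ : List (Color d)) : Prop :=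
  IsWeave ρ x σ ∧ ∀ v ∈ x, v.kind.isTri = false

theorem IsBraid.nil (ρ : List (Color d)) : IsBraid ρ [] ρ := ⟨rfl, by simp⟩

theorem IsBraid.append (h : IsBraid α x γ) (h' : IsBraid γ y δ) : IsBraid α (x ++ y) δ :=
  ⟨isWeave_append.2 ⟨γ, h.1, h'.1⟩, by
    intro v hv
    rcases List.mem_append.1 hv with hv | hv
    · exact h.2 v hv
    · exact h'.2 v hv⟩

theorem IsBraid.extend (h : IsBraid α x γ) (l r : List (Color d)) :
    IsBraid (l ++ α ++ r) (x.map (Vertex.extend l r)) (l ++ γ ++ r) :=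
  ⟨h.1.extend l r, by simpa [Vertex.extend] using h.2⟩

theorem IsBraid.weaveEquiv (h : IsBraid α x γ) (h' : IsBraid α y γ) : WeaveEquiv α γ x y :=
  weaveEquiv_of_move (.inl (.braid x y α γ h.1 h'.1 h.2 h'.2)) h.1 h'.1

theorem isBraid_four (l r : List (Color d)) {i j : Color d} (h : Distant i j) :
    IsBraid (l ++ [i, j] ++ r) [⟨l, .four i j h, r⟩] (l ++ [j, i] ++ r) :=
  ⟨⟨rfl, rfl⟩, by simp [VertexKind.isTri]⟩

theorem isBraid_six (l r : List (Color d)) {i j : Color d} (h : Adjacent i j) :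
    IsBraid (l ++ [i, j, i] ++ r) [⟨l, .six i j h, r⟩] (l ++ [j, i, j] ++ r) :=
  ⟨⟨rfl, rfl⟩, by simp [VertexKind.isTri]⟩

theorem IsBraid.exists_symm (h : IsBraid α x γ) : ∃ y, IsBraid γ y α := by
  induction x generalizing α with
  | nil =>
    obtain rfl : α = γ := h.1
    exact ⟨[], .nil _⟩
  | cons v x ih =>
    obtain ⟨⟨rfl, hx⟩, hv⟩ := h
    obtain ⟨y, hy⟩ := ih ⟨hx, fun u hu => hv u (List.mem_cons_of_mem _ hu)⟩
    obtain ⟨l, k, r⟩ := v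
    cases k with
    | tri i => simpa [VertexKind.isTri] using hv ⟨l, .tri i, r⟩ (by simp)
    | four i j h => exact ⟨_, hy.append (isBraid_four l r h.symm)⟩
    | six i j h => exact ⟨_, hy.append (isBraid_six l r h.symm)⟩

end Calculus

/-! ### Reduced words -/

section Reduced

variable {d : ℕ}

/-- The right action of the adjacent transposition `(i, i + 1)` on functions. -/
def swapAt (π : ℕ → ℕ) (i : Color d) : ℕ → ℕ := fun k =>
  if k = i then π (i + 1) else if k = (i : ℕ) + 1 then π i else π k

/-- The right action of a word on functions. -/
def actWord (π : ℕ → ℕ) (ρ : List (Color d)) : ℕ → ℕ := ρ.foldl swapAt π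

/-- The function `π` increases between `i` and `i + 1`. -/
def Ascent (π : ℕ → ℕ) (i : Color d) : Prop := π i < π (i + 1)

/-- Each letter of the word, in its turn, exchanges two neighboring values that are in order. -/
def Reduced : (ℕ → ℕ) → List (Color d) → Prop
  | _, [] => True
  | π, i :: ρ => Ascent π i ∧ Reduced (swapAt π i) ρ

instance (π : ℕ → ℕ) (i : Color d) : Decidable (Ascent π i) := by
  unfold Ascent
  infer_instance

/-- The right action of a word in the 0-Hecke monoid. -/
def demazureAct (π : ℕ → ℕ) (β : List (Color d)) : ℕ → ℕ :=
  β.foldl (fun π i => if Ascent π i then swapAt π i else π) π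

theorem actWord_append (π : ℕ → ℕ) (ρ σ : List (Color d)) :
    actWord π (ρ ++ σ) = actWord (actWord π ρ) σ := List.foldl_append

theorem demazureAct_append (π : ℕ → ℕ) (ρ σ : List (Color d)) :
    demazureAct π (ρ ++ σ) = demazureAct (demazureAct π ρ) σ := List.foldl_append

theorem reduced_append {π : ℕ → ℕ} {ρ σ : List (Color d)} :
    Reduced π (ρ ++ σ) ↔ Reduced π ρ ∧ Reduced (actWord π ρ) σ := by
  induction ρ generalizing π with
  | nil => simp [Reduced, actWord]
  | cons i ρ ih =>
    simp only [List.cons_append, Reduced, ih, and_assoc]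
    rfl

theorem reduced_concat {π : ℕ → ℕ} {ρ : List (Color d)} {i : Color d} :
    Reduced π (ρ ++ [i]) ↔ Reduced π ρ ∧ Ascent (actWord π ρ) i := by
  simp [reduced_append, Reduced]

theorem swapAt_swapAt (π : ℕ → ℕ) (i : Color d) : swapAt (swapAt π i) i = π := by
  funext k
  simp only [swapAt]
  split_ifs <;> simp_all

theorem swapAt_injective (i : Color d) : Function.Injective fun π => swapAt π i := fun π π' h => by
  rw [← swapAt_swapAt π i, ← swapAt_swapAt π' i]
  exact congrArg (fun π => swapAt π i) h

theorem not_ascent_swapAt {π : ℕ → ℕ} {i : Color d} (h : Ascent π i) :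
    ¬Ascent (swapAt π i) i := by
  simp only [Ascent, swapAt] at *
  simp
  omega

/-- The braid relations for the action on functions. For a 6-valent vertex, both words are reduced
exactly if the three values of `π` concerned are increasing. -/
theorem reduced_iff_of_kind (π : ℕ → ℕ) {k : VertexKind d} (hk : k.isTri = false) :
    (Reduced π k.top ↔ Reduced π k.bot) ∧ actWord π k.top = actWord π k.bot := by
  cases k with
  | tri i => simp [VertexKind.isTri] at hk
  | four i j h =>
    simp only [VertexKind.top, VertexKind.bot, Reduced, actWord, List.foldl, and_true]
    obtain ⟨h1, h2, h3⟩ : (j : ℕ) ≠ i ∧ (j : ℕ) ≠ i + 1 ∧ (i : ℕ) ≠ j + 1 := by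
      rw [Distant] at h
      omega
    constructor
    · simp [Ascent, swapAt, h1, h1.symm, h2, h2.symm, h3, h3.symm, and_comm]
    · funext k
      by_cases g1 : k = i
      · simp [swapAt, g1, h1.symm, h2.symm, h3]
      by_cases g2 : k = i + 1
      · simp [swapAt, g2, h1.symm, h2.symm, h3]
      · simp [swapAt, g1, g2, h1, h2, h3.symm]
  | six i j h =>
    have e1 : ∀ n : ℕ, (n = n + 1 + 1) = False := fun n => by simp [add_assoc]
    have e2 : ∀ n : ℕ, (n + 1 + 1 = n) = False := fun n => by simp [add_assoc]
    simp only [VertexKind.top, VertexKind.bot, Reduced, actWord, List.foldl, and_true]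
    rcases h with h | h
    · constructor
      · simp only [Ascent, swapAt, ← h]
        simp [e1, e2]
        omega
      · funext k
        by_cases h1 : k = (i : ℕ)
        · simp [swapAt, e1, e2, ← h, h1]
        by_cases h2 : k = (i : ℕ) + 1
        · simp [swapAt, e1, e2, ← h, h2]
        by_cases h3 : k = (i : ℕ) + 1 + 1
        · simp [swapAt, e1, e2, ← h, h3]
        · simp [swapAt, ← h, h1, h2, h3]
    · constructor
      · simp only [Ascent, swapAt, ← h]
        simp [e1, e2]
        omega
      · funext k
        by_cases h1 : k = (j : ℕ)
        · simp [swapAt, e1, e2, ← h, h1]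
        by_cases h2 : k = (j : ℕ) + 1
        · simp [swapAt, e1, e2, ← h, h2]
        by_cases h3 : k = (j : ℕ) + 1 + 1
        · simp [swapAt, e1, e2, ← h, h3]
        · simp [swapAt, ← h, h1, h2, h3]

theorem IsBraid.reduced {π : ℕ → ℕ} {ρ σ : List (Color d)} {x : List (Vertex d)}
    (h : IsBraid ρ x σ) :
    (Reduced π ρ ↔ Reduced π σ) ∧ actWord π ρ = actWord π σ := by
  induction x generalizing ρ with
  | nil =>
    obtain rfl : ρ = σ := h.1
    exact ⟨Iff.rfl, rfl⟩
  | cons v x ih =>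
    obtain ⟨⟨rfl, hx⟩, hv⟩ := h
    obtain ⟨e1, e2⟩ := ih ⟨hx, fun u hu => hv u (List.mem_cons_of_mem _ hu)⟩
    obtain ⟨e3, e4⟩ := reduced_iff_of_kind (actWord π v.left) (hv v (List.mem_cons_self ..))
    rw [← e1, ← e2]
    simp only [Vertex.top, Vertex.bot, reduced_append, actWord_append, e3, e4, and_self]

theorem IsBraid.length_eq {ρ σ : List (Color d)} {x : List (Vertex d)} (h : IsBraid ρ x σ) :
    ρ.length = σ.length := by
  induction x generalizing ρ with
  | nil =>
    obtain rfl : ρ = σ := h.1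
    rfl
  | cons v x ih =>
    obtain ⟨⟨rfl, hx⟩, hv⟩ := h
    rw [← ih ⟨hx, fun u hu => hv u (List.mem_cons_of_mem _ hu)⟩]
    have := hv v (List.mem_cons_self ..)
    obtain ⟨l, k, r⟩ := v
    cases k with
    | tri i => simp [VertexKind.isTri] at this
    | four i j h => simp [Vertex.top, Vertex.bot, VertexKind.top, VertexKind.bot]
    | six i j h => simp [Vertex.top, Vertex.bot, VertexKind.top, VertexKind.bot]

/-- The hypotheses fix enough of the order of three consecutive values of `π`. In the exchange
property this exposes the last letters of a word of the form `jij`. -/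
theorem not_ascent_of_adjacent {π : ℕ → ℕ} {i j : Color d} (h : Adjacent i j)
    (hi : ¬Ascent (swapAt π j) i) (hj : Ascent π j) :
    ¬Ascent π i ∧ ¬Ascent (swapAt π i) j := by
  have e1 : ∀ n : ℕ, (n = n + 1 + 1) = False := fun n => by simp [add_assoc]
  have e2 : ∀ n : ℕ, (n + 1 + 1 = n) = False := fun n => by simp [add_assoc]
  simp only [Ascent, swapAt] at hi hj ⊢
  rcases h with h | h
  · simp only [← h] at hi hj ⊢
    simp [e1, e2] at hi hj ⊢
    omega
  · simp only [← h] at hi hj ⊢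
    simp [e1, e2] at hi hj ⊢
    omega

/-- The exchange property. -/
theorem exists_isBraid_concat {ρ : List (Color d)} (h : Reduced id ρ) {i : Color d}
    (hi : ¬Ascent (actWord id ρ) i) : ∃ ρ' x, IsBraid ρ x (ρ' ++ [i]) := by
  induction hn : ρ.length using Nat.strong_induction_on generalizing ρ i with
  | _ n ih =>
    subst hn
    rcases List.eq_nil_or_concat ρ with rfl | ⟨ρ₀, j, rfl⟩
    · simp [actWord, Ascent] at hi
    rw [List.concat_eq_append] at *
    obtain ⟨h₀, hj⟩ := reduced_concat.1 h
    rw [actWord_append] at hi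
    change ¬Ascent (swapAt (actWord id ρ₀) j) i at hi
    have ih₀ : ∀ {i}, ¬Ascent (actWord id ρ₀) i → ∃ ρ' x, IsBraid ρ₀ x (ρ' ++ [i]) := fun hi =>
      ih _ (by simp) h₀ hi rfl
    rcases color_trichotomy i j with rfl | hij | hij
    · exact ⟨ρ₀, [], .nil _⟩
    · obtain ⟨ρ₁, x, hx⟩ := ih₀ (i := i) (by
        simp only [Ascent, swapAt, Distant] at *
        split_ifs at hi <;> omega)
      refine ⟨ρ₁ ++ [j], _, (hx.extend [] [j]).append (y := [⟨ρ₁, .four i j hij, []⟩]) ?_⟩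
      simpa using isBraid_four ρ₁ [] hij
    · obtain ⟨hi, hj'⟩ := not_ascent_of_adjacent hij hi hj
      obtain ⟨ρ₁, x, hx⟩ := ih₀ hi
      obtain ⟨h₁, h₁'⟩ := reduced_concat.1 (hx.reduced.1.1 h₀)
      have e := (hx.reduced (π := id)).2
      rw [actWord_append] at e
      change _ = swapAt _ _ at e
      have hlen := hx.length_eq
      -- Now `ρ₀` becomes `ρ₁ i`, and `ρ₁` becomes `ρ₂ j`. So the whole word becomes `ρ₂ jij`, and a
      -- last braid move makes it `ρ₂ iji`.
      obtain ⟨ρ₂, y, hy⟩ := ih ρ₁.length (by simp at hlen ⊢; omega) h₁ (i := j) (by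
        rwa [e, swapAt_swapAt] at hj') rfl
      refine ⟨ρ₂ ++ [i, j], _, ((hx.extend [] [j]).append
        (y := y.map (Vertex.extend [] [i, j])) (δ := ρ₂ ++ [j, i, j]) ?_).append
        (y := [⟨ρ₂, .six j i hij.symm, []⟩]) ?_⟩
      · simpa using hy.extend [] [i, j]
      · simpa using isBraid_six ρ₂ [] hij.symm

/-- Reduced words of the same permutation are related by braid moves. -/
theorem exists_isBraid {ρ σ : List (Color d)} (hρ : Reduced id ρ) (hσ : Reduced id σ)
    (h : actWord id ρ = actWord id σ) : ∃ x, IsBraid ρ x σ := by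
  induction hn : ρ.length generalizing ρ σ with
  | zero =>
    obtain rfl := List.length_eq_zero_iff.1 hn
    rcases List.eq_nil_or_concat σ with rfl | ⟨σ₀, j, rfl⟩
    · exact ⟨[], .nil _⟩
    rw [List.concat_eq_append, reduced_concat] at hσ
    have := not_ascent_swapAt hσ.2
    rw [List.concat_eq_append, actWord_append] at h
    change _ = swapAt _ _ at h
    rw [← h] at this
    simp [actWord, Ascent] at this
  | succ n ih =>
    rcases List.eq_nil_or_concat ρ with rfl | ⟨ρ₀, i, rfl⟩
    · simp at hn
    rw [List.concat_eq_append] at *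
    obtain ⟨h₀, hi⟩ := reduced_concat.1 hρ
    rw [actWord_append] at h
    change swapAt _ _ = _ at h
    obtain ⟨σ₀, x, hx⟩ := exists_isBraid_concat hσ (h ▸ not_ascent_swapAt hi)
    have e := (hx.reduced (π := id)).2
    rw [actWord_append] at e
    obtain ⟨y, hy⟩ := ih h₀ (reduced_concat.1 (hx.reduced.1.1 hσ)).1
      (swapAt_injective i (h.trans e)) (by simpa using hn)
    obtain ⟨x', hx'⟩ := hx.exists_symm
    exact ⟨_, (by simpa using hy.extend [] [i] : IsBraid _ (y.map (Vertex.extend [] [i])) _).append hx'⟩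

theorem demazureAct_of_reduced {π : ℕ → ℕ} {ρ : List (Color d)} (h : Reduced π ρ) :
    demazureAct π ρ = actWord π ρ := by
  induction ρ generalizing π with
  | nil => rfl
  | cons i ρ ih =>
    have := ih h.2
    simp only [demazureAct, actWord, List.foldl, h.1, if_true] at this ⊢
    exact this

theorem ascent_swapAt_of_distant {π : ℕ → ℕ} {i j : Color d} (h : Distant i j) :
    Ascent (swapAt π j) i ↔ Ascent π i := by
  obtain ⟨h1, h2, h3⟩ : (j : ℕ) ≠ i ∧ (j : ℕ) ≠ i + 1 ∧ (i : ℕ) ≠ j + 1 := by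
    rw [Distant] at h
    omega
  simp [Ascent, swapAt, h1.symm, h2.symm, h3]

/-- The operators that exchange two neighboring values only if they are increasing satisfy the
relations of the 0-Hecke monoid. They give an invariant of weaves that determines the permutation of
a reduced bottom word. -/
theorem demazureAct_kind (π : ℕ → ℕ) (k : VertexKind d) :
    demazureAct π k.top = demazureAct π k.bot := by
  cases k with
  | tri i =>
    by_cases h : Ascent π i
    · simp [demazureAct, VertexKind.top, VertexKind.bot, h, not_ascent_swapAt h]
    · simp [demazureAct, VertexKind.top, VertexKind.bot, h]
  | four i j h =>
    have e := (reduced_iff_of_kind π (k := .four i j h) rfl).2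
    simp only [VertexKind.top, VertexKind.bot, actWord, List.foldl] at e
    by_cases h1 : Ascent π i <;> by_cases h2 : Ascent π j <;>
      simp [demazureAct, VertexKind.top, VertexKind.bot, h1, h2, ascent_swapAt_of_distant h,
        ascent_swapAt_of_distant h.symm, e]
  | six i j h =>
    have e1 : ∀ n : ℕ, (n = n + 1 + 1) = False := fun n => by simp [add_assoc]
    have e2 : ∀ n : ℕ, (n + 1 + 1 = n) = False := fun n => by simp [add_assoc]
    have key : ∀ {i j : Color d} (h : (i : ℕ) + 1 = j),
        demazureAct π [i, j, i] = demazureAct π [j, i, j] := by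
      intro i j h
      have e := (reduced_iff_of_kind π (k := .six i j (.inl h)) rfl).2
      simp only [VertexKind.top, VertexKind.bot, actWord, List.foldl] at e
      simp only [demazureAct, List.foldl]
      by_cases a : π i < π (i + 1) <;> by_cases b : π (i + 1) < π (i + 1 + 1) <;>
        by_cases c : π i < π (i + 1 + 1) <;>
        first | omega | simp [Ascent, swapAt, ← h, a, b, c, e1, e2, e]
      all_goals exact fun h' => by omega
    rcases h with h | h
    · exact key h
    · exact (key h).symm

theorem IsWeave.demazureAct_eq {β γ : List (Color d)} {x : List (Vertex d)} (h : IsWeave β x γ)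
    (π : ℕ → ℕ) : demazureAct π β = demazureAct π γ := by
  induction x generalizing β with
  | nil => rw [show β = γ from h]
  | cons v x ih =>
    rw [← ih h.2, ← h.1, Vertex.top, Vertex.bot]
    simp only [demazureAct_append, demazureAct_kind]

theorem IsWeave.demazureProduct_eq {β γ : List (Color d)} {x : List (Vertex d)}
    (h : IsWeave β x γ) : demazureProduct β = demazureProduct γ := by
  induction x generalizing β with
  | nil => rw [show β = γ from h]
  | cons v x ih =>
    have hk : demazureProduct v.kind.top = demazureProduct v.kind.bot := by
      refine (Con.eq _).2 (ConGen.Rel.of _ _ ?_)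
      cases v.kind with
      | tri i => exact .idem i
      | four i j h => exact .comm i j h
      | six i j h => exact .braid i j h
    have happ : ∀ l r : List (Color d), demazureProduct (l ++ r) =
        demazureProduct l * demazureProduct r := fun l r => by
      simp [demazureProduct, FreeMonoid.ofList_append]
    rw [← ih h.2, ← h.1, Vertex.top, Vertex.bot, happ, happ, happ, happ, hk]

/-- A word of minimal length for its Demazure product is reduced. -/
theorem IsReducedWordFor.reduced {β : List (Color d)} {δ : ZeroHecke d}
    (h : IsReducedWordFor β δ) : Reduced id β := by
  by_contra hβ
  obtain ⟨l, i, r, rfl, hl, hi⟩ : ∃ l i r, β = l ++ i :: r ∧ Reduced id l ∧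
      ¬Ascent (actWord id l) i := by
    clear h
    induction β using List.reverseRecOn with
    | nil => exact absurd trivial hβ
    | append_singleton β j ih =>
      by_cases h : Reduced id β
      · exact ⟨β, j, [], rfl, h, fun h' => hβ (reduced_concat.2 ⟨h, h'⟩)⟩
      · obtain ⟨l, i, r, rfl, hl, hi⟩ := ih h
        exact ⟨l, i, r ++ [j], by simp, hl, hi⟩
  obtain ⟨l', x, hx⟩ := exists_isBraid_concat hl hi
  -- The first letter that is not an ascent can be absorbed by a trivalent vertex, which gives a
  -- shorter word with the same Demazure product.
  have h1 : IsWeave (l ++ i :: r) (x.map (Vertex.extend [] (i :: r)) ++ [⟨l', .tri i, r⟩])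
      (l' ++ [i] ++ r) :=
    isWeave_append.2 ⟨_, hx.1.extend [] (i :: r), by simp [IsWeave, Vertex.top, Vertex.bot,
      VertexKind.top, VertexKind.bot]⟩
  have h2 := h.2 _ (h1.demazureProduct_eq.symm.trans h.1)
  have h3 := hx.length_eq
  simp at h2 h3
  omega

end Reduced

/-! ### Inductive weaves -/

section Inductive

variable {d : ℕ}

/-- The weaves from `ρ₀ ++ t.reverse` that process the letters of `t.reverse` from left to right:
each letter is either added to the reduced word obtained so far, or absorbed by its last letter.
Braid moves are allowed at each stage. -/
def InductiveWeave (π : ℕ → ℕ) (ρ₀ : List (Color d)) :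
    List (Color d) → List (Vertex d) → List (Color d) → Prop
  | [], x, σ => IsBraid ρ₀ x σ
  | i :: t, z, σ => ∃ x ρ b, InductiveWeave π ρ₀ t x ρ ∧
      ((Ascent (actWord π ρ) i ∧ IsBraid (ρ ++ [i]) b σ ∧ z = x.map (Vertex.extend [] [i]) ++ b) ∨
        ∃ ρ', ρ = ρ' ++ [i] ∧ IsBraid (ρ' ++ [i]) b σ ∧
          z = x.map (Vertex.extend [] [i]) ++ ⟨ρ', .tri i, []⟩ :: b)

variable {π : ℕ → ℕ} {ρ₀ ρ σ τ t t' : List (Color d)} {x y b : List (Vertex d)}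

theorem isWeave_tri {ρ : List (Color d)} {i : Color d} {b : List (Vertex d)}
    (h : IsWeave (ρ ++ [i]) b σ) : IsWeave (ρ ++ [i] ++ [i]) (⟨ρ, .tri i, []⟩ :: b) σ :=
  ⟨by simp [Vertex.top, VertexKind.top], by simpa [Vertex.bot, VertexKind.bot] using h⟩

theorem map_extend_nil (x : List (Vertex d)) : x.map (Vertex.extend [] []) = x := by
  induction x with
  | nil => rfl
  | cons v x ih => simp [ih, Vertex.extend]

namespace InductiveWeave

theorem isWeave (h : InductiveWeave π ρ₀ t x σ) : IsWeave (ρ₀ ++ t.reverse) x σ := by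
  induction t generalizing x σ with
  | nil => simpa using h.1
  | cons i t ih =>
    obtain ⟨x, ρ, b, h, ⟨-, hb, rfl⟩ | ⟨ρ', rfl, hb, rfl⟩⟩ := h
    · exact isWeave_append.2 ⟨_, by simpa using (ih h).extend [] [i], hb.1⟩
    · exact isWeave_append.2 ⟨_, by simpa using (ih h).extend [] [i],
        by simpa using isWeave_tri hb.1⟩

theorem reduced (h : InductiveWeave π ρ₀ t x σ) (hρ : Reduced π ρ₀) : Reduced π σ := by
  induction t generalizing x σ with
  | nil => exact h.reduced.1.1 hρ
  | cons i t ih =>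
    obtain ⟨x, ρ, b, h, ⟨hi, hb, rfl⟩ | ⟨ρ', rfl, hb, rfl⟩⟩ := h
    · exact hb.reduced.1.1 (reduced_concat.2 ⟨ih h, hi⟩)
    · exact hb.reduced.1.1 (ih h)

theorem actWord_eq (h : InductiveWeave π ρ₀ t x σ) (hρ : Reduced π ρ₀) :
    actWord π σ = demazureAct π (ρ₀ ++ t.reverse) := by
  rw [h.isWeave.demazureAct_eq, demazureAct_of_reduced (h.reduced hρ)]

theorem append_braid (h : InductiveWeave π ρ₀ t x σ) (hb : IsBraid σ b τ) :
    InductiveWeave π ρ₀ t (x ++ b) τ := by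
  cases t with
  | nil => exact IsBraid.append h hb
  | cons i t =>
    obtain ⟨x, ρ, b', h, ⟨hi, hb', rfl⟩ | ⟨ρ', rfl, hb', rfl⟩⟩ := h
    · exact ⟨x, ρ, b' ++ b, h, .inl ⟨hi, hb'.append hb, by simp⟩⟩
    · exact ⟨x, _, b' ++ b, h, .inr ⟨ρ', rfl, hb'.append hb, by simp⟩⟩

theorem comp (h : InductiveWeave π ρ₀ t x ρ) (h' : InductiveWeave π ρ t' y σ) :
    InductiveWeave π ρ₀ (t' ++ t) (x.map (Vertex.extend [] t'.reverse) ++ y) σ := by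
  induction t' generalizing y σ with
  | nil =>
    simp only [List.reverse_nil, map_extend_nil]
    exact h.append_braid h'
  | cons i t' ih =>
    obtain ⟨y, ρ, b, h', hb⟩ := h'
    refine ⟨_, ρ, b, ih h', ?_⟩
    simp only [List.map_append, map_extend_extend, List.nil_append, List.reverse_cons]
    rcases hb with ⟨hi, hb, rfl⟩ | ⟨ρ', rfl, hb, rfl⟩
    · exact .inl ⟨hi, hb, by simp⟩
    · exact .inr ⟨ρ', rfl, hb, by simp⟩

theorem extend (l : List (Color d)) (h : InductiveWeave (actWord π l) ρ₀ t x σ) :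
    InductiveWeave π (l ++ ρ₀) t (x.map (Vertex.extend l [])) (l ++ σ) := by
  induction t generalizing x σ with
  | nil =>
    have := IsBraid.extend h l []
    rw [List.append_nil, List.append_nil] at this
    exact this
  | cons i t ih =>
    obtain ⟨x, ρ, b, h, hb⟩ := h
    refine ⟨_, _, b.map (Vertex.extend l []), ih h, ?_⟩
    simp only [map_extend_extend, List.nil_append]
    rcases hb with ⟨hi, hb, rfl⟩ | ⟨ρ', rfl, hb, rfl⟩
    · refine .inl ⟨by rwa [actWord_append], by simpa using hb.extend l [], ?_⟩
      simp [Vertex.extend]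
    · refine .inr ⟨l ++ ρ', by simp, by simpa using hb.extend l [], ?_⟩
      simp [Vertex.extend]

end InductiveWeave

/-- An ascent is added. For a descent, the exchange property first brings the letter to the end of
the word, where it absorbs the new letter. -/
theorem exists_inductiveWeave (hρ : Reduced id ρ₀) (t : List (Color d)) :
    ∃ x σ, InductiveWeave id ρ₀ t x σ := by
  induction t with
  | nil => exact ⟨[], ρ₀, .nil _⟩
  | cons i t ih =>
    obtain ⟨x, ρ, h⟩ := ih
    by_cases hi : Ascent (actWord id ρ) i
    · exact ⟨_, _, x, ρ, [], h, .inl ⟨hi, .nil _, rfl⟩⟩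
    · obtain ⟨ρ', b, hb⟩ := exists_isBraid_concat (h.reduced hρ) hi
      exact ⟨_, _, x ++ b, _, [], h.append_braid hb, .inr ⟨ρ', rfl, .nil _, rfl⟩⟩

/-- Inductive weaves are unique up to equivalence. -/
theorem InductiveWeave.weaveEquiv (hρ : Reduced id ρ₀) (h : InductiveWeave id ρ₀ t x σ)
    (h' : InductiveWeave id ρ₀ t y σ) : WeaveEquiv (ρ₀ ++ t.reverse) σ x y := by
  induction t generalizing x y σ with
  | nil => simpa using IsBraid.weaveEquiv h h'
  | cons i t ih =>
    obtain ⟨x, ρ₁, b₁, h, hb⟩ := h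
    obtain ⟨y, ρ₂, b₂, h', hb'⟩ := h'
    have e : actWord id ρ₁ = actWord id ρ₂ := (h.actWord_eq hρ).trans (h'.actWord_eq hρ).symm
    have r₁ := h.reduced hρ
    have r₂ := h'.reduced hρ
    -- The permutation reached at each stage is determined by the Demazure action, so both weaves
    -- add the letter or both absorb it.
    have not_both : ∀ {ρ ρ' : List (Color d)}, Reduced id (ρ' ++ [i]) → Ascent (actWord id ρ) i →
        actWord id ρ = actWord id (ρ' ++ [i]) → False := by
      intro ρ ρ' h h' e
      rw [e, actWord_append] at h'
      exact not_ascent_swapAt (reduced_concat.1 h).2 h'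
    rw [List.reverse_cons, ← List.append_assoc]
    rcases hb with ⟨hi, hb, rfl⟩ | ⟨ρ₁', rfl, hb, rfl⟩ <;>
      rcases hb' with ⟨hi', hb', rfl⟩ | ⟨ρ₂', rfl, hb', rfl⟩
    · obtain ⟨c, hc⟩ := exists_isBraid r₁ r₂ e
      have h1 := ((ih (h.append_braid hc) h').extend [] [i]).append (.refl hb'.1)
      have hci := hc.extend [] [i]
      have h2 := ((hci.append hb').weaveEquiv hb).context (b := [])
        (by simpa using h.isWeave.extend [] [i]) rfl
      simp only [List.map_append, List.append_nil, List.nil_append, List.append_assoc] at h1 h2 ⊢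
      exact h2.symm.trans h1
    · exact (not_both r₂ hi e).elim
    · exact (not_both r₁ hi' e.symm).elim
    · have e' : actWord id ρ₁' = actWord id ρ₂' := by
        rw [actWord_append, actWord_append] at e
        exact swapAt_injective i e
      obtain ⟨c, hc⟩ := exists_isBraid (reduced_concat.1 r₁).1 (reduced_concat.1 r₂).1 e'
      have hci := hc.extend [] [i]
      have h1 := ((ih (h.append_braid hci) h').extend [] [i]).append
        (.refl (by simpa using isWeave_tri hb'.1))
      -- The braid from `ρ₁'` to `ρ₂'` lies to the left of the trivalent vertex and slides past it.
      have h2 := (weaveEquiv_isotopy hc.1 (.tri i)).context (b := b₂) (γ₀ := σ)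
        (by simpa [VertexKind.top] using h.isWeave.extend [] [i]) hb'.1
      have h3 := ((hci.append hb').weaveEquiv hb).context (b := [])
        (a := x.map (Vertex.extend [] [i]) ++ [⟨ρ₁', .tri i, []⟩])
        (isWeave_append.2 ⟨_, by simpa using h.isWeave.extend [] [i],
          isWeave_tri (b := []) rfl⟩) rfl
      simp only [List.map_append, List.append_nil, List.nil_append, List.append_assoc,
        map_extend_extend, VertexKind.top, VertexKind.bot, List.cons_append] at h1 h2 h3 ⊢
      exact h3.symm.trans (h2.trans h1)

end Inductive

/-! ### Vertices on top of inductive weaves: the dihedral case -/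

section Dihedral

variable {d : ℕ} {π : ℕ → ℕ} {ρ₀ σ t α γ : List (Color d)} {x y : List (Vertex d)} {i j : Color d}

theorem WeaveEquiv.step (a b : List (Vertex d)) (h : EquivMove x y ∨ MutationMove x y)
    (hx : IsWeave α (a ++ x ++ b) γ) (hy : IsWeave α (a ++ y ++ b) γ) :
    WeaveEquiv α γ (a ++ x ++ b) (a ++ y ++ b) :=
  ⟨hx, hy, .rel _ _ (h.imp (fun h => ⟨a, x, y, b, rfl, rfl, h⟩) fun h => ⟨a, x, y, b, rfl, rfl, h⟩)⟩

theorem equivMove_six_six (l r : List (Color d)) (h : Adjacent i j) :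
    EquivMove [⟨l, .six i j h, r⟩, ⟨l, .six j i h.symm, r⟩] [] :=
  .braid _ _ (l ++ [i, j, i] ++ r) (l ++ [i, j, i] ++ r) ⟨rfl, rfl, rfl⟩ rfl
    (by simp [VertexKind.isTri]) (by simp)

theorem equivMove_four_four (l r : List (Color d)) (h : Distant i j) :
    EquivMove [⟨l, .four i j h, r⟩, ⟨l, .four j i h.symm, r⟩] [] :=
  .braid _ _ (l ++ [i, j] ++ r) (l ++ [i, j] ++ r) ⟨rfl, rfl, rfl⟩ rfl
    (by simp [VertexKind.isTri]) (by simp)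

theorem InductiveWeave.add {ρ : List (Color d)} (h : InductiveWeave π ρ₀ t x ρ)
    (hi : Ascent (actWord π ρ) i) :
    InductiveWeave π ρ₀ (i :: t) (x.map (Vertex.extend [] [i])) (ρ ++ [i]) :=
  ⟨x, ρ, [], h, .inl ⟨hi, .nil _, by simp⟩⟩

theorem InductiveWeave.absorb {ρ : List (Color d)} (h : InductiveWeave π ρ₀ t x (ρ ++ [i])) :
    InductiveWeave π ρ₀ (i :: t) (x.map (Vertex.extend [] [i]) ++ [⟨ρ, .tri i, []⟩]) (ρ ++ [i]) :=
  ⟨x, _, [], h, .inr ⟨ρ, rfl, .nil _, rfl⟩⟩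

/-- The inductive weaves for the words above and below the vertex of kind `k`, to the right of the
reduced word `u`, are related by this vertex. -/
def Confluent (π : ℕ → ℕ) (u : List (Color d)) (k : VertexKind d) : Prop :=
  ∃ x y σ, InductiveWeave π u k.top.reverse x σ ∧ InductiveWeave π u k.bot.reverse y σ ∧
    WeaveEquiv (u ++ k.top) σ (⟨u, k, []⟩ :: y) x

/-- Put the opposite vertex on top of both weaves and cancel the resulting pair. -/
theorem Confluent.six_symm {u : List (Color d)} {h : Adjacent i j}
    (hc : Confluent π u (.six i j h)) : Confluent π u (.six j i h.symm) := by
  obtain ⟨x, y, σ, hx, hy, he⟩ := hc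
  refine ⟨y, x, σ, hy, hx, ?_⟩
  have hw : ∀ {i j : Color d} (h : Adjacent i j),
      IsWeave (u ++ [i, j, i]) [⟨u, .six i j h, []⟩] (u ++ [j, i, j]) := fun h => by
    simpa using (isBraid_six u [] h).1
  simp only [VertexKind.top] at he
  have h1 := he.symm.context (b := []) (hw h.symm) rfl
  have h2 := WeaveEquiv.step (α := u ++ [j, i, j]) (γ := σ) [] y
    (.inl (equivMove_six_six u [] h.symm))
    (isWeave_append.2 ⟨u ++ [j, i, j], by
      simp [IsWeave, Vertex.top, Vertex.bot, VertexKind.top, VertexKind.bot],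
      by simpa [VertexKind.bot] using hy.isWeave⟩)
    (by simpa [VertexKind.bot] using hy.isWeave)
  simp only [List.nil_append, List.append_nil, List.cons_append] at h1 h2
  exact h1.trans h2

theorem Confluent.four_symm {u : List (Color d)} {h : Distant i j}
    (hc : Confluent π u (.four i j h)) : Confluent π u (.four j i h.symm) := by
  obtain ⟨x, y, σ, hx, hy, he⟩ := hc
  refine ⟨y, x, σ, hy, hx, ?_⟩
  have hw : ∀ {i j : Color d} (h : Distant i j),
      IsWeave (u ++ [i, j]) [⟨u, .four i j h, []⟩] (u ++ [j, i]) := fun h => by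
    simpa using (isBraid_four u [] h).1
  simp only [VertexKind.top] at he
  have h1 := he.symm.context (b := []) (hw h.symm) rfl
  have h2 := WeaveEquiv.step (α := u ++ [j, i]) (γ := σ) [] y
    (.inl (equivMove_four_four u [] h.symm))
    (isWeave_append.2 ⟨u ++ [j, i], by
      simp [IsWeave, Vertex.top, Vertex.bot, VertexKind.top, VertexKind.bot],
      by simpa [VertexKind.bot] using hy.isWeave⟩)
    (by simpa [VertexKind.bot] using hy.isWeave)
  simp only [List.nil_append, List.append_nil, List.cons_append] at h1 h2
  exact h1.trans h2

theorem confluent_tri_nil (hi : Ascent π i) : Confluent π [] (.tri i) := by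
  have h : InductiveWeave π [] [i] [] [i] := InductiveWeave.add (t := []) (.nil _) hi
  exact ⟨_, _, _, InductiveWeave.absorb (ρ := []) h, h, .refl ⟨rfl, rfl⟩⟩

/-- This is the mutation move itself: two letters are merged first, or absorbed one after the other.
-/
theorem confluent_tri_self : Confluent π [i] (.tri i) := by
  have h₀ : InductiveWeave π [i] [] [] [i] := .nil _
  have h : InductiveWeave π [i] [i] [⟨[], .tri i, []⟩] [i] := .absorb (ρ := []) h₀
  exact ⟨_, _, _, InductiveWeave.absorb (ρ := []) h, h,
    (WeaveEquiv.step [] [] (.inr (.mk [] [] i)) ⟨rfl, rfl, rfl⟩ ⟨rfl, rfl, rfl⟩).symm⟩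

/-! ### Confluence at a 4-valent vertex -/

section Distant

variable (h : Distant i j)

theorem confluent_four_nil (hi : Ascent π i) (hj : Ascent π j) : Confluent π [] (.four i j h) := by
  have hi' : Ascent (swapAt π j) i := (ascent_swapAt_of_distant h).2 hi
  have hj' : Ascent (swapAt π i) j := (ascent_swapAt_of_distant h.symm).2 hj
  have h₀ : InductiveWeave π ([] : List (Color d)) [] [] [] := .nil _
  have h₁ : InductiveWeave π [] [j, i] [] [i, j] := (h₀.add hi).add hj'
  have h₂ : InductiveWeave π [] [i, j] [] [j, i] := (h₀.add hj).add hi'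
  exact ⟨_, _, _, h₁.append_braid (isBraid_four [] [] h), h₂, .refl ⟨rfl, rfl⟩⟩

theorem confluent_four_left (hj : Ascent π j) :
    Confluent π [i] (.four i j h) := by
  have hj' : Ascent (swapAt π i) j := (ascent_swapAt_of_distant h.symm).2 hj
  have h₀ : InductiveWeave π [i] [] [] [i] := .nil _
  have h₁ : InductiveWeave π [i] [i] [⟨[], .tri i, []⟩] [i] := .absorb (ρ := []) h₀
  have h₂ : InductiveWeave π [i] [j, i] [⟨[], .tri i, [j]⟩] [i, j] := h₁.add hj'
  have h₃ : InductiveWeave π [i] [j] [] [i, j] := h₀.add hj'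
  have h₄ : InductiveWeave π [i] [i, j] [⟨[], .four i j h, [i]⟩, ⟨[j], .tri i, []⟩] [j, i] :=
    InductiveWeave.absorb (ρ := [j]) (h₃.append_braid (isBraid_four [] [] h))
  refine ⟨_, _, _, h₂.append_braid (isBraid_four [] [] h), h₄, ?_⟩
  have e₁ : WeaveEquiv [i, i, j] [j, i]
      [⟨[i], .four i j h, []⟩, ⟨[i], .four j i h.symm, []⟩, ⟨[], .tri i, [j]⟩, ⟨[], .four i j h, []⟩]
      [⟨[i], .four i j h, []⟩, ⟨[], .four i j h, [i]⟩, ⟨[j], .tri i, []⟩] :=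
    .step [⟨[i], .four i j h, []⟩] [] (.inl (.passThrough [] [] i j h))
      ⟨rfl, rfl, rfl, rfl, rfl⟩ ⟨rfl, rfl, rfl, rfl⟩
  have e₂ : WeaveEquiv [i, i, j] [j, i]
      [⟨[i], .four i j h, []⟩, ⟨[i], .four j i h.symm, []⟩, ⟨[], .tri i, [j]⟩, ⟨[], .four i j h, []⟩]
      [⟨[], .tri i, [j]⟩, ⟨[], .four i j h, []⟩] :=
    .step [] [⟨[], .tri i, [j]⟩, ⟨[], .four i j h, []⟩] (.inl (equivMove_four_four [i] [] h))
      ⟨rfl, rfl, rfl, rfl, rfl⟩ ⟨rfl, rfl, rfl⟩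
  exact e₁.symm.trans e₂

/-- Both letters are absorbed. The trivalent vertices are pulled through the crossings, after which
they are horizontally separated and exchange their heights. -/
theorem confluent_four_both :
    Confluent π [i, j] (.four i j h) := by
  have h₀ : InductiveWeave π [i, j] [] [] [i, j] := .nil _
  have h₁ : InductiveWeave π [i, j] [i] [⟨[], .four i j h, [i]⟩, ⟨[j], .tri i, []⟩] [j, i] :=
    InductiveWeave.absorb (ρ := [j]) (h₀.append_braid (isBraid_four [] [] h))
  have h₂ : InductiveWeave π [i, j] [j, i] [⟨[], .four i j h, [i, j]⟩, ⟨[j], .tri i, [j]⟩,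
      ⟨[], .four j i h.symm, [j]⟩, ⟨[i], .tri j, []⟩] [i, j] :=
    InductiveWeave.absorb (ρ := [i]) (h₁.append_braid (isBraid_four [] [] h.symm))
  have h₃ : InductiveWeave π [i, j] [j] [⟨[i], .tri j, []⟩] [i, j] := .absorb (ρ := [i]) h₀
  have h₄ : InductiveWeave π [i, j] [i, j] [⟨[i], .tri j, [i]⟩, ⟨[], .four i j h, [i]⟩,
      ⟨[j], .tri i, []⟩] [j, i] :=
    InductiveWeave.absorb (ρ := [j]) (h₃.append_braid (isBraid_four [] [] h))
  refine ⟨_, _, _, h₂, h₄.append_braid (isBraid_four [] [] h.symm), ?_⟩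
  have e₁ : WeaveEquiv [i, j, i, j] [i, j]
      [⟨[i, j], .four i j h, []⟩, ⟨[i], .tri j, [i]⟩, ⟨[], .four i j h, [i]⟩, ⟨[j], .tri i, []⟩,
        ⟨[], .four j i h.symm, []⟩]
      [⟨[i, j], .four i j h, []⟩, ⟨[i], .tri j, [i]⟩, ⟨[i], .four j i h.symm, []⟩,
        ⟨[], .tri i, [j]⟩] :=
    .step [⟨[i, j], .four i j h, []⟩, ⟨[i], .tri j, [i]⟩] [] (.inl (.passThroughMirror [] [] i j h))
      ⟨rfl, rfl, rfl, rfl, rfl, rfl⟩ ⟨rfl, rfl, rfl, rfl, rfl⟩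
  have e₂ : WeaveEquiv [i, j, i, j] [i, j]
      [⟨[i, j], .four i j h, []⟩, ⟨[i], .tri j, [i]⟩, ⟨[i], .four j i h.symm, []⟩,
        ⟨[], .tri i, [j]⟩]
      [⟨[i], .four j i h.symm, [j]⟩, ⟨[i, i], .tri j, []⟩, ⟨[], .tri i, [j]⟩] :=
    .step [] [⟨[], .tri i, [j]⟩] (.inl (.passThrough [i] [] j i h.symm))
      ⟨rfl, rfl, rfl, rfl, rfl⟩ ⟨rfl, rfl, rfl, rfl⟩
  have e₃ : WeaveEquiv [i, j, i, j] [i, j]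
      [⟨[i], .four j i h.symm, [j]⟩, ⟨[], .tri i, [j, j]⟩, ⟨[i], .tri j, []⟩]
      [⟨[i], .four j i h.symm, [j]⟩, ⟨[i, i], .tri j, []⟩, ⟨[], .tri i, [j]⟩] :=
    .step [⟨[i], .four j i h.symm, [j]⟩] [] (.inl (.isotopy [] [] [] (.tri i) (.tri j)))
      ⟨rfl, rfl, rfl, rfl⟩ ⟨rfl, rfl, rfl, rfl⟩
  have e₄ : WeaveEquiv [i, j, i, j] [i, j]
      [⟨[i], .four j i h.symm, [j]⟩, ⟨[], .tri i, [j, j]⟩, ⟨[], .four i j h, [j]⟩,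
        ⟨[], .four j i h.symm, [j]⟩, ⟨[i], .tri j, []⟩]
      [⟨[i], .four j i h.symm, [j]⟩, ⟨[], .tri i, [j, j]⟩, ⟨[i], .tri j, []⟩] :=
    .step [⟨[i], .four j i h.symm, [j]⟩, ⟨[], .tri i, [j, j]⟩] [⟨[i], .tri j, []⟩]
      (.inl (equivMove_four_four [] [j] h))
      ⟨rfl, rfl, rfl, rfl, rfl, rfl⟩ ⟨rfl, rfl, rfl, rfl⟩
  have e₅ : WeaveEquiv [i, j, i, j] [i, j]
      [⟨[i], .four j i h.symm, [j]⟩, ⟨[], .tri i, [j, j]⟩, ⟨[], .four i j h, [j]⟩,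
        ⟨[], .four j i h.symm, [j]⟩, ⟨[i], .tri j, []⟩]
      [⟨[], .four i j h, [i, j]⟩, ⟨[j], .tri i, [j]⟩, ⟨[], .four j i h.symm, [j]⟩,
        ⟨[i], .tri j, []⟩] :=
    .step [] [⟨[], .four j i h.symm, [j]⟩, ⟨[i], .tri j, []⟩] (.inl (.passThrough [] [j] i j h))
      ⟨rfl, rfl, rfl, rfl, rfl, rfl⟩ ⟨rfl, rfl, rfl, rfl, rfl⟩
  exact e₁.trans (e₂.trans (e₃.symm.trans (e₄.symm.trans e₅)))

end Distant

/-! ### Confluence at a 6-valent vertex -/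

section Adjacent

variable (h : Adjacent i j)

/-- The mirror image of a trivalent vertex that is pushed through a 6-valent vertex. -/
theorem weaveEquiv_push : WeaveEquiv [j, i, j, i] [i, j, i]
    [⟨[j], .six i j h, []⟩, ⟨[], .tri j, [i, j]⟩, ⟨[], .six j i h.symm, []⟩]
    [⟨[], .six j i h.symm, [i]⟩, ⟨[i, j], .tri i, []⟩] := by
  have e₁ : WeaveEquiv [j, i, j, i] [i, j, i]
      [⟨[j], .six i j h, []⟩, ⟨[], .tri j, [i, j]⟩, ⟨[], .six j i h.symm, []⟩]
      [⟨[], .six j i h.symm, [i]⟩, ⟨[i, j], .tri i, []⟩, ⟨[], .six i j h, []⟩,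
        ⟨[], .six j i h.symm, []⟩] :=
    .step [] [⟨[], .six j i h.symm, []⟩] (.inl (.pushBelowMirror [] [] i j h))
      ⟨rfl, rfl, rfl, rfl⟩ ⟨rfl, rfl, rfl, rfl, rfl⟩
  have e₂ : WeaveEquiv [j, i, j, i] [i, j, i]
      [⟨[], .six j i h.symm, [i]⟩, ⟨[i, j], .tri i, []⟩, ⟨[], .six i j h, []⟩,
        ⟨[], .six j i h.symm, []⟩]
      [⟨[], .six j i h.symm, [i]⟩, ⟨[i, j], .tri i, []⟩] :=
    .step [⟨[], .six j i h.symm, [i]⟩, ⟨[i, j], .tri i, []⟩] [] (.inl (equivMove_six_six [] [] h))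
      ⟨rfl, rfl, rfl, rfl, rfl⟩ ⟨rfl, rfl, rfl⟩
  exact e₁.trans e₂

/-- Together with `weaveEquiv_absorb_two_right`, this brings the two weaves of `confluent_six_two`
to one form, in which a 6-valent vertex is followed by two separated trivalent vertices of color
`i`. -/
theorem weaveEquiv_absorb_two_left : WeaveEquiv [i, j, i, j, i] [i, j, i]
    [⟨[i, j], .six i j h, []⟩, ⟨[i], .tri j, [i, j]⟩, ⟨[], .six i j h, [j]⟩, ⟨[j, i], .tri j, []⟩,
      ⟨[], .six j i h.symm, []⟩]
    [⟨[i], .six j i h.symm, [i]⟩, ⟨[i, i, j], .tri i, []⟩, ⟨[], .tri i, [j, i]⟩] := by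
  have e₁ : WeaveEquiv [i, j, i, j, i] [i, j, i]
      [⟨[i, j], .six i j h, []⟩, ⟨[i], .tri j, [i, j]⟩, ⟨[], .six i j h, [j]⟩,
        ⟨[j, i], .tri j, []⟩, ⟨[], .six j i h.symm, []⟩]
      [⟨[i, j], .six i j h, []⟩, ⟨[i], .tri j, [i, j]⟩, ⟨[i], .six j i h.symm, []⟩,
        ⟨[], .tri i, [j, i]⟩, ⟨[], .six i j h, []⟩, ⟨[], .six j i h.symm, []⟩] :=
    .step [⟨[i, j], .six i j h, []⟩, ⟨[i], .tri j, [i, j]⟩] [⟨[], .six j i h.symm, []⟩]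
      (.inl (.pushBelow [] [] i j h)) ⟨rfl, rfl, rfl, rfl, rfl, rfl⟩
      ⟨rfl, rfl, rfl, rfl, rfl, rfl, rfl⟩
  have e₂ : WeaveEquiv [i, j, i, j, i] [i, j, i]
      [⟨[i, j], .six i j h, []⟩, ⟨[i], .tri j, [i, j]⟩, ⟨[i], .six j i h.symm, []⟩,
        ⟨[], .tri i, [j, i]⟩, ⟨[], .six i j h, []⟩, ⟨[], .six j i h.symm, []⟩]
      [⟨[i, j], .six i j h, []⟩, ⟨[i], .tri j, [i, j]⟩, ⟨[i], .six j i h.symm, []⟩,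
        ⟨[], .tri i, [j, i]⟩] :=
    .step [⟨[i, j], .six i j h, []⟩, ⟨[i], .tri j, [i, j]⟩, ⟨[i], .six j i h.symm, []⟩,
        ⟨[], .tri i, [j, i]⟩] [] (.inl (equivMove_six_six [] [] h))
      ⟨rfl, rfl, rfl, rfl, rfl, rfl, rfl⟩ ⟨rfl, rfl, rfl, rfl, rfl⟩
  have e₃ := ((weaveEquiv_push h).extend [i] []).context (a := []) (b := [⟨[], .tri i, [j, i]⟩])
    (α₀ := [i, j, i, j, i]) (γ₀ := [i, j, i]) rfl ⟨rfl, rfl⟩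
  exact e₁.trans (e₂.trans e₃)

theorem weaveEquiv_absorb_two_right : WeaveEquiv [i, j, i, j, i] [i, j, i]
    [⟨[], .six i j h, [j, i]⟩, ⟨[j, i], .tri j, [i]⟩, ⟨[], .six j i h.symm, [i]⟩,
      ⟨[i, j], .tri i, []⟩]
    [⟨[i], .six j i h.symm, [i]⟩, ⟨[i, i, j], .tri i, []⟩, ⟨[], .tri i, [j, i]⟩] := by
  have e₁ : WeaveEquiv [i, j, i, j, i] [i, j, i]
      [⟨[], .six i j h, [j, i]⟩, ⟨[j, i], .tri j, [i]⟩, ⟨[], .six j i h.symm, [i]⟩,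
        ⟨[i, j], .tri i, []⟩]
      [⟨[i], .six j i h.symm, [i]⟩, ⟨[], .tri i, [j, i, i]⟩, ⟨[], .six i j h, [i]⟩,
        ⟨[], .six j i h.symm, [i]⟩, ⟨[i, j], .tri i, []⟩] :=
    .step [] [⟨[], .six j i h.symm, [i]⟩, ⟨[i, j], .tri i, []⟩] (.inl (.pushBelow [] [i] i j h))
      ⟨rfl, rfl, rfl, rfl, rfl⟩ ⟨rfl, rfl, rfl, rfl, rfl, rfl⟩
  have e₂ : WeaveEquiv [i, j, i, j, i] [i, j, i]
      [⟨[i], .six j i h.symm, [i]⟩, ⟨[], .tri i, [j, i, i]⟩, ⟨[], .six i j h, [i]⟩,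
        ⟨[], .six j i h.symm, [i]⟩, ⟨[i, j], .tri i, []⟩]
      [⟨[i], .six j i h.symm, [i]⟩, ⟨[], .tri i, [j, i, i]⟩, ⟨[i, j], .tri i, []⟩] :=
    .step [⟨[i], .six j i h.symm, [i]⟩, ⟨[], .tri i, [j, i, i]⟩] [⟨[i, j], .tri i, []⟩]
      (.inl (equivMove_six_six [] [i] h)) ⟨rfl, rfl, rfl, rfl, rfl, rfl⟩ ⟨rfl, rfl, rfl, rfl⟩
  have e₃ : WeaveEquiv [i, j, i, j, i] [i, j, i]
      [⟨[i], .six j i h.symm, [i]⟩, ⟨[], .tri i, [j, i, i]⟩, ⟨[i, j], .tri i, []⟩]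
      [⟨[i], .six j i h.symm, [i]⟩, ⟨[i, i, j], .tri i, []⟩, ⟨[], .tri i, [j, i]⟩] :=
    .step [⟨[i], .six j i h.symm, [i]⟩] [] (.inl (.isotopy [] [j] [] (.tri i) (.tri i)))
      ⟨rfl, rfl, rfl, rfl⟩ ⟨rfl, rfl, rfl, rfl⟩
  exact e₁.trans (e₂.trans e₃)

/-- Besides `confluent_tri_self`, this is the only confluence calculation with a mutation move: two
trivalent vertices of color `j` become consecutive on three parallel lines. -/
theorem weaveEquiv_absorb_three : WeaveEquiv [i, j, i, j, i, j] [j, i, j]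
    [⟨[i, j], .six i j h, [j]⟩, ⟨[i, j, j, i], .tri j, []⟩, ⟨[i], .tri j, [i, j]⟩,
      ⟨[], .six i j h, [j]⟩, ⟨[j, i], .tri j, []⟩]
    [⟨[i], .six j i h.symm, [i, j]⟩, ⟨[i, i, j], .tri i, [j]⟩, ⟨[], .tri i, [j, i, j]⟩,
      ⟨[], .six i j h, [j]⟩, ⟨[j, i], .tri j, []⟩] := by
  have e₁ : WeaveEquiv [i, j, i, j, i, j] [j, i, j]
      [⟨[i, j], .six i j h, [j]⟩, ⟨[i], .tri j, [i, j, j]⟩, ⟨[i, j, i], .tri j, []⟩,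
        ⟨[], .six i j h, [j]⟩, ⟨[j, i], .tri j, []⟩]
      [⟨[i, j], .six i j h, [j]⟩, ⟨[i, j, j, i], .tri j, []⟩, ⟨[i], .tri j, [i, j]⟩,
        ⟨[], .six i j h, [j]⟩, ⟨[j, i], .tri j, []⟩] :=
    .step [⟨[i, j], .six i j h, [j]⟩] [⟨[], .six i j h, [j]⟩, ⟨[j, i], .tri j, []⟩]
      (.inl (.isotopy [i] [i] [] (.tri j) (.tri j)))
      ⟨rfl, rfl, rfl, rfl, rfl, rfl⟩ ⟨rfl, rfl, rfl, rfl, rfl, rfl⟩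
  have e₂ : WeaveEquiv [i, j, i, j, i, j] [j, i, j]
      [⟨[i, j], .six i j h, [j]⟩, ⟨[i], .tri j, [i, j, j]⟩, ⟨[], .six i j h, [j, j]⟩,
        ⟨[j, i, j], .tri j, []⟩, ⟨[j, i], .tri j, []⟩]
      [⟨[i, j], .six i j h, [j]⟩, ⟨[i], .tri j, [i, j, j]⟩, ⟨[i, j, i], .tri j, []⟩,
        ⟨[], .six i j h, [j]⟩, ⟨[j, i], .tri j, []⟩] :=
    .step [⟨[i, j], .six i j h, [j]⟩, ⟨[i], .tri j, [i, j, j]⟩] [⟨[j, i], .tri j, []⟩]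
      (.inl (.isotopy [] [] [] (.six i j h) (.tri j)))
      ⟨rfl, rfl, rfl, rfl, rfl, rfl⟩ ⟨rfl, rfl, rfl, rfl, rfl, rfl⟩
  have e₃ : WeaveEquiv [i, j, i, j, i, j] [j, i, j]
      [⟨[i, j], .six i j h, [j]⟩, ⟨[i], .tri j, [i, j, j]⟩, ⟨[], .six i j h, [j, j]⟩,
        ⟨[j, i], .tri j, [j]⟩, ⟨[j, i], .tri j, []⟩]
      [⟨[i, j], .six i j h, [j]⟩, ⟨[i], .tri j, [i, j, j]⟩, ⟨[], .six i j h, [j, j]⟩,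
        ⟨[j, i, j], .tri j, []⟩, ⟨[j, i], .tri j, []⟩] :=
    .step [⟨[i, j], .six i j h, [j]⟩, ⟨[i], .tri j, [i, j, j]⟩, ⟨[], .six i j h, [j, j]⟩] []
      (.inr (.mk [j, i] [] j))
      ⟨rfl, rfl, rfl, rfl, rfl, rfl⟩ ⟨rfl, rfl, rfl, rfl, rfl, rfl⟩
  have e₄ : WeaveEquiv [i, j, i, j, i, j] [j, i, j]
      [⟨[i, j], .six i j h, [j]⟩, ⟨[i], .tri j, [i, j, j]⟩, ⟨[], .six i j h, [j, j]⟩,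
        ⟨[j, i], .tri j, [j]⟩, ⟨[j, i], .tri j, []⟩]
      [⟨[i, j], .six i j h, [j]⟩, ⟨[i], .tri j, [i, j, j]⟩, ⟨[i], .six j i h.symm, [j]⟩,
        ⟨[], .tri i, [j, i, j]⟩, ⟨[], .six i j h, [j]⟩, ⟨[j, i], .tri j, []⟩] :=
    .step [⟨[i, j], .six i j h, [j]⟩, ⟨[i], .tri j, [i, j, j]⟩] [⟨[j, i], .tri j, []⟩]
      (.inl (.pushBelow [] [j] i j h))
      ⟨rfl, rfl, rfl, rfl, rfl, rfl⟩ ⟨rfl, rfl, rfl, rfl, rfl, rfl, rfl⟩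
  have e₅ := ((weaveEquiv_push h).extend [i] [j]).context (a := [])
    (b := [⟨[], .tri i, [j, i, j]⟩, ⟨[], .six i j h, [j]⟩, ⟨[j, i], .tri j, []⟩])
    (α₀ := [i, j, i, j, i, j]) (γ₀ := [j, i, j]) rfl ⟨rfl, rfl, rfl, rfl⟩
  exact e₁.symm.trans (e₂.symm.trans (e₃.symm.trans (e₄.trans e₅)))

theorem reduced_of_adjacent (h : Adjacent i j) (hi : Ascent π i) (hj : Ascent π j) : Reduced π [i, j, i] := by
  have e1 : ∀ n : ℕ, (n = n + 1 + 1) = False := fun n => by simp [add_assoc]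
  have e2 : ∀ n : ℕ, (n + 1 + 1 = n) = False := fun n => by simp [add_assoc]
  simp only [Reduced, Ascent, swapAt] at hi hj ⊢
  rcases h with h | h
  · simp only [← h] at hi hj ⊢
    simp [e1, e2] at hi hj ⊢
    omega
  · simp only [← h] at hi hj ⊢
    simp [e1, e2] at hi hj ⊢
    omega

theorem confluent_six_nil (hi : Ascent π i) (hj : Ascent π j) : Confluent π [] (.six i j h) := by
  obtain ⟨a₁, a₂, a₃, -⟩ := reduced_of_adjacent h hi hj
  obtain ⟨b₁, b₂, b₃, -⟩ := reduced_of_adjacent h.symm hj hi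
  have h₀ : InductiveWeave π ([] : List (Color d)) [] [] [] := .nil _
  have h₁ : InductiveWeave π [] [i, j, i] [] [i, j, i] := ((h₀.add a₁).add a₂).add a₃
  have h₂ : InductiveWeave π [] [j, i, j] [] [j, i, j] := ((h₀.add b₁).add b₂).add b₃
  exact ⟨_, _, _, h₁.append_braid (isBraid_six [] [] h), h₂, .refl ⟨rfl, rfl⟩⟩

/-- The word to the left already ends in `i`, so one letter is absorbed, and the claim is a single
push move. -/
theorem confluent_six_one (hi : Ascent π i) (hj : Ascent π j) :
    Confluent π [i] (.six i j h) := by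
  obtain ⟨a₁, a₂, a₃, -⟩ := reduced_of_adjacent h hi hj
  have h₀ : InductiveWeave π [i] [] [] [i] := .nil _
  have h₁ : InductiveWeave π [i] [i] [⟨[], .tri i, []⟩] [i] := .absorb (ρ := []) h₀
  have h₂ : InductiveWeave π [i] [i, j, i] [⟨[], .tri i, [j, i]⟩] [i, j, i] := (h₁.add a₂).add a₃
  have h₃ : InductiveWeave π [i] [i, j] [] [i, j, i] := (h₀.add a₂).add a₃
  have h₄ : InductiveWeave π [i] [j, i, j] [⟨[], .six i j h, [j]⟩, ⟨[j, i], .tri j, []⟩]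
      [j, i, j] := InductiveWeave.absorb (ρ := [j, i]) (h₃.append_braid (isBraid_six [] [] h))
  exact ⟨_, _, _, h₂.append_braid (isBraid_six [] [] h), h₄,
    (WeaveEquiv.step [] [] (.inl (.pushAboveMirror [] [] i j h)) ⟨rfl, rfl, rfl⟩
      ⟨rfl, rfl, rfl, rfl⟩).symm⟩

theorem confluent_six_two (hi : Ascent π i) (hj : Ascent π j) :
    Confluent π [i, j] (.six i j h) := by
  obtain ⟨a₁, a₂, a₃, -⟩ := reduced_of_adjacent h hi hj
  have h₀ : InductiveWeave π [i, j] [] [] [i, j] := .nil _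
  have h₁ : InductiveWeave π [i, j] [i] [] [i, j, i] := h₀.add a₃
  have h₂ : InductiveWeave π [i, j] [j, i] [⟨[], .six i j h, [j]⟩, ⟨[j, i], .tri j, []⟩]
      [j, i, j] := InductiveWeave.absorb (ρ := [j, i]) (h₁.append_braid (isBraid_six [] [] h))
  have h₃ : InductiveWeave π [i, j] [i, j, i] [⟨[], .six i j h, [j, i]⟩, ⟨[j, i], .tri j, [i]⟩,
      ⟨[], .six j i h.symm, [i]⟩, ⟨[i, j], .tri i, []⟩] [i, j, i] :=
    InductiveWeave.absorb (ρ := [i, j]) (h₂.append_braid (isBraid_six [] [] h.symm))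
  have h₄ : InductiveWeave π [i, j] [j] [⟨[i], .tri j, []⟩] [i, j] := .absorb (ρ := [i]) h₀
  have h₅ : InductiveWeave π [i, j] [i, j] [⟨[i], .tri j, [i]⟩] [i, j, i] := h₄.add a₃
  have h₆ : InductiveWeave π [i, j] [j, i, j] [⟨[i], .tri j, [i, j]⟩, ⟨[], .six i j h, [j]⟩,
      ⟨[j, i], .tri j, []⟩] [j, i, j] :=
    InductiveWeave.absorb (ρ := [j, i]) (h₅.append_braid (isBraid_six [] [] h))
  exact ⟨_, _, _, h₃, h₆.append_braid (isBraid_six [] [] h.symm),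
    (weaveEquiv_absorb_two_left h).trans (weaveEquiv_absorb_two_right h).symm⟩

/-- The word to the left contains the longest word in `i` and `j`, so all three letters are
absorbed. The case of two absorbed letters simplifies both sides, and `weaveEquiv_absorb_three`
relates the results. -/
theorem confluent_six_three : Confluent π [i, j, i] (.six i j h) := by
  have h₀ : InductiveWeave π [i, j, i] [] [] [i, j, i] := .nil _
  have h₁ : InductiveWeave π [i, j, i] [i] [⟨[i, j], .tri i, []⟩] [i, j, i] :=
    .absorb (ρ := [i, j]) h₀
  have h₂ : InductiveWeave π [i, j, i] [j, i] [⟨[i, j], .tri i, [j]⟩, ⟨[], .six i j h, [j]⟩,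
      ⟨[j, i], .tri j, []⟩] [j, i, j] :=
    InductiveWeave.absorb (ρ := [j, i]) (h₁.append_braid (isBraid_six [] [] h))
  have h₃ : InductiveWeave π [i, j, i] [i, j, i] [⟨[i, j], .tri i, [j, i]⟩,
      ⟨[], .six i j h, [j, i]⟩, ⟨[j, i], .tri j, [i]⟩, ⟨[], .six j i h.symm, [i]⟩,
      ⟨[i, j], .tri i, []⟩] [i, j, i] :=
    InductiveWeave.absorb (ρ := [i, j]) (h₂.append_braid (isBraid_six [] [] h.symm))
  have h₄ : InductiveWeave π [i, j, i] [j] [⟨[], .six i j h, [j]⟩, ⟨[j, i], .tri j, []⟩]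
      [j, i, j] := InductiveWeave.absorb (ρ := [j, i]) (h₀.append_braid (isBraid_six [] [] h))
  have h₅ : InductiveWeave π [i, j, i] [i, j] [⟨[], .six i j h, [j, i]⟩, ⟨[j, i], .tri j, [i]⟩,
      ⟨[], .six j i h.symm, [i]⟩, ⟨[i, j], .tri i, []⟩] [i, j, i] :=
    InductiveWeave.absorb (ρ := [i, j]) (h₄.append_braid (isBraid_six [] [] h.symm))
  have h₆ : InductiveWeave π [i, j, i] [j, i, j] [⟨[], .six i j h, [j, i, j]⟩,
      ⟨[j, i], .tri j, [i, j]⟩, ⟨[], .six j i h.symm, [i, j]⟩, ⟨[i, j], .tri i, [j]⟩,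
      ⟨[], .six i j h, [j]⟩, ⟨[j, i], .tri j, []⟩] [j, i, j] :=
    InductiveWeave.absorb (ρ := [j, i]) (h₅.append_braid (isBraid_six [] [] h))
  refine ⟨_, _, _, h₃, h₆.append_braid (isBraid_six [] [] h.symm), ?_⟩
  have e₁ := ((weaveEquiv_absorb_two_right h).extend [] [j]).context
    (a := [⟨[i, j, i], .six i j h, []⟩])
    (b := [⟨[], .six i j h, [j]⟩, ⟨[j, i], .tri j, []⟩, ⟨[], .six j i h.symm, []⟩])
    (α₀ := [i, j, i, i, j, i]) (γ₀ := [i, j, i]) ⟨rfl, rfl⟩ ⟨rfl, rfl, rfl, rfl⟩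
  have e₂ := (weaveEquiv_absorb_three h).context
    (a := [⟨[i, j, i], .six i j h, []⟩])
    (b := [⟨[], .six j i h.symm, []⟩])
    (α₀ := [i, j, i, i, j, i]) (γ₀ := [i, j, i]) ⟨rfl, rfl⟩ ⟨rfl, rfl⟩
  have e₃ : WeaveEquiv [i, j, i, i, j, i] [i, j, i]
      [⟨[i, j], .tri i, [j, i]⟩, ⟨[i, j], .six i j h, []⟩, ⟨[i], .tri j, [i, j]⟩,
        ⟨[], .six i j h, [j]⟩, ⟨[j, i], .tri j, []⟩, ⟨[], .six j i h.symm, []⟩]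
      [⟨[i, j, i], .six i j h, []⟩, ⟨[i, j], .six i j h, [j]⟩, ⟨[i, j, j, i], .tri j, []⟩,
        ⟨[i], .tri j, [i, j]⟩, ⟨[], .six i j h, [j]⟩, ⟨[j, i], .tri j, []⟩,
        ⟨[], .six j i h.symm, []⟩] :=
    .step [] [⟨[i], .tri j, [i, j]⟩, ⟨[], .six i j h, [j]⟩, ⟨[j, i], .tri j, []⟩,
        ⟨[], .six j i h.symm, []⟩] (.inl (.pushAboveMirror [i, j] [] i j h))
      ⟨rfl, rfl, rfl, rfl, rfl, rfl, rfl⟩ ⟨rfl, rfl, rfl, rfl, rfl, rfl, rfl, rfl⟩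
  have e₄ := ((weaveEquiv_absorb_two_left h).trans (weaveEquiv_absorb_two_right h).symm).context
    (a := [⟨[i, j], .tri i, [j, i]⟩]) (b := []) (α₀ := [i, j, i, i, j, i]) (γ₀ := [i, j, i])
    ⟨rfl, rfl⟩ rfl
  exact e₁.trans (e₂.symm.trans (e₃.symm.trans e₄))

end Adjacent

end Dihedral

/-! ### Weaves to reduced words are mutation equivalent -/

section ReducedWeaves

variable {d : ℕ}

theorem exists_isBraid_concat_ascent {ρ : List (Color d)} (h : Reduced id ρ) {i : Color d}
    (hi : ¬Ascent (actWord id ρ) i) : ∃ ρ' x, IsBraid ρ x (ρ' ++ [i]) ∧ Reduced id ρ' ∧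
      Ascent (actWord id ρ') i ∧ actWord id ρ = swapAt (actWord id ρ') i := by
  obtain ⟨ρ', x, hx⟩ := exists_isBraid_concat h hi
  obtain ⟨h1, h2⟩ := reduced_concat.1 (hx.reduced.1.1 h)
  exact ⟨ρ', x, hx, h1, h2, hx.reduced.2.trans (actWord_append _ _ _)⟩

/-- Descents `i` and `j` are split off alternately from the end of the word, until neither remains
or three letters have been split off. The letters `u` are the part of the permutation in the
dihedral group of `i` and `j`. -/
theorem exists_confluent_six {ρ : List (Color d)} (h : Reduced id ρ) {i j : Color d}
    (hij : Adjacent i j) (hi : ¬Ascent (actWord id ρ) i) :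
    ∃ ρ' u b, IsBraid ρ b (ρ' ++ u) ∧ Confluent (actWord id ρ') u (.six i j hij) := by
  obtain ⟨ρ₁, x₁, h₁, r₁, a₁, -⟩ := exists_isBraid_concat_ascent h hi
  by_cases hj : Ascent (actWord id ρ₁) j
  · exact ⟨ρ₁, [i], x₁, h₁, confluent_six_one hij a₁ hj⟩
  obtain ⟨ρ₂, x₂, h₂, r₂, a₂, -⟩ := exists_isBraid_concat_ascent r₁ hj
  have h₂' := h₁.append (h₂.extend [] [i])
  by_cases hi' : Ascent (actWord id ρ₂) i
  · exact ⟨ρ₂, [j, i], _, by simpa using h₂', (confluent_six_two hij.symm a₂ hi').six_symm⟩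
  obtain ⟨ρ₃, x₃, h₃⟩ := exists_isBraid_concat r₂ hi'
  have h₃' := h₂'.append (y := x₃.map (Vertex.extend [] [j, i])) (δ := ρ₃ ++ [i, j, i])
    (by simpa using h₃.extend [] [j, i])
  exact ⟨ρ₃, [i, j, i], _, h₃', confluent_six_three hij⟩

theorem exists_confluent {ρ : List (Color d)} (h : Reduced id ρ) (k : VertexKind d) :
    ∃ ρ' u b, IsBraid ρ b (ρ' ++ u) ∧ Confluent (actWord id ρ') u k := by
  cases k with
  | tri i =>
    by_cases hi : Ascent (actWord id ρ) i
    · exact ⟨ρ, [], [], by simpa using IsBraid.nil ρ, confluent_tri_nil hi⟩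
    · obtain ⟨ρ₁, x₁, h₁⟩ := exists_isBraid_concat h hi
      exact ⟨ρ₁, [i], x₁, h₁, confluent_tri_self⟩
  | four i j hij =>
    by_cases hi : Ascent (actWord id ρ) i
    · by_cases hj : Ascent (actWord id ρ) j
      · exact ⟨ρ, [], [], by simpa using IsBraid.nil ρ, confluent_four_nil hij hi hj⟩
      · obtain ⟨ρ₁, x₁, h₁, -, a₁, e⟩ := exists_isBraid_concat_ascent h hj
        rw [e, ascent_swapAt_of_distant hij] at hi
        exact ⟨ρ₁, [j], x₁, h₁, (confluent_four_left hij.symm hi).four_symm⟩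
    · obtain ⟨ρ₁, x₁, h₁, r₁, a₁, -⟩ := exists_isBraid_concat_ascent h hi
      by_cases hj : Ascent (actWord id ρ₁) j
      · exact ⟨ρ₁, [i], x₁, h₁, confluent_four_left hij hj⟩
      · obtain ⟨ρ₂, x₂, h₂⟩ := exists_isBraid_concat r₁ hj
        exact ⟨ρ₂, [j, i], _, by simpa using h₁.append (h₂.extend [] [i]),
          (confluent_four_both hij.symm).four_symm⟩
  | six i j hij =>
    by_cases hi : Ascent (actWord id ρ) i
    · by_cases hj : Ascent (actWord id ρ) j
      · exact ⟨ρ, [], [], by simpa using IsBraid.nil ρ, confluent_six_nil hij hi hj⟩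
      · obtain ⟨ρ', u, b, hb, hc⟩ := exists_confluent_six h hij.symm hj
        exact ⟨ρ', u, b, hb, hc.six_symm⟩
    · exact exists_confluent_six h hij hi

/-- A vertex on top of an inductive weave. -/
theorem InductiveWeave.exists_cons {l : List (Color d)} {k : VertexKind d} {q : List (Color d)}
    {y : List (Vertex d)} {σ : List (Color d)}
    (h : InductiveWeave id [] (q ++ (k.bot.reverse ++ l.reverse)) y σ) :
    ∃ x, InductiveWeave id [] (q ++ (k.top.reverse ++ l.reverse)) x σ ∧
      WeaveEquiv (l ++ k.top ++ q.reverse) σ (⟨l, k, q.reverse⟩ :: y) x := by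
  have hnil : Reduced id ([] : List (Color d)) := trivial
  induction q generalizing y σ with
  | nil =>
    -- The letters to the left of the vertex are normalized by an inductive weave `c`, whose bottom
    -- word is then chosen such that the vertex is confluent with its end.
    obtain ⟨c, ρ, hc⟩ := exists_inductiveWeave hnil l.reverse
    obtain ⟨ρ', u, b, hb, xd, yd, τ, hx, hy, he⟩ := exists_confluent (hc.reduced hnil) k
    replace hc := hc.append_braid hb
    generalize c ++ b = c at hc
    have hx' := hc.comp (hx.extend ρ')
    have hy' := hc.comp (hy.extend ρ')
    obtain ⟨e, hbr⟩ := exists_isBraid (hy'.reduced hnil) (h.reduced hnil)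
      ((hy'.actWord_eq hnil).trans (h.actWord_eq hnil).symm)
    refine ⟨_, hx'.append_braid hbr, ?_⟩
    have hcw := hc.isWeave
    have h1 := ((hy'.append_braid hbr).weaveEquiv hnil h).context (α₀ := l ++ k.top)
      (a := [⟨l, k, []⟩]) (b := []) ⟨by simp [Vertex.top], by simp [Vertex.bot, IsWeave]⟩ rfl
    -- The vertex slides down past `c`, and there it meets the local inductive weave.
    have h2 := (weaveEquiv_isotopy hcw k).context (a := []) (b := yd.map (Vertex.extend ρ' []) ++ e)
      (α₀ := l ++ k.top) (γ₀ := σ) (by simp [IsWeave])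
      (isWeave_append.2 ⟨_, by simpa using (hy.extend ρ').isWeave, hbr.1⟩)
    have h3 := (he.extend ρ' []).context (a := c.map (Vertex.extend [] k.top)) (b := e)
      (α₀ := l ++ k.top) (γ₀ := σ) (by simpa using hcw.extend [] k.top) (by simpa using hbr.1)
    simp only [List.nil_append, List.append_nil, List.cons_append, List.reverse_reverse,
      List.append_assoc, List.map_cons, Vertex.extend, List.reverse_nil]
      at h1 h2 h3 ⊢
    exact h1.symm.trans (h2.trans h3)
  | cons i q ih =>
    obtain ⟨y, ρ, b, h, hb⟩ := h
    obtain ⟨x, hx, he⟩ := ih h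
    have h1 := he.extend [] [i]
    rcases hb with ⟨hi, hb, rfl⟩ | ⟨ρ', rfl, hb, rfl⟩
    · refine ⟨_, ⟨x, ρ, b, hx, .inl ⟨hi, hb, rfl⟩⟩, ?_⟩
      have h2 := h1.append (.refl hb.1)
      simpa [Vertex.extend] using h2
    · refine ⟨_, ⟨x, _, b, hx, .inr ⟨ρ', rfl, hb, rfl⟩⟩, ?_⟩
      have h2 := h1.append (.refl (isWeave_tri hb.1))
      simpa [Vertex.extend] using h2

theorem inductiveWeave_of_reduced {ρ : List (Color d)} (h : Reduced id ρ) :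
    InductiveWeave id [] ρ.reverse [] ρ := by
  induction ρ using List.reverseRecOn with
  | nil => exact .nil _
  | append_singleton ρ i ih =>
    obtain ⟨h1, h2⟩ := reduced_concat.1 h
    simpa using (ih h1).add h2

/-- Induction from the bottom: the trivial weave of a reduced word is inductive, and each further
vertex on top is incorporated by `InductiveWeave.exists_cons`. -/
theorem exists_inductiveWeave_weaveEquiv {β σ : List (Color d)} {w : List (Vertex d)}
    (hw : IsWeave β w σ) (hσ : Reduced id σ) :
    ∃ x, InductiveWeave id [] β.reverse x σ ∧ WeaveEquiv β σ w x := by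
  induction w generalizing β with
  | nil =>
    obtain rfl : β = σ := hw
    exact ⟨[], inductiveWeave_of_reduced hσ, .refl rfl⟩
  | cons v w ih =>
    obtain ⟨rfl, hw⟩ := hw
    obtain ⟨y, hy, he⟩ := ih hw
    obtain ⟨l, k, r⟩ := v
    obtain ⟨x, hx, he'⟩ := InductiveWeave.exists_cons (l := l) (k := k) (q := r.reverse) (y := y)
      (σ := σ) (by simpa [Vertex.bot] using hy)
    rw [List.reverse_reverse] at he'
    refine ⟨x, by simpa [Vertex.top] using hx, ?_⟩
    have := he.context (a := [⟨l, k, r⟩]) (b := []) (α₀ := l ++ k.top ++ r) ⟨rfl, rfl⟩ rfl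
    simp only [List.append_nil, List.cons_append, List.nil_append] at this
    exact this.trans he'

/-- Any two weaves to a reduced word are mutation equivalent. -/
theorem DemazureWeave.mutationEquivalent_of_reduced {β β' : List (Color d)}
    (w w' : DemazureWeave β β') (h : Reduced id β') : w.MutationEquivalent w' := by
  obtain ⟨x, hx, e⟩ := exists_inductiveWeave_weaveEquiv w.isWeave h
  obtain ⟨x', hx', e'⟩ := exists_inductiveWeave_weaveEquiv w'.isWeave h
  have h1 := hx.weaveEquiv (ρ₀ := []) trivial hx'
  simp only [List.nil_append, List.reverse_reverse] at h1
  exact (e.trans (h1.trans e'.symm)).2.2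

end ReducedWeaves

/-! ### Plücker coordinates of frames -/

section Pluecker

variable {K L : Type*} [Field K] [Field L] {d : ℕ}

open ExteriorAlgebra

theorem pluckerCoordinate_wedge {k : ℕ} (c : Fin k → Fin d) (g : ℕ → Fin d → K) :
    pluckerCoordinate K c (wedge g k) = Matrix.det (Matrix.of fun a b : Fin k => g a (c b)) := by
  rw [wedge_eq_ιMulti, pluckerCoordinate, liftAlternating_apply_ιMulti, Pi.single_eq_same]
  rfl

theorem det_wedge_mul_ι {k : ℕ} (c : Fin (k + 1) → Fin d) (g : ℕ → Fin d → K) (v : Fin d → K) :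
    pluckerCoordinate K c (wedge g k * ι K v) = Matrix.det (Matrix.of fun a b : Fin (k + 1) =>
      (if (a : ℕ) = k then v else g a) (c b)) := by
  have : wedge g k * ι K v = wedge (fun n => if n = k then v else g n) (k + 1) := by
    rw [wedge, wedge_congr (g := fun n => if n = k then v else g n) (h := g)
      fun m hm => by simp [hm.ne]]
    simp
  rw [this, pluckerCoordinate_wedge]

/-- Laplace expansion along the last row. Membership of Plücker coordinates in a subring thereby
passes to products with vectors. -/
theorem pluckerCoordinate_wedge_mul_ι {k : ℕ} (c : Fin (k + 1) → Fin d) (g : ℕ → Fin d → K)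
    (v : Fin d → K) : pluckerCoordinate K c (wedge g k * ι K v) =
      ∑ j : Fin (k + 1), (-1) ^ (k + (j : ℕ)) * v (c j) *
        pluckerCoordinate K (fun b => c (j.succAbove b)) (wedge g k) := by
  rw [det_wedge_mul_ι, Matrix.det_succ_row _ (Fin.last k)]
  refine Finset.sum_congr rfl fun j _ => ?_
  rw [pluckerCoordinate_wedge]
  simp only [Matrix.of_apply, Fin.val_last, if_true]
  congr 2
  ext a b
  simp [a.2.ne]

/-- The first vectors of the standard basis. -/
def standardFrame (K : Type*) [Field K] (d : ℕ) : ℕ → Fin d → K :=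
  fun n i => if (i : ℕ) = n then 1 else 0

theorem wedge_standardFrame : wedge (standardFrame K d) d = volumeForm K d :=
  volumeForm_eq_wedge.symm

theorem pluckerCoordinate_standardFrame {k : ℕ} (h : k ≤ d) :
    pluckerCoordinate K (Fin.castLE h) (wedge (standardFrame K d) k) = 1 := by
  rw [pluckerCoordinate_wedge]
  convert Matrix.det_one (n := Fin k) (R := K)
  ext a b
  simp [standardFrame, Matrix.one_apply, Fin.ext_iff, eq_comm]

/-- The frame of a flag with nonzero leading Plücker coordinates that is rational in the Plücker
coordinates. -/
noncomputable def leadingFrame (F : DecoratedFlag K d) (n : ℕ) (m : Fin d) : K :=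
  if h : n < d then
    pluckerCoordinate K (Fin.snoc (Fin.castLE h.le) m : Fin (n + 1) → Fin d) (F.level (n + 1)) /
      pluckerCoordinate K (Fin.castLE h.le) (F.level n)
  else 0

/-- Expansion of the numerator along its last column shows that each vector is the vector of an
arbitrary frame plus a combination of earlier ones, which does not change the extensors. -/
theorem isFrame_leadingFrame {F : DecoratedFlag K d}
    (hF : ∀ (n : ℕ) (h : n < d), pluckerCoordinate K (Fin.castLE h.le) (F.level n) ≠ 0) :
    IsFrame (leadingFrame F) F := by
  obtain ⟨f, hf⟩ := exists_frame F
  intro n hn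
  rw [hf n hn]
  induction n with
  | zero => rfl
  | succ n ih =>
    have hP := hF n hn
    rw [wedge, wedge, ← ih (by omega), ← sub_eq_zero, ← mul_sub, ← map_sub]
    refine wedge_mul_ι_of_mem_span ?_
    have key : ∃ c : Fin n → K, f n - leadingFrame F n = ∑ i, c i • f i := by
      let A : Matrix (Fin (n + 1)) (Fin n) K :=
        Matrix.of fun a b => f a (Fin.castLE (Nat.le_of_succ_le hn) b)
      let s : Fin (n + 1) → K := fun i => (-1) ^ ((i : ℕ) + n) * (A.submatrix i.succAbove id).det
      have e : ∀ m, pluckerCoordinate K (Fin.snoc (Fin.castLE (Nat.le_of_succ_le hn)) m :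
          Fin (n + 1) → Fin d) (F.level (n + 1)) = ∑ i, s i * f i m := by
        intro m
        rw [hf _ hn, pluckerCoordinate_wedge, Matrix.det_succ_column _ (Fin.last n)]
        refine Finset.sum_congr rfl fun i _ => ?_
        simp only [Matrix.of_apply, Fin.snoc_last, Fin.val_last, s]
        rw [mul_right_comm]
        congr 3
        ext a b
        simp [A]
      have e2 : s (Fin.last n) = pluckerCoordinate K (Fin.castLE (Nat.le_of_succ_le hn))
          (F.level n) := by
        rw [hf _ (by omega), pluckerCoordinate_wedge]
        simp only [s, Fin.val_last, Even.neg_one_pow ⟨n, rfl⟩, one_mul]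
        congr 1
        ext a b
        simp [A]
      refine ⟨fun i => -(s i.castSucc / pluckerCoordinate K (Fin.castLE (Nat.le_of_succ_le hn))
        (F.level n)), ?_⟩
      funext m
      rw [Pi.sub_apply, leadingFrame, dif_pos (show n < d from hn), e, Fin.sum_univ_castSucc, e2]
      simp only [Fin.val_last, Fin.val_castSucc, Finset.sum_apply, Pi.smul_apply, smul_eq_mul]
      rw [add_div, mul_div_cancel_left₀ _ hP, sub_add_cancel_right, Finset.sum_div,
        ← Finset.sum_neg_distrib]
      refine Finset.sum_congr rfl fun i _ => ?_
      ring
    obtain ⟨c, hc⟩ := key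
    rw [hc]
    exact Submodule.sum_mem _ fun i _ => Submodule.smul_mem _ _
      (Submodule.subset_span ⟨i, i.2, rfl⟩)

/-! ### Simultaneous specialization -/

variable (Γ : Subring (K × L))

/-- Pairs of multivectors with Plücker coordinates in `Γ`. -/
def PluckerIn (k : ℕ) (x : ExteriorAlgebra K (Fin d → K)) (x' : ExteriorAlgebra L (Fin d → L)) :
    Prop :=
  ∀ c : Fin k → Fin d, (pluckerCoordinate K c x, pluckerCoordinate L c x') ∈ Γ

/-- Pairs of sequences of vectors with coordinates in `Γ`. -/
def FrameIn (g : ℕ → Fin d → K) (g' : ℕ → Fin d → L) : Prop := ∀ n j, (g n j, g' n j) ∈ Γ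

/-- Pairs of flags that have frames with coordinates in `Γ`. -/
def Linked (F : DecoratedFlag K d) (F' : DecoratedFlag L d) : Prop :=
  ∃ g g', IsFrame g F ∧ IsFrame g' F' ∧ FrameIn Γ g g'

variable {Γ}

/-- The scalars are carried along because they are not yet known to be in `Γ`; this is deduced in
top degree by `mem_of_pluckerIn`. -/
theorem PluckerIn.mul_ι {k : ℕ} {z : K} {z' : L} {g : ℕ → Fin d → K} {g' : ℕ → Fin d → L}
    (h : PluckerIn Γ k (z • wedge g k) (z' • wedge g' k)) {v : Fin d → K} {v' : Fin d → L}
    (hv : ∀ j, (v j, v' j) ∈ Γ) :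
    PluckerIn Γ (k + 1) (z • (wedge g k * ι K v)) (z' • (wedge g' k * ι L v')) := by
  intro c
  rw [map_smul, map_smul, pluckerCoordinate_wedge_mul_ι, pluckerCoordinate_wedge_mul_ι,
    smul_eq_mul, smul_eq_mul, Finset.mul_sum, Finset.mul_sum]
  have e : ∀ (x : Fin (k + 1) → K) (y : Fin (k + 1) → L), (∀ j, (x j, y j) ∈ Γ) →
      (∑ j, x j, ∑ j, y j) ∈ Γ := by
    intro x y hxy
    have := Subring.sum_mem Γ (t := Finset.univ) fun j _ => hxy j
    convert this using 1
    ext <;> simp [Prod.fst_sum, Prod.snd_sum]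
  refine e _ _ fun j => ?_
  have h1 := h fun b => c (j.succAbove b)
  rw [map_smul, map_smul, smul_eq_mul, smul_eq_mul] at h1
  have h2 : ((-1 : K) ^ (k + (j : ℕ)), (-1 : L) ^ (k + (j : ℕ))) ∈ Γ :=
    Γ.pow_mem (Γ.neg_mem Γ.one_mem) _
  convert Γ.mul_mem (Γ.mul_mem h2 (hv (c j))) h1 using 1
  ext <;> simp <;> ring

theorem PluckerIn.smul_wedge {g : ℕ → Fin d → K} {g' : ℕ → Fin d → L} (hg : FrameIn Γ g g')
    {z : K} {z' : L} {k n : ℕ} (hkn : k ≤ n)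
    (h : PluckerIn Γ k (z • wedge g k) (z' • wedge g' k)) :
    PluckerIn Γ n (z • wedge g n) (z' • wedge g' n) := by
  induction n, hkn using Nat.le_induction with
  | base => exact h
  | succ n _ ih => exact ih.mul_ι (hg n)

theorem FrameIn.pluckerIn {g : ℕ → Fin d → K} {g' : ℕ → Fin d → L} (hg : FrameIn Γ g g') (k : ℕ) :
    PluckerIn Γ k (wedge g k) (wedge g' k) := by
  have := PluckerIn.smul_wedge hg (z := 1) (z' := 1) (Nat.zero_le k) fun c => by
    rw [one_smul, one_smul, pluckerCoordinate_wedge, pluckerCoordinate_wedge, Matrix.det_isEmpty,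
      Matrix.det_isEmpty]
    exact Γ.one_mem
  rwa [one_smul, one_smul] at this

theorem frameIn_standardFrame : FrameIn Γ (standardFrame K d) (standardFrame L d) := by
  intro n j
  simp only [standardFrame]
  split_ifs
  · exact Γ.one_mem
  · exact Γ.zero_mem

/-- `Γ` is a local ring with the kernel of the second projection as its maximal ideal. -/
def IsSpecialization (Γ : Subring (K × L)) : Prop :=
  ∀ x ∈ Γ, x.2 ≠ 0 → x.1 ≠ 0 ∧ x⁻¹ ∈ Γ

theorem IsSpecialization.div_mem (hΓ : IsSpecialization Γ) {x y : K} {x' y' : L}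
    (hx : (x, x') ∈ Γ) (hy : (y, y') ∈ Γ) (h : y' ≠ 0) : (x / y, x' / y') ∈ Γ := by
  rw [div_eq_mul_inv, div_eq_mul_inv]
  exact Γ.mul_mem hx (hΓ _ hy h).2

/-- The leading Plücker coordinates of the standard flag are one, so those of `F` are units of `Γ`,
and both leading frames have coordinates in `Γ`. -/
theorem IsSpecialization.linked_of_leading (hΓ : IsSpecialization Γ) {F : DecoratedFlag K d}
    {F' : DecoratedFlag L d} (hF : ∀ k ≤ d, PluckerIn Γ k (F.level k) (F'.level k))
    (hF' : IsFrame (standardFrame L d) F') : Linked Γ F F' := by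
  have h' : ∀ (n : ℕ) (h : n < d), pluckerCoordinate L (Fin.castLE h.le) (F'.level n) ≠ 0 := by
    intro n h
    rw [hF' n h.le, pluckerCoordinate_standardFrame]
    exact one_ne_zero
  refine ⟨leadingFrame F, leadingFrame F', isFrame_leadingFrame fun n h =>
    (hΓ _ (hF n h.le (Fin.castLE h.le)) (h' n h)).1, isFrame_leadingFrame h', fun n j => ?_⟩
  simp only [leadingFrame]
  split_ifs with h
  · exact hΓ.div_mem (hF _ h _) (hF n h.le _) (h' n h)
  · exact Γ.zero_mem

theorem pluckerIn_volumeForm : PluckerIn Γ d (volumeForm K d) (volumeForm L d) := by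
  rw [← wedge_standardFrame, ← wedge_standardFrame]
  exact frameIn_standardFrame.pluckerIn d

theorem FrameIn.crossFrame_mem (hΓ : IsSpecialization Γ) {g : ℕ → Fin d → K} {g' : ℕ → Fin d → L}
    (hg : FrameIn Γ g g') (p : ℕ) {z μ : K} {z' μ' : L} (hz : (z, z') ∈ Γ) (hμ : (μ, μ') ∈ Γ)
    (h : μ' ≠ 0) : FrameIn Γ (crossFrame p z μ g) (crossFrame p z' μ' g') := by
  intro n j
  unfold crossFrame
  split_ifs
  · exact Γ.add_mem (Γ.mul_mem hz (hg _ _)) (Γ.mul_mem hμ (hg _ _))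
  · exact Γ.neg_mem (Γ.mul_mem (hΓ _ hμ h).2 (hg _ _))
  · exact hg _ _

/-- Multiplication by the remaining vectors of the frames leads to the multiple of the volume form
by `z`, and its Plücker coordinate is `z`. -/
theorem mem_of_pluckerIn {g : ℕ → Fin d → K} {g' : ℕ → Fin d → L} (hg : FrameIn Γ g g')
    {F : DecoratedFlag K d} {F' : DecoratedFlag L d} (hF : IsFrame g F) (hF' : IsFrame g' F')
    {k : ℕ} (hk : k ≤ d) {z : K} {z' : L} (h : PluckerIn Γ k (z • wedge g k) (z' • wedge g' k)) :
    (z, z') ∈ Γ := by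
  have h1 := h.smul_wedge hg hk (Fin.castLE le_rfl)
  rw [← hF d le_rfl, ← hF' d le_rfl, F.level_self, F'.level_self, ← wedge_standardFrame,
    ← wedge_standardFrame, map_smul, map_smul] at h1
  have e1 := pluckerCoordinate_standardFrame (K := K) (le_refl d)
  have e2 := pluckerCoordinate_standardFrame (K := L) (le_refl d)
  rw [e1, e2] at h1
  simpa using h1

/-- The coordinates of a crossing are in `Γ`. -/
theorem mem_of_crossFrame {g : ℕ → Fin d → K} {g' : ℕ → Fin d → L} (hg : FrameIn Γ g g')
    {F G : DecoratedFlag K d} {F' G' : DecoratedFlag L d} (hF : IsFrame g F) (hF' : IsFrame g' F')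
    {p : ℕ} (hp : p + 2 ≤ d) {z μ : K} {z' μ' : L} (hG : IsFrame (crossFrame p z μ g) G)
    (hG' : IsFrame (crossFrame p z' μ' g') G')
    (h : PluckerIn Γ (p + 1) (G.level (p + 1)) (G'.level (p + 1))) :
    (z, z') ∈ Γ ∧ (μ, μ') ∈ Γ := by
  rw [hG _ (by omega), hG' _ (by omega)] at h
  have h1 : ∀ {v : Fin d → K} {v' : Fin d → L}, (∀ j, (v j, v' j) ∈ Γ) → PluckerIn Γ (p + 2)
      (wedge (crossFrame p z μ g) (p + 1) * ι K v)
      (wedge (crossFrame p z' μ' g') (p + 1) * ι L v') := by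
    intro v v' hv
    have h2 : PluckerIn Γ (p + 1) ((1 : K) • wedge (crossFrame p z μ g) (p + 1))
      ((1 : L) • wedge (crossFrame p z' μ' g') (p + 1)) := by rwa [one_smul, one_smul]
    simpa only [one_smul] using h2.mul_ι hv
  simp only [wedge_crossFrame_succ] at h1
  have h2 := h1 (hg (p + 1))
  have h3 := h1 (hg p)
  rw [(combination_mul_ι g p z μ).1, (combination_mul_ι g' p z' μ').1] at h2
  rw [(combination_mul_ι g p z μ).2, (combination_mul_ι g' p z' μ').2, ← neg_smul, ← neg_smul] at h3
  refine ⟨mem_of_pluckerIn hg hF hF' hp h2, ?_⟩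
  simpa using Γ.neg_mem (mem_of_pluckerIn hg hF hF' hp h3)

theorem Linked.pluckerIn {F : DecoratedFlag K d} {F' : DecoratedFlag L d} (h : Linked Γ F F')
    {k : ℕ} (hk : k ≤ d) : PluckerIn Γ k (F.level k) (F'.level k) := by
  obtain ⟨g, g', hF, hF', hg⟩ := h
  rw [hF k hk, hF' k hk]
  exact hg.pluckerIn k

theorem exists_crossFrame_of_pluckerIn {g : ℕ → Fin d → K} {g' : ℕ → Fin d → L}
    (hg : FrameIn Γ g g') {F G : DecoratedFlag K d} {F' G' : DecoratedFlag L d} (hF : IsFrame g F)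
    (hF' : IsFrame g' F') {k : Color d} {μ : K} {μ' : L}
    (hG : RelativePosition F G k ∧ HasCrossingValue F G k μ)
    (hG' : RelativePosition F' G' k ∧ HasCrossingValue F' G' k μ')
    (h : PluckerIn Γ k (G.level k) (G'.level k)) :
    μ' ≠ 0 ∧ (μ, μ') ∈ Γ ∧ ∃ z z', (z, z') ∈ Γ ∧ IsFrame (crossFrame ((k : ℕ) - 1) z μ g) G ∧
      IsFrame (crossFrame ((k : ℕ) - 1) z' μ' g') G' := by
  have hk := color_pred_add k
  obtain ⟨-, z, h1⟩ := exists_crossFrame_of_hasCrossingValue hF hk hG.1 hG.2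
  obtain ⟨hμ', z', h2⟩ := exists_crossFrame_of_hasCrossingValue hF' hk hG'.1 hG'.2
  rw [hk] at h
  obtain ⟨hz, hμ⟩ := mem_of_crossFrame hg hF hF' (by have := k.2; omega) h1 h2 h
  exact ⟨hμ', hμ, z, z', hz, h1, h2⟩

end Pluecker

/-! ### Runs over a specialization -/

section SpecializedRuns

variable {K L : Type*} [Field K] [Field L] {d : ℕ} {N : Type*} {Δ : N → K}
  {Γ : Subring (K × L)}

/-- Pairs of rows of linked flags. -/
def LinkedRow (Γ : Subring (K × L)) (X : List (Letter K d N)) (X' : List (Letter L d Empty)) :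
    Prop :=
  List.Forall₂ (fun x x' => x.col = x'.col ∧ Linked Γ x.flag x'.flag) X X'

theorem LinkedRow.endFlag {X : List (Letter K d N)} {X' : List (Letter L d Empty)}
    (h : LinkedRow Γ X X') {F : DecoratedFlag K d} {F' : DecoratedFlag L d} (hF : Linked Γ F F') :
    Linked Γ (endFlag F X) (endFlag F' X') := by
  induction h generalizing F F' with
  | nil => exact hF
  | cons h _ ih => exact ih h.2

theorem LinkedRow.append_inv {X : List (Letter K d N)} {Y Z : List (Letter L d Empty)}
    (h : LinkedRow Γ X (Y ++ Z)) :
    ∃ X₁ X₂, X = X₁ ++ X₂ ∧ LinkedRow Γ X₁ Y ∧ LinkedRow Γ X₂ Z :=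
  ⟨_, _, (List.take_append_drop _ X).symm, List.forall₂_take_append _ _ _ h,
    List.forall₂_drop_append _ _ _ h⟩

theorem LinkedRow.map_col {X : List (Letter K d N)} {X' : List (Letter L d Empty)}
    (h : LinkedRow Γ X X') : X.map Letter.col = X'.map Letter.col := by
  induction h with
  | nil => rfl
  | cons h _ ih => rw [List.map_cons, List.map_cons, h.1, ih]

theorem exists_eq_of_map_col_one {X : List (Letter K d N)} {i : Color d}
    (h : X.map Letter.col = [i]) : ∃ a F, X = [⟨i, a, F⟩] := by
  obtain ⟨⟨_, a, F⟩, Y, rfl, rfl, h'⟩ := List.map_eq_cons_iff.1 h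
  exact ⟨a, F, by rw [List.map_eq_nil_iff.1 h']⟩

theorem exists_eq_of_map_col_two {X : List (Letter K d N)} {i j : Color d}
    (h : X.map Letter.col = [i, j]) : ∃ a F b G, X = [⟨i, a, F⟩, ⟨j, b, G⟩] := by
  obtain ⟨⟨_, a, F⟩, Y, rfl, rfl, h'⟩ := List.map_eq_cons_iff.1 h
  obtain ⟨b, G, rfl⟩ := exists_eq_of_map_col_one h'
  exact ⟨a, F, b, G, rfl⟩

theorem exists_eq_of_map_col_three {X : List (Letter K d N)} {i j k : Color d}
    (h : X.map Letter.col = [i, j, k]) :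
    ∃ a F b G c H, X = [⟨i, a, F⟩, ⟨j, b, G⟩, ⟨k, c, H⟩] := by
  obtain ⟨⟨_, a, F⟩, Y, rfl, rfl, h'⟩ := List.map_eq_cons_iff.1 h
  obtain ⟨b, G, c, H, rfl⟩ := exists_eq_of_map_col_two h'
  exact ⟨a, F, b, G, c, H, rfl⟩

variable [Fintype N]

/-- The specialized rows have no cycles, so all their crossing values are empty products and equal
to one. -/
theorem weightValue_mem (h : ∀ n, (Δ n, 1) ∈ Γ) (a : N → ℕ) (Δ' : Empty → L) (a' : Empty → ℕ) :
    (weightValue Δ a, weightValue Δ' a') ∈ Γ := by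
  have := Γ.prod_mem (t := Finset.univ) fun n _ => Γ.pow_mem (h n) (a n)
  convert this using 1
  ext <;> simp [weightValue, Prod.fst_prod, Prod.snd_prod]

theorem exists_crossFrame_of_linked (hΓ : IsSpecialization Γ) {g : ℕ → Fin d → K}
    {g' : ℕ → Fin d → L} (hg : FrameIn Γ g g') {F G : DecoratedFlag K d} {F' G' : DecoratedFlag L d}
    (hF : IsFrame g F) (hF' : IsFrame g' F') {k : Color d} {μ : K} {μ' : L}
    (hG : RelativePosition F G k ∧ HasCrossingValue F G k μ)
    (hG' : RelativePosition F' G' k ∧ HasCrossingValue F' G' k μ')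
    (h : PluckerIn Γ k (G.level k) (G'.level k)) :
    ∃ z z', (z, z') ∈ Γ ∧ IsFrame (crossFrame ((k : ℕ) - 1) z μ g) G ∧
      IsFrame (crossFrame ((k : ℕ) - 1) z' μ' g') G' ∧
      FrameIn Γ (crossFrame ((k : ℕ) - 1) z μ g) (crossFrame ((k : ℕ) - 1) z' μ' g') := by
  obtain ⟨hμ', hμ, z, z', hz, h1, h2⟩ := exists_crossFrame_of_pluckerIn hg hF hF' hG hG' h
  exact ⟨z, z', hz, h1, h2, hg.crossFrame_mem hΓ _ hz hμ hμ'⟩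

variable {Δ' : Empty → L}

/-- The braid formulas divide only by crossing values, which specialize to one. So the new
coordinates are in `Γ`, and the new flags specialize to the unique inner flags of the given row. -/
theorem exists_linked_six (hΓ : IsSpecialization Γ) (hΔ : ∀ n, (Δ n, 1) ∈ Γ) {i j : Color d}
    (h : Adjacent i j) {F F₁ F₂ F₃ : DecoratedFlag K d} {F' F₁' F₂' F₃' G₁' G₂' : DecoratedFlag L d}
    (hF : Linked Γ F F') (h₁ : Linked Γ F₁ F₁') (h₂ : Linked Γ F₂ F₂') (h₃ : Linked Γ F₃ F₃')
    {a f e : N → ℕ} {a' f' e' b' c' x' : Empty → ℕ}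
    (hX : ValidRow Δ F [⟨i, a, F₁⟩, ⟨j, f, F₂⟩, ⟨i, e, F₃⟩])
    (hX' : ValidRow Δ' F' [⟨i, a', F₁'⟩, ⟨j, f', F₂'⟩, ⟨i, e', F₃'⟩])
    (hG' : ValidRow Δ' F' [⟨j, b', G₁'⟩, ⟨i, c', G₂'⟩, ⟨j, x', F₃'⟩]) :
    ∃ G₁ G₂, ValidRow Δ F [⟨j, f + e - a ⊓ e, G₁⟩, ⟨i, a ⊓ e, G₂⟩, ⟨j, a + f - a ⊓ e, F₃⟩] ∧
      Linked Γ G₁ G₁' ∧ Linked Γ G₂ G₂' := by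
  have hi := i.2.2.le
  have hj := j.2.2.le
  have nz : ∀ n, Δ n ≠ 0 := fun n => (hΓ _ (hΔ n) one_ne_zero).1
  have hw := weightValue_mem hΔ
  have nz' : ∀ a' : Empty → ℕ, weightValue Δ' a' ≠ 0 := by simp [weightValue]
  obtain ⟨g, g', f₀, f₀', k₀⟩ := hF
  obtain ⟨v₁, v₂, v₃, -⟩ := id hX
  obtain ⟨v₁', v₂', v₃', -⟩ := id hX'
  obtain ⟨z₁, z₁', m₁, f₁, f₁', k₁⟩ :=
    exists_crossFrame_of_linked hΓ k₀ f₀ f₀' v₁ v₁' (h₁.pluckerIn hi)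
  obtain ⟨z₂, z₂', m₂, f₂, f₂', k₂⟩ :=
    exists_crossFrame_of_linked hΓ k₁ f₁ f₁' v₂ v₂' (h₂.pluckerIn hj)
  obtain ⟨z₃, z₃', m₃, f₃, f₃', k₃⟩ :=
    exists_crossFrame_of_linked hΓ k₂ f₂ f₂' v₃ v₃' (h₃.pluckerIn hi)
  obtain ⟨b, c, x, G₁, G₂, hb, hG, -⟩ := exists_six nz h f₀ (a := a) (f := f) (e := e) (z₁ := z₁)
    (z₂ := z₂) (z₃ := z₃) ⟨F₁, _, rfl, f₁, F₂, _, rfl, f₂, F₃, [], rfl, f₃, rfl⟩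
  obtain ⟨y, t, s, H₁, H₂, hy, hH, -⟩ := exists_six (Δ := Δ') (fun n => n.elim) h f₀' (a := a')
    (f := f') (e := e') (z₁ := z₁') (z₂ := z₂') (z₃ := z₃')
    ⟨F₁', _, rfl, f₁', F₂', _, rfl, f₂', F₃', [], rfl, f₃', rfl⟩
  obtain rfl : c' = a' ⊓ e' := Subsingleton.elim _ _
  obtain ⟨rfl, rfl⟩ := six_unique h hG' (hH.valid (fun n => n.elim) f₀')
  simp only [sixLabels, sixWeights, Prod.mk.injEq] at hb hy
  obtain ⟨rfl, rfl, rfl⟩ := hb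
  obtain ⟨rfl, rfl, rfl⟩ := hy
  have hV := hG.valid nz f₀
  simp only [HasCoordinates, List.cons.injEq, Letter.mk.injEq, true_and] at hG hH
  obtain ⟨_, _, ⟨rfl, rfl⟩, q₁, _, _, ⟨rfl, rfl⟩, q₂, -⟩ := hG
  obtain ⟨_, _, ⟨rfl, rfl⟩, r₁, _, _, ⟨rfl, rfl⟩, r₂, -⟩ := hH
  have k₄ := k₀.crossFrame_mem hΓ ((j : ℕ) - 1)
    (hΓ.div_mem (Γ.mul_mem (hw a Δ' a') m₃) (hw (a ⊓ e) Δ' (a' ⊓ e')) (nz' _))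
    (hw (f + e - a ⊓ e) Δ' (f' + e' - a' ⊓ e')) (nz' _)
  have k₅ := k₄.crossFrame_mem hΓ ((i : ℕ) - 1)
    (Γ.sub_mem (Γ.mul_mem m₁ m₃)
      (hΓ.div_mem (Γ.mul_mem (hw e Δ' e') m₂) (hw a Δ' a') (nz' _)))
    (hw (a ⊓ e) Δ' (a' ⊓ e')) (nz' _)
  exact ⟨G₁, G₂, hV, ⟨_, _, q₁, r₁, k₄⟩, ⟨_, _, q₂, r₂, k₅⟩⟩

theorem exists_linked_four (hΓ : IsSpecialization Γ) (hΔ : ∀ n, (Δ n, 1) ∈ Γ) {i j : Color d}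
    (h : Distant i j) {F F₁ F₂ : DecoratedFlag K d} {F' F₁' F₂' G' : DecoratedFlag L d}
    (hF : Linked Γ F F') (h₁ : Linked Γ F₁ F₁') (h₂ : Linked Γ F₂ F₂')
    {a b : N → ℕ} {a' b' x' y' : Empty → ℕ} (hX : ValidRow Δ F [⟨i, a, F₁⟩, ⟨j, b, F₂⟩])
    (hX' : ValidRow Δ' F' [⟨i, a', F₁'⟩, ⟨j, b', F₂'⟩])
    (hG' : ValidRow Δ' F' [⟨j, x', G'⟩, ⟨i, y', F₂'⟩]) :
    ∃ G, ValidRow Δ F [⟨j, b, G⟩, ⟨i, a, F₂⟩] ∧ Linked Γ G G' := by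
  have nz : ∀ n, Δ n ≠ 0 := fun n => (hΓ _ (hΔ n) one_ne_zero).1
  obtain ⟨g, g', f₀, f₀', k₀⟩ := hF
  obtain ⟨v₁, v₂, -⟩ := id hX
  obtain ⟨v₁', v₂', -⟩ := id hX'
  obtain ⟨z₁, z₁', m₁, f₁, f₁', k₁⟩ :=
    exists_crossFrame_of_linked hΓ k₀ f₀ f₀' v₁ v₁' (h₁.pluckerIn i.2.2.le)
  obtain ⟨z₂, z₂', m₂, f₂, f₂', k₂⟩ :=
    exists_crossFrame_of_linked hΓ k₁ f₁ f₁' v₂ v₂' (h₂.pluckerIn j.2.2.le)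
  obtain ⟨G, hG, -⟩ := exists_four nz h f₀ (a := (a, z₁)) (f := (b, z₂))
    ⟨F₁, _, rfl, f₁, F₂, [], rfl, f₂, rfl⟩
  obtain ⟨H, hH, -⟩ := exists_four (Δ := Δ') (fun n => n.elim) h f₀' (a := (a', z₁'))
    (f := (b', z₂')) ⟨F₁', _, rfl, f₁', F₂', [], rfl, f₂', rfl⟩
  have hij : i ≠ j := by rintro rfl; simp [Distant] at h
  obtain rfl := four_unique hij hG' (hH.valid (fun n => n.elim) f₀')
  have hV := hG.valid nz f₀
  simp only [HasCoordinates, List.cons.injEq, Letter.mk.injEq, true_and] at hG hH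
  obtain ⟨_, _, ⟨rfl, rfl⟩, q₁, -⟩ := hG
  obtain ⟨_, _, ⟨rfl, rfl⟩, r₁, -⟩ := hH
  exact ⟨G, hV, _, _, q₁, r₁, k₀.crossFrame_mem hΓ _ m₂ (weightValue_mem hΔ b Δ' b')
    (by simp [weightValue])⟩

/-- The decisive nonvanishing: the coordinate `z₂` specializes to the crossing value below the
trivalent vertex of the specialized weave. This is one, so `z₂` is a unit. -/
theorem exists_linked_tri (hΓ : IsSpecialization Γ) (hΔ : ∀ n, (Δ n, 1) ∈ Γ) {i : Color d}
    {F F₁ F₂ : DecoratedFlag K d} {F' F₁' F₂' : DecoratedFlag L d}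
    (hF : Linked Γ F F') (h₁ : Linked Γ F₁ F₁') (h₂ : Linked Γ F₂ F₂')
    {a b : N → ℕ} {a' b' x' : Empty → ℕ} (hX : ValidRow Δ F [⟨i, a, F₁⟩, ⟨i, b, F₂⟩])
    (hX' : ValidRow Δ' F' [⟨i, a', F₁'⟩, ⟨i, b', F₂'⟩])
    (hG' : ValidRow Δ' F' [⟨i, x', F₂'⟩]) :
    ∃ μ, (μ, 1) ∈ Γ ∧ RelativePosition F F₂ i ∧ HasCrossingValue F F₂ i μ := by
  have nz : ∀ n, Δ n ≠ 0 := fun n => (hΓ _ (hΔ n) one_ne_zero).1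
  have nw := weightValue_ne_zero nz
  have nw' : ∀ a' : Empty → ℕ, weightValue Δ' a' = 1 := by simp [weightValue]
  obtain ⟨g, g', f₀, f₀', k₀⟩ := hF
  obtain ⟨v₁, v₂, -⟩ := id hX
  obtain ⟨v₁', v₂', -⟩ := id hX'
  rw [nw'] at v₁' v₂'
  obtain ⟨z₁, z₁', m₁, f₁, f₁', k₁⟩ :=
    exists_crossFrame_of_linked hΓ k₀ f₀ f₀' v₁ v₁' (h₁.pluckerIn i.2.2.le)
  obtain ⟨z₂, z₂', m₂, f₂, f₂', k₂⟩ :=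
    exists_crossFrame_of_linked hΓ k₁ f₁ f₁' v₂ v₂' (h₂.pluckerIn i.2.2.le)
  obtain ⟨-, e⟩ := (tri_iff f₀' one_ne_zero one_ne_zero f₁' f₂').1 hG'.1
  rw [nw', one_mul] at e
  subst e
  have hm := Γ.mul_mem (weightValue_mem hΔ a Δ' a') m₂
  rw [nw', Prod.mk_mul_mk, one_mul] at hm
  exact ⟨_, hm, (tri_iff f₀ (nw a) (nw b) f₁ f₂).2
    ⟨mul_ne_zero (nw a) (hΓ _ m₂ one_ne_zero).1, rfl⟩⟩

theorem exists_linked_kindStep (hΓ : IsSpecialization Γ) (hΔ : ∀ n, (Δ n, 1) ∈ Γ)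
    {k : VertexKind d} {o : Option N} (ho : o.isSome = k.isTri) {F : DecoratedFlag K d}
    {F' : DecoratedFlag L d} (hF : Linked Γ F F') {T : List (Letter K d N)}
    {T' S' : List (Letter L d Empty)} (hT : ValidRow Δ F T) (hT' : ValidRow Δ' F' T')
    (hS' : ValidRow Δ' F' S') (h : LinkedRow Γ T T') (ht : T'.map Letter.col = k.top)
    (hs : S'.map Letter.col = k.bot) (he : DemazureWeaves.endFlag F' S' = endFlag F' T')
    (hfr : ∀ n, o = some n → ∀ x ∈ T, x.wt n = 0) :
    ∃ Δ₁ : N → K, (∀ n, o ≠ some n → Δ₁ n = Δ n) ∧ (∀ n, (Δ₁ n, 1) ∈ Γ) ∧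
      ∃ S P, KindStep k o T S P ∧ ValidRow Δ₁ F S ∧ LinkedRow Γ S S' := by
  classical
  cases k with
  | tri i =>
    obtain ⟨n, rfl⟩ : ∃ n, o = some n := Option.isSome_iff_exists.1 ho
    obtain ⟨a, F₁, b, F₂, rfl⟩ := exists_eq_of_map_col_two (h.map_col.trans ht)
    obtain ⟨a', F₁', b', F₂', rfl⟩ := exists_eq_of_map_col_two ht
    obtain ⟨x', G', rfl⟩ := exists_eq_of_map_col_one hs
    obtain rfl : G' = F₂' := he
    simp only [LinkedRow, List.forall₂_cons, true_and, List.Forall₂.nil, and_true] at h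
    obtain ⟨μ, hμ, hR⟩ := exists_linked_tri hΓ hΔ hF h.1 h.2 hT hT' hS'
    have ha : a n = 0 := hfr n rfl ⟨i, a, F₁⟩ (List.mem_cons_self ..)
    have hw := weightValue_mem hΔ (a ⊓ b) (fun _ => (1 : L)) 0
    have hw0 : weightValue Δ (a ⊓ b) ≠ 0 := (hΓ _ hw (by simp [weightValue])).1
    have hm := hΓ.div_mem hμ hw (by simp [weightValue])
    -- The fresh name `n` enters the crossing value below the vertex with exponent one, so its value
    -- is the quotient of this crossing value by the contribution of the older names.
    refine ⟨Function.update Δ n (μ / weightValue Δ (a ⊓ b)), fun m hm => Function.update_of_ne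
      (fun h => hm (by rw [h])) _ _, fun m => ?_, [⟨i, Function.update (a ⊓ b) n 1, F₂⟩], _,
      ⟨n, a, b, F₁, F₂, rfl, rfl, rfl, rfl⟩, ⟨⟨hR.1, ?_⟩, trivial⟩,
      List.forall₂_cons.2 ⟨⟨rfl, h.2⟩, List.Forall₂.nil⟩⟩
    · by_cases h : m = n
      · subst h
        rw [Function.update_self]
        simpa [weightValue] using hm
      · rw [Function.update_of_ne h]
        exact hΔ m
    · have e : Function.update (a ⊓ b) n 0 = a ⊓ b := by
        rw [Function.update_eq_self_iff]
        simp [ha]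
      rw [weightValue_update, Function.update_self, e,
        weightValue_congr (Δ := Function.update Δ n _) (Δ' := Δ),
        div_mul_cancel₀ _ hw0]
      · exact hR.2
      · intro m hm
        refine Function.update_of_ne (fun h => hm ?_) _ _
        rw [h, ← e, Function.update_self]
  | four i j hij =>
    have ho : o = none := by simpa [VertexKind.isTri] using ho
    obtain ⟨a, F₁, b, F₂, rfl⟩ := exists_eq_of_map_col_two (h.map_col.trans ht)
    obtain ⟨a', F₁', b', F₂', rfl⟩ := exists_eq_of_map_col_two ht
    obtain ⟨x', G₁', y', G₂', rfl⟩ := exists_eq_of_map_col_two hs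
    obtain rfl : G₂' = F₂' := he
    simp only [LinkedRow, List.forall₂_cons, true_and, List.Forall₂.nil, and_true] at h
    obtain ⟨G, hG, hl⟩ := exists_linked_four hΓ hΔ hij hF h.1 h.2 hT hT' hS'
    exact ⟨Δ, fun _ _ => rfl, hΔ, _, _, ⟨a, b, F₁, F₂, G, ho, rfl, rfl, rfl⟩, hG,
      List.forall₂_cons.2 ⟨⟨rfl, hl⟩, List.forall₂_cons.2 ⟨⟨rfl, h.2⟩, List.Forall₂.nil⟩⟩⟩
  | six i j hij =>
    have ho : o = none := by simpa [VertexKind.isTri] using ho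
    obtain ⟨a, F₁, f, F₂, e, F₃, rfl⟩ := exists_eq_of_map_col_three (h.map_col.trans ht)
    obtain ⟨a', F₁', f', F₂', e', F₃', rfl⟩ := exists_eq_of_map_col_three ht
    obtain ⟨x', G₁', y', G₂', t', G₃', rfl⟩ := exists_eq_of_map_col_three hs
    obtain rfl : G₃' = F₃' := he
    simp only [LinkedRow, List.forall₂_cons, true_and, List.Forall₂.nil, and_true] at h
    obtain ⟨G₁, G₂, hG, hl₁, hl₂⟩ := exists_linked_six hΓ hΔ hij hF h.1 h.2.1 h.2.2 hT hT' hS'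
    exact ⟨Δ, fun _ _ => rfl, hΔ, _, _, ⟨a, f, e, F₁, F₂, F₃, G₁, G₂, ho, rfl, rfl, rfl⟩, hG,
      List.forall₂_cons.2 ⟨⟨rfl, hl₁⟩, List.forall₂_cons.2 ⟨⟨rfl, hl₂⟩,
        List.forall₂_cons.2 ⟨⟨rfl, h.2.2⟩, List.Forall₂.nil⟩⟩⟩⟩

/-- The row `X` of flags that begins with `F` extends to the faces of a weave, with all crossing
values equal to `1`. -/
def Descends (F : DecoratedFlag L d) : List (Vertex d) → List (Letter L d Empty) → Prop
  | [], _ => True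
  | v :: W, X => ∃ Y T S Z, X = Y ++ T ++ Z ∧ Y.map Letter.col = v.left ∧
      T.map Letter.col = v.kind.top ∧ S.map Letter.col = v.kind.bot ∧ Z.map Letter.col = v.right ∧
      endFlag (endFlag F Y) S = endFlag (endFlag F Y) T ∧
      ValidRow (fun _ => 1) F (Y ++ S ++ Z) ∧ Descends F W (Y ++ S ++ Z)

/-- The values `Δ₁` are constructed along the run. A name is assigned its value when its cycle
begins; it has the weight zero on all earlier rows, so these remain valid. -/
theorem exists_run_of_descends (hΓ : IsSpecialization Γ) {W : List (Vertex d × Option N)}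
    (hs : ∀ w ∈ W, w.2.isSome = w.1.kind.isTri) (hN : (names W).Nodup) (hΔ : ∀ n, (Δ n, 1) ∈ Γ)
    {F : DecoratedFlag K d} {F' : DecoratedFlag L d} (hF : Linked Γ F F')
    {X : List (Letter K d N)} {X' : List (Letter L d Empty)} (hX : ValidRow Δ F X)
    (hfr : ∀ n ∈ names W, ∀ x ∈ X, x.wt n = 0) (hX' : ValidRow (fun _ => 1) F' X')
    (hd : Descends F' (W.map Prod.fst) X') (h : LinkedRow Γ X X') :
    ∃ Δ₁ : N → K, (∀ n ∉ names W, Δ₁ n = Δ n) ∧ ∃ Z P, Run Δ₁ F W X Z P := by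
  induction W generalizing X X' Δ with
  | nil => exact ⟨Δ, fun _ _ => rfl, X, 0, rfl, rfl⟩
  | cons w W ih =>
    obtain ⟨Y', T', S', Z', rfl, hY, hT, hS, hZ, he, hV', hd⟩ := hd
    obtain ⟨_, Z, rfl, h, lZ⟩ := h.append_inv
    obtain ⟨Y, T, rfl, lY, lT⟩ := h.append_inv
    obtain ⟨⟨vY, vT⟩, vZ⟩ := (validRow_append.1 hX).imp_left validRow_append.1
    obtain ⟨⟨vY', vT'⟩, vZ'⟩ := (validRow_append.1 hX').imp_left validRow_append.1
    have hmem : ∀ n, w.2 = some n → n ∈ names (w :: W) := fun n hn =>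
      List.mem_filterMap.2 ⟨w, List.mem_cons_self .., hn⟩
    have hmem' : ∀ n ∈ names W, n ∈ names (w :: W) := fun n hn => by
      obtain ⟨u, hu, hun⟩ := List.mem_filterMap.1 hn
      exact List.mem_filterMap.2 ⟨u, List.mem_cons_of_mem _ hu, hun⟩
    obtain ⟨Δ₁, h1, h2, S, P, hK, hVS, lS⟩ := exists_linked_kindStep hΓ hΔ
      (hs w (List.mem_cons_self ..)) (lY.endFlag hF) vT vT'
      (validRow_append.1 (validRow_append.1 hV').1).2 lT hT hS he
      fun n hn x hx => hfr n (hmem n hn) x (by simp [hx])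
    have hstep : RowStep w.1 w.2 (Y ++ T ++ Z) (Y ++ S ++ Z) P :=
      ⟨Y, T, S, Z, rfl, rfl, lY.map_col.trans hY, lZ.map_col.trans hZ, hK⟩
    have hc : ∀ x ∈ Y ++ T ++ Z, ∀ n, x.wt n ≠ 0 → Δ n = Δ₁ n := fun x hx n hn =>
      (h1 n fun hw => hn (hfr n (hmem n hw) x hx)).symm
    have hV : ValidRow Δ₁ F (Y ++ S ++ Z) := by
      rw [validRow_append, validRow_append]
      refine ⟨⟨vY.congr fun x hx => hc x (by simp [hx]), hVS⟩, ?_⟩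
      rw [endFlag_append, hK.endFlag, ← endFlag_append]
      exact vZ.congr fun x hx => hc x (by simp [hx])
    have hne : ∀ n ∈ names W, w.2 ≠ some n := fun n hn hw => by
      rw [names, List.filterMap_cons_some hw, List.nodup_cons] at hN
      exact hN.1 hn
    have hN' : (names W).Nodup := hN.sublist ((List.sublist_cons_self w W).filterMap _)
    have lrow : LinkedRow Γ (Y ++ S ++ Z) (Y' ++ S' ++ Z') :=
      List.rel_append (List.rel_append lY lS) lZ
    have hfr' : ∀ n ∈ names W, ∀ x ∈ Y ++ S ++ Z, x.wt n = 0 := fun n hn =>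
      hstep.wt_eq_zero (hne n hn) (hfr n (hmem' n hn))
    obtain ⟨Δ₂, h3, Z₁, P₁, hr⟩ := ih (fun u hu => hs u (List.mem_cons_of_mem _ hu)) hN' h2 hV
      hfr' hV' hd lrow
    refine ⟨Δ₂, fun n hn => (h3 n fun hn' => hn (hmem' n hn')).trans
      (h1 n fun hw => hn (hmem n hw)), Z₁, _, _, P, P₁, hstep, hV.congr fun x hx n hn => ?_, hr,
      rfl⟩
    exact (h3 n fun hn' => hn (hfr' n hn' x hx)).symm

end SpecializedRuns

/-! ### Runs as decorations of weaves -/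

section DecorationOfRun

variable {K : Type*} [Field K] {d : ℕ} {N : Type*}

/-- The flags of a row, counted from the leftmost flag `F`. -/
def flagAt : DecoratedFlag K d → List (Letter K d N) → ℕ → DecoratedFlag K d
  | F, [], _ => F
  | F, _ :: _, 0 => F
  | _, x :: X, p + 1 => flagAt x.flag X p

theorem flagAt_zero (F : DecoratedFlag K d) (X : List (Letter K d N)) : flagAt F X 0 = F := by
  cases X <;> rfl

theorem flagAt_append_left {F : DecoratedFlag K d} {X Y : List (Letter K d N)} {p : ℕ}
    (hp : p ≤ X.length) : flagAt F (X ++ Y) p = flagAt F X p := by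
  induction X generalizing F p with
  | nil =>
    obtain rfl : p = 0 := by simpa using hp
    exact flagAt_zero F Y
  | cons x X ih =>
    cases p with
    | zero => rfl
    | succ p => exact ih (by simpa using hp)

theorem flagAt_append_right {F : DecoratedFlag K d} {X Y : List (Letter K d N)} (p : ℕ) :
    flagAt F (X ++ Y) (X.length + p) = flagAt (endFlag F X) Y p := by
  induction X generalizing F with
  | nil => simp [endFlag]
  | cons x X ih =>
    rw [List.length_cons, Nat.add_right_comm]
    exact ih

theorem map_flag_toRow {α : List (Color d)} {X : List (Letter K d N)} (h : α.length = X.length)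
    (wt : ℕ → N → ℕ) (F : DecoratedFlag K d) :
    (toRow α wt (flagAt F X)).map Letter.flag = X.map Letter.flag := by
  induction X generalizing F α wt with
  | nil =>
    obtain rfl := List.length_eq_zero_iff.1 h
    rfl
  | cons x X ih =>
    cases α with
    | nil => simp at h
    | cons c α =>
      rw [toRow, List.map_cons, List.map_cons]
      exact congrArg₂ _ (flagAt_zero x.flag X) (ih (by simpa using h) _ x.flag)

theorem flagAt_toRow {α : List (Color d)} {wt : ℕ → N → ℕ} {fl : ℕ → DecoratedFlag K d} {p : ℕ}
    (hp : p ≤ α.length) : flagAt (fl 0) (toRow α wt fl) p = fl p := by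
  induction α generalizing wt fl p with
  | nil =>
    obtain rfl : p = 0 := by simpa using hp
    rfl
  | cons c α ih =>
    cases p with
    | zero => rfl
    | succ p => exact ih (fl := fun p => fl (p + 1)) (by simpa using hp)

theorem exists_eq_toRow (F : DecoratedFlag K d) (X : List (Letter K d N)) :
    ∃ wt, X = toRow (X.map Letter.col) wt (flagAt F X) := by
  induction X generalizing F with
  | nil => exact ⟨fun _ _ => 0, rfl⟩
  | cons x X ih =>
    obtain ⟨wt, h⟩ := ih x.flag
    refine ⟨fun p => Nat.casesOn p x.wt wt, ?_⟩
    rw [List.map_cons, toRow]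
    refine congrArg₂ _ ?_ h
    change x = ⟨x.col, x.wt, flagAt x.flag X 0⟩
    rw [flagAt_zero]

theorem RowStep.facesAgree {v : Vertex d} {o : Option N} {X X' : List (Letter K d N)}
    {P : N → N → ℤ} (h : RowStep v o X X' P) (F : DecoratedFlag K d) :
    v.FacesAgree (flagAt F X) (flagAt F X') := by
  obtain ⟨Y, T, S, Z, rfl, rfl, hY, -, hK⟩ := h
  obtain ⟨l, k, r⟩ := v
  obtain rfl : Y.map Letter.col = l := hY
  rw [List.append_assoc, List.append_assoc]
  have left : ∀ p ≤ Y.length, flagAt F (Y ++ (S ++ Z)) p = flagAt F (Y ++ (T ++ Z)) p :=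
    fun p hp => by rw [flagAt_append_left hp, flagAt_append_left hp]
  unfold Vertex.FacesAgree
  simp only [List.length_map]
  cases k with
  | tri i =>
    obtain ⟨n, a, b, F₁, F₂, -, rfl, rfl, -⟩ := hK
    refine ⟨left, fun p hp => ?_⟩
    obtain ⟨q, rfl⟩ := Nat.exists_eq_add_of_lt hp
    rw [Nat.add_assoc, flagAt_append_right, Nat.add_assoc, flagAt_append_right]
    rfl
  | four i j _ =>
    obtain ⟨a, b, F₁, F₂, G, -, rfl, rfl, -⟩ := hK
    intro p hp
    by_cases hpl : p ≤ Y.length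
    · exact left p hpl
    obtain ⟨q, rfl⟩ : ∃ q, p = Y.length + (q + 2) := ⟨p - Y.length - 2, by omega⟩
    rw [flagAt_append_right, flagAt_append_right]
    rfl
  | six i j _ =>
    obtain ⟨a, f, e, F₁, F₂, F₃, G₁, G₂, -, rfl, rfl, -⟩ := hK
    intro p hp hp'
    by_cases hpl : p ≤ Y.length
    · exact left p hpl
    obtain ⟨q, rfl⟩ : ∃ q, p = Y.length + (q + 3) := ⟨p - Y.length - 3, by omega⟩
    rw [flagAt_append_right, flagAt_append_right]
    rfl

/-- The colors and weights after a step are functions of the row above, and only the flags leave a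
choice. -/
theorem RowStep.eq_of_map_flag {v : Vertex d} {o : Option N} {X X' X'' : List (Letter K d N)}
    {P P' : N → N → ℤ} (h : RowStep v o X X' P) (h' : RowStep v o X X'' P')
    (e : X'.map Letter.flag = X''.map Letter.flag) : X' = X'' := by
  obtain ⟨Y, T, S, Z, rfl, rfl, hY, hZ, hK⟩ := h
  rw [rowStep_append_iff (by rw [← hY, List.length_map])
    (by rw [← hK.map_col.1, List.length_map])] at h'
  obtain ⟨-, -, S', rfl, hK'⟩ := h'
  simp only [List.map_append, List.append_cancel_left_eq, List.append_cancel_right_eq] at e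
  congr 2
  obtain ⟨l, k, r⟩ := v
  cases k with
  | tri i =>
    obtain ⟨n, a, b, F₁, F₂, rfl, rfl, rfl, -⟩ := hK
    obtain ⟨n', a', b', F₁', F₂', hn, hT, rfl, -⟩ := hK'
    simp only [List.cons.injEq, Letter.mk.injEq, true_and, and_true, Option.some.injEq] at hT hn
    obtain ⟨⟨rfl, rfl⟩, rfl, rfl⟩ := hT
    rw [hn]
  | four i j _ =>
    obtain ⟨a, b, F₁, F₂, G, -, rfl, rfl, -⟩ := hK
    obtain ⟨a', b', F₁', F₂', G', -, hT, rfl, -⟩ := hK'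
    simp only [List.cons.injEq, Letter.mk.injEq, true_and, and_true] at hT
    obtain ⟨⟨rfl, rfl⟩, rfl, rfl⟩ := hT
    simpa using e
  | six i j _ =>
    obtain ⟨a, f, c, F₁, F₂, F₃, G₁, G₂, -, rfl, rfl, -⟩ := hK
    obtain ⟨a', f', c', F₁', F₂', F₃', G₁', G₂', -, hT, rfl, -⟩ := hK'
    simp only [List.cons.injEq, Letter.mk.injEq, true_and, and_true] at hT
    obtain ⟨⟨rfl, rfl⟩, ⟨rfl, rfl⟩, rfl, rfl⟩ := hT
    simpa using e

variable [Fintype N] {Δ : N → K}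

theorem Run.exists_rows {F : DecoratedFlag K d} {W : List (Vertex d × Option N)}
    {X Z : List (Letter K d N)} {P : N → N → ℤ} (h : Run Δ F W X Z P) (hX : ValidRow Δ F X) :
    ∃ Y : ℕ → List (Letter K d N), Y 0 = X ∧
      (∀ t (ht : t < W.length), ∃ p, RowStep W[t].1 W[t].2 (Y t) (Y (t + 1)) p) ∧
      ∀ t ≤ W.length, ValidRow Δ F (Y t) := by
  induction W generalizing X P with
  | nil =>
    refine ⟨fun _ => X, rfl, fun t ht => by simp at ht, fun _ _ => hX⟩
  | cons w W ih =>
    obtain ⟨X', p, P', hs, hV, h, -⟩ := h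
    obtain ⟨Y, rfl, h1, h2⟩ := ih h hV
    refine ⟨fun t => Nat.casesOn t X Y, rfl, fun t ht => ?_, fun t ht => ?_⟩
    · cases t with
      | zero => exact ⟨p, hs⟩
      | succ t => exact h1 t (by simpa using ht)
    · cases t with
      | zero => exact hX
      | succ t => exact h2 t (by simpa using ht)

variable {β β' : List (Color d)} {M : Finset (Fin β.length)}

theorem Run.exists_decoration {w : DemazureWeave β β'} (ν : Cycle M w ≃ N)
    {fl : ℕ → DecoratedFlag K d} {Z : List (Letter K d N)} {P : N → N → ℤ}
    (h : Run Δ (fl 0) (w.labels ν) (topRow β M (ν ∘ .inl) fl) Z P)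
    (hX : ValidRow Δ (fl 0) (topRow β M (ν ∘ .inl) fl)) :
    ∃ D : Decoration K M w, ∀ p ≤ β.length, D.flag 0 p = fl p := by
  obtain ⟨Y, hY, hs, hV⟩ := h.exists_rows hX
  rw [topRow_eq] at hY
  have hs' : ∀ t (ht : t < w.vertices.length), ∃ o p, o = ((w.labels ν)[t]'(by
      rw [w.length_labels]; exact ht)).2 ∧ RowStep w.vertices[t] o (Y t) (Y (t + 1)) p := by
    intro t ht
    obtain ⟨p, hp⟩ := hs t (by rw [w.length_labels]; exact ht)
    refine ⟨_, p, rfl, ?_⟩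
    convert hp using 1
    simp [DemazureWeave.labels]
  have faces : ∀ t : Fin w.vertices.length, (w.vertices.get t).FacesAgree
      (flagAt (fl 0) (Y t)) (flagAt (fl 0) (Y (t + 1))) := by
    intro t
    obtain ⟨o, p, -, hp⟩ := hs' t t.2
    exact hp.facesAgree (fl 0)
  -- The weights that the run produces are the values of the cycles of `w`: both arise from the same
  -- top row by steps at the same vertices, with the same flags.
  have rows : ∀ t ≤ w.vertices.length, Y t = toRow (w.rowWord t)
      (fun p n => Cycle.weight (ν.symm n) t p) (flagAt (fl 0) (Y t)) := by
    intro t ht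
    induction t with
    | zero =>
      rw [hY]
      exact toRow_congr (fun _ _ => rfl) fun p hp => (flagAt_toRow hp).symm
    | succ t ih =>
      obtain ⟨o, p, rfl, hp⟩ := hs' t ht
      have h1 := w.rowStep_labels ν ht (faces ⟨t, ht⟩)
      rw [← ih (by omega)] at h1
      have e : ((w.labels ν)[t]'(by rw [w.length_labels]; exact ht)).1 = w.vertices[t] := by
        simp [DemazureWeave.labels]
      rw [e] at h1
      refine hp.eq_of_map_flag h1 (map_flag_toRow ?_ _ _).symm
      rw [w.rowWord_succ ht, ← hp.map_col.2, List.length_map]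
  refine ⟨⟨fun t => flagAt (fl 0) (Y t), Δ ∘ ν, faces, fun t ht p => ?_⟩, fun p hp => ?_⟩
  · have h1 := hV t (by rw [w.length_labels]; exact ht)
    rw [rows t ht] at h1
    have h2 := (validRow_toRow (fl := flagAt (fl 0) (Y t))).1 (by rwa [flagAt_zero]) p
    convert h2 using 2
    rw [weightValue, ← ν.prod_comp]
    simp
  · change flagAt (fl 0) (Y 0) p = fl p
    rw [hY, flagAt_toRow hp]

end DecorationOfRun

/-! ### Weaves with all crossing values equal to one -/

section UnitWeaves

variable {L : Type*} [Field L] {d : ℕ}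

theorem exists_validRow (F : DecoratedFlag L d) (α : List (Color d)) :
    ∃ X : List (Letter L d Empty), X.map Letter.col = α ∧ ValidRow (fun _ => 1) F X := by
  induction α generalizing F with
  | nil => exact ⟨[], rfl, trivial⟩
  | cons k α ih =>
    obtain ⟨g, hF⟩ := exists_frame F
    obtain ⟨G, hG⟩ := exists_flag_crossFrame hF (p := (k : ℕ) - 1)
      (by have := k.2; omega) 0 one_ne_zero
    obtain ⟨X, rfl, hX⟩ := ih G
    refine ⟨⟨k, 0, G⟩ :: X, rfl, ?_, hX⟩
    convert relativePosition_of_crossFrame hF (color_pred_add k) one_ne_zero hG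
    simp [weightValue]

/-- At 4- and 6-valent vertices this is a step through the opposite vertex. At a trivalent vertex, a
suitable intermediate flag always exists. -/
theorem exists_validRow_above (k : VertexKind d) {F : DecoratedFlag L d}
    {S : List (Letter L d Empty)} (hS : ValidRow (fun _ => 1) F S) (hs : S.map Letter.col = k.bot) :
    ∃ T : List (Letter L d Empty), T.map Letter.col = k.top ∧ ValidRow (fun _ => 1) F T ∧
      endFlag F S = endFlag F T := by
  cases k with
  | tri i =>
    obtain ⟨a, G, rfl⟩ := exists_eq_of_map_col_one hs
    have hw : ∀ a : Empty → ℕ, weightValue (fun _ => (1 : L)) a = 1 := by simp [weightValue]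
    have hi := color_pred_add i
    obtain ⟨g, hF⟩ := exists_frame F
    obtain ⟨⟨h1, h2⟩, -⟩ := hS
    rw [hw] at h2
    obtain ⟨-, z, hz⟩ := exists_crossFrame_of_hasCrossingValue hF hi h1 h2
    -- The coordinates `z + 1` and `1` with unit crossing values merge to the coordinate `(z + 1) *
    -- 1 - 1 = z` and the crossing value `1`.
    obtain ⟨H, hH⟩ := exists_flag_crossFrame hF (p := (i : ℕ) - 1)
      (by have := i.2; omega) (z + 1) one_ne_zero
    obtain ⟨G', hG'⟩ := exists_flag_crossFrame hH (p := (i : ℕ) - 1)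
      (by have := i.2; omega) 1 one_ne_zero
    have h3 := isFrame_tri hF hi one_ne_zero one_ne_zero hH hG' one_ne_zero
    rw [mul_one, mul_one, div_one, add_sub_cancel_right] at h3
    obtain rfl := h3.unique hz
    refine ⟨[⟨i, 0, H⟩, ⟨i, 0, G'⟩], rfl, ⟨?_, ?_, trivial⟩, rfl⟩
    · rw [hw]
      exact relativePosition_of_crossFrame hF hi one_ne_zero hH
    · rw [hw]
      exact relativePosition_of_crossFrame hH hi one_ne_zero hG'
  | four i j h =>
    obtain ⟨a, G₁, b, G₂, rfl⟩ := exists_eq_of_map_col_two hs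
    obtain ⟨G, hG⟩ := exists_valid_four (fun n => n.elim) h.symm hS
    exact ⟨_, rfl, hG, rfl⟩
  | six i j h =>
    obtain ⟨a, G₁, b, G₂, c, G₃, rfl⟩ := exists_eq_of_map_col_three hs
    obtain ⟨H₁, H₂, hG⟩ := exists_valid_six (fun n => n.elim) h.symm hS
    exact ⟨_, rfl, hG, rfl⟩

/-- The flags are constructed from the bottom to the top, since in this direction no vertex is an
obstruction. -/
theorem exists_descends (F : DecoratedFlag L d) {W : List (Vertex d)} {α α' : List (Color d)}
    (h : IsWeave α W α') : ∃ X : List (Letter L d Empty), X.map Letter.col = α ∧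
      ValidRow (fun _ => 1) F X ∧ Descends F W X := by
  induction W generalizing α with
  | nil =>
    obtain ⟨X, h1, h2⟩ := exists_validRow F α
    exact ⟨X, h1, h2, trivial⟩
  | cons v W ih =>
    obtain ⟨rfl, h⟩ := h
    obtain ⟨X, h1, h2, h3⟩ := ih h
    obtain ⟨Y, Z, rfl, h1, hZ⟩ := List.map_eq_append_iff.1 h1
    obtain ⟨Y, S, rfl, hY, hS⟩ := List.map_eq_append_iff.1 h1
    obtain ⟨⟨vY, vS⟩, vZ⟩ := (validRow_append.1 h2).imp_left validRow_append.1
    obtain ⟨T, hT, vT, he⟩ := exists_validRow_above v.kind vS hS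
    refine ⟨Y ++ T ++ Z, by simp [hY, hT, hZ, Vertex.top], ?_,
      Y, T, S, Z, rfl, hY, hT, hS, hZ, he, h2, h3⟩
    rw [validRow_append, validRow_append, endFlag_append, ← he, ← endFlag_append]
    exact ⟨⟨vY, vT⟩, vZ⟩

end UnitWeaves

/-! ### Generic decorations are extendable -/

section Generic

variable {K : Type*} [Field K]

theorem linkedRow_toRow {L : Type*} [Field L] {d : ℕ} {N : Type*} {Γ : Subring (K × L)}
    {α : List (Color d)} (wt : ℕ → N → ℕ) (wt' : ℕ → Empty → ℕ) {fl : ℕ → DecoratedFlag K d}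
    {fl' : ℕ → DecoratedFlag L d} (h : ∀ p ≤ α.length, Linked Γ (fl p) (fl' p)) :
    LinkedRow Γ (toRow α wt fl) (toRow α wt' fl') := by
  induction α generalizing wt wt' fl fl' with
  | nil => exact List.Forall₂.nil
  | cons c α ih =>
    exact List.forall₂_cons.2 ⟨⟨rfl, h 1 (by simp)⟩,
      ih _ _ fun p hp => h (p + 1) (by simpa using hp)⟩

theorem exists_hasCrossingValue {d : ℕ} {F G : DecoratedFlag K d} {k : Color d}
    (h : RelativePosition F G k) : ∃ μ, HasCrossingValue F G k μ := by
  obtain ⟨g, hF⟩ := exists_frame F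
  obtain ⟨z, μ, hμ, hG⟩ := exists_crossFrame hF (color_pred_add k) h
  exact ⟨μ, (relativePosition_of_crossFrame hF (color_pred_add k) hμ hG).2⟩

variable {d : ℕ} {β β' : List (Color d)} {M : Finset (Fin β.length)}

theorem weightValue_topRow {w : DemazureWeave β β'} {μ : Fin β.length → K}
    (hμ : ∀ p ∉ M, μ p = 1) (p : Fin β.length) :
    weightValue (Sum.elim (fun q => μ q.1) fun _ => 1 : Cycle M w → K)
      (fun c => Cycle.weight c 0 p) = μ p := by
  rw [weightValue, Fintype.prod_sum_type]
  simp only [Sum.elim_inl, Sum.elim_inr, one_pow, Finset.prod_const_one, mul_one, Cycle.weight]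
  by_cases hp : p ∈ M
  · rw [Finset.prod_eq_single ⟨p, hp⟩]
    · simp
    · intro q _ hq
      rw [if_neg fun h => hq (Subtype.ext (Fin.ext h.symm)), pow_zero]
    · simp
  · rw [hμ p hp]
    refine Finset.prod_eq_one fun q _ => ?_
    rw [if_neg fun h => hp ((Fin.ext h : p = q.1) ▸ q.2), pow_zero]

variable [Algebra ℂ K]

/-- The pairs of the values at `a` and at `b` of the rational functions that are defined at `b`. -/
noncomputable def specialization {σ : Type*} (a : σ → K) (b : σ → ℂ) : Subring (K × ℂ) where
  carrier := {x | ∃ P Q : MvPolynomial σ ℂ, MvPolynomial.eval b Q ≠ 0 ∧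
    x.1 * MvPolynomial.aeval a Q = MvPolynomial.aeval a P ∧
    x.2 * MvPolynomial.eval b Q = MvPolynomial.eval b P}
  mul_mem' := by
    rintro x y ⟨P, Q, h1, h2, h3⟩ ⟨P', Q', h1', h2', h3'⟩
    refine ⟨P * P', Q * Q', by simp [h1, h1'], ?_, ?_⟩
    · rw [map_mul, map_mul, ← h2, ← h2', Prod.fst_mul, mul_mul_mul_comm]
    · rw [map_mul, map_mul, ← h3, ← h3', Prod.snd_mul, mul_mul_mul_comm]
  one_mem' := ⟨1, 1, by simp, by simp, by simp⟩
  add_mem' := by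
    rintro x y ⟨P, Q, h1, h2, h3⟩ ⟨P', Q', h1', h2', h3'⟩
    refine ⟨P * Q' + P' * Q, Q * Q', by simp [h1, h1'], ?_, ?_⟩
    · rw [map_mul, map_add, map_mul, map_mul, ← h2, ← h2', Prod.fst_add]
      ring
    · rw [map_mul, map_add, map_mul, map_mul, ← h3, ← h3', Prod.snd_add]
      ring
  zero_mem' := ⟨0, 1, by simp, by simp, by simp⟩
  neg_mem' := by
    rintro x ⟨P, Q, h1, h2, h3⟩
    exact ⟨-P, Q, h1, by simp [h2], by simp [h3]⟩

/-- The inverse of a fraction is obtained by the exchange of numerator and denominator. By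
hypothesis, polynomials that do not vanish at `b` do not vanish at `a` either. -/
theorem isSpecialization_specialization {σ : Type*} {a : σ → K} {b : σ → ℂ}
    (h : ∀ P : MvPolynomial σ ℂ, MvPolynomial.aeval a P = 0 → MvPolynomial.eval b P = 0) :
    IsSpecialization (specialization a b) := by
  rintro x ⟨P, Q, h1, h2, h3⟩ hx
  have hQ : MvPolynomial.aeval a Q ≠ 0 := fun h0 => h1 (h Q h0)
  have hP : MvPolynomial.eval b P ≠ 0 := h3 ▸ mul_ne_zero hx h1
  have hP' : MvPolynomial.aeval a P ≠ 0 := fun h0 => hP (h P h0)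
  have hx1 : x.1 ≠ 0 := left_ne_zero_of_mul (h2 ▸ hP')
  refine ⟨hx1, Q, P, hP, ?_, ?_⟩
  · rw [← h2, Prod.fst_inv, inv_mul_cancel_left₀ hx1]
  · rw [← h3, Prod.snd_inv, inv_mul_cancel_left₀ hx]

theorem mem_specialization {σ : Type*} (a : σ → K) (b : σ → ℂ) (i : σ) :
    (a i, b i) ∈ specialization a b :=
  ⟨MvPolynomial.X i, 1, by simp, by simp, by simp⟩

/-- The given weave is decorated over the complex numbers with unit crossing values. Genericity
allows specialization from `𝔡` to the top row of this decoration, and the run of `𝔡` is constructed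
vertex by vertex above it. -/
theorem IsGeneric.isExtendable {𝔡 : Fin (β.length + 1) → DecoratedFlag K d}
    (hg : IsGeneric M 𝔡) (h𝔡 : IsNormalizedDecoration M 𝔡) : IsExtendable M 𝔡 := by
  intro β' w
  -- The specialized row begins with the standard flag, whose leading Plücker coordinates are
  -- nonzero. This gives the leftmost flags linked frames.
  obtain ⟨F', hF'⟩ := exists_flag (wedge_standardFrame (K := ℂ) (d := d))
  obtain ⟨X', hcol, hX', hd⟩ := exists_descends F' w.isWeave
  obtain ⟨wt', eX'⟩ := exists_eq_toRow F' X'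
  rw [hcol] at eX'
  have hV' : ValidRow (fun _ => 1) (flagAt F' X' 0) (toRow β wt' (flagAt F' X')) := by
    rw [← eX', flagAt_zero]
    exact hX'
  rw [validRow_toRow] at hV'
  let 𝔢 : Fin (β.length + 1) → DecoratedFlag ℂ d := fun p => flagAt F' X' p
  have h𝔢 : ∀ p : Fin β.length, RelativePosition (𝔢 p.castSucc) (𝔢 p.succ) (β.get p) ∧
      HasCrossingValue (𝔢 p.castSucc) (𝔢 p.succ) (β.get p) 1 := by
    intro p
    refine ⟨(hV' p).1, ?_⟩
    have e : weightValue (fun _ => (1 : ℂ)) (wt' p) = 1 := by simp [weightValue]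
    exact e ▸ (hV' p).2
  let Γ := specialization (flagCoordinates 𝔡) (flagCoordinates 𝔢)
  have hΓ : IsSpecialization Γ := isSpecialization_specialization fun P hP =>
    hg P hP 𝔢 fun p => ⟨(h𝔢 p).1, fun _ => (h𝔢 p).2⟩
  have hpl : ∀ (p : Fin (β.length + 1)) (k : Color d),
      PluckerIn Γ k ((𝔡 p).level k) ((𝔢 p).level k) := by
    intro p k c
    rw [DecoratedFlag.level_color, DecoratedFlag.level_color]
    exact mem_specialization (flagCoordinates 𝔡) (flagCoordinates 𝔢) (p, ⟨k, c⟩)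
  have hl0 : Linked Γ (𝔡 0) (𝔢 0) := by
    refine hΓ.linked_of_leading (fun k hk => ?_) (by simpa [𝔢, flagAt_zero] using hF')
    rcases Nat.eq_zero_or_pos k with rfl | hk0
    · rw [DecoratedFlag.level_zero, DecoratedFlag.level_zero]
      exact frameIn_standardFrame.pluckerIn 0
    · rcases hk.eq_or_lt with rfl | hkd
      · rw [DecoratedFlag.level_self, DecoratedFlag.level_self]
        exact pluckerIn_volumeForm
      · exact hpl 0 ⟨k, hk0, hkd⟩
  have hμ : ∀ p : Fin β.length, ∃ μ, HasCrossingValue (𝔡 p.castSucc) (𝔡 p.succ) (β.get p) μ ∧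
      (p ∉ M → μ = 1) := by
    intro p
    by_cases hp : p ∈ M
    · obtain ⟨μ, hμ⟩ := exists_hasCrossingValue (h𝔡 p).1
      exact ⟨μ, hμ, fun h => absurd hp h⟩
    · exact ⟨1, (h𝔡 p).2 hp, fun _ => rfl⟩
  choose μ hμ hμ1 using hμ
  -- Linked frames propagate from left to right. The crossing values of marked letters turn out to
  -- be elements of `Γ` that specialize to one.
  have step : ∀ p : Fin β.length, Linked Γ (𝔡 p.castSucc) (𝔢 p.castSucc) →
      (μ p, 1) ∈ Γ ∧ Linked Γ (𝔡 p.succ) (𝔢 p.succ) := by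
    rintro p ⟨g, g', f, f', k⟩
    obtain ⟨h0, h1, z, z', hz, h2, h3⟩ := exists_crossFrame_of_pluckerIn k f f' ⟨(h𝔡 p).1, hμ p⟩
      (h𝔢 p) (hpl p.succ _)
    exact ⟨h1, _, _, h2, h3, k.crossFrame_mem hΓ _ hz h1 h0⟩
  have hl : ∀ p, Linked Γ (𝔡 p) (𝔢 p) := Fin.induction hl0 fun p hp => (step p hp).2
  let fl : ℕ → DecoratedFlag K d := fun p => if h : p < β.length + 1 then 𝔡 ⟨p, h⟩ else 𝔡 0
  have hfl : ∀ p : Fin (β.length + 1), fl p = 𝔡 p := fun p => dif_pos p.2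
  let Δ : Cycle M w → K := Sum.elim (fun q => μ q.1) fun _ => 1
  have hΔ : ∀ c, (Δ c, 1) ∈ Γ := by
    rintro (q | s)
    · exact (step q.1 (hl _)).1
    · exact Γ.one_mem
  let ν := Equiv.refl (Cycle M w)
  have hX : ValidRow Δ (fl 0) (topRow β M (ν ∘ .inl) fl) := by
    rw [topRow_eq, validRow_toRow]
    intro p
    have e1 := hfl p.castSucc
    have e2 := hfl p.succ
    rw [Fin.val_castSucc] at e1
    rw [Fin.val_succ] at e2
    rw [e1, e2]
    refine ⟨(h𝔡 p).1, ?_⟩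
    have e3 := weightValue_topRow (w := w) hμ1 p
    exact e3 ▸ hμ p
  have hrow : LinkedRow Γ (topRow β M (ν ∘ .inl) fl) X' := by
    rw [eX', topRow_eq]
    refine linkedRow_toRow _ _ fun p hp => ?_
    have := hl ⟨p, Nat.lt_succ_of_le hp⟩
    rwa [← hfl] at this
  have hF : Linked Γ (fl 0) F' := by
    have := hl 0
    rw [← hfl] at this
    simpa [𝔢, flagAt_zero] using this
  have hs : ∀ v ∈ w.labels ν, v.2.isSome = v.1.kind.isTri := by
    intro v hv
    obtain ⟨t, rfl⟩ := List.mem_ofFn.1 hv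
    change (dite _ _ _ : Option (Cycle M w)).isSome = (w.vertices.get t).kind.isTri
    by_cases h : (w.vertices.get t).kind.isTri = true
    · rw [dif_pos h]
      exact h.symm
    · rw [dif_neg h]
      exact (Bool.not_eq_true _ ▸ h).symm
  rw [← w.labels_map_fst ν] at hd
  obtain ⟨Δ₁, h1, Z, P, hr⟩ := exists_run_of_descends hΓ hs (w.nodup_names_labels ν.injective) hΔ
    hF hX (fun n hn => w.topRow_fresh ν fl hn) hX' hd hrow
  obtain ⟨D, hD⟩ := hr.exists_decoration ν (hX.congr fun x hx n hn =>
    (h1 n fun hn' => hn (w.topRow_fresh ν fl hn' x hx)).symm)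
  exact ⟨D, fun p => (hD p (Nat.le_of_lt_succ p.2)).trans (hfl p)⟩

end Generic

end DemazureWeaves

/-! ### The main theorem -/

theorem mainTheorem11 {d : ℕ} (β : List (DemazureWeaves.Color d)) (M : Finset (Fin β.length))
    {K : Type*} [Field K] [Algebra ℂ K]
    (𝔡 : Fin (β.length + 1) → DemazureWeaves.DecoratedFlag K d)
    (h𝔡 : DemazureWeaves.IsNormalizedDecoration M 𝔡) :
    -- the seeds are defined: generic decorations extend, and extensions have unique variables
    (DemazureWeaves.IsGeneric M 𝔡 → DemazureWeaves.IsExtendable M 𝔡) ∧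
    (∀ (β' : List (DemazureWeaves.Color d)) (w : DemazureWeaves.DemazureWeave β β')
      (D D' : DemazureWeaves.Decoration K M w), D.Extends 𝔡 → D'.Extends 𝔡 → D.Δ = D'.Δ) ∧
    -- equivalent weaves
    (∀ (β' : List (DemazureWeaves.Color d)) (w w' : DemazureWeaves.DemazureWeave β β')
      (D : DemazureWeaves.Decoration K M w) (D' : DemazureWeaves.Decoration K M w'),
      D.Extends 𝔡 → D'.Extends 𝔡 → w.Equivalent w' →
        D.seed.Same D'.seed ∧ D.seed.clusterAlgebra = D'.seed.clusterAlgebra) ∧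
    (DemazureWeaves.IsExtendable M 𝔡 →
      ∀ (β' : List (DemazureWeaves.Color d)) (w w' : DemazureWeaves.DemazureWeave β β')
        (D : DemazureWeaves.Decoration K M w) (D' : DemazureWeaves.Decoration K M w'),
        D.Extends 𝔡 → D'.Extends 𝔡 →
        -- mutation equivalent weaves
        (w.MutationEquivalent w' →
          D.seed.MutationEquivalent D'.seed ∧
            D.seed.clusterAlgebra = D'.seed.clusterAlgebra) ∧
        -- reduced weaves
        (DemazureWeaves.IsReducedWordFor β' (DemazureWeaves.demazureProduct β) →
          D.seed.MutationEquivalent D'.seed ∧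
            D.seed.clusterAlgebra = D'.seed.clusterAlgebra)) := by
  refine ⟨fun hg => hg.isExtendable h𝔡, fun β' w D D' hD hD' => hD.Δ_eq hD', fun β' w w' D D' hD hD' h => ?_,
    fun hE β' w w' D D' hD hD' => ⟨fun h => ?_, fun h => ?_⟩⟩
  · have hs := hD.seed_same_of_equivalent hD' h
    exact ⟨hs, DemazureWeaves.Seed.clusterAlgebra_eq (.same hs) (.same hs.symm)⟩
  · obtain ⟨h1, h2⟩ := hE.mutationEquivalent h hD hD'
    exact ⟨h1, DemazureWeaves.Seed.clusterAlgebra_eq h1 h2⟩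
  · have h0 := w.mutationEquivalent_of_reduced w' h.reduced
    obtain ⟨h1, h2⟩ := hE.mutationEquivalent h0 hD hD'
    exact ⟨h1, DemazureWeaves.Seed.clusterAlgebra_eq h1 h2⟩
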